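/- **Setting.** Let $f\colon\mathbb R\to\mathbb R$ be $C^2$, let $f''$ be piecewise monotone with finitely many monotonicity intervals, and let $\varepsilon_\infty>0$ be such that $\int_{\mathbb R} e^{-|t|/\varepsilon_\infty}\,|df''(t)|<\infty$. Write $\langle g\rangle_{[a,b]}$ for the average of $g$ over $[a,b]$ ($=g(a)$ if $a=b$). A pair $a\le b$ satisfies the *cup equation* if $\langle f'\rangle_{[a,b]}=\frac12(f'(a)+f'(b))$. Put $D_L(a,b)=f''(a)-\langle f''\rangle_{[a,b]}$, $D_R(a,b)=f''(b)-\langle f''\rangle_{[a,b]}$. A *root $c$ of $f'''$* is a non-empty closed interval (possibly a point, a ray or the line) on which $f''$ is constant and such that just before its left end (if any) $f''$ is non-decreasing and strictly less than this constant, and just after its right end (if any) $f''$ is non-increasing and strictly less than this constant. *Forces.* For $\varepsilon\in(0,\varepsilon_\infty)$, $$F_R(u;a,b;\varepsilon)=D_R(a,b)e^{(b-u)/\varepsilon}+e^{-u/\varepsilon}\int_b^u e^{t/\varepsilon}\,df''(t)\ (u\ge b),\quad F_L(u;a,b;\varepsilon)=-D_L(a,b)e^{(u-a)/\varepsilon}+e^{u/\varepsilon}\int_u^a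 e^{-t/\varepsilon}\,df''(t)\ (u\le a),$$ $$F_R(u;-\infty;\varepsilon)=e^{-u/\varepsilon}\int_{-\infty}^u e^{t/\varepsilon}\,df''(t),\qquad F_L(u;+\infty;\varepsilon)=e^{u/\varepsilon}\int_u^{\infty} e^{-t/\varepsilon}\,df''(t).$$ The right tail of $F_R$ starting at $b$ (or $-\infty$) is the maximal interval $(b,t^R)$ on which $F_R<0$; the left tail of $F_L$ starting at $a$ (or $+\infty$) is the maximal interval $(t^L,a)$ on which $F_L>0$. *Chordal domains.* A chordal domain is a family of chords $[a(l),b(l)]$, $b(l)-a(l)=l$, $l\in[l_0,l_1]$, $0\le l_0<l_1$, with $a,b$ continuous, differentiable with $a'<0<b'$ for $l_0<l<l_1$, satisfying the cup equation and $D_L,D_R\le 0$, with strict inequalities for $l_0<l<l_1$. The chords for $l_0$, $l_1$ are its lower and upper chord. A *tree hanging at a chord* is a chordal domain having it as upper chord, together with what lies at its lower chord: a point $c$, if $l_0=0$ (origin of a cup); or a chord with $D_L=0$ or $D_R=0$ with a tree hanging at it; or a *closed multicup* over bounded arcs $\mathfrak a_0<\dots<\mathfrak a_k$, whose ends span the lower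 chord, of total width $<2\varepsilon$, with a tree hanging at the chord over each gap between consecutive arcs. *Arcs* $\mathfrak a_0<\dots<\mathfrak a_k$ of a multifigure are disjoint non-empty closed intervals (points allowed), consecutive ones at distance at most $2\varepsilon$, such that the points $(x,f'(x))$, $x\in\bigcup\mathfrak a_i$, lie on one line, any two points of $\bigcup\mathfrak a_i$ satisfy the cup equation, and there are at least three points in $\bigcup\mathfrak a_i$. *Graphs.* A graph $\Gamma$ is a sequence of free vertices $v_0,\dots,v_n$, read from left to right, with consecutive ones separated by tangent domains (edges), right (R) or left (L), over non-empty intervals $(u_l,u_r)$ between the right end of $v_{i}$ and the left end of $v_{i+1}$; $v_0$ extends to $-\infty$ and $v_n$ to $+\infty$. The free vertices, with the orientations of the left and right adjacent tangent domains, are: an angle $w$ (R, L); a right trolleybus (R, R), a left trolleybus (L, L), a birdie (R, L) over a chord $[a,b]$, $0<b-a\le2\varepsilon$, with a tree hanging at it; a multicup (L, R) of width $\mathfrak a_k^r-\mathfrak a_0^l\ge 2\varepsilon$ (full if $=2\varepsilon$; its extreme arcs may be rays), a right multitrolleybus (R, R; only the last arc may be a ray to $+\infty$), a left multitrolleybus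 (L, L; only the first arc may be a ray to $-\infty$), a multibirdie (R, L; arcs bounded), with trees hanging at the chords over the gaps between arcs; a long chord $[a,b]$, $b-a=2\varepsilon$, (L, R) with a tree hanging at it, of the first type if $D_L\ne0\ne D_R$ (the top of a full chordal domain) and of the third type otherwise; a vertex $\pm\infty$; and a right (R, R) or left (L, L) vertex of the fifth type, a point $c$. The base of a trolleybus, a birdie or a long chord is $(a,b)$, of a multifigure $(\mathfrak a_0^l,\mathfrak a_k^r)$ (an infinite end being replaced by a point of the ray), of a vertex of the fifth type $(c,c)$; $\lambda$ is the average of $f''$ over the base. A right domain starts at its left neighbour, and its force is $F_R$ of the base of that neighbour, or $F_R(\cdot;-\infty;\varepsilon)$; a left domain starts at its right neighbour, and its force is $F_L$ of the base of that neighbour, or $F_L(\cdot;+\infty;\varepsilon)$. The graph is *admissible for $f$ and $\varepsilon$* if all this holds and there are functions $m$, one for each tangent domain, continuous up to the finite ends of the domain, with $\varepsilon m'+m=f'$, $m''<0$ on right domains, $-\varepsilon m'+m=f'$, $m''>0$ on left ones; $m(u)=\varepsilon^{-1}e^{-u/\varepsilon}\int_{-\infty}^uf'(t)e^{t/\varepsilon}dt$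 on right domains starting from $-\infty$ and $m(u)=\varepsilon^{-1}e^{u/\varepsilon}\int_u^\infty f'(t)e^{-t/\varepsilon}dt$ on left domains starting from $+\infty$; $m(x)=f'(x)-\varepsilon\lambda$ (right domain) or $m(x)=f'(x)+\varepsilon\lambda$ (left domain) at each end $x$ at which a domain meets a vertex with a base; and $m_R(w)+m_L(w)=2f'(w)$ for the two domains meeting at an angle $w$. *Non-degeneracy force condition*: the interval of each tangent domain lies in the tail of its force. *Leaf–root condition*: each arc, of any multifigure of $\Gamma$, that is not a single point is a root $c$ of $f'''$; each origin of a cup is a one-point root $c$; for each vertex of the third type over a chord $[a,b]$ (long or short), $b$ is a one-point root $c$ if $D_R(a,b)=0$, and $a$ is one if $D_L(a,b)=0$; the point of each vertex of the fifth type is a one-point root $c$. *Smooth*: there are no full multicups, multitrolleybuses, multibirdies, long chords of the third type, or vertices of the fifth type. **Theorem.** Let $0<\eta_1<\varepsilon_\infty$, and let $\Gamma$ be admissible for $f$ and $\eta_1$ and satisfy the non-degeneracy force condition and the leaf–root condition. Then there are $\eta_2\in(\eta_1,\varepsilon_\infty)$ and, for every $\varepsilon\in(\eta_1,\eta_2]$,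 a smooth graph $\Gamma(\varepsilon)$, admissible for $f$ and $\varepsilon$, that satisfies both conditions and in which every angle lies in the (open) tails of the forces of the two adjacent tangent domains. Moreover, the row of free vertices of $\Gamma(\varepsilon)$ arises from that of $\Gamma$ by replacing each vertex as follows: * an angle $w$ by an angle $W(\varepsilon)$, $W$ continuous on $[\eta_1,\eta_2]$, $W(\eta_1)=w$; * a trolleybus over the chordal domain $(a,b)$ by the trolleybus of the same orientation over its chord of length $\mathfrak l(\varepsilon)$ (the domain being cut at this chord), with $\mathfrak l$ continuous and strictly decreasing on $[\eta_1,\eta_2]$, starting at $\eta_1$ from the length of the original chord; * a birdie, with $\mathfrak l$ as above, for each $\varepsilon$ by the birdie over the chord of length $\mathfrak l(\varepsilon)$, or by the right trolleybus over it followed by an angle, or by the left trolleybus over it preceded by an angle; * a non-full multicup and the infinities by themselves; * a full multicup by a closed multicup with the same arcs and trees, with a full chordal domain above it: there is a chordal domain whose lower chord (length $2\eta_1$) is that of the multicup and whose lengths range over $[2\eta_1,2\eta_2]$, and at $\varepsilon$ it is cut at its chord of length $2\varepsilon$, a vertex of the first type; * a vertex of the first type by another one: its chordal domain extends to a chordal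 domain with upper chord of length $2\eta_2$, which is cut at the chord of length $2\varepsilon$; * a long chord of the third type by a short one with the same tree below it and a full chordal domain above it, as for a full multicup; * a right (left) multitrolleybus by the row of right (left) trolleybuses over the gaps between its arcs, each over the chord of length $\mathfrak l_i(\varepsilon)$ of its chordal domain, with $\mathfrak l_i$ continuous, strictly decreasing, $\mathfrak l_i(\eta_1)$ being the length of the gap (nothing remains of a multitrolleybus on one bounded arc); if its last (first) arc is a ray, the vertex $+\infty$ ($-\infty$) is put at the end of the row; * a multibirdie, with $\mathfrak l_i$ of the same kind, for each $\varepsilon$ by right trolleybuses over the first several gaps, then an angle, then left trolleybuses over the remaining gaps, where the angle may have merged with an adjacent trolleybus into a birdie over the same chord; * a vertex of the fifth type disappears (its two tangent domains become one). -/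

import Mathlib

/-!
Foliations of the parabolic strip `x₁² ≤ x₂ ≤ x₁² + ε²` by extremals of a boundary datum `f`, their
combinatorial description by a graph, and the local rules by which the graph changes with `ε`.

Throughout `f'` is `deriv f`, `f''` is `deriv (deriv f)`, and `f'''` is the signed measure `df''`.
-/

namespace BellmanFoliation

open Set MeasureTheory

noncomputable section

/-! ### The signed measure `dg` of a function of locally bounded variation -/

lemma monotone_var {g : ℝ → ℝ} (h : LocallyBoundedVariationOn g univ) :
    Monotone (variationOnFromTo g univ 0) := fun _ _ hxy =>
  variationOnFromTo.monotoneOn h (mem_univ 0) (mem_univ _) (mem_univ _) hxy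

lemma monotone_var_sub {g : ℝ → ℝ} (h : LocallyBoundedVariationOn g univ) :
    Monotone (variationOnFromTo g univ 0 - g) := fun _ _ hxy =>
  variationOnFromTo.sub_self_monotoneOn h (mem_univ 0) (mem_univ _) (mem_univ _) hxy

open Classical in
/-- `|dg|`: the Lebesgue–Stieltjes measure of the variation `V` of `g`. -/
def totalVar (g : ℝ → ℝ) : Measure ℝ :=
  if h : LocallyBoundedVariationOn g univ then (monotone_var h).stieltjesFunction.measure else 0

open Classical in
/-- The Lebesgue–Stieltjes measure of `V - g`, so that `dg = |dg| - d(V - g)`. -/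
def defectVar (g : ℝ → ℝ) : Measure ℝ :=
  if h : LocallyBoundedVariationOn g univ then (monotone_var_sub h).stieltjesFunction.measure else 0

/-- `∫_s φ dg`. -/
def intd (g φ : ℝ → ℝ) (s : Set ℝ) : ℝ :=
  (∫ t in s, φ t ∂(totalVar g)) - ∫ t in s, φ t ∂(defectVar g)

/-! ### Conditions on the boundary datum -/

/-- `f ∈ C²` and `f''` is piecewise monotone with finitely many monotonicity intervals. -/
def RegularDatum (f : ℝ → ℝ) : Prop :=
  ContDiff ℝ 2 f ∧ ∃ S : Finset ℝ, ∀ I : Set ℝ, I.OrdConnected → Disjoint I (S : Set ℝ) →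
    MonotoneOn (deriv (deriv f)) I ∨ AntitoneOn (deriv (deriv f)) I

/-- `∫ e^{-|t|/ε∞} |df''(t)| < ∞`. -/
def SummableDatum (f : ℝ → ℝ) (εinf : ℝ) : Prop :=
  Integrable (fun t : ℝ => Real.exp (-|t| / εinf)) (totalVar (deriv (deriv f)))

/-- `C` is an essential root of `f'''` at which `f'''` changes sign from `+` to `-`: a closed
interval (a point, a segment, a ray, or the line) on which `f''` is constant, to the left of which
`f''` strictly grows to this constant, and to the right of which it strictly decreases from it. -/
def IsRootC (f : ℝ → ℝ) (C : Set ℝ) : Prop :=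
  C.Nonempty ∧ IsClosed C ∧ C.OrdConnected ∧
  (∀ x ∈ C, ∀ y ∈ C, deriv (deriv f) x = deriv (deriv f) y) ∧
  (∀ x, IsLeast C x → ∃ δ > 0, MonotoneOn (deriv (deriv f)) (Icc (x - δ) x) ∧
    ∀ y ∈ Ico (x - δ) x, deriv (deriv f) y < deriv (deriv f) x) ∧
  (∀ x, IsGreatest C x → ∃ δ > 0, AntitoneOn (deriv (deriv f)) (Icc x (x + δ)) ∧
    ∀ y ∈ Ioc x (x + δ), deriv (deriv f) y < deriv (deriv f) x)

/-! ### Chords, differentials, and forces -/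

/-- The average of `g` over `[a, b]` (over a point: the value). -/
def av (g : ℝ → ℝ) (a b : ℝ) : ℝ := if a = b then g a else (∫ t in a..b, g t) / (b - a)

/-- The cup equation for the pair `(a, b)`. -/
def CupEq (f : ℝ → ℝ) (a b : ℝ) : Prop := av (deriv f) a b = (deriv f a + deriv f b) / 2

/-- The left differential. -/
def DL (f : ℝ → ℝ) (a b : ℝ) : ℝ := deriv (deriv f) a - av (deriv (deriv f)) a b

/-- The right differential. -/
def DR (f : ℝ → ℝ) (a b : ℝ) : ℝ := deriv (deriv f) b - av (deriv (deriv f)) a b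

/-- The right force of the pair `(a, b)`, for `u ≥ b`. -/
def forceR (f : ℝ → ℝ) (ε a b u : ℝ) : ℝ :=
  DR f a b * Real.exp ((b - u) / ε) +
    Real.exp (-u / ε) * intd (deriv (deriv f)) (fun t => Real.exp (t / ε)) (Ioc b u)

/-- The left force of the pair `(a, b)`, for `u ≤ a`. -/
def forceL (f : ℝ → ℝ) (ε a b u : ℝ) : ℝ :=
  -DL f a b * Real.exp ((u - a) / ε) +
    Real.exp (u / ε) * intd (deriv (deriv f)) (fun t => Real.exp (-t / ε)) (Ioc u a)

/-- The right force coming from `-∞`. -/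
def forceRInf (f : ℝ → ℝ) (ε u : ℝ) : ℝ :=
  Real.exp (-u / ε) * intd (deriv (deriv f)) (fun t => Real.exp (t / ε)) (Iic u)

/-- The left force coming from `+∞`. -/
def forceLInf (f : ℝ → ℝ) (ε u : ℝ) : ℝ :=
  Real.exp (u / ε) * intd (deriv (deriv f)) (fun t => Real.exp (-t / ε)) (Ioi u)

/-- The right tail, starting from `x` (possibly `-∞`), of a force `F`: the interval `(x, t^R)`. -/
def rightTail (F : ℝ → ℝ) (x : EReal) : Set ℝ :=
  {u | x < (u : EReal) ∧
    (u : EReal) < sSup {t : EReal | x < t ∧ ∀ s : ℝ, x < (s : EReal) → (s : EReal) < t → F s < 0}}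

/-- The left tail, starting from `x` (possibly `+∞`), of a force `F`: the interval `(t^L, x)`. -/
def leftTail (F : ℝ → ℝ) (x : EReal) : Set ℝ :=
  {u | (u : EReal) < x ∧
    sInf {t : EReal | t < x ∧ ∀ s : ℝ, t < (s : EReal) → (s : EReal) < x → 0 < F s} < (u : EReal)}

/-! ### Chordal domains and the figures below the free boundary chords -/

/-- The orientation (right or left) of a tangent domain or of a trolleybus. -/
inductive Side
  | R
  | L

/-- A closed interval of the line: a point, a segment, a ray, or the line. -/
structure Arc where
  lo : EReal
  hi : EReal

/-- The real points of an arc. -/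
def Arc.toSet (A : Arc) : Set ℝ := {x | A.lo ≤ (x : EReal) ∧ (x : EReal) ≤ A.hi}

/-- The arc is a non-empty closed interval of the real line. -/
def Arc.Valid (A : Arc) : Prop := A.lo ≤ A.hi ∧ A.lo < ⊤ ∧ ⊥ < A.hi

open Classical in
/-- The left end of an arc or, on a ray going to `-∞`, some point of the ray. -/
def Arc.leftPt (A : Arc) : ℝ :=
  if A.lo = ⊥ then (if A.hi = ⊤ then 0 else A.hi.toReal - 1) else A.lo.toReal

open Classical in
/-- The right end of an arc or, on a ray going to `+∞`, some point of the ray. -/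
def Arc.rightPt (A : Arc) : ℝ :=
  if A.hi = ⊤ then (if A.lo = ⊥ then 0 else A.lo.toReal + 1) else A.hi.toReal

/-- A chordal domain: the chords `[a l, b l]` of lengths `l ∈ [bot, top]`. -/
structure ChordalDomain where
  a : ℝ → ℝ
  b : ℝ → ℝ
  bot : ℝ
  top : ℝ

/-- The chords foliate a domain that carries a standard candidate. -/
def ChordalDomain.Admissible (f : ℝ → ℝ) (d : ChordalDomain) : Prop :=
  0 ≤ d.bot ∧ d.bot < d.top ∧
  ContinuousOn d.a (Icc d.bot d.top) ∧ ContinuousOn d.b (Icc d.bot d.top) ∧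
  (∀ l ∈ Icc d.bot d.top, d.b l - d.a l = l) ∧
  (∀ l ∈ Ioo d.bot d.top, DifferentiableAt ℝ d.a l ∧ DifferentiableAt ℝ d.b l ∧
    deriv d.a l < 0 ∧ 0 < deriv d.b l) ∧
  (∀ l ∈ Icc d.bot d.top, CupEq f (d.a l) (d.b l) ∧
    DL f (d.a l) (d.b l) ≤ 0 ∧ DR f (d.a l) (d.b l) ≤ 0) ∧
  (∀ l ∈ Ioo d.bot d.top, DL f (d.a l) (d.b l) < 0 ∧ DR f (d.a l) (d.b l) < 0)

/-- `[a, b]` is the upper chord of `d`. -/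
def ChordalDomain.UpperChord (d : ChordalDomain) (a b : ℝ) : Prop :=
  d.top = b - a ∧ d.a d.top = a ∧ d.b d.top = b

/-- `[a, b]` is the lower chord of `d`. -/
def ChordalDomain.LowerChord (d : ChordalDomain) (a b : ℝ) : Prop :=
  d.bot = b - a ∧ d.a d.bot = a ∧ d.b d.bot = b

/-- The part of the graph that hangs below a chord: the chordal domain adjacent to the chord, and
what this domain stands on. This is the origin of a cup (fictitious vertex of the second type), or a
short chord with a further tree below (fictitious vertex of the third type), or a closed multicup
with arcs `𝔞₀ < … < 𝔞ₖ` and a further tree below each of its `k` gaps. -/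
inductive FixedTree
  | cup (dom : ChordalDomain) (c : ℝ)
  | chord (dom : ChordalDomain) (a b : ℝ) (below : FixedTree)
  | closed (dom : ChordalDomain) (k : ℕ) (arcs : Fin (k + 1) → Arc) (below : Fin k → FixedTree)

/-- The uppermost chordal domain. -/
def FixedTree.dom : FixedTree → ChordalDomain
  | .cup d _ => d
  | .chord d _ _ _ => d
  | .closed d _ _ _ => d

/-- Replace the uppermost chordal domain. -/
def FixedTree.withDom (d : ChordalDomain) : FixedTree → FixedTree
  | .cup _ c => .cup d c
  | .chord _ a b t => .chord d a b t
  | .closed _ k arcs t => .closed d k arcs t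

/-- Replace the length of the upper chord of a chordal domain. -/
def ChordalDomain.withTop (d : ChordalDomain) (l : ℝ) : ChordalDomain :=
  { d with top := l }

/-- Replace the length of the upper chord of the uppermost chordal domain. -/
def FixedTree.withTop (l : ℝ) (t : FixedTree) : FixedTree := t.withDom (t.dom.withTop l)

/-- The tree hangs below the chord `[a, b]`. -/
def FixedTree.HangsAt (t : FixedTree) (a b : ℝ) : Prop := t.dom.UpperChord a b

/-- The arcs `𝔞₀ < … < 𝔞ₖ` form the base of a linearity domain of the strip of width `ε`:
they are disjoint closed intervals, consecutive ones at distance at most `2ε`; the points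
`(x, f'(x))` over them lie on one line, and any two of their points satisfy the cup equation.
They contain at least three points. -/
def MultiBase (f : ℝ → ℝ) (ε : ℝ) {k : ℕ} (arcs : Fin (k + 1) → Arc) : Prop :=
  (∀ i, (arcs i).Valid) ∧
  (∀ i : Fin k, (arcs i.castSucc).hi < (arcs i.succ).lo ∧
    (arcs i.succ).lo ≤ (arcs i.castSucc).hi + ((2 * ε : ℝ) : EReal)) ∧
  (∃ α β : ℝ, ∀ i, ∀ x ∈ (arcs i).toSet, deriv f x = α + β * x) ∧
  (∀ i j, ∀ x ∈ (arcs i).toSet, ∀ y ∈ (arcs j).toSet, CupEq f x y) ∧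
  (2 ≤ k ∨ ∃ i, (arcs i).lo < (arcs i).hi)

/-- All arcs are bounded. -/
def BoundedArcs {k : ℕ} (arcs : Fin (k + 1) → Arc) : Prop :=
  ∀ i, ⊥ < (arcs i).lo ∧ (arcs i).hi < ⊤

/-- The figures of the tree satisfy their local requirements. -/
def FixedTree.Admissible (f : ℝ → ℝ) (ε : ℝ) : FixedTree → Prop
  | .cup d c => d.Admissible f ∧ d.LowerChord c c
  | .chord d a b t => d.Admissible f ∧ a < b ∧ d.LowerChord a b ∧ (DL f a b = 0 ∨ DR f a b = 0) ∧
      t.HangsAt a b ∧ t.Admissible f ε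
  | .closed d k arcs t => d.Admissible f ∧
      MultiBase f ε arcs ∧ BoundedArcs arcs ∧
      d.LowerChord (arcs 0).lo.toReal (arcs (Fin.last k)).hi.toReal ∧
      (arcs (Fin.last k)).hi.toReal - (arcs 0).lo.toReal < 2 * ε ∧
      (∀ i : Fin k, (t i).HangsAt (arcs i.castSucc).hi.toReal (arcs i.succ).lo.toReal) ∧
      ∀ i : Fin k, (t i).Admissible f ε

/-- Every arc that is not a single point is a root of `f'''`. -/
def ArcsAreRoots (f : ℝ → ℝ) {k : ℕ} (arcs : Fin (k + 1) → Arc) : Prop :=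
  ∀ i, (arcs i).lo < (arcs i).hi → IsRootC f (arcs i).toSet

/-- An end of the chord `[a, b]` with vanishing differential is a one-point root of `f'''`. -/
def ChordEndsAreRoots (f : ℝ → ℝ) (a b : ℝ) : Prop :=
  (DR f a b = 0 → IsRootC f {b}) ∧ (DL f a b = 0 → IsRootC f {a})

/-- The leaf-root condition on a tree. -/
def FixedTree.LeafRoot (f : ℝ → ℝ) : FixedTree → Prop
  | .cup _ c => IsRootC f {c}
  | .chord _ a b t => ChordEndsAreRoots f a b ∧ t.LeafRoot f
  | .closed _ _ arcs t => ArcsAreRoots f arcs ∧ ∀ i, (t i).LeafRoot f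

/-! ### The figures that meet the upper boundary of the strip -/

/-- The kinds of linearity domains over a system of arcs that touch the upper boundary. -/
inductive MultiKind
  | multicup
  | multitrolleybus (s : Side)
  | multibirdie

/-- The figures between which the tangent domains are stretched, together with the trees below
them: angles; trolleybuses and birdies over a chord `[a, b]`; the linearity domains over a system of
arcs (full multicups are `multicup`s of width `2ε`); the long chords `[a, b]`, `b - a = 2ε`, with
two non-zero differentials (`fict1`) or with a vanishing differential (`fict3`); the infinities
(with the orientation of the adjacent tangent domain); and the points `c` that separate two tangent
domains of the same orientation (`fict5`). -/
inductive FreeVertex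
  | angle (w : ℝ)
  | trolleybus (s : Side) (a b : ℝ) (below : FixedTree)
  | birdie (a b : ℝ) (below : FixedTree)
  | multi (kind : MultiKind) (k : ℕ) (arcs : Fin (k + 1) → Arc) (below : Fin k → FixedTree)
  | fict1 (a b : ℝ) (below : FixedTree)
  | fict3 (a b : ℝ) (below : FixedTree)
  | minusInfinity (s : Side)
  | plusInfinity (s : Side)
  | fict5 (s : Side) (c : ℝ)

namespace FreeVertex

/-- The left end of the figure on the lower boundary. -/
def leftEnd : FreeVertex → EReal
  | angle w => w
  | trolleybus _ a _ _ => a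
  | birdie a _ _ => a
  | multi _ _ arcs _ => (arcs 0).lo
  | fict1 a _ _ => a
  | fict3 a _ _ => a
  | minusInfinity _ => ⊥
  | plusInfinity _ => ⊤
  | fict5 _ c => c

/-- The right end of the figure on the lower boundary. -/
def rightEnd : FreeVertex → EReal
  | angle w => w
  | trolleybus _ _ b _ => b
  | birdie _ b _ => b
  | multi _ k arcs _ => (arcs (Fin.last k)).hi
  | fict1 _ b _ => b
  | fict3 _ b _ => b
  | minusInfinity _ => ⊥
  | plusInfinity _ => ⊤
  | fict5 _ c => c

/-- The orientation of the tangent domain on the left of the figure. -/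
def leftDir : FreeVertex → Side
  | angle _ => .R
  | trolleybus s _ _ _ => s
  | birdie _ _ _ => .R
  | multi .multicup _ _ _ => .L
  | multi (.multitrolleybus s) _ _ _ => s
  | multi .multibirdie _ _ _ => .R
  | fict1 _ _ _ => .L
  | fict3 _ _ _ => .L
  | minusInfinity s => s
  | plusInfinity s => s
  | fict5 s _ => s

/-- The orientation of the tangent domain on the right of the figure. -/
def rightDir : FreeVertex → Side
  | angle _ => .L
  | trolleybus s _ _ _ => s
  | birdie _ _ _ => .L
  | multi .multicup _ _ _ => .R
  | multi (.multitrolleybus s) _ _ _ => s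
  | multi .multibirdie _ _ _ => .L
  | fict1 _ _ _ => .R
  | fict3 _ _ _ => .R
  | minusInfinity s => s
  | plusInfinity s => s
  | fict5 s _ => s

/-- The chord on which the figure stands (`none` for angles and infinities). If an arc at an end of
the figure is a ray, its infinite end is replaced by a point of the ray; neither the slope of the
chord nor its differential at the other end depends on this point. -/
def base : FreeVertex → Option (ℝ × ℝ)
  | angle _ => none
  | trolleybus _ a b _ => some (a, b)
  | birdie a b _ => some (a, b)
  | multi _ k arcs _ => some ((arcs 0).leftPt, (arcs (Fin.last k)).rightPt)
  | fict1 a b _ => some (a, b)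
  | fict3 a b _ => some (a, b)
  | minusInfinity _ => none
  | plusInfinity _ => none
  | fict5 _ c => some (c, c)

/-- The figure and everything below it satisfy their local requirements. -/
def Admissible (f : ℝ → ℝ) (ε : ℝ) : FreeVertex → Prop
  | angle _ => True
  | trolleybus _ a b t => a < b ∧ b - a ≤ 2 * ε ∧ t.HangsAt a b ∧ t.Admissible f ε
  | birdie a b t => a < b ∧ b - a ≤ 2 * ε ∧ t.HangsAt a b ∧ t.Admissible f ε
  | multi kind k arcs t => MultiBase f ε arcs ∧
      (∀ i : Fin k, (t i).HangsAt (arcs i.castSucc).hi.toReal (arcs i.succ).lo.toReal) ∧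
      (∀ i : Fin k, (t i).Admissible f ε) ∧
      match kind with
      | .multicup => (arcs 0).lo + ((2 * ε : ℝ) : EReal) ≤ (arcs (Fin.last k)).hi
      | .multitrolleybus .R => ⊥ < (arcs 0).lo
      | .multitrolleybus .L => (arcs (Fin.last k)).hi < ⊤
      | .multibirdie => BoundedArcs arcs
  | fict1 a b t => b - a = 2 * ε ∧ DL f a b ≠ 0 ∧ DR f a b ≠ 0 ∧ t.HangsAt a b ∧ t.Admissible f ε
  | fict3 a b t => b - a = 2 * ε ∧ (DL f a b = 0 ∨ DR f a b = 0) ∧ t.HangsAt a b ∧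
      t.Admissible f ε
  | minusInfinity _ => True
  | plusInfinity _ => True
  | fict5 _ _ => True

/-- The leaf-root condition on a figure and on everything below it. -/
def LeafRoot (f : ℝ → ℝ) : FreeVertex → Prop
  | angle _ => True
  | trolleybus _ _ _ t => t.LeafRoot f
  | birdie _ _ t => t.LeafRoot f
  | multi _ _ arcs t => ArcsAreRoots f arcs ∧ ∀ i, (t i).LeafRoot f
  | fict1 _ _ t => t.LeafRoot f
  | fict3 a b t => ChordEndsAreRoots f a b ∧ t.LeafRoot f
  | minusInfinity _ => True
  | plusInfinity _ => True
  | fict5 _ c => IsRootC f {c}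

/-- The figure is a multicup of width exactly `2ε`. -/
def IsFullMulticup (ε : ℝ) : FreeVertex → Prop
  | multi .multicup k arcs _ => (arcs 0).lo + ((2 * ε : ℝ) : EReal) = (arcs (Fin.last k)).hi
  | _ => False

/-- The figure may occur in a smooth graph: it is not a full multicup, a multitrolleybus, a
multibirdie, a long chord with a vanishing differential, or a fictitious vertex of the fifth type. -/
def Smooth (ε : ℝ) : FreeVertex → Prop
  | multi .multicup k arcs t => ¬ IsFullMulticup ε (multi .multicup k arcs t)
  | multi (.multitrolleybus _) _ _ _ => False
  | multi .multibirdie _ _ _ => False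
  | fict3 _ _ _ => False
  | fict5 _ _ => False
  | _ => True

/-- The force of the right tangent domain that starts from the figure. -/
def rightForce (f : ℝ → ℝ) (ε : ℝ) (v : FreeVertex) : ℝ → ℝ :=
  match v.base with
  | some p => forceR f ε p.1 p.2
  | none => forceRInf f ε

/-- The force of the left tangent domain that starts from the figure. -/
def leftForce (f : ℝ → ℝ) (ε : ℝ) (v : FreeVertex) : ℝ → ℝ :=
  match v.base with
  | some p => forceL f ε p.1 p.2
  | none => forceLInf f ε

/-- The slope coefficient `m` of a tangent domain of orientation `s` has at the end `x` of the
figure the value that makes the candidates on the two figures agree. (Angles are treated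
separately, and there is nothing to require at the infinities.) -/
def Glues (f : ℝ → ℝ) (ε : ℝ) (v : FreeVertex) (s : Side) (m : ℝ → ℝ) (x : EReal) : Prop :=
  match v.base with
  | some p =>
    match s with
    | .R => m x.toReal = deriv f x.toReal - ε * av (deriv (deriv f)) p.1 p.2
    | .L => m x.toReal = deriv f x.toReal + ε * av (deriv (deriv f)) p.1 p.2
  | none => True

end FreeVertex

/-! ### Graphs -/

/-- The domain of right or left tangents with tangency points over `(ul, ur)`. -/
structure TangentDomain where
  dir : Side
  ul : EReal
  ur : EReal

/-- The graph of a foliation. Its free part is a path: read from left to right, vertices alternate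
with edges (tangent domains). The remaining part is a forest hanging from the free vertices. -/
structure FoliationGraph where
  n : ℕ
  vertex : Fin (n + 1) → FreeVertex
  edge : Fin n → TangentDomain

namespace FoliationGraph

/-- The figures fit together and exhaust the strip. -/
def WellFormed (Γ : FoliationGraph) : Prop :=
  (Γ.vertex 0).leftEnd = ⊥ ∧ (Γ.vertex (Fin.last Γ.n)).rightEnd = ⊤ ∧
  ∀ i : Fin Γ.n,
    (Γ.edge i).ul = (Γ.vertex i.castSucc).rightEnd ∧ (Γ.edge i).ur = (Γ.vertex i.succ).leftEnd ∧
    (Γ.edge i).ul < (Γ.edge i).ur ∧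
    (Γ.edge i).dir = (Γ.vertex i.castSucc).rightDir ∧ (Γ.edge i).dir = (Γ.vertex i.succ).leftDir

/-- `m` is the slope coefficient of a standard candidate on the tangent domain `E`: it satisfies
`ε m' + m - f' = 0` and `m'' < 0` on a right domain, `-ε m' + m - f' = 0` and `m'' > 0` on a left
one, and is given by the explicit integral if the tangents come from infinity. -/
def IsSlope (f : ℝ → ℝ) (ε : ℝ) (E : TangentDomain) (m : ℝ → ℝ) : Prop :=
  ContinuousOn m {u | E.ul ≤ (u : EReal) ∧ (u : EReal) ≤ E.ur} ∧
  match E.dir with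
  | .R =>
    (∀ u : ℝ, E.ul < (u : EReal) → (u : EReal) < E.ur →
      HasDerivAt m ((deriv f u - m u) / ε) u ∧ deriv (deriv m) u < 0) ∧
    (E.ul = ⊥ → ∀ u : ℝ, (u : EReal) ≤ E.ur →
      m u = ε⁻¹ * Real.exp (-u / ε) * ∫ t in Iic u, deriv f t * Real.exp (t / ε))
  | .L =>
    (∀ u : ℝ, E.ul < (u : EReal) → (u : EReal) < E.ur →
      HasDerivAt m ((m u - deriv f u) / ε) u ∧ 0 < deriv (deriv m) u) ∧
    (E.ur = ⊤ → ∀ u : ℝ, E.ul ≤ (u : EReal) →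
      m u = ε⁻¹ * Real.exp (u / ε) * ∫ t in Ioi u, deriv f t * Real.exp (-t / ε))

/-- All figures of the graph satisfy their local requirements for `f` and `ε`. -/
def Admissible (f : ℝ → ℝ) (ε : ℝ) (Γ : FoliationGraph) : Prop :=
  Γ.WellFormed ∧ (∀ i, (Γ.vertex i).Admissible f ε) ∧
  ∃ m : Fin Γ.n → ℝ → ℝ, ∀ i : Fin Γ.n,
    IsSlope f ε (Γ.edge i) (m i) ∧
    (Γ.vertex i.castSucc).Glues f ε (Γ.edge i).dir (m i) (Γ.edge i).ul ∧
    (Γ.vertex i.succ).Glues f ε (Γ.edge i).dir (m i) (Γ.edge i).ur ∧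
    ∀ j : Fin Γ.n, (j : ℕ) = i + 1 → ∀ w : ℝ, Γ.vertex i.succ = .angle w →
      m i w + m j w = 2 * deriv f w

/-- The tail of the force assigned to an edge. Right tangent domains start from their left
neighbour, left ones from their right neighbour. -/
def edgeTail (f : ℝ → ℝ) (ε : ℝ) (Γ : FoliationGraph) (i : Fin Γ.n) : Set ℝ :=
  match (Γ.edge i).dir with
  | .R => rightTail ((Γ.vertex i.castSucc).rightForce f ε) (Γ.edge i).ul
  | .L => leftTail ((Γ.vertex i.succ).leftForce f ε) (Γ.edge i).ur

/-- The non-degeneracy force condition. -/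
def NonDegenerateForces (f : ℝ → ℝ) (ε : ℝ) (Γ : FoliationGraph) : Prop :=
  ∀ i : Fin Γ.n, ∀ u : ℝ, (Γ.edge i).ul < (u : EReal) → (u : EReal) < (Γ.edge i).ur →
    u ∈ Γ.edgeTail f ε i

/-- The leaf-root condition. -/
def LeafRoot (f : ℝ → ℝ) (Γ : FoliationGraph) : Prop := ∀ i, (Γ.vertex i).LeafRoot f

/-- The graph has no unstable vertices. -/
def Smooth (ε : ℝ) (Γ : FoliationGraph) : Prop := ∀ i, (Γ.vertex i).Smooth ε

/-- Each angle lies in the (open) tails of the forces of both tangent domains adjacent to it. -/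
def AnglesInTails (f : ℝ → ℝ) (ε : ℝ) (Γ : FoliationGraph) : Prop :=
  ∀ i : Fin Γ.n, ∀ w : ℝ, (Γ.vertex i.castSucc = .angle w ∨ Γ.vertex i.succ = .angle w) →
    w ∈ Γ.edgeTail f ε i

end FoliationGraph

/-! ### Local evolution rules -/

/-- A continuous strictly decreasing length of a chord that starts at time `η₁` from `l₀`. -/
def ShrinkingLength (η₁ η₂ l₀ : ℝ) (l : ℝ → ℝ) : Prop :=
  ContinuousOn l (Icc η₁ η₂) ∧ StrictAntiOn l (Icc η₁ η₂) ∧ l η₁ = l₀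

/-- The trolleybus over the chord of length `l` of the uppermost chordal domain of `t`. -/
def shrunkTrolleybus (s : Side) (t : FixedTree) (l : ℝ) : FreeVertex :=
  .trolleybus s (t.dom.a l) (t.dom.b l) (t.withTop l)

/-- The birdie over the chord of length `l` of the uppermost chordal domain of `t`. -/
def shrunkBirdie (t : FixedTree) (l : ℝ) : FreeVertex :=
  .birdie (t.dom.a l) (t.dom.b l) (t.withTop l)

/-- The full chordal domain with upper chord of length `2ε` cut out of the domain `d`, standing on
the lower part of `t`. -/
def fullChordal (d : ChordalDomain) (t : FixedTree) (ε : ℝ) : FreeVertex :=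
  .fict1 (d.a (2 * ε)) (d.b (2 * ε)) (t.withDom (d.withTop (2 * ε)))

/-- A full flow of chordal domains above the chord `[a, b]`, `b - a = 2η₁`. -/
def FullFlowAbove (f : ℝ → ℝ) (η₁ η₂ a b : ℝ) (d : ChordalDomain) : Prop :=
  d.Admissible f ∧ d.LowerChord a b ∧ d.bot = 2 * η₁ ∧ d.top = 2 * η₂

/-- A full flow of chordal domains that extends the full chordal domain `d₀`. -/
def FullFlowExtending (f : ℝ → ℝ) (η₁ η₂ : ℝ) (d₀ d : ChordalDomain) : Prop :=
  d.Admissible f ∧ d.bot = d₀.bot ∧ d.top = 2 * η₂ ∧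
    EqOn d.a d₀.a (Icc d₀.bot (2 * η₁)) ∧ EqOn d.b d₀.b (Icc d₀.bot (2 * η₁))

/-- A row of trolleybuses of orientation `s`, one over each of the trees `t i`. -/
def parade (s : Side) {k : ℕ} (t : Fin k → FixedTree) (l : Fin k → ℝ) : List FreeVertex :=
  List.ofFn fun i => shrunkTrolleybus s (t i) (l i)

open Classical in
/-- `L ε`, `η₁ < ε ≤ η₂`, is the row of vertices by which the vertex `v` is replaced at time `ε`
according to the local evolution rule for the type of `v`. -/
def LocalRule (f : ℝ → ℝ) (η₁ η₂ : ℝ) (L : ℝ → List FreeVertex) : FreeVertex → Prop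
  | .angle w => ∃ W : ℝ → ℝ, ContinuousOn W (Icc η₁ η₂) ∧ W η₁ = w ∧
      ∀ ε ∈ Ioc η₁ η₂, L ε = [.angle (W ε)]
  | .trolleybus s a b t => ∃ l, ShrinkingLength η₁ η₂ (b - a) l ∧
      ∀ ε ∈ Ioc η₁ η₂, L ε = [shrunkTrolleybus s t (l ε)]
  | .birdie a b t => ∃ l, ShrinkingLength η₁ η₂ (b - a) l ∧
      ∀ ε ∈ Ioc η₁ η₂, L ε = [shrunkBirdie t (l ε)] ∨
        ∃ w : ℝ, L ε = [shrunkTrolleybus .R t (l ε), .angle w] ∨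
          L ε = [.angle w, shrunkTrolleybus .L t (l ε)]
  | .multi .multicup k arcs t =>
      if FreeVertex.IsFullMulticup η₁ (.multi .multicup k arcs t) then
        ∃ d, FullFlowAbove f η₁ η₂ (arcs 0).lo.toReal (arcs (Fin.last k)).hi.toReal d ∧
          ∀ ε ∈ Ioc η₁ η₂, L ε = [fullChordal d (.closed d k arcs t) ε]
      else ∀ ε ∈ Ioc η₁ η₂, L ε = [.multi .multicup k arcs t]
  | .multi (.multitrolleybus .R) k arcs t => ∃ l : Fin k → ℝ → ℝ,
      (∀ i : Fin k, ShrinkingLength η₁ η₂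
        ((arcs i.succ).lo.toReal - (arcs i.castSucc).hi.toReal) (l i)) ∧
      ∀ ε ∈ Ioc η₁ η₂, L ε = parade .R t (fun i => l i ε) ++
        (if (arcs (Fin.last k)).hi = ⊤ then [.plusInfinity .R] else [])
  | .multi (.multitrolleybus .L) k arcs t => ∃ l : Fin k → ℝ → ℝ,
      (∀ i : Fin k, ShrinkingLength η₁ η₂
        ((arcs i.succ).lo.toReal - (arcs i.castSucc).hi.toReal) (l i)) ∧
      ∀ ε ∈ Ioc η₁ η₂, L ε =
        (if (arcs 0).lo = ⊥ then [.minusInfinity .L] else []) ++ parade .L t (fun i => l i ε)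
  | .multi .multibirdie k arcs t => ∃ l : Fin k → ℝ → ℝ,
      (∀ i : Fin k, ShrinkingLength η₁ η₂
        ((arcs i.succ).lo.toReal - (arcs i.castSucc).hi.toReal) (l i)) ∧
      ∀ ε ∈ Ioc η₁ η₂,
        (∃ j ≤ k, ∃ w : ℝ, L ε = (parade .R t (fun i => l i ε)).take j ++
          [.angle w] ++ (parade .L t (fun i => l i ε)).drop j) ∨
        (∃ j : Fin k, L ε = (parade .R t (fun i => l i ε)).take j ++
          [shrunkBirdie (t j) (l j ε)] ++ (parade .L t (fun i => l i ε)).drop (j + 1))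
  | .fict1 _ _ t => ∃ d, FullFlowExtending f η₁ η₂ t.dom d ∧
      ∀ ε ∈ Ioc η₁ η₂, L ε = [fullChordal d t ε]
  | .fict3 a b t => ∃ d, FullFlowAbove f η₁ η₂ a b d ∧
      ∀ ε ∈ Ioc η₁ η₂, L ε = [fullChordal d (.chord d a b t) ε]
  | .minusInfinity s => ∀ ε ∈ Ioc η₁ η₂, L ε = [.minusInfinity s]
  | .plusInfinity s => ∀ ε ∈ Ioc η₁ η₂, L ε = [.plusInfinity s]
  | .fict5 _ _ => ∀ ε ∈ Ioc η₁ η₂, L ε = []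

/-- Along `η₁ < ε ≤ η₂`, the row of free vertices of `G ε` is obtained from that of `Γ` by replacing
each vertex according to its local evolution rule. -/
def Evolves (f : ℝ → ℝ) (η₁ η₂ : ℝ) (Γ : FoliationGraph) (G : ℝ → FoliationGraph) : Prop :=
  ∃ L : Fin (Γ.n + 1) → ℝ → List FreeVertex,
    (∀ i, LocalRule f η₁ η₂ (L i) (Γ.vertex i)) ∧
    ∀ ε ∈ Ioc η₁ η₂, List.ofFn (G ε).vertex = (List.ofFn fun i => L i ε).flatten

end

end BellmanFoliation

namespace BellmanFoliation

open Set MeasureTheory Filter Topology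

noncomputable section

/-! ### Solutions of `ε Q' = G - Q` -/

/-! On a tangent domain everything is governed by the derivative of the slope coefficient. On a
right domain put Q = m'. The equation ε m' + m = f' becomes ε Q' = G - Q with G = f''; the condition
m'' < 0 becomes G < Q; the force is G - Q; gluing to a figure whose base has average λ of f'' means
Q = λ at its end; and the condition at an angle says that the two waves take the same value there.
The substitution z ↦ -z turns left domains into right ones. An admissible graph is thus a system of
solutions ("waves") of one linear equation, lying above G, that are transferred by chords: a wave
enters at a(l) with the value λ(l) = ⟨f''⟩ over [a(l), b(l)], and a new one leaves b(l) with the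
same value.

Two computations drive the evolution. First, if Q and Q' are waves for ε < ε', then e^{z/ε'}(Q' - Q)
has the derivative e^{z/ε'}(Q - G)(1/ε - 1/ε'). So, as long as Q stays above G, waves are ordered by
ε and the order is never lost (`Solves.lt_of_lt`, `Solves.lt_of_le`, `waveInf_lt_waveInf`). Second,
the cup equation relates λ' to the differentials: e^{a/ε}(Q(a) - λ) increases with the length l,
while the derivative of e^{b/ε}(Q(b) - λ) has the sign of 2ε - l (`Flow.strictMonoOn_enter`,
`Flow.hasDerivAt_exit`). Hence a wave that has grown enters a chordal domain at a shorter chord,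
and, since lengths there are at most 2ε, the wave leaving that chord has grown too
(`exists_gapCrossing`). For full chordal domains the lengths are at least 2ε, the sign is opposite,
and it is the wave leaving the longer chord that has grown (`Flow.exists_source`).

On a non-degenerate arc of a multifigure G is constant and the initial wave runs along it; for
larger ε it lies strictly above, so the arc is swallowed by a tangent domain and the multifigure
falls apart into the figures over its gaps (`exists_rowWaves`). Where right and left waves run
towards each other their difference is strictly decreasing, so they match in exactly one way, at a
common chord of a gap or at an angle (`Meeting.resolve`, `meets_angle`). Above a long chord from
which tangents start in both directions f'' drops below its average outwards; then for every
slightly larger length exactly one nearby chord satisfies the cup equation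
(`exists_cup_neighbourhood`, `exists_chords_above`, `exists_chordal_extension`).

Globally the free vertices form a path whose edges are oriented by the motion of their waves. New
waves are created at sources (`springs_vertex`, `passes_startInfinity`), carried through vertices
that keep the orientation (`passes_vertex`), and matched at sinks (`meets_vertex`). Every choice
depends only on earlier ones along the arrows, so the choices are compatible (`exists_path_data`),
and the smallest of the finitely many times can serve as η₂. -/

/-- `Q` is a solution of `ε Q' = G - Q` on the line. -/
def Solves (G : ℝ → ℝ) (ε : ℝ) (Q : ℝ → ℝ) : Prop := ∀ z, HasDerivAt Q ((G z - Q z) / ε) z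

/-- The solution of `ε Q' = G - Q` with `Q β = c`. -/
def wave (G : ℝ → ℝ) (ε β c z : ℝ) : ℝ :=
  Real.exp (-z / ε) * (Real.exp (β / ε) * c + ε⁻¹ * ∫ t in β..z, Real.exp (t / ε) * G t)

lemma wave_self (G : ℝ → ℝ) (ε β c : ℝ) : wave G ε β c β = c := by
  rw [wave, intervalIntegral.integral_same, mul_zero, add_zero, ← mul_assoc, ← Real.exp_add]
  simp [neg_div]

lemma Solves.continuous {G Q : ℝ → ℝ} {ε : ℝ} (h : Solves G ε Q) : Continuous Q :=
  continuous_iff_continuousAt.2 fun z => (h z).continuousAt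

lemma hasDerivAt_exp_div (ε z : ℝ) :
    HasDerivAt (fun z => Real.exp (z / ε)) (Real.exp (z / ε) * (1 / ε)) z :=
  ((hasDerivAt_id z).div_const ε).exp

lemma hasDerivAt_exp_neg_div (ε z : ℝ) :
    HasDerivAt (fun z => Real.exp (-z / ε)) (Real.exp (-z / ε) * (-1 / ε)) z :=
  ((hasDerivAt_id z).neg.div_const ε).exp

lemma wave_solves {G : ℝ → ℝ} (hG : Continuous G) {ε : ℝ} (β c : ℝ) :
    Solves G ε (wave G ε β c) := by
  intro z
  have hc : Continuous fun t => Real.exp (t / ε) * G t := by fun_prop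
  have h1 : HasDerivAt (fun z => ∫ t in β..z, Real.exp (t / ε) * G t)
      (Real.exp (z / ε) * G z) z := hc.integral_hasStrictDerivAt β z |>.hasDerivAt
  have h2 := (hasDerivAt_exp_neg_div ε z).mul ((h1.const_mul ε⁻¹).const_add (Real.exp (β / ε) * c))
  refine h2.congr_deriv ?_
  have h3 : Real.exp (-z / ε) * Real.exp (z / ε) = 1 := by
    rw [← Real.exp_add]; simp [neg_div]
  simp only [wave]
  linear_combination (G z / ε) * h3

/-- The quantity whose monotonicity compares solutions for different `ε`. -/
lemma Solves.hasDerivAt_cmp {G Q Q' : ℝ → ℝ} {ε ε' : ℝ} (h : Solves G ε Q) (h' : Solves G ε' Q')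
    (z : ℝ) : HasDerivAt (fun z => Real.exp (z / ε') * (Q' z - Q z))
      (Real.exp (z / ε') * ((Q z - G z) * (1 / ε - 1 / ε'))) z := by
  refine ((hasDerivAt_exp_div ε' z).mul ((h' z).sub (h z))).congr_deriv ?_
  simp only [Pi.sub_apply]
  ring

lemma Solves.monotoneOn_cmp {G Q Q' : ℝ → ℝ} {ε ε' x y : ℝ} (h : Solves G ε Q)
    (h' : Solves G ε' Q') (hε : 0 < ε) (hle : ε ≤ ε') (hpos : ∀ z ∈ Ioo x y, G z ≤ Q z) :
    MonotoneOn (fun z => Real.exp (z / ε') * (Q' z - Q z)) (Icc x y) := by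
  refine monotoneOn_of_hasDerivWithinAt_nonneg (convex_Icc x y)
    (fun z _ => (h.hasDerivAt_cmp h' z).continuousAt.continuousWithinAt)
    (fun z _ => (h.hasDerivAt_cmp h' z).hasDerivWithinAt) fun z hz => ?_
  rw [interior_Icc] at hz
  have := one_div_le_one_div_of_le hε hle
  exact mul_nonneg (Real.exp_pos _).le
    (mul_nonneg (sub_nonneg.2 (hpos z hz)) (sub_nonneg.2 this))

lemma Solves.strictMonoOn_cmp {G Q Q' : ℝ → ℝ} {ε ε' x y : ℝ} (h : Solves G ε Q)
    (h' : Solves G ε' Q') (hε : 0 < ε) (hlt : ε < ε') (hpos : ∀ z ∈ Ioo x y, G z < Q z) :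
    StrictMonoOn (fun z => Real.exp (z / ε') * (Q' z - Q z)) (Icc x y) := by
  refine strictMonoOn_of_hasDerivWithinAt_pos (convex_Icc x y)
    (fun z _ => (h.hasDerivAt_cmp h' z).continuousAt.continuousWithinAt)
    (fun z _ => (h.hasDerivAt_cmp h' z).hasDerivWithinAt) fun z hz => ?_
  rw [interior_Icc] at hz
  have := one_div_lt_one_div_of_lt hε hlt
  exact mul_pos (Real.exp_pos _) (mul_pos (sub_pos.2 (hpos z hz)) (sub_pos.2 this))

/-- Only the wave with the smaller parameter has to stay above G: then the weighted difference is
non-decreasing, so a gap between the waves cannot close. Equal parameters are allowed. -/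
lemma Solves.lt_of_lt {G Q Q' : ℝ → ℝ} {ε ε' x y : ℝ} (h : Solves G ε Q)
    (h' : Solves G ε' Q') (hε : 0 < ε) (hle : ε ≤ ε') (hxy : x ≤ y)
    (hpos : ∀ z ∈ Ioo x y, G z ≤ Q z) (hx : Q x < Q' x) : Q y < Q' y := by
  have := h.monotoneOn_cmp h' hε hle hpos (left_mem_Icc.2 hxy) (right_mem_Icc.2 hxy) hxy
  have h0 : 0 < Real.exp (x / ε') * (Q' x - Q x) := mul_pos (Real.exp_pos _) (sub_pos.2 hx)
  exact sub_pos.1 (pos_of_mul_pos_right (h0.trans_le this) (Real.exp_pos _).le)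

/-- For different parameters the weighted difference strictly increases, so even waves with a common
initial value separate at once. -/
lemma Solves.lt_of_le {G Q Q' : ℝ → ℝ} {ε ε' x y : ℝ} (h : Solves G ε Q)
    (h' : Solves G ε' Q') (hε : 0 < ε) (hlt : ε < ε') (hxy : x < y)
    (hpos : ∀ z ∈ Ioo x y, G z < Q z) (hx : Q x ≤ Q' x) : Q y < Q' y := by
  have := h.strictMonoOn_cmp h' hε hlt hpos (left_mem_Icc.2 hxy.le) (right_mem_Icc.2 hxy.le) hxy
  have h0 : 0 ≤ Real.exp (x / ε') * (Q' x - Q x) := mul_nonneg (Real.exp_pos _).le (sub_nonneg.2 hx)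
  exact sub_pos.1 (pos_of_mul_pos_right (h0.trans_lt this) (Real.exp_pos _).le)

/-- For equal parameters the weighted difference is constant: uniqueness for a linear equation of
first order. -/
lemma Solves.eq_of_eq {G Q Q' : ℝ → ℝ} {ε x : ℝ} (h : Solves G ε Q) (h' : Solves G ε Q')
    (hx : Q x = Q' x) : Q = Q' := by
  have hd : ∀ z, HasDerivAt (fun z => Real.exp (z / ε) * (Q' z - Q z)) 0 z := fun z =>
    (h.hasDerivAt_cmp h' z).congr_deriv (by simp)
  funext y
  have := is_const_of_deriv_eq_zero (fun z => (hd z).differentiableAt) (fun z => (hd z).deriv) x y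
  simp only [hx, sub_self, mul_zero] at this
  have h2 := (mul_eq_zero.1 this.symm).resolve_left (Real.exp_pos _).ne'
  linarith

/-- A solution that stays above `G` decreases. -/
lemma Solves.antitoneOn {G Q : ℝ → ℝ} {ε x y : ℝ} (h : Solves G ε Q) (hε : 0 < ε)
    (hpos : ∀ z ∈ Ioo x y, G z ≤ Q z) : AntitoneOn Q (Icc x y) := by
  refine antitoneOn_of_hasDerivWithinAt_nonpos (convex_Icc x y) h.continuous.continuousOn
    (fun z _ => (h z).hasDerivWithinAt) fun z hz => ?_
  rw [interior_Icc] at hz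
  exact div_nonpos_of_nonpos_of_nonneg (sub_nonpos.2 (hpos z hz)) hε.le

lemma Solves.strictAntiOn {G Q : ℝ → ℝ} {ε x y : ℝ} (h : Solves G ε Q) (hε : 0 < ε)
    (hpos : ∀ z ∈ Ioo x y, G z < Q z) : StrictAntiOn Q (Icc x y) := by
  refine strictAntiOn_of_hasDerivWithinAt_neg (convex_Icc x y) h.continuous.continuousOn
    (fun z _ => (h z).hasDerivWithinAt) fun z hz => ?_
  rw [interior_Icc] at hz
  exact div_neg_of_neg_of_pos (sub_neg.2 (hpos z hz)) hε

lemma Solves.hasDerivAt_sub_const {G Q : ℝ → ℝ} {ε : ℝ} (h : Solves G ε Q) (c z : ℝ) :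
    HasDerivAt (fun z => Real.exp (z / ε) * (Q z - c)) (Real.exp (z / ε) * ((G z - c) / ε)) z := by
  refine ((hasDerivAt_exp_div ε z).mul ((h z).sub_const c)).congr_deriv ?_
  ring

/-- The constant c is compared with the wave: where G ≥ c, the wave is pushed up relative to c. This
gives positivity even where the wave starts on the graph of G. -/
lemma Solves.monotoneOn_sub_const {G Q : ℝ → ℝ} {ε x y c : ℝ} (h : Solves G ε Q) (hε : 0 < ε)
    (hpos : ∀ z ∈ Ioo x y, c ≤ G z) :
    MonotoneOn (fun z => Real.exp (z / ε) * (Q z - c)) (Icc x y) := by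
  refine monotoneOn_of_hasDerivWithinAt_nonneg (convex_Icc x y)
    (fun z _ => (h.hasDerivAt_sub_const c z).continuousAt.continuousWithinAt)
    (fun z _ => (h.hasDerivAt_sub_const c z).hasDerivWithinAt) fun z hz => ?_
  rw [interior_Icc] at hz
  exact mul_nonneg (Real.exp_pos _).le (div_nonneg (sub_nonneg.2 (hpos z hz)) hε.le)

/-- Where `G` is the constant `c`, the sign of `Q - c` does not change. -/
lemma Solves.eq_const {G Q : ℝ → ℝ} {ε x y c : ℝ} (h : Solves G ε Q) (hxy : x ≤ y)
    (hc : ∀ z ∈ Icc x y, G z = c) (hx : Q x = c) : Q y = c := by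
  have := constant_of_has_deriv_right_zero (a := x) (b := y)
    (f := fun z => Real.exp (z / ε) * (Q z - c))
    (fun z _ => (h.hasDerivAt_sub_const c z).continuousAt.continuousWithinAt)
    (fun z hz => ((h.hasDerivAt_sub_const c z).congr_deriv
      (by simp [hc z ⟨hz.1, hz.2.le⟩])).hasDerivWithinAt) y (right_mem_Icc.2 hxy)
  simp only [hx, sub_self, mul_zero] at this
  have h2 := (mul_eq_zero.1 this).resolve_left (Real.exp_pos _).ne'
  linarith

/-! ### Tails at a zero of the force -/

/-- On one-sided neighbourhoods of each point the function is monotone or antitone. -/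
def LocallyMonotone (G : ℝ → ℝ) : Prop := ∀ x, ∃ δ > 0,
  (MonotoneOn G (Icc x (x + δ)) ∨ AntitoneOn G (Icc x (x + δ))) ∧
  (MonotoneOn G (Icc (x - δ) x) ∨ AntitoneOn G (Icc (x - δ) x))

/-- `G` falls strictly below `G x` just after `x`, in a non-increasing way. -/
def FallsAfter (G : ℝ → ℝ) (x : ℝ) : Prop :=
  ∃ δ > 0, AntitoneOn G (Icc x (x + δ)) ∧ ∀ z ∈ Ioc x (x + δ), G z < G x

/-- `G` rises, in a non-decreasing way, from strictly smaller values to `G x` just before `x`. -/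
def RisesBefore (G : ℝ → ℝ) (x : ℝ) : Prop :=
  ∃ δ > 0, MonotoneOn G (Icc (x - δ) x) ∧ ∀ z ∈ Ico (x - δ) x, G z < G x

lemma RisesBefore.reflect {G : ℝ → ℝ} {x : ℝ} (h : RisesBefore (fun z => G (-z)) (-x)) :
    FallsAfter G x := by
  obtain ⟨δ, hδ, hm, hlt⟩ := h
  refine ⟨δ, hδ, fun u hu v hv huv => ?_, fun z hz => ?_⟩
  · have := hm (a := -v) (b := -u) ⟨by linarith [hv.2], by linarith [hv.1]⟩
      ⟨by linarith [hu.2], by linarith [hu.1]⟩ (by linarith)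
    simpa using this
  · have := hlt (-z) ⟨by linarith [hz.2], by linarith [hz.1]⟩
    simpa using this

lemma LocallyMonotone.reflect {G : ℝ → ℝ} (h : LocallyMonotone G) :
    LocallyMonotone fun z => G (-z) := by
  intro x
  obtain ⟨δ, hδ, h1, h2⟩ := h (-x)
  refine ⟨δ, hδ, ?_, ?_⟩
  · rcases h2 with h2 | h2
    · exact Or.inr fun u hu v hv huv => h2 ⟨by linarith [hv.2], by linarith [hv.1]⟩
        ⟨by linarith [hu.2], by linarith [hu.1]⟩ (by linarith)
    · exact Or.inl fun u hu v hv huv => h2 ⟨by linarith [hv.2], by linarith [hv.1]⟩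
        ⟨by linarith [hu.2], by linarith [hu.1]⟩ (by linarith)
  · rcases h1 with h1 | h1
    · exact Or.inr fun u hu v hv huv => h1 ⟨by linarith [hv.2], by linarith [hv.1]⟩
        ⟨by linarith [hu.2], by linarith [hu.1]⟩ (by linarith)
    · exact Or.inl fun u hu v hv huv => h1 ⟨by linarith [hv.2], by linarith [hv.1]⟩
        ⟨by linarith [hu.2], by linarith [hu.1]⟩ (by linarith)

/-- A wave above G decreases, so after x the function G stays below Q x = G x; of the two
alternatives for a one-sided monotone piece only the non-increasing one is left. So the mere
presence of a tangent domain determines the shape of f'' at an end with vanishing differential. -/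
lemma Solves.fallsAfter {G Q : ℝ → ℝ} {ε x y : ℝ} (h : Solves G ε Q) (hε : 0 < ε)
    (hG : LocallyMonotone G) (hxy : x < y) (hx : Q x = G x) (hpos : ∀ z ∈ Ioo x y, G z < Q z) :
    FallsAfter G x := by
  have key : ∀ z ∈ Ioo x y, G z < G x := fun z hz =>
    (hpos z hz).trans_le (hx ▸ h.antitoneOn hε (fun w hw => (hpos w hw).le)
      (left_mem_Icc.2 hxy.le) ⟨hz.1.le, hz.2.le⟩ hz.1.le)
  obtain ⟨δ, hδ, h1, -⟩ := hG x
  have hm : 0 < min δ ((y - x) / 2) := lt_min hδ (by linarith)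
  have hm1 := min_le_left δ ((y - x) / 2)
  have hm2 := min_le_right δ ((y - x) / 2)
  refine ⟨min δ ((y - x) / 2), hm, ?_, fun z hz => key z ⟨hz.1, by linarith [hz.2]⟩⟩
  rcases h1 with h1 | h1
  · exfalso
    have := h1 (a := x) (b := x + min δ ((y - x) / 2)) ⟨le_rfl, by linarith⟩
      ⟨by linarith, by linarith⟩ (by linarith)
    exact absurd (key _ ⟨by linarith, by linarith⟩) this.not_gt
  · exact h1.mono (Icc_subset_Icc_right (by linarith))

/-- If G were at least G x on some [z, x], the weighted excess Q - G x would be non-decreasing there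
and vanish at x, whence Q z ≤ G x ≤ G z, contrary to Q > G. Local monotonicity turns this into a
rise. -/
lemma Solves.risesBefore {G Q : ℝ → ℝ} {ε x y : ℝ} (h : Solves G ε Q) (hε : 0 < ε)
    (hG : LocallyMonotone G) (hxy : y < x) (hx : Q x = G x) (hpos : ∀ z ∈ Ioo y x, G z < Q z) :
    RisesBefore G x := by
  have key : ∀ z ∈ Ioo y x, ¬ ∀ w ∈ Icc z x, G x ≤ G w := fun z hz hcon => by
    have := h.monotoneOn_sub_const hε (fun w hw => hcon w (Ioo_subset_Icc_self hw))
      (left_mem_Icc.2 hz.2.le) (right_mem_Icc.2 hz.2.le) hz.2.le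
    simp only [hx, sub_self, mul_zero] at this
    have h2 : Q z - G x ≤ 0 := nonpos_of_mul_nonpos_right this (Real.exp_pos _)
    linarith [hpos z hz, hcon z (left_mem_Icc.2 hz.2.le)]
  obtain ⟨δ, hδ, -, h1⟩ := hG x
  have hm : 0 < min δ ((x - y) / 2) := lt_min hδ (by linarith)
  have hm1 := min_le_left δ ((x - y) / 2)
  have hm2 := min_le_right δ ((x - y) / 2)
  refine ⟨min δ ((x - y) / 2), hm, ?_, fun z hz => ?_⟩
  · rcases h1 with h1 | h1
    · exact h1.mono (Icc_subset_Icc_left (by linarith))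
    · exfalso
      refine key (x - min δ ((x - y) / 2)) ⟨by linarith, by linarith⟩ fun w hw => ?_
      exact h1 ⟨by linarith [hw.1], hw.2⟩ ⟨by linarith, le_rfl⟩ hw.2
  · by_contra hcon
    push Not at hcon
    refine key z ⟨by linarith [hz.1], hz.2⟩ fun w hw => ?_
    rcases h1 with h1 | h1
    · exact hcon.trans (h1 ⟨by linarith [hz.1], hz.2.le⟩ ⟨by linarith [hz.1, hw.1], hw.2⟩ hw.1)
    · exact h1 ⟨by linarith [hz.1, hw.1], hw.2⟩ ⟨by linarith, le_rfl⟩ hw.2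

/-- If the start lies strictly above G this is continuity; if it lies on G, the fall of G makes the
wave lag behind it, hence above it. -/
lemma Solves.exists_tail {G Q : ℝ → ℝ} {ε x : ℝ} (h : Solves G ε Q) (hε : 0 < ε)
    (hG : Continuous G) (hx : G x ≤ Q x) (hc : Q x = G x → FallsAfter G x) :
    ∃ δ > 0, ∀ z ∈ Ioc x (x + δ), G z < Q z := by
  rcases hx.eq_or_lt with heq | hlt
  · obtain ⟨δ, hδ, hanti, hlt⟩ := hc heq.symm
    refine ⟨δ, hδ, fun z hz => ?_⟩
    -- The comparison constant is G z, a lower bound of G on the interval from x to z.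
    have := h.monotoneOn_sub_const (x := x) (y := z) (c := G z) hε (fun w hw =>
      hanti ⟨hw.1.le, by linarith [hw.2, hz.2]⟩ ⟨hz.1.le, hz.2⟩ hw.2.le)
      (left_mem_Icc.2 hz.1.le) (right_mem_Icc.2 hz.1.le) hz.1.le
    have h0 : 0 < Real.exp (x / ε) * (Q x - G z) :=
      mul_pos (Real.exp_pos _) (by linarith [hlt z hz])
    exact sub_pos.1 (pos_of_mul_pos_right (h0.trans_le this) (Real.exp_pos _).le)
  · have : ∀ᶠ z in 𝓝 x, G z < Q z := (hG.continuousAt).eventually_lt h.continuous.continuousAt hlt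
    obtain ⟨δ, hδ, hb⟩ := Metric.eventually_nhds_iff.1 this
    refine ⟨δ / 2, half_pos hδ, fun z hz => hb ?_⟩
    rw [Real.dist_eq, abs_of_pos (by linarith [hz.1])]
    linarith [hz.2]

/-! ### Roots depending on a parameter -/

/-- Strict monotonicity in x gives a unique root and locates it by the sign of y at any test point;
that sign persists for nearby ε, which is continuity of the root. No differentiability in ε is
needed. -/
lemma exists_continuous_root {y : ℝ → ℝ → ℝ} {η₁ η p q : ℝ} (hpq : p ≤ q)
    (hc : ∀ x ∈ Icc p q, ContinuousOn (fun ε => y ε x) (Icc η₁ η))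
    (hy : ∀ ε ∈ Icc η₁ η, ContinuousOn (y ε) (Icc p q))
    (hm : ∀ ε ∈ Icc η₁ η, StrictMonoOn (y ε) (Icc p q))
    (hp : ∀ ε ∈ Icc η₁ η, y ε p < 0) (hq : ∀ ε ∈ Icc η₁ η, 0 ≤ y ε q) :
    ∃ l : ℝ → ℝ, ContinuousOn l (Icc η₁ η) ∧
      ∀ ε ∈ Icc η₁ η, l ε ∈ Ioc p q ∧ y ε (l ε) = 0 := by
  have hex : ∀ ε, ∃ x, ε ∈ Icc η₁ η → x ∈ Ioc p q ∧ y ε x = 0 := fun ε => by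
    by_cases hε : ε ∈ Icc η₁ η
    · obtain ⟨x, hx, hx0⟩ := intermediate_value_Icc hpq (hy ε hε) ⟨(hp ε hε).le, hq ε hε⟩
      refine ⟨x, fun _ => ⟨⟨lt_of_le_of_ne hx.1 ?_, hx.2⟩, hx0⟩⟩
      rintro rfl
      exact (hp ε hε).ne hx0
    · exact ⟨0, fun h => absurd h hε⟩
  choose l hl using hex
  refine ⟨l, fun ε₀ hε₀ => ?_, hl⟩
  obtain ⟨hmem, h0⟩ := hl ε₀ hε₀
  refine tendsto_order.2 ⟨fun a ha => ?_, fun b hb => ?_⟩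
  -- The test point is moved to `max a p` because signs can be used only inside [p, q].
  · have hr : max a p ∈ Icc p q := ⟨le_max_right _ _, max_le (ha.le.trans hmem.2) hpq⟩
    have hrl : max a p < l ε₀ := max_lt ha hmem.1
    have hneg : y ε₀ (max a p) < 0 := h0 ▸ hm ε₀ hε₀ hr ⟨hmem.1.le, hmem.2⟩ hrl
    filter_upwards [(hc _ hr ε₀ hε₀).eventually_lt_const hneg, self_mem_nhdsWithin] with ε h1 h2
    obtain ⟨hm', h0'⟩ := hl ε h2
    by_contra hcon
    have := (hm ε h2).monotoneOn ⟨hm'.1.le, hm'.2⟩ hr ((not_lt.1 hcon).trans (le_max_left a p))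
    linarith
  · rcases lt_or_ge q b with hqb | hqb
    · filter_upwards [self_mem_nhdsWithin] with ε h2 using (hl ε h2).1.2.trans_lt hqb
    · have hr : b ∈ Icc p q := ⟨hmem.1.le.trans hb.le, hqb⟩
      have hpos : 0 < y ε₀ b := h0 ▸ hm ε₀ hε₀ ⟨hmem.1.le, hmem.2⟩ hr hb
      filter_upwards [(hc _ hr ε₀ hε₀).eventually_const_lt hpos, self_mem_nhdsWithin] with ε h1 h2
      obtain ⟨hm', h0'⟩ := hl ε h2
      by_contra hcon
      have := (hm ε h2).monotoneOn hr ⟨hm'.1.le, hm'.2⟩ (not_lt.1 hcon)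
      linarith

lemma continuousOn_wave {G : ℝ → ℝ} (hG : Continuous G) {s : Set ℝ} (hs : ∀ ε ∈ s, 0 < ε)
    {β c : ℝ → ℝ} (hβ : ContinuousOn β s) (hc : ContinuousOn c s) (z : ℝ) :
    ContinuousOn (fun ε => wave G ε (β ε) (c ε) z) s := by
  have hK : ∀ u : ℝ → ℝ, ContinuousOn u s →
      ContinuousOn (fun ε => ∫ t in (0 : ℝ)..u ε, Real.exp (t / ε) * G t) s := fun u hu => by
    -- The parameter of the integral is ε⁻¹, so the integrand is jointly continuous on the whole
    -- plane, and the moving limit of integration becomes one more continuous variable.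
    have h1 : Continuous fun p : ℝ × ℝ => ∫ t in (0 : ℝ)..p.2, Real.exp (t * p.1) * G t :=
      intervalIntegral.continuous_parametric_intervalIntegral_of_continuous
        (f := fun (p : ℝ × ℝ) t => Real.exp (t * p.1) * G t) (by fun_prop) continuous_snd
    have h2 : ContinuousOn (fun ε : ℝ => (ε⁻¹, u ε)) s :=
      (continuousOn_id.inv₀ fun ε hε => (hs ε hε).ne').prodMk hu
    exact h1.comp_continuousOn h2
  have hint : ∀ ε a b : ℝ, IntervalIntegrable (fun t => Real.exp (t / ε) * G t) volume a b :=
    fun ε a b => (by fun_prop : Continuous fun t => Real.exp (t / ε) * G t).intervalIntegrable a b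
  have heq : (fun ε => wave G ε (β ε) (c ε) z) = fun ε => Real.exp (-z / ε) *
      (Real.exp (β ε / ε) * c ε + ε⁻¹ * ((∫ t in (0 : ℝ)..z, Real.exp (t / ε) * G t) -
        ∫ t in (0 : ℝ)..β ε, Real.exp (t / ε) * G t)) := by
    funext ε
    rw [wave, intervalIntegral.integral_interval_sub_left (hint _ _ _) (hint _ _ _)]
  rw [heq]
  have hd : ∀ u : ℝ → ℝ, ContinuousOn u s → ContinuousOn (fun ε => u ε / ε) s := fun u hu =>
    hu.div continuousOn_id fun ε hε => (hs ε hε).ne'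
  refine (hd _ continuousOn_const).rexp.mul (((hd _ hβ).rexp.mul hc).add
    ((continuousOn_id.inv₀ fun ε hε => (hs ε hε).ne').mul ((hK _ continuousOn_const).sub (hK _ hβ))))

/-! ### Families of solutions growing with `ε` -/

/-- A family of solutions of `ε Q' = G - Q`, continuous in `ε`, strictly increasing in `ε` at `x`. -/
structure Family (G : ℝ → ℝ) (η₁ η x : ℝ) (Q : ℝ → ℝ → ℝ) : Prop where
  solves : ∀ ε ∈ Icc η₁ η, Solves G ε (Q ε)
  cont : ∀ z, ContinuousOn (fun ε => Q ε z) (Icc η₁ η)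
  mono : ∀ ε ∈ Icc η₁ η, ∀ ε' ∈ Icc η₁ η, ε < ε' → Q ε x < Q ε' x

lemma Family.restrict {G : ℝ → ℝ} {η₁ η η' x : ℝ} {Q : ℝ → ℝ → ℝ} (h : Family G η₁ η x Q)
    (hη : η' ≤ η) : Family G η₁ η' x Q :=
  ⟨fun ε hε => h.solves ε ⟨hε.1, hε.2.trans hη⟩,
    fun z => (h.cont z).mono (Icc_subset_Icc_right hη),
    fun ε hε ε' hε' => h.mono ε ⟨hε.1, hε.2.trans hη⟩ ε' ⟨hε'.1, hε'.2.trans hη⟩⟩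

lemma Family.gt {G : ℝ → ℝ} {η₁ η x y : ℝ} {Q : ℝ → ℝ → ℝ} (h : Family G η₁ η x Q)
    (hη₁ : 0 < η₁) (hpos : ∀ z ∈ Ioo x y, G z ≤ Q η₁ z) {ε : ℝ} (hε : ε ∈ Ioc η₁ η)
    {z : ℝ} (hz : z ∈ Icc x y) : Q η₁ z < Q ε z := by
  have h1 : η₁ ∈ Icc η₁ η := ⟨le_rfl, hε.1.le.trans hε.2⟩
  have h2 : ε ∈ Icc η₁ η := ⟨hε.1.le, hε.2⟩
  exact (h.solves _ h1).lt_of_lt (h.solves _ h2) hη₁ hε.1.le hz.1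
    (fun w hw => hpos w ⟨hw.1, hw.2.trans_le hz.2⟩) (h.mono _ h1 _ h2 hε.1)

/-- Positivity is required of the initial wave only: all later waves lie above it by `Family.gt`,
hence above G, and can be compared with each other. -/
lemma Family.advance {G : ℝ → ℝ} {η₁ η x y : ℝ} {Q : ℝ → ℝ → ℝ} (h : Family G η₁ η x Q)
    (hη₁ : 0 < η₁) (hxy : x ≤ y) (hpos : ∀ z ∈ Ioo x y, G z ≤ Q η₁ z) : Family G η₁ η y Q :=
  ⟨h.solves, h.cont, fun ε hε ε' hε' hlt => by
    refine (h.solves ε hε).lt_of_lt (h.solves ε' hε') (hη₁.trans_le hε.1) hlt.le hxy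
      (fun w hw => ?_) (h.mono ε hε ε' hε' hlt)
    rcases hε.1.eq_or_lt with rfl | hlt'
    · exact hpos w hw
    · exact (hpos w hw).trans (h.gt hη₁ hpos ⟨hlt', hε.2⟩ (Ioo_subset_Icc_self hw)).le⟩

/-! ### Flows of chords -/

/-- Chords `[A l, B l]` with average `lam l` of `G`, `bot ≤ l ≤ top`, satisfying the differential
relations that follow from the cup equation. -/
structure Flow (G A B lam : ℝ → ℝ) (bot top : ℝ) : Prop where
  pos : 0 < bot
  lt : bot < top
  contA : ContinuousOn A (Icc bot top)
  contB : ContinuousOn B (Icc bot top)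
  contlam : ContinuousOn lam (Icc bot top)
  deriv : ∀ l ∈ Ioo bot top, ∃ A' B' : ℝ, A' < 0 ∧ 0 < B' ∧ HasDerivAt A A' l ∧
    HasDerivAt B B' l ∧ HasDerivAt lam (-2 * (G (A l) - lam l) * A' / l) l ∧
    (G (A l) - lam l) * A' + (G (B l) - lam l) * B' = 0
  ltA : ∀ l ∈ Ioo bot top, G (A l) < lam l
  ltB : ∀ l ∈ Ioo bot top, G (B l) < lam l
  leA : ∀ l ∈ Icc bot top, G (A l) ≤ lam l
  leB : ∀ l ∈ Icc bot top, G (B l) ≤ lam l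

/-- The reflection exchanges the two ends. The formula for λ' survives because the last relation in
`Flow.deriv` lets it be written through either end. -/
lemma Flow.reflect {G A B lam : ℝ → ℝ} {bot top : ℝ} (h : Flow G A B lam bot top) :
    Flow (fun z => G (-z)) (fun l => -B l) (fun l => -A l) lam bot top where
  pos := h.pos
  lt := h.lt
  contA := h.contB.neg
  contB := h.contA.neg
  contlam := h.contlam
  deriv l hl := by
    obtain ⟨A', B', hA, hB, dA, dB, dl, hrel⟩ := h.deriv l hl
    refine ⟨-B', -A', by linarith, by linarith, dB.neg, dA.neg, dl.congr_deriv ?_, ?_⟩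
    · simp only [neg_neg]
      congr 1
      linear_combination -2 * hrel
    · simp only [neg_neg]
      linear_combination -hrel
  ltA l hl := by simpa using h.ltB l hl
  ltB l hl := by simpa using h.ltA l hl
  leA l hl := by simpa using h.leB l hl
  leB l hl := by simpa using h.leA l hl

lemma Flow.strictAntiOn_A {G A B lam : ℝ → ℝ} {bot top : ℝ} (h : Flow G A B lam bot top) :
    StrictAntiOn A (Icc bot top) := by
  refine strictAntiOn_of_deriv_neg (convex_Icc _ _) h.contA fun l hl => ?_
  rw [interior_Icc] at hl
  obtain ⟨A', B', hA, hB, dA, -⟩ := h.deriv l hl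
  rwa [dA.deriv]

lemma Flow.strictMonoOn_B {G A B lam : ℝ → ℝ} {bot top : ℝ} (h : Flow G A B lam bot top) :
    StrictMonoOn B (Icc bot top) := by
  refine strictMonoOn_of_deriv_pos (convex_Icc _ _) h.contB fun l hl => ?_
  rw [interior_Icc] at hl
  obtain ⟨A', B', hA, hB, dA, dB, -⟩ := h.deriv l hl
  rwa [dB.deriv]

lemma Flow.continuousOn_enter {G A B lam Q : ℝ → ℝ} {bot top ε : ℝ} (h : Flow G A B lam bot top)
    (hQ : Continuous Q) :
    ContinuousOn (fun l => Real.exp (A l / ε) * (Q (A l) - lam l)) (Icc bot top) :=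
  (h.contA.div_const ε).rexp.mul ((hQ.comp_continuousOn h.contA).sub h.contlam)

lemma Flow.continuousOn_exit {G A B lam Q : ℝ → ℝ} {bot top ε : ℝ} (h : Flow G A B lam bot top)
    (hQ : Continuous Q) :
    ContinuousOn (fun l => Real.exp (B l / ε) * (Q (B l) - lam l)) (Icc bot top) :=
  (h.contB.div_const ε).rexp.mul ((hQ.comp_continuousOn h.contB).sub h.contlam)

/-- The derivative is e^{A/ε}(-A')(λ - G(A))(1/ε + 2/l): at the entering end the equation of the
wave and the change of λ act in the same direction. So a wave can enter at one chord at most,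
whatever the lengths are. -/
lemma Flow.strictMonoOn_enter {G A B lam Q : ℝ → ℝ} {bot top ε : ℝ} (h : Flow G A B lam bot top)
    (hε : 0 < ε) (hQ : Solves G ε Q) :
    StrictMonoOn (fun l => Real.exp (A l / ε) * (Q (A l) - lam l)) (Icc bot top) := by
  refine strictMonoOn_of_deriv_pos (convex_Icc _ _) (h.continuousOn_enter hQ.continuous)
    fun l hl => ?_
  rw [interior_Icc] at hl
  obtain ⟨A', B', hA, hB, dA, dB, dl, hrel⟩ := h.deriv l hl
  have hl0 : 0 < l := h.pos.trans hl.1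
  have hd : HasDerivAt (fun l => Real.exp (A l / ε) * (Q (A l) - lam l))
      (Real.exp (A l / ε) * (-A' * (lam l - G (A l)) * -(1 / ε + 2 / l) * -1)) l := by
    refine ((dA.div_const ε).exp.mul (((hQ (A l)).comp l dA).sub dl)).congr_deriv ?_
    simp only [Pi.sub_apply, Function.comp_apply]
    ring
  rw [hd.deriv]
  have h1 := h.ltA l hl
  have h2 : 0 < 1 / ε + 2 / l := by positivity
  have h3 := mul_pos (mul_pos (neg_pos.2 hA) (sub_pos.2 h1)) h2
  refine mul_pos (Real.exp_pos _) ?_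
  linarith

/-- At the leaving end the two contributions compete and balance exactly at l = 2ε. This is why
chords of length 2ε separate the figures that shrink from those that grow. -/
lemma Flow.hasDerivAt_exit {G A B lam Q : ℝ → ℝ} {bot top ε : ℝ} (h : Flow G A B lam bot top)
    (hQ : Solves G ε Q) {l : ℝ} (hl : l ∈ Ioo bot top) : ∃ c : ℝ, 0 < c ∧
    HasDerivAt (fun l => Real.exp (B l / ε) * (Q (B l) - lam l)) (c * (2 / l - 1 / ε)) l := by
  obtain ⟨A', B', hA, hB, dA, dB, dl, hrel⟩ := h.deriv l hl
  refine ⟨Real.exp (B l / ε) * (B' * (lam l - G (B l))),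
    mul_pos (Real.exp_pos _) (mul_pos hB (sub_pos.2 (h.ltB l hl))), ?_⟩
  refine ((dB.div_const ε).exp.mul (((hQ (B l)).comp l dB).sub dl)).congr_deriv ?_
  simp only [Pi.sub_apply, Function.comp_apply]
  linear_combination (Real.exp (B l / ε) * (2 / l)) * hrel

lemma Flow.strictMonoOn_exit {G A B lam Q : ℝ → ℝ} {bot top ε : ℝ} (h : Flow G A B lam bot top)
    (hQ : Solves G ε Q) (htop : top ≤ 2 * ε) :
    StrictMonoOn (fun l => Real.exp (B l / ε) * (Q (B l) - lam l)) (Icc bot top) := by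
  refine strictMonoOn_of_deriv_pos (convex_Icc _ _) (h.continuousOn_exit hQ.continuous)
    fun l hl => ?_
  rw [interior_Icc] at hl
  have hl0 : 0 < l := h.pos.trans hl.1
  have hε : 0 < ε := by linarith [hl.2]
  obtain ⟨c, hc, hd⟩ := h.hasDerivAt_exit hQ hl
  rw [hd.deriv]
  refine mul_pos hc (sub_pos.2 ?_)
  rw [div_lt_div_iff₀ hε hl0]
  linarith [hl.2]

lemma Flow.strictAntiOn_exit {G A B lam Q : ℝ → ℝ} {bot top ε : ℝ} (h : Flow G A B lam bot top)
    (hε : 0 < ε) (hQ : Solves G ε Q) (hbot : 2 * ε ≤ bot) :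
    StrictAntiOn (fun l => Real.exp (B l / ε) * (Q (B l) - lam l)) (Icc bot top) := by
  refine strictAntiOn_of_deriv_neg (convex_Icc _ _) (h.continuousOn_exit hQ.continuous)
    fun l hl => ?_
  rw [interior_Icc] at hl
  have hl0 : 0 < l := h.pos.trans hl.1
  obtain ⟨c, hc, hd⟩ := h.hasDerivAt_exit hQ hl
  rw [hd.deriv]
  refine mul_neg_of_pos_of_neg hc (sub_neg.2 ?_)
  rw [div_lt_div_iff₀ hl0 hε]
  linarith [hl.1]

lemma Flow.mono {G A B lam : ℝ → ℝ} {bot top bot' top' : ℝ} (h : Flow G A B lam bot top)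
    (h1 : bot ≤ bot') (h2 : top' ≤ top) (h3 : bot' < top') : Flow G A B lam bot' top' where
  pos := h.pos.trans_le h1
  lt := h3
  contA := h.contA.mono (Icc_subset_Icc h1 h2)
  contB := h.contB.mono (Icc_subset_Icc h1 h2)
  contlam := h.contlam.mono (Icc_subset_Icc h1 h2)
  deriv l hl := h.deriv l (Ioo_subset_Ioo h1 h2 hl)
  ltA l hl := h.ltA l (Ioo_subset_Ioo h1 h2 hl)
  ltB l hl := h.ltB l (Ioo_subset_Ioo h1 h2 hl)
  leA l hl := h.leA l (Icc_subset_Icc h1 h2 hl)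
  leB l hl := h.leB l (Icc_subset_Icc h1 h2 hl)

/-! ### Crossing a gap -/

/-- The family `Q` meets the flow of chords at the chord of length `ℓ ε`, and the family `Q'` leaves
from the other end of this chord. -/
structure GapCrossing (G A B lam : ℝ → ℝ) (bot top η₁ η : ℝ) (ℓ : ℝ → ℝ) (Q Q' : ℝ → ℝ → ℝ) :
    Prop where
  shrink : ShrinkingLength η₁ η top ℓ
  mem : ∀ ε ∈ Icc η₁ η, ℓ ε ∈ Ioc bot top
  enter : ∀ ε ∈ Icc η₁ η, Q ε (A (ℓ ε)) = lam (ℓ ε)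
  exit : ∀ ε ∈ Icc η₁ η, Q' ε (B (ℓ ε)) = lam (ℓ ε)
  enter_gt : ∀ ε ∈ Icc η₁ η, ∀ l ∈ Ioc (ℓ ε) top, lam l < Q ε (A l)
  exit_gt : ∀ ε ∈ Icc η₁ η, ∀ l ∈ Ioc (ℓ ε) top, lam l < Q' ε (B l)
  pos_enter : ∀ ε ∈ Ioc η₁ η, ∀ z ∈ Icc (A top) (A (ℓ ε)), G z < Q ε z
  pos_exit : ∀ ε ∈ Ioc η₁ η, ∀ z ∈ Icc (B (ℓ ε)) (B top), G z < Q' ε z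

lemma GapCrossing.restrict {G A B lam : ℝ → ℝ} {bot top η₁ η η' : ℝ} {ℓ : ℝ → ℝ}
    {Q Q' : ℝ → ℝ → ℝ} (h : GapCrossing G A B lam bot top η₁ η ℓ Q Q') (hη : η' ≤ η) :
    GapCrossing G A B lam bot top η₁ η' ℓ Q Q' := by
  have h1 : Icc η₁ η' ⊆ Icc η₁ η := Icc_subset_Icc_right hη
  have h2 : Ioc η₁ η' ⊆ Ioc η₁ η := Ioc_subset_Ioc_right hη
  exact ⟨⟨h.shrink.1.mono h1, h.shrink.2.1.mono h1, h.shrink.2.2⟩, fun ε hε => h.mem ε (h1 hε),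
    fun ε hε => h.enter ε (h1 hε), fun ε hε => h.exit ε (h1 hε),
    fun ε hε => h.enter_gt ε (h1 hε), fun ε hε => h.exit_gt ε (h1 hε),
    fun ε hε => h.pos_enter ε (h2 hε), fun ε hε => h.pos_exit ε (h2 hε)⟩

lemma exists_Icc_of_continuousOn_lt {η₁ η : ℝ} (hη : η₁ < η) {y : ℝ → ℝ}
    (hy : ContinuousOn y (Icc η₁ η)) {c : ℝ} (h0 : y η₁ < c) :
    ∃ η' ∈ Ioc η₁ η, ∀ ε ∈ Icc η₁ η', y ε < c := by
  have h1 : ∀ᶠ ε in 𝓝[Icc η₁ η] η₁, y ε < c :=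
    (hy η₁ (left_mem_Icc.2 hη.le)).eventually_lt_const h0
  rw [nhdsWithin_Icc_eq_nhdsGE hη] at h1
  obtain ⟨u, hu, hsub⟩ := (mem_nhdsGE_iff_exists_Icc_subset).1 h1
  exact ⟨min u η, ⟨lt_min hu hη, min_le_right _ _⟩,
    fun ε hε => hsub ⟨hε.1, hε.2.trans (min_le_left _ _)⟩⟩

/-- As ε grows, the incoming wave rises at the entering ends, so the root of its excess over λ moves
to shorter chords. A wave emitted from a shorter chord exceeds λ at the leaving ends of all longer
ones, because lengths do not exceed 2ε; so the emitted family grows as well and the argument can be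
repeated at the next gap. -/
lemma exists_gapCrossing {G A B lam : ℝ → ℝ} {bot top η₁ η : ℝ} {Q : ℝ → ℝ → ℝ}
    (hG : Continuous G) (hF : Flow G A B lam bot top) (hη₁ : 0 < η₁) (hη : η₁ < η)
    (htop : top ≤ 2 * η₁) (hQ : Family G η₁ η (A top) Q) (h0 : Q η₁ (A top) = lam top) :
    ∃ η' ∈ Ioc η₁ η, ∃ (ℓ : ℝ → ℝ) (Q' : ℝ → ℝ → ℝ), Family G η₁ η' (B top) Q' ∧
      Q' η₁ (B top) = lam top ∧ GapCrossing G A B lam bot top η₁ η' ℓ Q Q' := by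
  set y : ℝ → ℝ → ℝ := fun ε l => Real.exp (A l / ε) * (Q ε (A l) - lam l) with hy
  have mb : bot ∈ Icc bot top := left_mem_Icc.2 hF.lt.le
  have mt : top ∈ Icc bot top := right_mem_Icc.2 hF.lt.le
  have m1 : η₁ ∈ Icc η₁ η := left_mem_Icc.2 hη.le
  have hymono : ∀ ε ∈ Icc η₁ η, StrictMonoOn (y ε) (Icc bot top) := fun ε hε =>
    hF.strictMonoOn_enter (hη₁.trans_le hε.1) (hQ.solves ε hε)
  have hycont : ∀ l, ContinuousOn (fun ε => y ε l) (Icc η₁ η) := fun l =>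
    ((continuousOn_const.div continuousOn_id fun ε hε => (hη₁.trans_le hε.1).ne').rexp).mul
      ((hQ.cont (A l)).sub continuousOn_const)
  have hy1 : y η₁ top = 0 := by simp [hy, h0]
  have hyb : y η₁ bot < 0 := hy1 ▸ hymono η₁ m1 mb mt hF.lt
  -- At η₁ the root is the upper chord, so the excess at the lower chord is negative. The time is
  -- cut so that this persists and the root stays inside the flow.
  obtain ⟨η', hη', hneg⟩ := exists_Icc_of_continuousOn_lt hη (hycont bot) hyb
  have hsub : Icc η₁ η' ⊆ Icc η₁ η := Icc_subset_Icc_right hη'.2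
  have hytop : ∀ ε ∈ Icc η₁ η', 0 ≤ y ε top := fun ε hε => by
    refine mul_nonneg (Real.exp_pos _).le (sub_nonneg.2 ?_)
    rcases hε.1.eq_or_lt with rfl | hlt
    · exact h0.ge
    · exact h0 ▸ (hQ.mono η₁ m1 ε (hsub hε) hlt).le
  obtain ⟨ℓ, hℓc, hℓ⟩ := exists_continuous_root hF.lt.le (fun l _ => (hycont l).mono hsub)
    (fun ε hε => hF.continuousOn_enter (hQ.solves ε (hsub hε)).continuous)
    (fun ε hε => hymono ε (hsub hε)) hneg hytop
  have memI : ∀ ε ∈ Icc η₁ η', ℓ ε ∈ Icc bot top := fun ε hε => Ioc_subset_Icc_self (hℓ ε hε).1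
  have m1' : η₁ ∈ Icc η₁ η' := left_mem_Icc.2 hη'.1.le
  have henter : ∀ ε ∈ Icc η₁ η', Q ε (A (ℓ ε)) = lam (ℓ ε) := fun ε hε =>
    sub_eq_zero.1 ((mul_eq_zero.1 (hℓ ε hε).2).resolve_left (Real.exp_pos _).ne')
  have hgt : ∀ ε ∈ Icc η₁ η', ∀ l ∈ Ioc (ℓ ε) top, lam l < Q ε (A l) := fun ε hε l hl => by
    have := hymono ε (hsub hε) (memI ε hε) ⟨(memI ε hε).1.trans hl.1.le, hl.2⟩ hl.1
    rw [(hℓ ε hε).2] at this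
    exact sub_pos.1 (pos_of_mul_pos_right this (Real.exp_pos _).le)
  have hsurjA : ∀ ε ∈ Icc η₁ η', ∀ z ∈ Icc (A top) (A (ℓ ε)), ∃ l ∈ Icc (ℓ ε) top, A l = z :=
    fun ε hε z hz => intermediate_value_Icc' (memI ε hε).2
      (hF.contA.mono (Icc_subset_Icc_left (memI ε hε).1)) hz
  have hge : ∀ ε ∈ Icc η₁ η', ∀ z ∈ Icc (A top) (A (ℓ ε)), G z ≤ Q ε z := fun ε hε z hz => by
    obtain ⟨l, hl, rfl⟩ := hsurjA ε hε z hz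
    have hle := hF.leA l ⟨(memI ε hε).1.trans hl.1, hl.2⟩
    rcases hl.1.eq_or_lt with rfl | hlt
    · rwa [henter ε hε]
    · exact hle.trans (hgt ε hε l ⟨hlt, hl.2⟩).le
  -- At the point where the earlier wave enters its chord the later wave is already larger, so its
  -- own root lies at a smaller length.
  have hanti : StrictAntiOn ℓ (Icc η₁ η') := fun ε hε ε' hε' hlt => by
    have h1 := (hQ.solves ε (hsub hε)).lt_of_lt (hQ.solves ε' (hsub hε')) (hη₁.trans_le hε.1) hlt.le
      (hF.strictAntiOn_A.antitoneOn (memI ε hε) mt (memI ε hε).2)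
      (fun z hz => hge ε hε z (Ioo_subset_Icc_self hz)) (hQ.mono ε (hsub hε) ε' (hsub hε') hlt)
    have h2 : y ε' (ℓ ε') < y ε' (ℓ ε) := by
      rw [(hℓ ε' hε').2]
      refine mul_pos (Real.exp_pos _) (sub_pos.2 ?_)
      rwa [← henter ε hε]
    exact ((hymono ε' (hsub hε')).lt_iff_lt (memI ε' hε') (memI ε hε)).1 h2
  have hℓ1 : ℓ η₁ = top :=
    (hymono η₁ m1).injOn (memI η₁ m1') mt ((hℓ η₁ m1').2.trans hy1.symm)
  have hlt_top : ∀ ε ∈ Ioc η₁ η', ℓ ε < top := fun ε hε =>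
    hℓ1 ▸ hanti m1' ⟨hε.1.le, hε.2⟩ hε.1
  set Q' : ℝ → ℝ → ℝ := fun ε => wave G ε (B (ℓ ε)) (lam (ℓ ε)) with hQ'
  have hsol : ∀ ε, Solves G ε (Q' ε) := fun ε => wave_solves hG _ _
  have hexit : ∀ ε, Q' ε (B (ℓ ε)) = lam (ℓ ε) := fun ε => wave_self _ _ _ _
  have hxmono : ∀ ε ∈ Icc η₁ η', ∀ Q'' : ℝ → ℝ, Solves G ε Q'' →
      StrictMonoOn (fun l => Real.exp (B l / ε) * (Q'' (B l) - lam l)) (Icc bot top) :=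
    fun ε hε Q'' h => hF.strictMonoOn_exit h (by linarith [hε.1])
  have hxgt : ∀ ε ∈ Icc η₁ η', ∀ l ∈ Ioc (ℓ ε) top, lam l < Q' ε (B l) := fun ε hε l hl => by
    have := hxmono ε hε _ (hsol ε) (memI ε hε) ⟨(memI ε hε).1.trans hl.1.le, hl.2⟩ hl.1
    simp only [hexit, sub_self, mul_zero] at this
    exact sub_pos.1 (pos_of_mul_pos_right this (Real.exp_pos _).le)
  have hsurjB : ∀ ε ∈ Icc η₁ η', ∀ z ∈ Icc (B (ℓ ε)) (B top), ∃ l ∈ Icc (ℓ ε) top, B l = z :=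
    fun ε hε z hz => intermediate_value_Icc (memI ε hε).2
      (hF.contB.mono (Icc_subset_Icc_left (memI ε hε).1)) hz
  have hxge : ∀ ε ∈ Icc η₁ η', ∀ z ∈ Icc (B (ℓ ε)) (B top), G z ≤ Q' ε z := fun ε hε z hz => by
    obtain ⟨l, hl, rfl⟩ := hsurjB ε hε z hz
    have hle := hF.leB l ⟨(memI ε hε).1.trans hl.1, hl.2⟩
    rcases hl.1.eq_or_lt with rfl | hlt
    · rwa [hexit]
    · exact hle.trans (hxgt ε hε l ⟨hlt, hl.2⟩).le
  refine ⟨η', hη', ℓ, Q', ⟨fun ε _ => hsol ε, fun z => ?_, fun ε hε ε' hε' hlt => ?_⟩, ?_,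
    ⟨⟨hℓc, hanti, hℓ1⟩, fun ε hε => (hℓ ε hε).1, henter, fun ε _ => hexit ε, hgt, hxgt,
      fun ε hε z hz => ?_, fun ε hε z hz => ?_⟩⟩
  · exact continuousOn_wave hG (fun ε hε => hη₁.trans_le hε.1) (hF.contB.comp hℓc memI)
      (hF.contlam.comp hℓc memI) z
  -- The comparison starts at the leaving end of the longer of the two chords, that of ε: there the
  -- earlier wave equals λ and the later one exceeds it.
  · refine (hsol ε).lt_of_lt (hsol ε') (hη₁.trans_le hε.1) hlt.le
      (hF.strictMonoOn_B.monotoneOn (memI ε hε) mt (memI ε hε).2)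
      (fun z hz => hxge ε hε z (Ioo_subset_Icc_self hz)) ?_
    rw [hexit]
    exact hxgt ε' hε' _ ⟨hanti hε hε' hlt, (memI ε hε).2⟩
  · have := hexit η₁
    rwa [hℓ1] at this
  · have hε' : ε ∈ Icc η₁ η' := ⟨hε.1.le, hε.2⟩
    obtain ⟨l, hl, rfl⟩ := hsurjA ε hε' z hz
    -- Two sources of strictness: the differential may vanish at the upper chord, but there the wave
    -- exceeds λ since ℓ ε < top; at shorter chords the differential is strictly negative.
    rcases hl.2.eq_or_lt with rfl | hlt
    · exact (hF.leA l mt).trans_lt (hgt ε hε' l ⟨hlt_top ε hε, le_rfl⟩)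
    · refine (hF.ltA l ⟨(hℓ ε hε').1.1.trans_le hl.1, hlt⟩).trans_le ?_
      rcases hl.1.eq_or_lt with rfl | hlt'
      · exact (henter ε hε').ge
      · exact (hgt ε hε' l ⟨hlt', hl.2⟩).le
  · have hε' : ε ∈ Icc η₁ η' := ⟨hε.1.le, hε.2⟩
    obtain ⟨l, hl, rfl⟩ := hsurjB ε hε' z hz
    rcases hl.2.eq_or_lt with rfl | hlt
    · exact (hF.leB l mt).trans_lt (hxgt ε hε' l ⟨hlt_top ε hε, le_rfl⟩)
    · refine (hF.ltB l ⟨(hℓ ε hε').1.1.trans_le hl.1, hlt⟩).trans_le ?_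
      rcases hl.1.eq_or_lt with rfl | hlt'
      · exact (hexit ε).ge
      · exact (hxgt ε hε' l ⟨hlt', hl.2⟩).le

/-! ### Rows of arcs and gaps -/

/-- Arcs `[lo j, hi j]`, on which the solution `Lam` may run along `G`, separated by the upper chords
of flows. -/
structure IsRow (G : ℝ → ℝ) (η₁ Lam : ℝ) {k : ℕ} (lo hi : Fin (k + 1) → ℝ)
    (A B lam : Fin k → ℝ → ℝ) (bot top : Fin k → ℝ) : Prop where
  le : ∀ j, lo j ≤ hi j
  arc_le : ∀ j, ∀ z ∈ Icc (lo j) (hi j), G z ≤ Lam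
  arc_eq : ∀ j, lo j < hi j → ∀ z ∈ Icc (lo j) (hi j), G z = Lam
  flow : ∀ i, Flow G (A i) (B i) (lam i) (bot i) (top i)
  A_top : ∀ i, A i (top i) = hi i.castSucc
  B_top : ∀ i, B i (top i) = lo i.succ
  lam_top : ∀ i, lam i (top i) = Lam
  top_le : ∀ i, top i ≤ 2 * η₁

/-- Families of solutions on the arcs of a row that cross all the gaps. -/
structure RowWaves (G : ℝ → ℝ) (η₁ η Lam : ℝ) {k : ℕ} (lo : Fin (k + 1) → ℝ)
    (A B lam : Fin k → ℝ → ℝ) (bot top : Fin k → ℝ) (ℓ : Fin k → ℝ → ℝ)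
    (Q : Fin (k + 1) → ℝ → ℝ → ℝ) : Prop where
  fam : ∀ j, Family G η₁ η (lo j) (Q j)
  start : ∀ j, Q j η₁ (lo j) = Lam
  gap : ∀ i, GapCrossing G (A i) (B i) (lam i) (bot i) (top i) η₁ η (ℓ i) (Q i.castSucc) (Q i.succ)

lemma RowWaves.restrict {G : ℝ → ℝ} {η₁ η η' Lam : ℝ} {k : ℕ} {lo : Fin (k + 1) → ℝ}
    {A B lam : Fin k → ℝ → ℝ} {bot top : Fin k → ℝ} {ℓ : Fin k → ℝ → ℝ}
    {Q : Fin (k + 1) → ℝ → ℝ → ℝ} (h : RowWaves G η₁ η Lam lo A B lam bot top ℓ Q) (hη : η' ≤ η) :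
    RowWaves G η₁ η' Lam lo A B lam bot top ℓ Q :=
  ⟨fun j => (h.fam j).restrict hη, h.start, fun i => (h.gap i).restrict hη⟩

lemma IsRow.tail {G : ℝ → ℝ} {η₁ Lam : ℝ} {k : ℕ} {lo hi : Fin (k + 1 + 1) → ℝ}
    {A B lam : Fin (k + 1) → ℝ → ℝ} {bot top : Fin (k + 1) → ℝ}
    (h : IsRow G η₁ Lam lo hi A B lam bot top) :
    IsRow G η₁ Lam (fun j => lo j.succ) (fun j => hi j.succ) (fun i => A i.succ) (fun i => B i.succ)
      (fun i => lam i.succ) (fun i => bot i.succ) (fun i => top i.succ) :=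
  ⟨fun _ => h.le _, fun _ => h.arc_le _, fun _ => h.arc_eq _, fun _ => h.flow _,
    fun _ => h.A_top _, fun _ => h.B_top _, fun _ => h.lam_top _, fun _ => h.top_le _⟩

/-- On a non-degenerate arc G is the constant Lam, which is itself a solution for every ε. -/
lemma IsRow.eq_at_hi {G : ℝ → ℝ} {η₁ Lam : ℝ} {k : ℕ} {lo hi : Fin (k + 1) → ℝ}
    {A B lam : Fin k → ℝ → ℝ} {bot top : Fin k → ℝ} (h : IsRow G η₁ Lam lo hi A B lam bot top)
    {Q : ℝ → ℝ} {ε : ℝ} (hQ : Solves G ε Q) {j : Fin (k + 1)} (h0 : Q (lo j) = Lam) :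
    ∀ z ∈ Icc (lo j) (hi j), Q z = Lam := by
  intro z hz
  rcases (h.le j).eq_or_lt with heq | hlt
  · obtain rfl : z = lo j := le_antisymm (heq ▸ hz.2) hz.1
    exact h0
  · exact hQ.eq_const hz.1 (fun w hw => h.arc_eq j hlt w ⟨hw.1, hw.2.trans hz.2⟩) h0

lemma IsRow.family_at_hi {G : ℝ → ℝ} {η₁ η Lam : ℝ} {k : ℕ} {lo hi : Fin (k + 1) → ℝ}
    {A B lam : Fin k → ℝ → ℝ} {bot top : Fin k → ℝ} (h : IsRow G η₁ Lam lo hi A B lam bot top)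
    (hη₁ : 0 < η₁) (hη : η₁ < η) {Q : ℝ → ℝ → ℝ} {j : Fin (k + 1)} (hQ : Family G η₁ η (lo j) Q)
    (h0 : Q η₁ (lo j) = Lam) : Family G η₁ η (hi j) Q := by
  refine hQ.advance hη₁ (h.le j) fun z hz => ?_
  rw [h.eq_at_hi (hQ.solves η₁ (left_mem_Icc.2 hη.le)) h0 z (Ioo_subset_Icc_self hz)]
  exact h.arc_le j z (Ioo_subset_Icc_self hz)

/-- On an arc the initial wave is the constant Lam ≥ G, possibly equal to G; the strict growth in ε
makes the inequality strict. This is where an unstable figure dissolves. -/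
lemma IsRow.pos_on_arc {G : ℝ → ℝ} {η₁ η Lam : ℝ} {k : ℕ} {lo hi : Fin (k + 1) → ℝ}
    {A B lam : Fin k → ℝ → ℝ} {bot top : Fin k → ℝ} (h : IsRow G η₁ Lam lo hi A B lam bot top)
    (hη₁ : 0 < η₁) {Q : ℝ → ℝ → ℝ} {j : Fin (k + 1)} (hQ : Family G η₁ η (lo j) Q)
    (h0 : Q η₁ (lo j) = Lam) {ε : ℝ} (hε : ε ∈ Ioc η₁ η) :
    ∀ z ∈ Icc (lo j) (hi j), G z < Q ε z := by
  intro z hz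
  have h1 := h.eq_at_hi (hQ.solves η₁ ⟨le_rfl, hε.1.le.trans hε.2⟩) h0
  have h2 := hQ.gt (y := hi j) hη₁ (fun w hw => by
    rw [h1 w (Ioo_subset_Icc_self hw)]
    exact h.arc_le j w (Ioo_subset_Icc_self hw)) hε hz
  rw [h1 z hz] at h2
  exact (h.arc_le j z hz).trans_lt h2

/-- Induction over the gaps: the family leaving a gap serves as the initial family on the next arc.
Each gap may shorten the time interval, and there are finitely many. -/
lemma exists_rowWaves {G : ℝ → ℝ} (hG : Continuous G) {η₁ Lam : ℝ} (hη₁ : 0 < η₁) {k : ℕ}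
    {lo hi : Fin (k + 1) → ℝ} {A B lam : Fin k → ℝ → ℝ} {bot top : Fin k → ℝ}
    (h : IsRow G η₁ Lam lo hi A B lam bot top) {η : ℝ} (hη : η₁ < η) {Q₀ : ℝ → ℝ → ℝ}
    (hQ : Family G η₁ η (lo 0) Q₀) (h0 : Q₀ η₁ (lo 0) = Lam) :
    ∃ η' ∈ Ioc η₁ η, ∃ ℓ Q, RowWaves G η₁ η' Lam lo A B lam bot top ℓ Q ∧ Q 0 = Q₀ := by
  induction k generalizing η Q₀ with
  | zero =>
    exact ⟨η, ⟨hη, le_rfl⟩, Fin.elim0, fun _ => Q₀,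
      ⟨fun j => by rwa [Fin.fin_one_eq_zero j], fun j => by rwa [Fin.fin_one_eq_zero j],
        fun i => i.elim0⟩, rfl⟩
  | succ k ih =>
    have hhi := h.family_at_hi hη₁ hη hQ h0
    have h0' := h.eq_at_hi (hQ.solves η₁ (left_mem_Icc.2 hη.le)) h0 _ (right_mem_Icc.2 (h.le 0))
    obtain ⟨η', hη', ℓ, Q', hfam, hst, hgap⟩ := exists_gapCrossing hG (h.flow 0) hη₁ hη (h.top_le 0)
      (Q := Q₀) (by rw [h.A_top]; exact hhi) (by rw [h.A_top, h.lam_top]; exact h0')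
    rw [h.B_top] at hfam hst
    rw [h.lam_top] at hst
    obtain ⟨η'', hη'', ℓ', Qs, hrow, hQs⟩ := ih h.tail hη'.1 hfam hst
    refine ⟨η'', ⟨hη''.1, hη''.2.trans hη'.2⟩, Fin.cons ℓ ℓ', Fin.cons Q₀ Qs, ⟨?_, ?_, ?_⟩, rfl⟩
    · refine Fin.cases ?_ fun j => ?_
      · exact hQ.restrict (hη''.2.trans hη'.2)
      · exact hrow.fam j
    · refine Fin.cases h0 fun j => ?_
      exact hrow.start j
    · refine Fin.cases ?_ fun i => ?_
      · have := hgap.restrict hη''.2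
        rw [← hQs] at this
        exact this
      · exact hrow.gap i

/-! ### Solutions starting from a growing full chord -/

/-- Lengths from 2ε upwards lie in the range where the excess at leaving ends decreases. A wave
emitted at time ε therefore has dropped below λ when it reaches the start of the wave emitted at ε'
> ε, and the later wave starts above it. -/
lemma Flow.exists_source {G A B lam : ℝ → ℝ} {η₁ η : ℝ} (hG : Continuous G) (hη₁ : 0 < η₁)
    (hF : Flow G A B lam (2 * η₁) (2 * η)) {Q₀ : ℝ → ℝ} (hQ₀ : Solves G η₁ Q₀)
    (h0 : Q₀ (B (2 * η₁)) = lam (2 * η₁)) {e : ℝ} (he : B (2 * η₁) < e)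
    (hpos : ∀ z ∈ Ioo (B (2 * η₁)) e, G z < Q₀ z) :
    ∃ η' ∈ Ioc η₁ η, ∃ x ∈ Ioo (B (2 * η₁)) e,
      Family G η₁ η' x (fun ε => wave G ε (B (2 * ε)) (lam (2 * ε))) ∧
      wave G η₁ (B (2 * η₁)) (lam (2 * η₁)) = Q₀ ∧
      ∀ ε ∈ Ioc η₁ η', B (2 * ε) < x ∧
        ∀ z ∈ Icc (B (2 * ε)) x, G z < wave G ε (B (2 * ε)) (lam (2 * ε)) z := by
  have hη : η₁ < η := by linarith [hF.lt]
  have hmaps : MapsTo (fun ε : ℝ => 2 * ε) (Icc η₁ η) (Icc (2 * η₁) (2 * η)) :=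
    fun ε hε => ⟨by linarith [hε.1], by linarith [hε.2]⟩
  have hcB : ContinuousOn (fun ε => B (2 * ε)) (Icc η₁ η) :=
    hF.contB.comp (by fun_prop) hmaps
  have hcl : ContinuousOn (fun ε => lam (2 * ε)) (Icc η₁ η) :=
    hF.contlam.comp (by fun_prop) hmaps
  -- The starts B(2ε) move to the right, so waves are compared at a fixed x beyond all of them; the
  -- time is cut accordingly.
  obtain ⟨x, hx⟩ := exists_between he
  obtain ⟨η', hη', hlt⟩ := exists_Icc_of_continuousOn_lt hη hcB hx.1
  have hsub : Icc η₁ η' ⊆ Icc η₁ η := Icc_subset_Icc_right hη'.2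
  set Q : ℝ → ℝ → ℝ := fun ε => wave G ε (B (2 * ε)) (lam (2 * ε)) with hQ
  have hsol : ∀ ε, Solves G ε (Q ε) := fun ε => wave_solves hG _ _
  have hst : ∀ ε, Q ε (B (2 * ε)) = lam (2 * ε) := fun ε => wave_self _ _ _ _
  have hQ0 : Q η₁ = Q₀ := (hsol η₁).eq_of_eq hQ₀ ((hst η₁).trans h0.symm)
  -- an earlier solution is smaller at the start of a later one
  have hbelow : ∀ ε ∈ Icc η₁ η', ∀ ε' ∈ Icc η₁ η', ε < ε' →
      Q ε (B (2 * ε')) < lam (2 * ε') := fun ε hε ε' hε' h => by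
    -- Restricted to lengths in [2ε, 2ε'], the flow has all its lengths on the decreasing side for
    -- the parameter ε.
    have hF' : Flow G A B lam (2 * ε) (2 * ε') := hF.mono (by linarith [hε.1])
      (by linarith [(hsub hε').2]) (by linarith)
    have := hF'.strictAntiOn_exit (hη₁.trans_le hε.1) (hsol ε) le_rfl
      (left_mem_Icc.2 hF'.lt.le) (right_mem_Icc.2 hF'.lt.le) hF'.lt
    simp only [hst, sub_self, mul_zero] at this
    exact sub_neg.1 (neg_of_mul_neg_right this (Real.exp_pos _).le)
  have hBlt : ∀ ε ∈ Ioc η₁ η', B (2 * η₁) < B (2 * ε) := fun ε hε =>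
    hF.strictMonoOn_B (hmaps (left_mem_Icc.2 hη.le)) (hmaps (hsub ⟨hε.1.le, hε.2⟩))
      (by linarith [hε.1])
  have m1 : η₁ ∈ Icc η₁ η' := left_mem_Icc.2 hη'.1.le
  have hgt : ∀ ε ∈ Ioc η₁ η', ∀ z ∈ Icc (B (2 * ε)) x, G z < Q ε z := fun ε hε z hz => by
    have hz' : G z < Q₀ z := hpos z ⟨(hBlt ε hε).trans_le hz.1, hz.2.trans_lt hx.2⟩
    refine hz'.trans (hQ0 ▸ (hsol η₁).lt_of_lt (hsol ε) hη₁ hε.1.le hz.1 (fun w hw => ?_) ?_)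
    · rw [hQ0]
      exact (hpos w ⟨(hBlt ε hε).trans hw.1, (hw.2.trans_le hz.2).trans hx.2⟩).le
    · rw [hst]
      exact hbelow _ m1 _ ⟨hε.1.le, hε.2⟩ hε.1
  refine ⟨η', hη', x, hx, ⟨fun ε _ => hsol ε, fun z => ?_, fun ε hε ε' hε' h => ?_⟩, hQ0,
    fun ε hε => ⟨hlt ε ⟨hε.1.le, hε.2⟩, hgt ε hε⟩⟩
  · exact continuousOn_wave hG (fun ε hε => hη₁.trans_le hε.1) (hcB.mono hsub) (hcl.mono hsub) z
  · refine (hsol ε).lt_of_lt (hsol ε') (hη₁.trans_le hε.1) h.le (hlt ε' hε').le (fun z hz => ?_) ?_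
    · have hB : B (2 * ε) < B (2 * ε') := hF.strictMonoOn_B (hmaps (hsub hε)) (hmaps (hsub hε'))
        (by linarith)
      rcases hε.1.eq_or_lt with rfl | hlt'
      · rw [hQ0]
        exact (hpos z ⟨hB.trans hz.1, hz.2.trans hx.2⟩).le
      · exact (hgt ε ⟨hlt', hε.2⟩ z ⟨hB.le.trans hz.1.le, hz.2.le⟩).le
    · rw [hst]
      exact hbelow ε hε ε' hε' h

/-! ### Two families that meet -/

/-- Two solutions running in opposite directions that agree at `h`, seen just after `h`. -/
lemma exists_crossing_end {g : ℝ → ℝ} (hg : Continuous g) (hlm : LocallyMonotone g) {η₁ η h y : ℝ}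
    (hη₁ : 0 < η₁) (hη : η₁ < η) (hy : h < y) {QR QL : ℝ → ℝ → ℝ} (hR : Family g η₁ η h QR)
    (hL : ∀ ε ∈ Icc η₁ η, Solves (fun z => g (-z)) ε (QL ε))
    (hLc : ∀ z, ContinuousOn (fun ε => QL ε z) (Icc η₁ η))
    (heq : QR η₁ h = QL η₁ (-h)) (hle : g h ≤ QR η₁ h)
    (hpos : ∀ z ∈ Ioo h y, g z < QL η₁ (-z)) :
    ∃ q ∈ Ioo h y, ∃ η' ∈ Ioc η₁ η, (∀ ε ∈ Icc η₁ η', QR ε q < QL ε (-q)) ∧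
      (∀ z ∈ Ioc h q, g z < QR η₁ z) ∧ ∀ ε ∈ Ioc η₁ η', ∀ z ∈ Icc h q, g z < QR ε z := by
  have m1 : η₁ ∈ Icc η₁ η := left_mem_Icc.2 hη.le
  have hpos' : ∀ z ∈ Ioo (-y) (-h), g (-z) < QL η₁ z := fun z hz => by
    have := hpos (-z) ⟨by linarith [hz.2], by linarith [hz.1]⟩
    rwa [neg_neg] at this
  -- If the right wave touches g at h, so does the left wave, which stayed above g on its way to h.
  -- Hence g rises before -h in the reflected coordinate, that is, falls after h, and the right wave
  -- leaves g upwards.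
  obtain ⟨δ, hδ, htail⟩ := (hR.solves η₁ m1).exists_tail hη₁ hg hle fun hc => by
    refine RisesBefore.reflect ((hL η₁ m1).risesBefore hη₁ hlm.reflect (by linarith : -y < -h) ?_
      hpos')
    rw [← heq, hc, neg_neg]
  have hm1 := min_le_left δ ((y - h) / 2)
  have hm2 := min_le_right δ ((y - h) / 2)
  have hm : 0 < min δ ((y - h) / 2) := lt_min hδ (by linarith)
  set q := h + min δ ((y - h) / 2) with hq
  have htail' : ∀ z ∈ Ioc h q, g z < QR η₁ z := fun z hz => htail z ⟨hz.1, by linarith [hz.2]⟩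
  have h1 : QR η₁ q < QR η₁ h := (hR.solves η₁ m1).strictAntiOn hη₁
    (fun z hz => htail' z ⟨hz.1, hz.2.le⟩) (left_mem_Icc.2 (by linarith : h ≤ q))
    (right_mem_Icc.2 (by linarith)) (by linarith)
  have h2 : QL η₁ (-h) < QL η₁ (-q) := (hL η₁ m1).strictAntiOn (x := -q) (y := -h) hη₁
    (fun z hz => hpos' z ⟨by linarith [hz.1], hz.2⟩) (left_mem_Icc.2 (by linarith))
    (right_mem_Icc.2 (by linarith)) (by linarith)
  obtain ⟨η', hη', hlt⟩ := exists_Icc_of_continuousOn_lt hη ((hR.cont q).sub (hLc (-q)))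
    (show QR η₁ q - QL η₁ (-q) < 0 by linarith)
  refine ⟨q, ⟨by linarith, by linarith⟩, η', hη', fun ε hε => sub_neg.1 (hlt ε hε), htail',
    fun ε hε z hz => ?_⟩
  refine lt_of_le_of_lt ?_ (hR.gt (y := q) hη₁ (fun w hw => (htail' w ⟨hw.1, hw.2.le⟩).le)
    ⟨hε.1, hε.2.trans hη'.2⟩ hz)
  rcases hz.1.eq_or_lt with rfl | hlt'
  · exact hle
  · exact (htail' z ⟨hlt', hz.2⟩).le

/-- A solution running to the right minus a solution running to the left is strictly decreasing. -/
lemma strictAntiOn_sub_reflect {g QR QL : ℝ → ℝ} {ε p q : ℝ} (hε : 0 < ε) (hR : Solves g ε QR)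
    (hL : Solves (fun z => g (-z)) ε QL) (hRpos : ∀ z ∈ Ioo p q, g z < QR z)
    (hLpos : ∀ z ∈ Ioo p q, g z < QL (-z)) :
    StrictAntiOn (fun z => QR z - QL (-z)) (Icc p q) := by
  have h1 := hR.strictAntiOn hε hRpos
  have h2 : StrictAntiOn QL (Icc (-q) (-p)) := hL.strictAntiOn hε fun z hz => by
    have := hLpos (-z) ⟨by linarith [hz.2], by linarith [hz.1]⟩
    rwa [neg_neg] at this
  intro u hu v hv huv
  have h3 := h1 hu hv huv
  have h4 := h2 (a := -v) (b := -u) ⟨by linarith [hv.2], by linarith [hv.1]⟩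
    ⟨by linarith [hu.2], by linarith [hu.1]⟩ (by linarith)
  simp only
  linarith

/-- The data of two families, running to the right and to the left through the gaps of a row. -/
structure Meeting (g : ℝ → ℝ) (ε : ℝ) {k : ℕ} (lo hi : Fin (k + 1) → ℝ)
    (A B lam : Fin k → ℝ → ℝ) (bot top r s : Fin k → ℝ) (QR QL : Fin (k + 1) → ℝ → ℝ)
    (p q : ℝ) : Prop where
  pos : 0 < ε
  le : ∀ j, lo j ≤ hi j
  flow : ∀ i, Flow g (A i) (B i) (lam i) (bot i) (top i)
  A_top : ∀ i, A i (top i) = hi i.castSucc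
  B_top : ∀ i, B i (top i) = lo i.succ
  hr : ∀ i, r i ∈ Ioo (bot i) (top i)
  hs : ∀ i, s i ∈ Ioo (bot i) (top i)
  solR : ∀ j, Solves g ε (QR j)
  solL : ∀ j, Solves (fun z => g (-z)) ε (QL j)
  arcR : ∀ j, ∀ z ∈ Icc (lo j) (hi j), g z < QR j z
  arcL : ∀ j, ∀ z ∈ Icc (lo j) (hi j), g z < QL j (-z)
  enterR : ∀ i, QR i.castSucc (A i (r i)) = lam i (r i)
  exitR : ∀ i, QR i.succ (B i (r i)) = lam i (r i)
  enterR_gt : ∀ i, ∀ l ∈ Ioc (r i) (top i), lam i l < QR i.castSucc (A i l)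
  exitR_gt : ∀ i, ∀ l ∈ Ioc (r i) (top i), lam i l < QR i.succ (B i l)
  pos_enterR : ∀ i, ∀ z ∈ Icc (A i (top i)) (A i (r i)), g z < QR i.castSucc z
  pos_exitR : ∀ i, ∀ z ∈ Icc (B i (r i)) (B i (top i)), g z < QR i.succ z
  enterL : ∀ i, QL i.succ (-B i (s i)) = lam i (s i)
  exitL : ∀ i, QL i.castSucc (-A i (s i)) = lam i (s i)
  enterL_gt : ∀ i, ∀ l ∈ Ioc (s i) (top i), lam i l < QL i.succ (-B i l)
  exitL_gt : ∀ i, ∀ l ∈ Ioc (s i) (top i), lam i l < QL i.castSucc (-A i l)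
  pos_enterL : ∀ i, ∀ z ∈ Icc (B i (s i)) (B i (top i)), g z < QL i.succ (-z)
  pos_exitL : ∀ i, ∀ z ∈ Icc (A i (top i)) (A i (s i)), g z < QL i.castSucc (-z)
  hp : p < lo 0
  hq : hi (Fin.last k) < q
  posp_R : ∀ z ∈ Icc p (lo 0), g z < QR 0 z
  posp_L : ∀ z ∈ Icc p (lo 0), g z < QL 0 (-z)
  posq_R : ∀ z ∈ Icc (hi (Fin.last k)) q, g z < QR (Fin.last k) z
  posq_L : ∀ z ∈ Icc (hi (Fin.last k)) q, g z < QL (Fin.last k) (-z)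
  gtp : QL 0 (-p) < QR 0 p
  ltq : QR (Fin.last k) q < QL (Fin.last k) (-q)

namespace Meeting

variable {g : ℝ → ℝ} {ε : ℝ} {k : ℕ} {lo hi : Fin (k + 1) → ℝ}
    {A B lam : Fin k → ℝ → ℝ} {bot top r s : Fin k → ℝ} {QR QL : Fin (k + 1) → ℝ → ℝ}
    {p q : ℝ}

lemma anti (h : Meeting g ε lo hi A B lam bot top r s QR QL p q) (j : Fin (k + 1)) {x y : ℝ}
    (hR : ∀ z ∈ Icc x y, g z < QR j z) (hL : ∀ z ∈ Icc x y, g z < QL j (-z)) :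
    StrictAntiOn (fun z => QR j z - QL j (-z)) (Icc x y) :=
  strictAntiOn_sub_reflect h.pos (h.solR j) (h.solL j) (fun z hz => hR z (Ioo_subset_Icc_self hz))
    (fun z hz => hL z (Ioo_subset_Icc_self hz))

lemma mr (h : Meeting g ε lo hi A B lam bot top r s QR QL p q) (i : Fin k) :
    r i ∈ Icc (bot i) (top i) := Ioo_subset_Icc_self (h.hr i)

lemma ms (h : Meeting g ε lo hi A B lam bot top r s QR QL p q) (i : Fin k) :
    s i ∈ Icc (bot i) (top i) := Ioo_subset_Icc_self (h.hs i)

lemma mt (h : Meeting g ε lo hi A B lam bot top r s QR QL p q) (i : Fin k) :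
    top i ∈ Icc (bot i) (top i) := right_mem_Icc.2 (h.flow i).lt.le

/-- At the leaving end of its chord the right wave equals λ, while the left wave, having entered at
a chord that is not longer, is at least λ there. The decrease of the difference makes this strict at
the next arc. -/
lemma lt_after (h : Meeting g ε lo hi A B lam bot top r s QR QL p q) (i : Fin k)
    (hrs : s i ≤ r i) : QR i.succ (lo i.succ) < QL i.succ (-lo i.succ) := by
  have hB := (h.flow i).strictMonoOn_B
  have h0 : QR i.succ (B i (r i)) ≤ QL i.succ (-B i (r i)) := by
    rw [h.exitR]
    rcases hrs.eq_or_lt with heq | hlt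
    · rw [← heq, h.enterL]
    · exact (h.enterL_gt i _ ⟨hlt, (h.hr i).2.le⟩).le
  have hlt : B i (r i) < lo i.succ := h.B_top i ▸ hB (h.mr i) (h.mt i) (h.hr i).2
  have hle : B i (s i) ≤ B i (r i) := hB.monotoneOn (h.ms i) (h.mr i) hrs
  have := h.anti i.succ (x := B i (r i)) (y := lo i.succ)
    (fun z hz => h.pos_exitR i z ⟨hz.1, by rw [h.B_top]; exact hz.2⟩)
    (fun z hz => h.pos_enterL i z ⟨hle.trans hz.1, by rw [h.B_top]; exact hz.2⟩)
    (left_mem_Icc.2 hlt.le) (right_mem_Icc.2 hlt.le) hlt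
  simp only at this
  linarith

/-- The mirror image: the comparison is made at the end where the left wave leaves its chord. -/
lemma gt_before (h : Meeting g ε lo hi A B lam bot top r s QR QL p q) (i : Fin k)
    (hrs : r i ≤ s i) :
    QL i.castSucc (-hi i.castSucc) < QR i.castSucc (hi i.castSucc) := by
  have hA := (h.flow i).strictAntiOn_A
  have h0 : QL i.castSucc (-A i (s i)) ≤ QR i.castSucc (A i (s i)) := by
    rw [h.exitL]
    rcases hrs.eq_or_lt with heq | hlt
    · rw [← heq, h.enterR]
    · exact (h.enterR_gt i _ ⟨hlt, (h.hs i).2.le⟩).le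
  have hlt : hi i.castSucc < A i (s i) := h.A_top i ▸ hA (h.ms i) (h.mt i) (h.hs i).2
  have hle : A i (s i) ≤ A i (r i) := hA.antitoneOn (h.mr i) (h.ms i) hrs
  have := h.anti i.castSucc (x := hi i.castSucc) (y := A i (s i))
    (fun z hz => h.pos_enterR i z ⟨by rw [h.A_top]; exact hz.1, hz.2.trans hle⟩)
    (fun z hz => h.pos_exitL i z ⟨by rw [h.A_top]; exact hz.1, hz.2⟩)
    (left_mem_Icc.2 hlt.le) (right_mem_Icc.2 hlt.le) hlt
  simp only at this
  linarith

/-- Otherwise the difference of the two waves would be negative at the left end of the arc between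
the gaps and positive at its right end, though it decreases along the arc. So dominance of the left
wave persists through all later gaps. -/
lemma lt_next (h : Meeting g ε lo hi A B lam bot top r s QR QL p q) (i i' : Fin k)
    (hii : i.succ = i'.castSucc) (hrs : s i ≤ r i) : s i' < r i' := by
  by_contra hcon
  have h1 := h.gt_before i' (not_lt.1 hcon)
  have h2 := h.lt_after i hrs
  rw [hii] at h2
  have := (h.anti i'.castSucc (h.arcR _) (h.arcL _)).antitoneOn
    (left_mem_Icc.2 (h.le _)) (right_mem_Icc.2 (h.le _)) (h.le i'.castSucc)
  linarith

lemma lt_of_le (h : Meeting g ε lo hi A B lam bot top r s QR QL p q) {i i' : Fin k}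
    (hii : i < i') (hrs : s i ≤ r i) : s i' < r i' := by
  obtain ⟨n, hn⟩ : ∃ n : ℕ, (i' : ℕ) = i + 1 + n := ⟨i' - (i + 1), by omega⟩
  induction n generalizing i' with
  | zero => exact h.lt_next i i' (Fin.ext (by simp [hn])) hrs
  | succ n ih =>
    have hlt : (i : ℕ) + 1 + n < k := by have := i'.2; omega
    have h1 := ih (i' := ⟨i + 1 + n, hlt⟩) (Fin.lt_def.2 (by simp only; omega)) rfl
    exact h.lt_next ⟨i + 1 + n, hlt⟩ i' (Fin.ext (by simp [hn]; omega)) h1.le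

/-- The two families meet either at a common chord of a gap or at an angle on an extended arc. -/
lemma resolve (h : Meeting g ε lo hi A B lam bot top r s QR QL p q) :
    (∃ j : Fin k, r j = s j ∧ (∀ i < j, r i < s i) ∧ ∀ i, j < i → s i < r i) ∨
    ∃ (j : Fin (k + 1)) (w : ℝ), (∀ i : Fin k, i.castSucc < j → r i < s i) ∧
      (∀ i : Fin k, j ≤ i.castSucc → s i < r i) ∧ QR j w = QL j (-w) ∧
      (j = 0 → p < w ∧ ∀ z ∈ Icc p w, g z < QR j z) ∧
      (∀ i : Fin k, i.succ = j → B i (r i) < w ∧ ∀ z ∈ Icc (B i (r i)) w, g z < QR j z) ∧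
      (j = Fin.last k → w < q ∧ ∀ z ∈ Icc w q, g z < QL j (-z)) ∧
      (∀ i : Fin k, i.castSucc = j → w < A i (s i) ∧
        ∀ z ∈ Icc w (A i (s i)), g z < QL j (-z)) := by
  -- the first gap that the right family does not dominate
  obtain ⟨j, hj1, hj2⟩ : ∃ j : Fin (k + 1), (∀ i : Fin k, i.castSucc < j → r i < s i) ∧
      ∀ i : Fin k, i.castSucc = j → s i ≤ r i := by
    classical
    by_cases hex : ∃ n : ℕ, ∃ hn : n < k, s ⟨n, hn⟩ ≤ r ⟨n, hn⟩
    · obtain ⟨hn, hle⟩ := Nat.find_spec hex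
      refine ⟨⟨Nat.find hex, by omega⟩, fun i hi => ?_, fun i hi => ?_⟩
      · by_contra hcon
        exact Nat.find_min hex (m := i) hi ⟨i.2, not_lt.1 hcon⟩
      · have : i = ⟨Nat.find hex, hn⟩ := Fin.ext (by simpa using congrArg Fin.val hi)
        rwa [this]
    · refine ⟨Fin.last k, fun i _ => ?_, fun i hi => ?_⟩
      · by_contra hcon
        exact hex ⟨i, i.2, not_lt.1 hcon⟩
      · exact absurd hi (Fin.castSucc_lt_last i).ne
  by_cases hbird : ∃ i : Fin k, i.castSucc = j ∧ r i = s i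
  · obtain ⟨i, rfl, heq⟩ := hbird
    exact Or.inl ⟨i, heq, fun i' hi' => hj1 i' hi', fun i' hi' => h.lt_of_le hi' heq.ge⟩
  right
  have hj2' : ∀ i : Fin k, i.castSucc = j → s i < r i := fun i hi =>
    lt_of_le_of_ne (hj2 i hi) fun he => hbird ⟨i, hi, he.symm⟩
  have hj3 : ∀ i : Fin k, j ≤ i.castSucc → s i < r i := fun i hi => by
    rcases hi.eq_or_lt with heq | hlt
    · exact hj2' i heq.symm
    · have hjk : (j : ℕ) < k := by have := i.2; have : (j : ℕ) < i := hlt; omega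
      exact h.lt_of_le (i := ⟨j, hjk⟩) (i' := i) hlt (hj2' ⟨j, hjk⟩ rfl).le
  have hj1' : ∀ i : Fin k, i.succ = j → r i < s i := fun i hi =>
    hj1 i (hi ▸ Fin.castSucc_lt_succ)
  -- the extended arc
  obtain ⟨x, hx, hxR, hxL, hxD, hx0, hx1⟩ : ∃ x ≤ lo j, (∀ z ∈ Icc x (lo j), g z < QR j z) ∧
      (∀ z ∈ Icc x (lo j), g z < QL j (-z)) ∧ QL j (-x) < QR j x ∧ (j = 0 → x = p) ∧
      ∀ i : Fin k, i.succ = j → x = B i (s i) ∧ B i (r i) < x ∧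
        ∀ z ∈ Icc (B i (r i)) (lo j), g z < QR j z := by
    rcases Fin.eq_zero_or_eq_succ j with rfl | ⟨i, rfl⟩
    · exact ⟨p, h.hp.le, h.posp_R, h.posp_L, h.gtp, fun _ => rfl,
        fun i hi => absurd hi (Fin.succ_ne_zero i)⟩
    · have hB := (h.flow i).strictMonoOn_B
      have hrs := hj1' i rfl
      have h1 : B i (r i) < B i (s i) := hB (h.mr i) (h.ms i) hrs
      refine ⟨B i (s i), h.B_top i ▸ hB.monotoneOn (h.ms i) (h.mt i) (h.hs i).2.le,
        fun z hz => h.pos_exitR i z ⟨h1.le.trans hz.1, by rw [h.B_top]; exact hz.2⟩,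
        fun z hz => h.pos_enterL i z (by rw [h.B_top]; exact hz), ?_,
        fun h0 => absurd h0 (Fin.succ_ne_zero i), fun i' hi' => ?_⟩
      · rw [h.enterL]
        exact h.exitR_gt i _ ⟨hrs, (h.hs i).2.le⟩
      · obtain rfl := Fin.succ_injective _ hi'
        exact ⟨rfl, h1, fun z hz => h.pos_exitR i' z (by rw [h.B_top]; exact hz)⟩
  obtain ⟨y, hy, hyR, hyL, hyD, hy0, hy1⟩ : ∃ y, hi j ≤ y ∧ (∀ z ∈ Icc (hi j) y, g z < QR j z) ∧
      (∀ z ∈ Icc (hi j) y, g z < QL j (-z)) ∧ QR j y < QL j (-y) ∧ (j = Fin.last k → y = q) ∧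
      ∀ i : Fin k, i.castSucc = j → y = A i (r i) ∧ y < A i (s i) ∧
        ∀ z ∈ Icc (hi j) (A i (s i)), g z < QL j (-z) := by
    rcases Fin.eq_castSucc_or_eq_last j with ⟨i, rfl⟩ | rfl
    · have hA := (h.flow i).strictAntiOn_A
      have hrs := hj2' i rfl
      have h1 : A i (r i) < A i (s i) := hA (h.ms i) (h.mr i) hrs
      refine ⟨A i (r i), h.A_top i ▸ hA.antitoneOn (h.mr i) (h.mt i) (h.hr i).2.le,
        fun z hz => h.pos_enterR i z (by rw [h.A_top]; exact hz),
        fun z hz => h.pos_exitL i z ⟨by rw [h.A_top]; exact hz.1, hz.2.trans h1.le⟩, ?_,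
        fun h0 => absurd h0 (Fin.castSucc_lt_last i).ne, fun i' hi' => ?_⟩
      · rw [h.enterR]
        exact h.exitL_gt i _ ⟨hrs, (h.hr i).2.le⟩
      · obtain rfl := Fin.castSucc_injective _ hi'
        exact ⟨rfl, h1, fun z hz => h.pos_exitL i' z (by rw [h.A_top]; exact hz)⟩
    · exact ⟨q, h.hq.le, h.posq_R, h.posq_L, h.ltq, fun _ => rfl,
        fun i hi => absurd hi (Fin.castSucc_lt_last i).ne⟩
  have hR : ∀ z ∈ Icc x y, g z < QR j z := fun z hz => by
    rcases le_total z (lo j) with h1 | h1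
    · exact hxR z ⟨hz.1, h1⟩
    rcases le_total z (hi j) with h2 | h2
    · exact h.arcR j z ⟨h1, h2⟩
    · exact hyR z ⟨h2, hz.2⟩
  have hL : ∀ z ∈ Icc x y, g z < QL j (-z) := fun z hz => by
    rcases le_total z (lo j) with h1 | h1
    · exact hxL z ⟨hz.1, h1⟩
    rcases le_total z (hi j) with h2 | h2
    · exact h.arcL j z ⟨h1, h2⟩
    · exact hyL z ⟨h2, hz.2⟩
  have hxy : x ≤ y := hx.trans ((h.le j).trans hy)
  have hcont : ContinuousOn (fun z => QR j z - QL j (-z)) (Icc x y) :=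
    ((h.solR j).continuous.sub ((h.solL j).continuous.comp continuous_neg)).continuousOn
  -- On the extended arc the difference of the waves is positive at x and negative at y; its zero is
  -- the angle.
  obtain ⟨w, hw, hw0⟩ := intermediate_value_Ioo' hxy hcont
    (show (0 : ℝ) ∈ Ioo (QR j y - QL j (-y)) (QR j x - QL j (-x)) from
      ⟨by linarith, by linarith⟩)
  refine ⟨j, w, hj1, hj3, sub_eq_zero.1 hw0, fun h0 => ⟨hx0 h0 ▸ hw.1, fun z hz =>
    hR z ⟨(hx0 h0) ▸ hz.1, hz.2.trans hw.2.le⟩⟩, fun i hi' => ?_, fun h0 => ⟨hy0 h0 ▸ hw.2,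
    fun z hz => hL z ⟨hw.1.le.trans hz.1, (hy0 h0) ▸ hz.2⟩⟩, fun i hi' => ?_⟩
  · obtain ⟨-, h2, h3⟩ := hx1 i hi'
    refine ⟨h2.trans hw.1, fun z hz => ?_⟩
    rcases le_total z (lo j) with h4 | h4
    · exact h3 z ⟨hz.1, h4⟩
    · exact hR z ⟨hx.trans h4, hz.2.trans hw.2.le⟩
  · obtain ⟨-, h2, h3⟩ := hy1 i hi'
    refine ⟨hw.2.trans h2, fun z hz => ?_⟩
    rcases le_total z (hi j) with h4 | h4
    · exact hL z ⟨hw.1.le.trans hz.1, h4.trans hy⟩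
    · exact h3 z ⟨h4, hz.2⟩

end Meeting

/-! ### The cup equation -/

lemma hasDerivAt_datum {f : ℝ → ℝ} (hf : ContDiff ℝ 2 f) (x : ℝ) : HasDerivAt f (deriv f x) x :=
  (hf.differentiable (by norm_num) x).hasDerivAt

lemma contDiff_deriv_datum {f : ℝ → ℝ} (hf : ContDiff ℝ 2 f) : ContDiff ℝ 1 (deriv f) :=
  ((contDiff_succ_iff_deriv (n := 1)).1 hf).2.2

lemma hasDerivAt_deriv_datum {f : ℝ → ℝ} (hf : ContDiff ℝ 2 f) (x : ℝ) :
    HasDerivAt (deriv f) (deriv (deriv f) x) x :=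
  ((contDiff_deriv_datum hf).differentiable (by norm_num) x).hasDerivAt

lemma continuous_deriv2_datum {f : ℝ → ℝ} (hf : ContDiff ℝ 2 f) :
    Continuous (deriv (deriv f)) :=
  (contDiff_deriv_datum hf).continuous_deriv (by norm_num)

lemma av_deriv {f : ℝ → ℝ} (hf : ContDiff ℝ 1 f) {a b : ℝ} (hab : a < b) :
    av (deriv f) a b = (f b - f a) / (b - a) := by
  rw [av, if_neg hab.ne, intervalIntegral.integral_deriv_eq_sub
    (fun x _ => hf.differentiable (by norm_num) x)
    ((hf.continuous_deriv (by norm_num)).intervalIntegrable _ _)]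

lemma cupEq_iff {f : ℝ → ℝ} (hf : ContDiff ℝ 2 f) {a b : ℝ} (hab : a < b) :
    CupEq f a b ↔ f b - f a - (b - a) * ((deriv f a + deriv f b) / 2) = 0 := by
  rw [CupEq, av_deriv (hf.of_le (by norm_num)) hab, div_eq_iff (sub_pos.2 hab).ne', sub_eq_zero,
    mul_comm]

/-- Both relations come from differentiating identities in l: the length of the chord and the cup
equation cleared of denominators. -/
lemma cup_deriv_relation {f : ℝ → ℝ} (hf : ContDiff ℝ 2 f) {a b : ℝ → ℝ} {l a' b' : ℝ} (hl : 0 < l)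
    (hlen : ∀ᶠ x in 𝓝 l, b x - a x = x) (hcup : ∀ᶠ x in 𝓝 l, CupEq f (a x) (b x))
    (da : HasDerivAt a a' l) (db : HasDerivAt b b' l) :
    b' - a' = 1 ∧ DL f (a l) (b l) * a' + DR f (a l) (b l) * b' = 0 := by
  have h1 : b' - a' = 1 :=
    ((db.sub da).congr_of_eventuallyEq (hlen.mono fun x hx => hx.symm)).unique (hasDerivAt_id l)
  refine ⟨h1, ?_⟩
  have hlen' := hlen.self_of_nhds
  have hab : a l < b l := by linarith
  have hz : ∀ᶠ x in 𝓝 l,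
      f (b x) - f (a x) - x * ((deriv f (a x) + deriv f (b x)) / 2) = 0 := by
    filter_upwards [hlen, hcup, eventually_gt_nhds hl] with x h2 h3 h4
    have := (cupEq_iff hf (by linarith : a x < b x)).1 h3
    rwa [h2] at this
  have hd := ((((hasDerivAt_datum hf (b l)).comp l db).sub ((hasDerivAt_datum hf (a l)).comp l da)).sub
    ((hasDerivAt_id l).mul ((((hasDerivAt_deriv_datum hf (a l)).comp l da).add
      ((hasDerivAt_deriv_datum hf (b l)).comp l db)).div_const 2)))
  have hd0 := (hd.congr_of_eventuallyEq (f₁ := fun _ => (0 : ℝ))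
    (hz.mono fun x hx => by simpa using hx.symm)).unique (hasDerivAt_const l 0)
  simp only [Pi.add_apply, Function.comp_apply, id_eq] at hd0
  rw [DL, DR, av_deriv (contDiff_deriv_datum hf) hab, hlen']
  have hb' : b' = 1 + a' := by linarith
  subst hb'
  field_simp
  linear_combination -2 * hd0

/-! ### Chordal domains as flows -/

/-- The average of f'' is the difference quotient (f'(b) - f'(a))/l, whence the formula for its
derivative. The lengths must stay away from zero, so a cup is cut above its origin. -/
lemma ChordalDomain.Admissible.flow {f : ℝ → ℝ} (hf : ContDiff ℝ 2 f) {d : ChordalDomain}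
    (hd : d.Admissible f) {bot : ℝ} (h0 : 0 < bot) (h1 : d.bot ≤ bot) (h2 : bot < d.top) :
    Flow (deriv (deriv f)) d.a d.b (fun l => av (deriv (deriv f)) (d.a l) (d.b l)) bot d.top := by
  obtain ⟨-, -, hca, hcb, hlen, hdiff, hcup, hneg⟩ := hd
  have hsub : Icc bot d.top ⊆ Icc d.bot d.top := Icc_subset_Icc_left h1
  have hsubo : Ioo bot d.top ⊆ Ioo d.bot d.top := Ioo_subset_Ioo_left h1
  have hav : ∀ l ∈ Icc bot d.top, av (deriv (deriv f)) (d.a l) (d.b l) =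
      (deriv f (d.b l) - deriv f (d.a l)) / l := fun l hl => by
    have := hlen l (hsub hl)
    rw [av_deriv (contDiff_deriv_datum hf) (by linarith [hl.1]), this]
  have hcf := (contDiff_deriv_datum hf).continuous
  refine ⟨h0, h2, hca.mono hsub, hcb.mono hsub, ?_, fun l hl => ?_,
    fun l hl => sub_neg.1 (hneg l (hsubo hl)).1, fun l hl => sub_neg.1 (hneg l (hsubo hl)).2,
    fun l hl => sub_nonpos.1 (hcup l (hsub hl)).2.1, fun l hl => sub_nonpos.1 (hcup l (hsub hl)).2.2⟩
  · refine ContinuousOn.congr ?_ hav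
    exact ((hcf.comp_continuousOn (hcb.mono hsub)).sub (hcf.comp_continuousOn (hca.mono hsub))).div
      continuousOn_id fun l hl => (h0.trans_le hl.1).ne'
  · obtain ⟨da, db, hda, hdb⟩ := hdiff l (hsubo hl)
    have hl0 : 0 < l := h0.trans hl.1
    have hnhds : Ioo d.bot d.top ∈ 𝓝 l := Ioo_mem_nhds (h1.trans_lt hl.1) hl.2
    obtain ⟨h3, h4⟩ := cup_deriv_relation hf hl0
      (mem_of_superset hnhds fun x hx => hlen x (Ioo_subset_Icc_self hx))
      (mem_of_superset hnhds fun x hx => (hcup x (Ioo_subset_Icc_self hx)).1)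
      da.hasDerivAt db.hasDerivAt
    refine ⟨_, _, hda, hdb, da.hasDerivAt, db.hasDerivAt, ?_, h4⟩
    have hd := (((hasDerivAt_deriv_datum hf (d.b l)).comp l db.hasDerivAt).sub
      ((hasDerivAt_deriv_datum hf (d.a l)).comp l da.hasDerivAt)).div (hasDerivAt_id l) hl0.ne'
    have hev : (fun l => av (deriv (deriv f)) (d.a l) (d.b l)) =ᶠ[𝓝 l]
        ((deriv f ∘ d.b - deriv f ∘ d.a) / id) :=
      mem_of_superset (Ioo_mem_nhds hl.1 hl.2) fun x hx => by
        simpa using hav x (Ioo_subset_Icc_self hx)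
    refine (hd.congr_of_eventuallyEq hev).congr_deriv ?_
    simp only [DL, DR] at h4
    simp only [Pi.sub_apply, Function.comp_apply, id_eq]
    set lam := av (deriv (deriv f)) (d.a l) (d.b l) with hlam
    have hlam' : deriv f (d.b l) - deriv f (d.a l) = lam * l := by
      rw [hlam, hav l (Ioo_subset_Icc_self hl)]
      field_simp
    have hb' : deriv d.b l = 1 + deriv d.a l := by linarith
    rw [hlam', hb']
    rw [hb'] at h4
    field_simp
    linear_combination h4

/-! ### Growing chords above a given chord -/

/-- A vanishing differential with a monotone fall and a negative differential are brought to one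
form: just outside the chord g is below c, and the deficit c - g at an inner point is at most twice
the deficit farther out. -/
lemma FallsAfter.exists_comparable {g : ℝ → ℝ} (hg : Continuous g) {x c : ℝ} (hle : g x ≤ c)
    (hc : g x = c → FallsAfter g x) :
    ∃ δ > 0, ∀ s t, x < s → s ≤ t → t ≤ x + δ → g t < c ∧ 2 * (g t - c) ≤ g s - c := by
  rcases hle.eq_or_lt with heq | hlt
  · obtain ⟨δ, hδ, hanti, hlt⟩ := hc heq
    refine ⟨δ, hδ, fun s t hs hst ht => ?_⟩
    have h1 := hlt t ⟨hs.trans_le hst, ht⟩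
    have h2 := hanti ⟨hs.le, hst.trans ht⟩ ⟨hs.le.trans hst, ht⟩ hst
    constructor <;> linarith
  -- With oscillation below a quarter of c - g x the deficits lie between 3/4 and 5/4 of it, and 5/4
  -- ≤ 2 · 3/4.
  · have hev : ∀ᶠ z in 𝓝 x, |g z - g x| < (c - g x) / 4 := by
      have := Metric.continuousAt_iff'.1 (hg.continuousAt (x := x)) ((c - g x) / 4) (by linarith)
      simpa [Real.dist_eq] using this
    obtain ⟨δ, hδ, hb⟩ := Metric.eventually_nhds_iff.1 hev
    refine ⟨δ / 2, half_pos hδ, fun s t hs hst ht => ?_⟩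
    have h1 := abs_lt.1 (hb (y := s) (by
      rw [Real.dist_eq, abs_of_pos (by linarith)]; linarith))
    have h2 := abs_lt.1 (hb (y := t) (by
      rw [Real.dist_eq, abs_of_pos (by linarith)]; linarith))
    constructor <;> linarith [h1.1, h1.2, h2.1, h2.2]

lemma RisesBefore.exists_comparable {g : ℝ → ℝ} (hg : Continuous g) {x c : ℝ} (hle : g x ≤ c)
    (hc : g x = c → RisesBefore g x) :
    ∃ δ > 0, ∀ s t, s < x → t ≤ s → x - δ ≤ t → g t < c ∧ 2 * (g t - c) ≤ g s - c := by
  obtain ⟨δ, hδ, h⟩ := FallsAfter.exists_comparable (g := fun z => g (-z)) (x := -x) (c := c)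
    (by fun_prop) (by simpa using hle) fun heq => by
      refine RisesBefore.reflect ?_
      simpa using hc (by simpa using heq)
  refine ⟨δ, hδ, fun s t hs hst ht => ?_⟩
  simpa using h (-s) (-t) (by linarith) (by linarith) (by linarith)

/-- The left-hand side of the cup equation. -/
def cupDefect (f : ℝ → ℝ) (a b : ℝ) : ℝ := f b - f a - (b - a) * ((deriv f a + deriv f b) / 2)

/-- The constant c is free because the weight t - (a+b)/2 has mean zero; choosing c as the average
over a chord later makes the inner part of the integral vanish. -/
lemma cupDefect_eq_integral {f : ℝ → ℝ} (hf : ContDiff ℝ 2 f) (a b c : ℝ) :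
    cupDefect f a b = -∫ t in a..b, (t - (a + b) / 2) * (deriv (deriv f) t - c) := by
  have hd : ∀ t, HasDerivAt (fun t => (t - (a + b) / 2) * (deriv f t - c * t) - f t +
      c * t ^ 2 / 2) ((t - (a + b) / 2) * (deriv (deriv f) t - c)) t := fun t => by
    refine ((((((hasDerivAt_id t).sub_const ((a + b) / 2)).mul ((hasDerivAt_deriv_datum hf t).sub
      ((hasDerivAt_id t).const_mul c))).sub (hasDerivAt_datum hf t))).add
      (((hasDerivAt_pow 2 t).const_mul c).div_const 2)).congr_deriv ?_
    simp only [Pi.sub_apply, id_eq]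
    ring
  have hg := continuous_deriv2_datum hf
  rw [intervalIntegral.integral_eq_sub_of_hasDerivAt (fun t _ => hd t)
    ((by fun_prop : Continuous fun t => (t - (a + b) / 2) *
      (deriv (deriv f) t - c)).intervalIntegrable a b), cupDefect]
  ring

lemma hasDerivAt_cupDefect {f : ℝ → ℝ} (hf : ContDiff ℝ 2 f) (l a : ℝ) :
    HasDerivAt (fun a => cupDefect f a (a + l)) (deriv f (a + l) - deriv f a -
      l * ((deriv (deriv f) a + deriv (deriv f) (a + l)) / 2)) a := by
  have hs : HasDerivAt (fun a => a + l) 1 a := (hasDerivAt_id a).add_const l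
  have h := (((hasDerivAt_datum hf (a + l)).comp a hs).sub (hasDerivAt_datum hf a)).sub
    ((((hasDerivAt_deriv_datum hf a).add ((hasDerivAt_deriv_datum hf (a + l)).comp a hs)).div_const
      2).const_mul l)
  have heq : (fun a => cupDefect f a (a + l)) = fun a => f (a + l) - f a -
      l * ((deriv f a + deriv f (a + l)) / 2) := by
    funext x; simp [cupDefect]
  rw [heq]
  refine h.congr_deriv ?_
  simp

/-- Near a chord from which the second derivative falls, outwards, below its average, the cup
equation is monotone along chords of equal length, and on its solutions both differentials are
negative. -/
lemma exists_cup_neighbourhood {f : ℝ → ℝ} (hf : ContDiff ℝ 2 f) {a₀ b₀ : ℝ} (hab : a₀ < b₀)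
    (hcup : CupEq f a₀ b₀) (hL : DL f a₀ b₀ ≤ 0) (hR : DR f a₀ b₀ ≤ 0)
    (hL0 : DL f a₀ b₀ = 0 → RisesBefore (deriv (deriv f)) a₀)
    (hR0 : DR f a₀ b₀ = 0 → FallsAfter (deriv (deriv f)) b₀) :
    ∃ ρ > 0, (∀ b ∈ Ioc b₀ (b₀ + ρ), 0 < cupDefect f a₀ b) ∧
      (∀ a ∈ Ico (a₀ - ρ) a₀, cupDefect f a b₀ < 0) ∧
      ∀ a ∈ Ico (a₀ - ρ) a₀, ∀ b ∈ Ioc b₀ (b₀ + ρ),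
        0 < deriv f b - deriv f a - (b - a) * ((deriv (deriv f) a + deriv (deriv f) b) / 2) ∧
        (cupDefect f a b = 0 → DL f a b < 0 ∧ DR f a b < 0) := by
  set g := deriv (deriv f) with hgdef
  have hg : Continuous g := continuous_deriv2_datum hf
  set c := av g a₀ b₀ with hc
  obtain ⟨δ₁, hδ₁, hRc⟩ := FallsAfter.exists_comparable hg (sub_nonpos.1 hR)
    fun h => hR0 (sub_eq_zero.2 h)
  obtain ⟨δ₂, hδ₂, hLc⟩ := RisesBefore.exists_comparable hg (sub_nonpos.1 hL)
    fun h => hL0 (sub_eq_zero.2 h)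
  -- The added pieces must be short compared with the chord: their points then stay far from the
  -- midpoint, and the constants 2, 3, 6 below leave room.
  obtain ⟨ρ, hρ, hρ1, hρ2, hρ3⟩ : ∃ ρ > 0, ρ ≤ δ₁ ∧ ρ ≤ δ₂ ∧ 16 * ρ ≤ b₀ - a₀ :=
    ⟨min (min δ₁ δ₂) ((b₀ - a₀) / 16), lt_min (lt_min hδ₁ hδ₂) (by linarith),
      (min_le_left _ _).trans (min_le_left _ _), (min_le_left _ _).trans (min_le_right _ _), by
        linarith [min_le_right (min δ₁ δ₂) ((b₀ - a₀) / 16)]⟩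
  have hint : ∀ u v : ℝ, IntervalIntegrable (fun t => c - g t) volume u v := fun u v =>
    (by fun_prop : Continuous fun t => c - g t).intervalIntegrable u v
  have hintm : ∀ m u v : ℝ, IntervalIntegrable (fun t => (t - m) * (c - g t)) volume u v :=
    fun m u v => (by fun_prop : Continuous fun t => (t - m) * (c - g t)).intervalIntegrable u v
  -- moments over the base vanish
  have hM0 : ∫ t in a₀..b₀, (c - g t) = 0 := by
    rw [intervalIntegral.integral_sub (by simp) (hg.intervalIntegrable _ _),
      intervalIntegral.integral_const, hc, av, if_neg hab.ne, smul_eq_mul,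
      mul_div_cancel₀ _ (sub_pos.2 hab).ne', sub_self]
  have hbase : ∀ m, ∫ t in a₀..b₀, (t - m) * (c - g t) = 0 := fun m => by
    have h1 := cupDefect_eq_integral hf a₀ b₀ c
    rw [cupDefect, (cupEq_iff hf hab).1 hcup] at h1
    have h2 : ∫ t in a₀..b₀, (t - (a₀ + b₀) / 2) * (c - g t) = 0 := by
      rw [h1, ← intervalIntegral.integral_neg]
      exact intervalIntegral.integral_congr fun t _ => by simp only [hgdef]; ring
    have h3 : ∀ t, (t - m) * (c - g t) =
        (t - (a₀ + b₀) / 2) * (c - g t) + ((a₀ + b₀) / 2 - m) * (c - g t) := fun t => by ring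
    simp only [h3]
    rw [intervalIntegral.integral_add (hintm _ _ _) ((hint _ _).const_mul _), h2,
      intervalIntegral.integral_const_mul, hM0]
    simp
  -- Zeroth and first moments of c - g over the old chord vanish, so only the two added pieces
  -- contribute, each with a positive weight, the distance to the midpoint.
  have hsplit : ∀ a b, cupDefect f a b = (∫ t in b₀..b, (t - (a + b) / 2) * (c - g t)) -
      ∫ t in a..a₀, ((a + b) / 2 - t) * (c - g t) := fun a b => by
    have h4 : ∫ t in a..b, (t - (a + b) / 2) * (c - g t) = cupDefect f a b := by
      rw [cupDefect_eq_integral hf a b c, ← intervalIntegral.integral_neg]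
      exact intervalIntegral.integral_congr fun t _ => by simp only [hgdef]; ring
    have h5 : ∫ t in a..a₀, ((a + b) / 2 - t) * (c - g t) =
        -∫ t in a..a₀, (t - (a + b) / 2) * (c - g t) := by
      rw [← intervalIntegral.integral_neg]
      exact intervalIntegral.integral_congr fun t _ => by ring
    rw [h5, ← h4, ← intervalIntegral.integral_add_adjacent_intervals (hintm _ a a₀) (hintm _ a₀ b),
      ← intervalIntegral.integral_add_adjacent_intervals (hintm _ a₀ b₀) (hintm _ b₀ b), hbase]
    ring
  have hposR : ∀ t ∈ Ioc b₀ (b₀ + ρ), 0 < c - g t := fun t ht =>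
    sub_pos.2 (hRc t t ht.1 le_rfl (by linarith [ht.2])).1
  have hposL : ∀ t ∈ Ico (a₀ - ρ) a₀, 0 < c - g t := fun t ht =>
    sub_pos.2 (hLc t t ht.2 le_rfl (by linarith [ht.1])).1
  refine ⟨ρ, hρ, fun b hb => ?_, fun a ha => ?_, fun a ha b hb => ?_⟩
  · rw [hsplit, intervalIntegral.integral_same, sub_zero]
    refine intervalIntegral.intervalIntegral_pos_of_pos_on (hintm _ _ _) (fun t ht => ?_) hb.1
    exact mul_pos (by linarith [ht.1, hb.2]) (hposR t ⟨ht.1, ht.2.le.trans hb.2⟩)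
  · rw [hsplit, intervalIntegral.integral_same, zero_sub, neg_lt_zero]
    refine intervalIntegral.intervalIntegral_pos_of_pos_on
      ((by fun_prop : Continuous fun t => ((a + b₀) / 2 - t) * (c - g t)).intervalIntegrable _ _)
      (fun t ht => ?_) ha.2
    exact mul_pos (by linarith [ht.2, ha.1]) (hposL t ⟨ha.1.trans ht.1.le, ht.2⟩)
  -- masses of the two added pieces
  · set MR := ∫ t in b₀..b, (c - g t) with hMR
    set ML := ∫ t in a..a₀, (c - g t) with hML
    have ha1 := ha.1
    have ha2 := ha.2
    have hb1 := hb.1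
    have hb2 := hb.2
    have hpR := hposR b hb
    have hpL := hposL a ha
    have hMR0 : 0 ≤ MR := intervalIntegral.integral_nonneg hb1.le fun t ht => by
      rcases ht.1.eq_or_lt with rfl | h
      · exact sub_nonneg.2 (sub_nonpos.1 hR)
      · exact (hposR t ⟨h, ht.2.trans hb2⟩).le
    have hML0 : 0 ≤ ML := intervalIntegral.integral_nonneg ha2.le fun t ht => by
      rcases ht.2.eq_or_lt with rfl | h
      · exact sub_nonneg.2 (sub_nonpos.1 hL)
      · exact (hposL t ⟨ha1.trans ht.1, h⟩).le
    -- Comparability bounds the mass of an added piece by twice the deficit at its outer end times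
    -- its length.
    have hMR1 : MR ≤ 2 * (c - g b) * ρ := by
      have h1 : MR ≤ ∫ t in b₀..b, 2 * (c - g b) := by
        refine intervalIntegral.integral_mono_on_of_le_Ioo hb1.le (hint _ _) (by simp) fun t ht => ?_
        linarith [(hRc t b ht.1 ht.2.le (by linarith)).2]
      rw [intervalIntegral.integral_const, smul_eq_mul] at h1
      nlinarith
    have hML1 : ML ≤ 2 * (c - g a) * ρ := by
      have h1 : ML ≤ ∫ t in a..a₀, 2 * (c - g a) := by
        refine intervalIntegral.integral_mono_on_of_le_Ioo ha2.le (hint _ _) (by simp) fun t ht => ?_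
        linarith [(hLc t a ht.2 ht.1.le (by linarith)).2]
      rw [intervalIntegral.integral_const, smul_eq_mul] at h1
      nlinarith
    have hlen : deriv f b - deriv f a = c * (b - a) - (ML + MR) := by
      have h1 : ∫ t in a..b, (c - g t) = ML + MR := by
        rw [← intervalIntegral.integral_add_adjacent_intervals (hint a a₀) (hint a₀ b),
          ← intervalIntegral.integral_add_adjacent_intervals (hint a₀ b₀) (hint b₀ b), hM0]
        ring
      rw [intervalIntegral.integral_sub (by simp) (hg.intervalIntegrable _ _),
        intervalIntegral.integral_const, smul_eq_mul, hgdef,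
        intervalIntegral.integral_eq_sub_of_hasDerivAt (fun t _ => hasDerivAt_deriv_datum hf t)
          (hg.intervalIntegrable _ _)] at h1
      linarith
    refine ⟨?_, fun h0 => ?_⟩
    · rw [hlen]
      nlinarith [mul_pos hpR hρ, mul_pos hpL hρ]
    · set IR := ∫ t in b₀..b, (t - (a + b) / 2) * (c - g t) with hIR
      set IL := ∫ t in a..a₀, ((a + b) / 2 - t) * (c - g t) with hIL
      -- The cup equation balances the first moments of the two pieces. All weights lie between (b₀
      -- - a₀ - ρ)/2 and (b - a)/2, so the masses are comparable up to the factor 2.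
      have hI : IR = IL := by
        have := hsplit a b
        rw [h0] at this
        linarith
      have hcont2 : Continuous fun t => ((a + b) / 2 - t) * (c - g t) := by fun_prop
      have hIR1 : IR ≤ ((b - a) / 2) * MR := by
        rw [hMR, ← intervalIntegral.integral_const_mul]
        refine intervalIntegral.integral_mono_on_of_le_Ioo hb1.le (hintm _ _ _)
          ((hint _ _).const_mul _) fun t ht => ?_
        exact mul_le_mul_of_nonneg_right (by linarith [ht.2])
          (hposR t ⟨ht.1, ht.2.le.trans hb2⟩).le
      have hIL1 : IL ≤ ((b - a) / 2) * ML := by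
        rw [hML, ← intervalIntegral.integral_const_mul]
        refine intervalIntegral.integral_mono_on_of_le_Ioo ha2.le (hcont2.intervalIntegrable _ _)
          ((hint _ _).const_mul _) fun t ht => ?_
        exact mul_le_mul_of_nonneg_right (by linarith [ht.1])
          (hposL t ⟨ha1.trans ht.1.le, ht.2⟩).le
      have hIR2 : (b₀ - a₀ - ρ) / 2 * MR ≤ IR := by
        rw [hMR, ← intervalIntegral.integral_const_mul]
        refine intervalIntegral.integral_mono_on_of_le_Ioo hb1.le ((hint _ _).const_mul _)
          (hintm _ _ _) fun t ht => ?_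
        exact mul_le_mul_of_nonneg_right (by linarith [ht.1])
          (hposR t ⟨ht.1, ht.2.le.trans hb2⟩).le
      have hIL2 : (b₀ - a₀ - ρ) / 2 * ML ≤ IL := by
        rw [hML, ← intervalIntegral.integral_const_mul]
        refine intervalIntegral.integral_mono_on_of_le_Ioo ha2.le ((hint _ _).const_mul _)
          (hcont2.intervalIntegrable _ _) fun t ht => ?_
        exact mul_le_mul_of_nonneg_right (by linarith [ht.2])
          (hposL t ⟨ha1.trans ht.1.le, ht.2⟩).le
      have hl0 : 0 < b₀ - a₀ := sub_pos.2 hab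
      have hlr : b - a ≤ b₀ - a₀ + 2 * ρ := by linarith
      have hML2 : ML ≤ 2 * MR := by
        have h1 : (b₀ - a₀ - ρ) * ML ≤ (b - a) * MR := by linarith
        have h2 : (b - a) * MR ≤ (b₀ - a₀ + 2 * ρ) * MR := mul_le_mul_of_nonneg_right hlr hMR0
        have h3 : (b₀ - a₀ + 2 * ρ) * MR ≤ (b₀ - a₀ - ρ) * (2 * MR) := by
          rw [show (b₀ - a₀ - ρ) * (2 * MR) = (2 * (b₀ - a₀ - ρ)) * MR by ring]
          exact mul_le_mul_of_nonneg_right (by linarith) hMR0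
        exact le_of_mul_le_mul_left (h1.trans (h2.trans h3)) (by linarith)
      have hMR2 : MR ≤ 2 * ML := by
        have h1 : (b₀ - a₀ - ρ) * MR ≤ (b - a) * ML := by linarith
        have h2 : (b - a) * ML ≤ (b₀ - a₀ + 2 * ρ) * ML := mul_le_mul_of_nonneg_right hlr hML0
        have h3 : (b₀ - a₀ + 2 * ρ) * ML ≤ (b₀ - a₀ - ρ) * (2 * ML) := by
          rw [show (b₀ - a₀ - ρ) * (2 * ML) = (2 * (b₀ - a₀ - ρ)) * ML by ring]
          exact mul_le_mul_of_nonneg_right (by linarith) hML0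
        exact le_of_mul_le_mul_left (h1.trans (h2.trans h3)) (by linarith)
      have hlt : a < b := by linarith
      rw [DL, DR, ← hgdef, av_deriv (contDiff_deriv_datum hf) hlt, sub_neg, sub_neg,
        lt_div_iff₀ (sub_pos.2 hlt), lt_div_iff₀ (sub_pos.2 hlt), hlen]
      -- Both differentials follow from ML + MR ≤ 3 ML ≤ 6ρ(c - g a) and the same bound with MR and
      -- b.
      have h6 : 6 * ρ < b - a := by linarith
      have h7 := mul_lt_mul_of_pos_left h6 hpL
      have h8 := mul_lt_mul_of_pos_left h6 hpR
      constructor <;> linarith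

/-- The implicit function theorem for a function of two real variables. -/
lemma exists_differentiable_implicit {F : ℝ × ℝ → ℝ} (hF : ContDiff ℝ 1 F) {l a c : ℝ}
    (hd : HasDerivAt (fun a => F (l, a)) c a) (hc : c ≠ 0) :
    ∃ ψ : ℝ → ℝ, DifferentiableAt ℝ ψ l ∧ Tendsto ψ (𝓝 l) (𝓝 a) ∧
      ∀ᶠ x in 𝓝 l, F (x, ψ x) = F (l, a) := by
  have dfu : HasStrictFDerivAt F (fderiv ℝ F (l, a)) (l, a) :=
    hF.contDiffAt.hasStrictFDerivAt (by norm_num)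
  have h1 : HasFDerivAt (fun a => F (l, a)) (fderiv ℝ F (l, a) ∘L .inr ℝ ℝ ℝ) a :=
    dfu.hasFDerivAt.comp a (hasFDerivAt_prodMk_right l a)
  have h2 : fderiv ℝ F (l, a) ∘L .inr ℝ ℝ ℝ = ContinuousLinearMap.toSpanSingleton ℝ c :=
    h1.unique hd.hasFDerivAt
  have hinv : (fderiv ℝ F (l, a) ∘L .inr ℝ ℝ ℝ).IsInvertible := by
    rw [h2]
    refine ⟨ContinuousLinearEquiv.equivOfInverse (ContinuousLinearMap.toSpanSingleton ℝ c)
      (ContinuousLinearMap.toSpanSingleton ℝ c⁻¹) (fun x => ?_) (fun x => ?_), ?_⟩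
    · simp [ContinuousLinearMap.toSpanSingleton_apply, hc]
    · simp [ContinuousLinearMap.toSpanSingleton_apply, hc]
    · ext; simp
  exact ⟨dfu.implicitFunctionOfProdDomain hinv,
    (dfu.hasStrictFDerivAt_implicitFunctionOfProdDomain hinv).hasFDerivAt.differentiableAt,
    dfu.tendsto_implicitFunctionOfProdDomain hinv,
    dfu.eventually_apply_implicitFunctionOfProdDomain hinv⟩

/-- The chord `[a l, b l]` of length `l` belongs to the interior of an admissible chordal domain. -/
structure InnerChord (f a b : ℝ → ℝ) (l : ℝ) : Prop where
  diffa : DifferentiableAt ℝ a l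
  diffb : DifferentiableAt ℝ b l
  nega : deriv a l < 0
  posb : 0 < deriv b l
  cup : CupEq f (a l) (b l)
  DL_neg : DL f (a l) (b l) < 0
  DR_neg : DR f (a l) (b l) < 0

/-- Two linear equations for a' and b'. The explicit a' is recorded because its continuity in the
chord is what makes glued families differentiable. -/
lemma slopes_of_relation {L R a' b' : ℝ} (hL : L < 0) (hR : R < 0) (h1 : b' - a' = 1)
    (h2 : L * a' + R * b' = 0) : a' = -R / (L + R) ∧ a' < 0 ∧ 0 < b' := by
  have hLR : L + R < 0 := by linarith
  have ha : a' = -R / (L + R) := by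
    rw [eq_div_iff hLR.ne]
    have : b' = 1 + a' := by linarith
    subst this
    linarith
  have ha' : a' < 0 := ha ▸ div_neg_of_pos_of_neg (by linarith) hLR
  refine ⟨ha, ha', ?_⟩
  nlinarith

/-- For fixed l > b₀ - a₀ let a chord of length l slide from the position with right end b₀ to the
one with left end a₀. The cup defect grows strictly from negative to positive, so exactly one
position satisfies the cup equation. It depends differentiably on l by the implicit function
theorem, except at the initial length, where a squeeze gives continuity. -/
lemma exists_chords_above {f : ℝ → ℝ} (hf : ContDiff ℝ 2 f) {a₀ b₀ : ℝ} (hab : a₀ < b₀)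
    (hcup : CupEq f a₀ b₀) (hL : DL f a₀ b₀ ≤ 0) (hR : DR f a₀ b₀ ≤ 0)
    (hL0 : DL f a₀ b₀ = 0 → RisesBefore (deriv (deriv f)) a₀)
    (hR0 : DR f a₀ b₀ = 0 → FallsAfter (deriv (deriv f)) b₀) :
    ∃ δ > 0, ∃ a b : ℝ → ℝ, a (b₀ - a₀) = a₀ ∧ b (b₀ - a₀) = b₀ ∧
      ContinuousOn a (Icc (b₀ - a₀) (b₀ - a₀ + δ)) ∧
      ContinuousOn b (Icc (b₀ - a₀) (b₀ - a₀ + δ)) ∧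
      (∀ l, b l - a l = l) ∧
      ∀ l ∈ Ioc (b₀ - a₀) (b₀ - a₀ + δ), InnerChord f a b l := by
  obtain ⟨ρ, hρ, hpos, hneg, hin⟩ := exists_cup_neighbourhood hf hab hcup hL hR hL0 hR0
  set l₀ := b₀ - a₀ with hl₀
  have hl₀0 : 0 < l₀ := sub_pos.2 hab
  have hmono : ∀ l ∈ Ioc l₀ (l₀ + ρ),
      StrictMonoOn (fun a => cupDefect f a (a + l)) (Icc (a₀ - (l - l₀)) a₀) := fun l hl => by
    refine strictMonoOn_of_deriv_pos (convex_Icc _ _)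
      (fun a _ => (hasDerivAt_cupDefect hf l a).continuousAt.continuousWithinAt) fun a ha => ?_
    rw [interior_Icc] at ha
    rw [(hasDerivAt_cupDefect hf l a).deriv]
    have := (hin a ⟨by linarith [ha.1, hl.2], ha.2⟩ (a + l)
      ⟨by linarith [ha.1], by linarith [ha.2, hl.2]⟩).1
    rwa [add_sub_cancel_left] at this
  -- The default a₀ outside the range also provides the prescribed value at l₀.
  have hex : ∀ l, ∃ a, (l ∈ Ioc l₀ (l₀ + ρ) → a ∈ Ioo (a₀ - (l - l₀)) a₀ ∧
      cupDefect f a (a + l) = 0) ∧ (l ∉ Ioc l₀ (l₀ + ρ) → a = a₀) := fun l => by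
    by_cases hl : l ∈ Ioc l₀ (l₀ + ρ)
    · obtain ⟨a, ha, h0⟩ := intermediate_value_Ioo (by linarith [hl.1] : a₀ - (l - l₀) ≤ a₀)
        (fun a _ => (hasDerivAt_cupDefect hf l a).continuousAt.continuousWithinAt)
        (show (0 : ℝ) ∈ Ioo _ _ from ⟨by
          have := hneg (a₀ - (l - l₀)) ⟨by linarith [hl.2], by linarith [hl.1]⟩
          rwa [show a₀ - (l - l₀) + l = b₀ by rw [hl₀]; ring], by
          exact hpos (a₀ + l) ⟨by linarith [hl.1], by linarith [hl.2]⟩⟩)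
      exact ⟨a, fun _ => ⟨ha, h0⟩, fun h => absurd hl h⟩
    · exact ⟨a₀, fun h => absurd h hl, fun _ => rfl⟩
  choose a ha ha' using hex
  have hal₀ : a l₀ = a₀ := ha' l₀ fun h => lt_irrefl _ h.1
  have hdiff : ∀ l ∈ Ioo l₀ (l₀ + ρ), DifferentiableAt ℝ a l := fun l hl => by
    have hl' : l ∈ Ioc l₀ (l₀ + ρ) := ⟨hl.1, hl.2.le⟩
    obtain ⟨hmem, h0⟩ := ha l hl'
    have hd := hasDerivAt_cupDefect hf l (a l)
    have hp := (hin (a l) ⟨by linarith [hmem.1, hl.2], hmem.2⟩ (a l + l)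
      ⟨by linarith [hmem.1], by linarith [hmem.2, hl.2]⟩).1
    rw [add_sub_cancel_left] at hp
    have hC : ContDiff ℝ 1 fun p : ℝ × ℝ => cupDefect f p.2 (p.2 + p.1) := by
      have h1 := contDiff_deriv_datum hf
      have h2 : ContDiff ℝ 1 f := hf.of_le (by norm_num)
      unfold cupDefect
      fun_prop
    obtain ⟨ψ, hψd, hψt, hψ⟩ := exists_differentiable_implicit hC hd hp.ne'
    refine hψd.congr_of_eventuallyEq ?_
    have e1 : ∀ᶠ x in 𝓝 l, ψ x < a₀ := hψt.eventually_lt_const hmem.2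
    have e2 : ∀ᶠ x in 𝓝 l, a₀ - (x - l₀) < ψ x :=
      Tendsto.eventually_lt (Continuous.tendsto (by fun_prop) l) hψt hmem.1
    filter_upwards [hψ, e1, e2, Ioo_mem_nhds hl.1 hl.2] with x h1 h2 h3 h4
    have hx' : x ∈ Ioc l₀ (l₀ + ρ) := ⟨h4.1, h4.2.le⟩
    obtain ⟨hmx, h0x⟩ := ha x hx'
    -- Monotonicity of the defect identifies the selected root with the implicit function near l.
    refine (hmono x hx').injOn (Ioo_subset_Icc_self hmx) ⟨h3.le, h2.le⟩ ?_
    show cupDefect f (a x) (a x + x) = cupDefect f (ψ x) (ψ x + x)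
    rw [h0x, h1, h0]
  have hcont : ContinuousOn a (Icc l₀ (l₀ + ρ / 2)) := fun l hl => by
    rcases hl.1.eq_or_lt with heq | hlt
    · rw [← heq]
      refine ContinuousWithinAt.mono (t := Ico l₀ (l₀ + ρ)) ?_ fun x hx => ⟨hx.1, by linarith [hx.2]⟩
      rw [ContinuousWithinAt, hal₀]
      -- At l₀ the derivative of the defect is not controlled; a(l) is squeezed between a₀ - (l -
      -- l₀) and a₀.
      have hlow : Tendsto (fun l => a₀ - (l - l₀)) (𝓝[Ico l₀ (l₀ + ρ)] l₀) (𝓝 a₀) := by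
        have : Tendsto (fun l => a₀ - (l - l₀)) (𝓝 l₀) (𝓝 (a₀ - (l₀ - l₀))) :=
          Continuous.tendsto (by fun_prop) l₀
        rw [sub_self, sub_zero] at this
        exact this.mono_left nhdsWithin_le_nhds
      refine tendsto_of_tendsto_of_tendsto_of_le_of_le' hlow tendsto_const_nhds ?_ ?_
      · filter_upwards [self_mem_nhdsWithin] with x hx
        rcases hx.1.eq_or_lt with heq' | hlt'
        · rw [← heq', hal₀]; linarith
        · exact (ha x ⟨hlt', hx.2.le⟩).1.1.le
      · filter_upwards [self_mem_nhdsWithin] with x hx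
        rcases hx.1.eq_or_lt with heq' | hlt'
        · rw [← heq', hal₀]
        · exact (ha x ⟨hlt', hx.2.le⟩).1.2.le
    · exact (hdiff l ⟨hlt, by linarith [hl.2]⟩).continuousAt.continuousWithinAt
  refine ⟨ρ / 2, half_pos hρ, a, fun l => a l + l, hal₀,
    by show a l₀ + l₀ = b₀; rw [hal₀, hl₀]; ring, hcont,
    hcont.add continuousOn_id, fun l => by ring, fun l hl => ?_⟩
  have hl' : l ∈ Ioo l₀ (l₀ + ρ) := ⟨hl.1, by linarith [hl.2]⟩
  have hlt0 : ∀ x, l₀ < x → a x < a x + x := fun x hx => by linarith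
  obtain ⟨hmem, h0⟩ := ha l ⟨hl'.1, hl'.2.le⟩
  obtain ⟨hDL, hDR⟩ := (hin (a l) ⟨by linarith [hmem.1, hl'.2], hmem.2⟩ (a l + l)
      ⟨by linarith [hmem.1], by linarith [hmem.2, hl'.2]⟩).2 h0
  have hda := hdiff l hl'
  have hdb : DifferentiableAt ℝ (fun l => a l + l) l := hda.add differentiableAt_id
  have hcupx : ∀ x ∈ Ioo l₀ (l₀ + ρ), CupEq f (a x) (a x + x) := fun x hx =>
    (cupEq_iff hf (hlt0 x hx.1)).2 (ha x ⟨hx.1, hx.2.le⟩).2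
  obtain ⟨h1, h2⟩ := cup_deriv_relation hf (hl₀0.trans hl.1) (b := fun l => a l + l)
    (Eventually.of_forall fun x => by ring)
    (mem_of_superset (Ioo_mem_nhds hl'.1 hl'.2) hcupx) hda.hasDerivAt hdb.hasDerivAt
  obtain ⟨-, h3, h4⟩ := slopes_of_relation hDL hDR h1 h2
  exact ⟨hda, hdb, h3, h4, hcupx l hl', hDL, hDR⟩

/-- Each one-sided derivative is the limit of derivatives from that side. It serves at the length
where two families of chords are joined. -/
lemma hasDerivAt_of_eventually_punctured {u v : ℝ → ℝ} {x : ℝ}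
    (h : ∀ᶠ y in 𝓝[≠] x, HasDerivAt u (v y) y) (hu : ContinuousAt u x) (hv : ContinuousAt v x) :
    HasDerivAt u (v x) x := by
  have key : ∀ s : Set ℝ, s ⊆ {x}ᶜ → Tendsto (fun y => deriv u y) (𝓝[s] x) (𝓝 (v x)) :=
    fun s hs => ((hv.mono_left nhdsWithin_le_nhds : Tendsto v (𝓝[s] x) (𝓝 (v x)))).congr'
      ((h.filter_mono (nhdsWithin_mono x hs)).mono fun y hy => hy.deriv.symm)
  have hd : ∀ y ∈ {y | HasDerivAt u (v y) y}, DifferentiableWithinAt ℝ u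
      {y | HasDerivAt u (v y) y} y := fun y hy => (hy : HasDerivAt u _ y).differentiableAt.differentiableWithinAt
  have h1 : HasDerivWithinAt u (v x) (Ici x) x :=
    hasDerivWithinAt_Ici_of_tendsto_deriv hd hu.continuousWithinAt
      (h.filter_mono (nhdsWithin_mono x fun y (hy : x < y) => hy.ne')) (key _ fun y hy => (ne_of_gt hy))
  have h2 : HasDerivWithinAt u (v x) (Iic x) x :=
    hasDerivWithinAt_Iic_of_tendsto_deriv hd hu.continuousWithinAt
      (h.filter_mono (nhdsWithin_mono x fun y (hy : y < x) => hy.ne)) (key _ fun y hy => (ne_of_lt hy))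
  simpa using h2.union h1

lemma ContinuousAt.av_deriv2 {f : ℝ → ℝ} (hf : ContDiff ℝ 2 f) {a b : ℝ → ℝ} {l : ℝ}
    (ha : ContinuousAt a l) (hb : ContinuousAt b l) (hab : a l < b l) :
    ContinuousAt (fun x => av (deriv (deriv f)) (a x) (b x)) l := by
  have hc := (contDiff_deriv_datum hf).continuous
  have h1 : ContinuousAt (fun x => (deriv f (b x) - deriv f (a x)) / (b x - a x)) l :=
    ((hc.continuousAt.comp hb).sub (hc.continuousAt.comp ha)).div (hb.sub ha) (sub_pos.2 hab).ne'
  refine h1.congr ?_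
  filter_upwards [ha.eventually_lt hb hab] with x hx
  rw [BellmanFoliation.av_deriv (contDiff_deriv_datum hf) hx]

/-- A chordal domain whose upper chord has non-zero differentials can be continued upwards. -/
lemma exists_chordal_extension {f : ℝ → ℝ} (hf : ContDiff ℝ 2 f) {d₀ : ChordalDomain}
    (hd₀ : d₀.Admissible f) (hDL : DL f (d₀.a d₀.top) (d₀.b d₀.top) < 0)
    (hDR : DR f (d₀.a d₀.top) (d₀.b d₀.top) < 0) :
    ∃ δ > 0, ∃ a b : ℝ → ℝ, EqOn a d₀.a (Iic d₀.top) ∧ EqOn b d₀.b (Iic d₀.top) ∧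
      ContinuousOn a (Icc d₀.bot (d₀.top + δ)) ∧ ContinuousOn b (Icc d₀.bot (d₀.top + δ)) ∧
      (∀ l ∈ Icc d₀.bot (d₀.top + δ), b l - a l = l) ∧
      (∀ l ∈ Ioc d₀.bot (d₀.top + δ), InnerChord f a b l) := by
  obtain ⟨h0, hlt, hca, hcb, hlen, hdiff, hcup, hneg⟩ := hd₀
  set t := d₀.top with ht
  have mt : t ∈ Icc d₀.bot t := right_mem_Icc.2 hlt.le
  have ht0 : 0 < t := h0.trans_lt hlt
  have hlt_t : d₀.a t < d₀.b t := by linarith [hlen t mt]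
  -- Both differentials of the upper chord are non-zero, so the requirements on a rise or a fall of
  -- f'' are void.
  obtain ⟨δ, hδ, a₁, b₁, ha₁, hb₁, hca₁, hcb₁, hlen₁, hin₁⟩ := exists_chords_above hf hlt_t
    (hcup t mt).1 hDL.le hDR.le (fun h => absurd h hDL.ne) (fun h => absurd h hDR.ne)
  rw [hlen t mt] at ha₁ hb₁ hca₁ hcb₁ hin₁
  classical
  set a : ℝ → ℝ := fun l => if l ≤ t then d₀.a l else a₁ l with ha
  set b : ℝ → ℝ := fun l => if l ≤ t then d₀.b l else b₁ l with hb
  have hale : ∀ l ≤ t, a l = d₀.a l := fun l hl => if_pos hl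
  have hble : ∀ l ≤ t, b l = d₀.b l := fun l hl => if_pos hl
  have hage : ∀ l, t ≤ l → a l = a₁ l := fun l hl => by
    rcases hl.eq_or_lt with rfl | h
    · rw [hale _ le_rfl, ha₁]
    · exact if_neg h.not_ge
  have hbge : ∀ l, t ≤ l → b l = b₁ l := fun l hl => by
    rcases hl.eq_or_lt with rfl | h
    · rw [hble _ le_rfl, hb₁]
    · exact if_neg h.not_ge
  have hunion : Icc d₀.bot (t + δ) = Icc d₀.bot t ∪ Icc t (t + δ) :=
    (Icc_union_Icc_eq_Icc hlt.le (by linarith)).symm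
  have hcont_a : ContinuousOn a (Icc d₀.bot (t + δ)) := by
    rw [hunion]
    exact (hca.congr fun l hl => hale l hl.2).union_of_isClosed (hca₁.congr fun l hl => hage l hl.1)
      isClosed_Icc isClosed_Icc
  have hcont_b : ContinuousOn b (Icc d₀.bot (t + δ)) := by
    rw [hunion]
    exact (hcb.congr fun l hl => hble l hl.2).union_of_isClosed (hcb₁.congr fun l hl => hbge l hl.1)
      isClosed_Icc isClosed_Icc
  have hlen' : ∀ l ∈ Icc d₀.bot (t + δ), b l - a l = l := fun l hl => by
    rcases le_total l t with h | h
    · rw [hale l h, hble l h, hlen l ⟨hl.1, h⟩]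
    · rw [hage l h, hbge l h, hlen₁]
  have hev_lt : ∀ l < t, a =ᶠ[𝓝 l] d₀.a ∧ b =ᶠ[𝓝 l] d₀.b := fun l hl =>
    ⟨(eventually_lt_nhds hl).mono fun x hx => hale x hx.le,
      (eventually_lt_nhds hl).mono fun x hx => hble x hx.le⟩
  have hev_gt : ∀ l, t < l → a =ᶠ[𝓝 l] a₁ ∧ b =ᶠ[𝓝 l] b₁ := fun l hl =>
    ⟨(eventually_gt_nhds hl).mono fun x hx => hage x (le_of_lt hx),
      (eventually_gt_nhds hl).mono fun x hx => hbge x (le_of_lt hx)⟩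
  have hoff : ∀ l ∈ Ioc d₀.bot (t + δ), l ≠ t → InnerChord f a b l := fun l hl hne => by
    rcases lt_or_gt_of_ne hne with h | h
    · obtain ⟨e1, e2⟩ := hev_lt l h
      have hl' : l ∈ Ioo d₀.bot t := ⟨hl.1, h⟩
      obtain ⟨da, db, h1, h2⟩ := hdiff l hl'
      refine ⟨da.congr_of_eventuallyEq e1, db.congr_of_eventuallyEq e2, by rwa [e1.deriv_eq],
        by rwa [e2.deriv_eq], ?_, ?_, ?_⟩ <;> rw [hale l h.le, hble l h.le]
      · exact (hcup l (Ioo_subset_Icc_self hl')).1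
      · exact (hneg l hl').1
      · exact (hneg l hl').2
    · obtain ⟨e1, e2⟩ := hev_gt l h
      have h1 := hin₁ l ⟨h, hl.2⟩
      refine ⟨h1.diffa.congr_of_eventuallyEq e1, h1.diffb.congr_of_eventuallyEq e2, ?_,
        ?_, ?_, ?_, ?_⟩
      · rw [e1.deriv_eq]; exact h1.nega
      · rw [e2.deriv_eq]; exact h1.posb
      · rw [hage l h.le, hbge l h.le]; exact h1.cup
      · rw [hage l h.le, hbge l h.le]; exact h1.DL_neg
      · rw [hage l h.le, hbge l h.le]; exact h1.DR_neg
  have hcup' : ∀ l ∈ Ioc d₀.bot (t + δ), CupEq f (a l) (b l) := fun l hl => by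
    rcases eq_or_ne l t with rfl | hne
    · rw [hale _ le_rfl, hble _ le_rfl]; exact (hcup _ mt).1
    · exact (hoff l hl hne).cup
  have htn : Ioo d₀.bot (t + δ) ∈ 𝓝 t := Ioo_mem_nhds hlt (by linarith)
  have hIcc : Icc d₀.bot (t + δ) ∈ 𝓝 t := mem_of_superset htn Ioo_subset_Icc_self
  have hat : ContinuousAt a t := hcont_a.continuousAt hIcc
  have hbt : ContinuousAt b t := hcont_b.continuousAt hIcc
  have hDLt : DL f (a t) (b t) < 0 := by rwa [hale _ le_rfl, hble _ le_rfl]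
  have hDRt : DR f (a t) (b t) < 0 := by rwa [hale _ le_rfl, hble _ le_rfl]
  have hg := continuous_deriv2_datum hf
  have hcav := ContinuousAt.av_deriv2 hf hat hbt (by rw [hale _ le_rfl, hble _ le_rfl]; exact hlt_t)
  have hcDL : ContinuousAt (fun l => DL f (a l) (b l)) t := (hg.continuousAt.comp hat).sub hcav
  have hcDR : ContinuousAt (fun l => DR f (a l) (b l)) t := (hg.continuousAt.comp hbt).sub hcav
  -- Away from the junction the cup relation forces a' to equal this function of the chord; being
  -- continuous at t, it is the derivative there too, so the two families join smoothly.
  have hslope : ContinuousAt (fun l => -DR f (a l) (b l) / (DL f (a l) (b l) + DR f (a l) (b l))) t :=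
    hcDR.neg.div (hcDL.add hcDR) (by linarith)
  have hrel : ∀ l ∈ Ioo d₀.bot (t + δ), ∀ a' b', HasDerivAt a a' l → HasDerivAt b b' l →
      b' - a' = 1 ∧ DL f (a l) (b l) * a' + DR f (a l) (b l) * b' = 0 := fun l hl a' b' da db =>
    cup_deriv_relation hf (h0.trans_lt hl.1)
      (mem_of_superset (Ioo_mem_nhds hl.1 hl.2) fun x hx => hlen' x (Ioo_subset_Icc_self hx))
      (mem_of_superset (Ioo_mem_nhds hl.1 hl.2) fun x hx => hcup' x ⟨hx.1, hx.2.le⟩) da db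
  have hda : HasDerivAt a (-DR f (a t) (b t) / (DL f (a t) (b t) + DR f (a t) (b t))) t := by
    refine hasDerivAt_of_eventually_punctured
      (v := fun l => -DR f (a l) (b l) / (DL f (a l) (b l) + DR f (a l) (b l))) ?_ hat hslope
    filter_upwards [nhdsWithin_le_nhds htn, self_mem_nhdsWithin] with l hl hne
    have h1 := hoff l ⟨hl.1, hl.2.le⟩ hne
    obtain ⟨h2, h3⟩ := hrel l hl _ _ h1.diffa.hasDerivAt h1.diffb.hasDerivAt
    rw [← (slopes_of_relation h1.DL_neg h1.DR_neg h2 h3).1]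
    exact h1.diffa.hasDerivAt
  have hdb : DifferentiableAt ℝ b t := by
    have : b =ᶠ[𝓝 t] fun l => a l + l :=
      mem_of_superset hIcc fun l hl => by
        have := hlen' l hl
        show b l = a l + l
        linarith
    exact (hda.differentiableAt.add differentiableAt_id).congr_of_eventuallyEq this
  refine ⟨δ, hδ, a, b, fun l hl => hale l hl, fun l hl => hble l hl, hcont_a, hcont_b, hlen',
    fun l hl => ?_⟩
  rcases eq_or_ne l t with rfl | hne
  · obtain ⟨h2, h3⟩ := hrel _ (mem_of_mem_nhds htn) _ _ hda.differentiableAt.hasDerivAt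
      hdb.hasDerivAt
    obtain ⟨-, h4, h5⟩ := slopes_of_relation hDLt hDRt h2 h3
    exact ⟨hda.differentiableAt, hdb, h4, h5, hcup' _ hl, hDLt, hDRt⟩
  · exact hoff l hl hne

lemma admissible_of_innerChord {f : ℝ → ℝ} {d : ChordalDomain} (h0 : 0 ≤ d.bot) (hlt : d.bot < d.top)
    (ha : ContinuousOn d.a (Icc d.bot d.top)) (hb : ContinuousOn d.b (Icc d.bot d.top))
    (hlen : ∀ l ∈ Icc d.bot d.top, d.b l - d.a l = l)
    (hbot : CupEq f (d.a d.bot) (d.b d.bot) ∧ DL f (d.a d.bot) (d.b d.bot) ≤ 0 ∧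
      DR f (d.a d.bot) (d.b d.bot) ≤ 0)
    (hin : ∀ l ∈ Ioc d.bot d.top, InnerChord f d.a d.b l) : d.Admissible f := by
  refine ⟨h0, hlt, ha, hb, hlen, fun l hl => ?_, fun l hl => ?_, fun l hl => ?_⟩
  · have h := hin l ⟨hl.1, hl.2.le⟩
    exact ⟨h.diffa, h.diffb, h.nega, h.posb⟩
  · rcases hl.1.eq_or_lt with heq | hlt'
    · rw [← heq]; exact hbot
    · have h := hin l ⟨hlt', hl.2⟩
      exact ⟨h.cup, h.DL_neg.le, h.DR_neg.le⟩
  · have h := hin l ⟨hl.1, hl.2.le⟩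
    exact ⟨h.DL_neg, h.DR_neg⟩

/-! ### Piecewise monotone functions -/

lemma monotoneOn_Icc_of_Ioo {g : ℝ → ℝ} (hg : Continuous g) {a b : ℝ} (h : MonotoneOn g (Ioo a b)) :
    MonotoneOn g (Icc a b) := by
  rcases lt_or_ge a b with hab | hab
  · intro x hx y hy hxy
    rcases hxy.eq_or_lt with rfl | hlt
    · exact le_rfl
    have hx' : Tendsto g (𝓝[>] x) (𝓝 (g x)) := hg.continuousAt.mono_left nhdsWithin_le_nhds
    have hy' : Tendsto g (𝓝[<] y) (𝓝 (g y)) := hg.continuousAt.mono_left nhdsWithin_le_nhds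
    obtain ⟨m, hm⟩ := exists_between hlt
    have h1 : g x ≤ g m := le_of_tendsto hx' (by
      filter_upwards [Ioo_mem_nhdsGT hm.1] with z hz
      exact h ⟨hx.1.trans_lt hz.1, hz.2.trans (hm.2.trans_le hy.2)⟩
        ⟨hx.1.trans_lt hm.1, hm.2.trans_le hy.2⟩ hz.2.le)
    have h2 : g m ≤ g y := ge_of_tendsto hy' (by
      filter_upwards [Ioo_mem_nhdsLT hm.2] with z hz
      exact h ⟨hx.1.trans_lt hm.1, hm.2.trans_le hy.2⟩
        ⟨hx.1.trans_lt (hm.1.trans hz.1), hz.2.trans_le hy.2⟩ hz.1.le)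
    exact h1.trans h2
  · exact (Set.subsingleton_Icc_of_ge hab).monotoneOn g

lemma antitoneOn_Icc_of_Ioo {g : ℝ → ℝ} (hg : Continuous g) {a b : ℝ} (h : AntitoneOn g (Ioo a b)) :
    AntitoneOn g (Icc a b) := by
  have := monotoneOn_Icc_of_Ioo hg.neg (a := a) (b := b)
    (fun x hx y hy hxy => neg_le_neg (h hx hy hxy))
  exact fun x hx y hy hxy => neg_le_neg_iff.1 (this hx hy hxy)

lemma RegularDatum.monotoneOn_or {f : ℝ → ℝ} (h : RegularDatum f) :
    ∃ S : Finset ℝ, ∀ a b, Disjoint (Ioo a b) (S : Set ℝ) →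
      MonotoneOn (deriv (deriv f)) (Icc a b) ∨ AntitoneOn (deriv (deriv f)) (Icc a b) := by
  obtain ⟨hf, S, hS⟩ := h
  have hg := continuous_deriv2_datum hf
  exact ⟨S, fun a b hd => (hS _ ordConnected_Ioo hd).imp (monotoneOn_Icc_of_Ioo hg)
    (antitoneOn_Icc_of_Ioo hg)⟩

lemma RegularDatum.locallyMonotone {f : ℝ → ℝ} (h : RegularDatum f) :
    LocallyMonotone (deriv (deriv f)) := by
  obtain ⟨S, hS⟩ := h.monotoneOn_or
  intro x
  have hopen : ((S : Set ℝ) \ {x})ᶜ ∈ 𝓝 x :=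
    (S.finite_toSet.sdiff (t := {x})).isClosed.isOpen_compl.mem_nhds (by simp)
  obtain ⟨δ, hδ, hb⟩ := Metric.mem_nhds_iff.1 hopen
  refine ⟨δ, hδ, hS _ _ ?_, hS _ _ ?_⟩
  · refine Set.disjoint_left.2 fun z hz hzS => ?_
    have h1 : z ∈ Metric.ball x δ := by
      rw [Metric.mem_ball, Real.dist_eq, abs_of_pos (by linarith [hz.1])]
      linarith [hz.2]
    exact hb h1 ⟨hzS, hz.1.ne'⟩
  · refine Set.disjoint_left.2 fun z hz hzS => ?_
    have h1 : z ∈ Metric.ball x δ := by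
      rw [Metric.mem_ball, Real.dist_eq, abs_of_neg (by linarith [hz.2])]
      linarith [hz.1]
    exact hb h1 ⟨hzS, hz.2.ne⟩

lemma boundedVariationOn_Icc_of_monotone {g : ℝ → ℝ} {a b : ℝ}
    (h : MonotoneOn g (Icc a b) ∨ AntitoneOn g (Icc a b)) : BoundedVariationOn g (Icc a b) := by
  rcases le_or_gt a b with hab | hab
  · have h1 : LocallyBoundedVariationOn g (Icc a b) := by
      rcases h with h | h
      · exact h.locallyBoundedVariationOn
      · have h2 : LocallyBoundedVariationOn (fun x => -g x) (Icc a b) :=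
          MonotoneOn.locallyBoundedVariationOn fun x hx y hy hxy => neg_le_neg (h hx hy hxy)
        have h3 := LipschitzWith.comp_locallyBoundedVariationOn (f := fun x : ℝ => -x) (C := 1)
          (LipschitzWith.of_dist_le_mul fun x y => by simp [dist_neg_neg]) h2
        simpa [Function.comp_def] using h3
    simpa using h1 a b (left_mem_Icc.2 hab) (right_mem_Icc.2 hab)
  · rw [Icc_eq_empty hab.not_ge]
    simp [BoundedVariationOn, eVariationOn.subsingleton]

/-- Induction on the number of break points inside the interval: splitting at one of them leaves
fewer on either side. -/
lemma RegularDatum.locallyBoundedVariationOn {f : ℝ → ℝ} (h : RegularDatum f) :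
    LocallyBoundedVariationOn (deriv (deriv f)) univ := by
  classical
  obtain ⟨S, hS⟩ := h.monotoneOn_or
  set g := deriv (deriv f) with hg
  have key : ∀ n : ℕ, ∀ a b : ℝ, (S.filter fun s => s ∈ Ioo a b).card = n →
      BoundedVariationOn g (Icc a b) := fun n => by
    induction n using Nat.strong_induction_on with
    | _ n ih =>
      intro a b hn
      by_cases hex : ∃ s ∈ S, s ∈ Ioo a b
      · obtain ⟨s, hsS, hs⟩ := hex
        have hmem : s ∈ S.filter fun s => s ∈ Ioo a b := Finset.mem_filter.2 ⟨hsS, hs⟩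
        have h1 : (S.filter fun t => t ∈ Ioo a s).card < n := by
          rw [← hn]
          refine Finset.card_lt_card (Finset.ssubset_iff_of_subset ?_ |>.2 ⟨s, hmem, by simp⟩)
          exact fun t ht => by
            obtain ⟨h1, h2, h3⟩ := Finset.mem_filter.1 ht
            exact Finset.mem_filter.2 ⟨h1, h2, h3.trans hs.2⟩
        have h2 : (S.filter fun t => t ∈ Ioo s b).card < n := by
          rw [← hn]
          refine Finset.card_lt_card (Finset.ssubset_iff_of_subset ?_ |>.2 ⟨s, hmem, by simp⟩)
          exact fun t ht => by
            obtain ⟨h1, h2, h3⟩ := Finset.mem_filter.1 ht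
            exact Finset.mem_filter.2 ⟨h1, hs.1.trans h2, h3⟩
        have h3 := eVariationOn.Icc_add_Icc g (s := univ) hs.1.le hs.2.le (mem_univ s)
        simp only [univ_inter] at h3
        rw [BoundedVariationOn, ← h3]
        exact ENNReal.add_ne_top.2 ⟨ih _ h1 a s rfl, ih _ h2 s b rfl⟩
      · refine boundedVariationOn_Icc_of_monotone (hS a b ?_)
        exact Set.disjoint_left.2 fun z hz hzS => hex ⟨z, hzS, hz⟩
  intro a b _ _
  rw [univ_inter]
  exact key _ a b rfl

/-! ### Integration by parts -/

/-- Fubini for φ'(s) on the triangle t ≤ s, with respect to dS(t) ds: one order of integration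
produces φ u - φ t, the other S s - S b. -/
lemma StieltjesFunction_integral_by_parts (S : StieltjesFunction ℝ) {φ φ' : ℝ → ℝ}
    (hφ : ∀ x, HasDerivAt φ (φ' x) x) (hφ' : Continuous φ') {b u : ℝ} (hbu : b ≤ u) :
    ∫ t in Ioc b u, φ t ∂S.measure = φ u * S u - φ b * S b - ∫ t in b..u, φ' t * S t := by
  have hSint : ∀ x y : ℝ, IntervalIntegrable (fun t => φ' t * S t) volume x y := fun x y =>
    (S.mono.intervalIntegrable).continuousOn_mul hφ'.continuousOn
  set μ := S.measure.restrict (Ioc b u) with hμ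
  set ν := (volume : Measure ℝ).restrict (Ioc b u) with hν
  have hfin : IsFiniteMeasure μ := ⟨by
    rw [hμ, Measure.restrict_apply_univ, StieltjesFunction.measure_Ioc]
    exact ENNReal.ofReal_lt_top⟩
  have hφc : Continuous φ := continuous_iff_continuousAt.2 fun x => (hφ x).continuousAt
  have hν' : Integrable φ' ν := (hφ'.integrableOn_Icc).mono_set Ioc_subset_Icc_self
  have hprod : Integrable (Function.uncurry fun t s : ℝ => if t ≤ s then φ' s else 0)
      (μ.prod ν) := by
    have h1 : Integrable (fun p : ℝ × ℝ => φ' p.2) (μ.prod ν) := hν'.comp_snd μ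
    have h2 := h1.indicator (measurableSet_le measurable_fst measurable_snd)
    refine h2.congr (Eventually.of_forall fun p => ?_)
    simp only [Function.uncurry, indicator, mem_ofPred_eq]
  have hswap := integral_integral_swap hprod
  have hL : ∫ t, ∫ s, (if t ≤ s then φ' s else 0) ∂ν ∂μ = ∫ t, (φ u - φ t) ∂μ := by
    rw [hμ]
    refine setIntegral_congr_fun measurableSet_Ioc fun t ht => ?_
    have h1 : ∫ s, (if t ≤ s then φ' s else 0) ∂ν = ∫ s in Icc t u, φ' s := by
      rw [hν, ← integral_indicator measurableSet_Ioc, ← integral_indicator measurableSet_Icc]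
      congr 1
      funext s
      by_cases h2 : s ∈ Icc t u
      · rw [indicator_of_mem h2, indicator_of_mem (show s ∈ Ioc b u from ⟨ht.1.trans_le h2.1, h2.2⟩),
          if_pos h2.1]
      · rw [indicator_of_notMem h2]
        by_cases h3 : s ∈ Ioc b u
        · rw [indicator_of_mem h3, if_neg fun h4 => h2 ⟨h4, h3.2⟩]
        · rw [indicator_of_notMem h3]
    rw [h1, integral_Icc_eq_integral_Ioc, ← intervalIntegral.integral_of_le ht.2,
      intervalIntegral.integral_eq_sub_of_hasDerivAt (fun x _ => hφ x) (hφ'.intervalIntegrable _ _)]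
  have hR : ∫ s, ∫ t, (if t ≤ s then φ' s else 0) ∂μ ∂ν = ∫ s in b..u, φ' s * (S s - S b) := by
    rw [intervalIntegral.integral_of_le hbu, hν]
    refine setIntegral_congr_fun measurableSet_Ioc fun s hs => ?_
    have h1 : ∫ t, (if t ≤ s then φ' s else 0) ∂μ = ∫ t in Ioc b s, φ' s ∂S.measure := by
      rw [hμ, ← integral_indicator measurableSet_Ioc, ← integral_indicator measurableSet_Ioc]
      congr 1
      funext t
      by_cases h2 : t ∈ Ioc b s
      · rw [indicator_of_mem h2, indicator_of_mem (show t ∈ Ioc b u from ⟨h2.1, h2.2.trans hs.2⟩),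
          if_pos h2.2]
      · rw [indicator_of_notMem h2]
        by_cases h3 : t ∈ Ioc b u
        · rw [indicator_of_mem h3, if_neg fun h4 => h2 ⟨h3.1, h4⟩]
        · rw [indicator_of_notMem h3]
    rw [h1, setIntegral_const, Measure.real, StieltjesFunction.measure_Ioc,
      ENNReal.toReal_ofReal (sub_nonneg.2 (S.mono hs.1.le)), smul_eq_mul, mul_comm]
  rw [hL, hR] at hswap
  have hφi : Integrable φ μ := by
    have h1 : IntegrableOn φ (Icc b u) S.measure :=
      hφc.continuousOn.integrableOn_compact isCompact_Icc
    exact h1.mono_set Ioc_subset_Icc_self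
  rw [integral_sub (integrable_const _) hφi, integral_const, Measure.real, hμ,
    Measure.restrict_apply_univ, StieltjesFunction.measure_Ioc,
    ENNReal.toReal_ofReal (sub_nonneg.2 (S.mono hbu)), smul_eq_mul] at hswap
  have h5 : ∫ s in b..u, φ' s * (S s - S b) = (∫ s in b..u, φ' s * S s) - (φ u - φ b) * S b := by
    simp only [mul_sub]
    rw [intervalIntegral.integral_sub (hSint _ _)
      ((by fun_prop : Continuous fun s => φ' s * S b).intervalIntegrable _ _), intervalIntegral.integral_mul_const,
      intervalIntegral.integral_eq_sub_of_hasDerivAt (fun x _ => hφ x) (hφ'.intervalIntegrable _ _)]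
  rw [h5] at hswap
  linarith

/-- The Stieltjes functions are right limits of V and of V - g. Since g is continuous they still
differ by exactly g, and continuity of V need not be discussed. -/
lemma rightLim_var_sub {g : ℝ → ℝ} (hg : Continuous g) (h : LocallyBoundedVariationOn g univ)
    (x : ℝ) : (monotone_var h).stieltjesFunction x - (monotone_var_sub h).stieltjesFunction x =
      g x := by
  rw [Monotone.stieltjesFunction_eq, Monotone.stieltjesFunction_eq]
  have h1 := (monotone_var h).tendsto_rightLim x
  have h2 := (monotone_var_sub h).tendsto_rightLim x
  have h3 : Tendsto (variationOnFromTo g univ 0 - g) (𝓝[>] x)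
      (𝓝 (Function.rightLim (variationOnFromTo g univ 0) x - g x)) :=
    h1.sub (hg.continuousAt.mono_left nhdsWithin_le_nhds)
  rw [tendsto_nhds_unique h2 h3]
  ring

lemma intd_by_parts {g : ℝ → ℝ} (hg : Continuous g) (h : LocallyBoundedVariationOn g univ)
    {φ φ' : ℝ → ℝ} (hφ : ∀ x, HasDerivAt φ (φ' x) x) (hφ' : Continuous φ') {b u : ℝ} (hbu : b ≤ u) :
    intd g φ (Ioc b u) = φ u * g u - φ b * g b - ∫ t in b..u, φ' t * g t := by
  rw [intd, totalVar, defectVar, dif_pos h, dif_pos h,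
    StieltjesFunction_integral_by_parts _ hφ hφ' hbu, StieltjesFunction_integral_by_parts _ hφ hφ' hbu]
  have hint : ∀ S : StieltjesFunction ℝ, IntervalIntegrable (fun t => φ' t * S t) volume b u :=
    fun S => (S.mono.intervalIntegrable).continuousOn_mul hφ'.continuousOn
  have h1 : ∫ t in b..u, φ' t * g t = (∫ t in b..u, φ' t * (monotone_var h).stieltjesFunction t) -
      ∫ t in b..u, φ' t * (monotone_var_sub h).stieltjesFunction t := by
    rw [← intervalIntegral.integral_sub (hint _) (hint _)]
    refine intervalIntegral.integral_congr fun t _ => ?_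
    simp only [← mul_sub, rightLim_var_sub hg h t]
  rw [h1, ← rightLim_var_sub hg h u, ← rightLim_var_sub hg h b]
  ring

lemma monotone_var_add {g : ℝ → ℝ} (h : LocallyBoundedVariationOn g univ) :
    Monotone (variationOnFromTo g univ 0 + g) := fun x y hxy => by
  have h1 := variationOnFromTo.add h (mem_univ 0) (mem_univ x) (mem_univ y)
  have h2 : |g x - g y| ≤ variationOnFromTo g univ x y := by
    rw [variationOnFromTo.eq_of_le g univ hxy, ← Real.dist_eq, dist_edist]
    exact ENNReal.toReal_mono (h x y (mem_univ _) (mem_univ _))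
      (eVariationOn.edist_le g ⟨mem_univ _, le_rfl, hxy⟩ ⟨mem_univ _, hxy, le_rfl⟩)
  simp only [Pi.add_apply]
  linarith [(abs_le.1 h2).2]

/-- 2V is the sum of V - g and V + g, both non-decreasing; hence d(V - g) ≤ 2 dV, and whatever is
integrable against the variation is integrable against both parts of dg. -/
lemma defectVar_le {g : ℝ → ℝ} (hg : Continuous g) : defectVar g ≤ (2 : NNReal) • totalVar g := by
  by_cases h : LocallyBoundedVariationOn g univ
  · rw [totalVar, defectVar, dif_pos h, dif_pos h, ← StieltjesFunction.measure_smul]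
    have : (2 : NNReal) • (monotone_var h).stieltjesFunction =
        (monotone_var_sub h).stieltjesFunction + (monotone_var_add h).stieltjesFunction := by
      ext x
      have h1 := rightLim_var_sub hg h x
      have h2 := (monotone_var h).tendsto_rightLim x
      have h3 := (monotone_var_add h).tendsto_rightLim x
      have h4 : Tendsto (variationOnFromTo g univ 0 + g) (𝓝[>] x)
          (𝓝 (Function.rightLim (variationOnFromTo g univ 0) x + g x)) :=
        h2.add (hg.continuousAt.mono_left nhdsWithin_le_nhds)
      have h5 := tendsto_nhds_unique h3 h4
      rw [StieltjesFunction.add_apply, (monotone_var_add h).stieltjesFunction_eq, h5]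
      rw [(monotone_var h).stieltjesFunction_eq] at h1
      show (2 : ℝ) * (monotone_var h).stieltjesFunction x = _
      rw [(monotone_var h).stieltjesFunction_eq]
      linarith
    rw [this, StieltjesFunction.measure_add]
    exact Measure.le_add_right le_rfl
  · rw [totalVar, defectVar, dif_neg h, dif_neg h]
    simp

/-! ### Functions of exponential growth and the solutions coming from infinity -/

/-- `|h t| ≤ C e^{κ |t|}`. -/
def ExpBound (κ : ℝ) (h : ℝ → ℝ) : Prop := ∃ C, ∀ t, |h t| ≤ C * Real.exp (κ * |t|)

lemma ExpBound.comp_neg {κ : ℝ} {h : ℝ → ℝ} (hb : ExpBound κ h) : ExpBound κ fun t => h (-t) := by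
  obtain ⟨C, hC⟩ := hb
  exact ⟨C, fun t => by simpa using hC (-t)⟩

lemma ExpBound.mono {κ κ' : ℝ} {h : ℝ → ℝ} (hb : ExpBound κ h) (hκ : κ ≤ κ') : ExpBound κ' h := by
  obtain ⟨C, hC⟩ := hb
  have hC0 : 0 ≤ C := by simpa using (abs_nonneg _).trans (hC 0)
  refine ⟨C, fun t => (hC t).trans ?_⟩
  gcongr

lemma ExpBound.bound_Iic {κ ε : ℝ} {h : ℝ → ℝ} (hκ : 0 ≤ κ) (hb : ExpBound κ h) (z : ℝ) :
    ∃ C, 0 ≤ C ∧ ∀ t ≤ z, |Real.exp (t / ε) * h t| ≤ C * Real.exp ((1 / ε - κ) * t) := by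
  obtain ⟨C, hC⟩ := hb
  have hC0 : 0 ≤ C := by simpa using (abs_nonneg _).trans (hC 0)
  refine ⟨C * Real.exp (κ * (2 * |z|)), by positivity, fun t ht => ?_⟩
  rw [abs_mul, abs_of_pos (Real.exp_pos _)]
  -- On the half-line t ≤ z this turns the two-sided bound into a multiple of e^{(1/ε - κ)t}, which
  -- decays at -∞ when κ < 1/ε.
  have h1 : |t| ≤ 2 * |z| - t := by
    rcases abs_cases t with h | h <;> rcases abs_cases z with h' | h' <;> linarith
  calc Real.exp (t / ε) * |h t| ≤ Real.exp (t / ε) * (C * Real.exp (κ * (2 * |z| - t))) := by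
        gcongr
        exact (hC t).trans (by gcongr)
    _ = C * Real.exp (κ * (2 * |z|)) * Real.exp ((1 / ε - κ) * t) := by
        rw [mul_left_comm, mul_assoc, ← Real.exp_add, ← Real.exp_add]
        congr 2
        ring

lemma ExpBound.integrableOn {κ ε : ℝ} {h : ℝ → ℝ} (hκ : 0 ≤ κ) (hε : κ < 1 / ε) (hb : ExpBound κ h)
    (hc : Continuous h) (z : ℝ) : IntegrableOn (fun t => Real.exp (t / ε) * h t) (Iic z) := by
  obtain ⟨C, -, hC⟩ := hb.bound_Iic (ε := ε) hκ z
  refine Integrable.mono' ((integrableOn_exp_mul_Iic (sub_pos.2 hε) z).const_mul C)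
    (by fun_prop : Continuous fun t => Real.exp (t / ε) * h t).aestronglyMeasurable ?_
  exact (ae_restrict_iff' measurableSet_Iic).2 (Eventually.of_forall fun t ht => hC t ht)

lemma ExpBound.tendsto_atBot {κ ε : ℝ} {h : ℝ → ℝ} (hκ : 0 ≤ κ) (hε : κ < 1 / ε)
    (hb : ExpBound κ h) : Tendsto (fun t => Real.exp (t / ε) * h t) atBot (𝓝 0) := by
  obtain ⟨C, -, hC⟩ := hb.bound_Iic (ε := ε) hκ 0
  have h1 : Tendsto (fun t => C * Real.exp ((1 / ε - κ) * t)) atBot (𝓝 (C * 0)) :=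
    (Real.tendsto_exp_atBot.comp
      (tendsto_id.const_mul_atBot (sub_pos.2 hε))).const_mul C
  rw [mul_zero] at h1
  exact squeeze_zero_norm' ((eventually_le_atBot 0).mono fun t ht => hC t ht) h1

lemma tendsto_integral_Iic_atBot {h : ℝ → ℝ} {x : ℝ} (hi : IntegrableOn h (Iic x)) :
    Tendsto (fun z => ∫ t in Iic z, h t) atBot (𝓝 0) := by
  have h1 := intervalIntegral_tendsto_integral_Iic x hi tendsto_id
  have h2 : Tendsto (fun z => (∫ t in Iic x, h t) - ∫ t in z..x, h t) atBot (𝓝 0) := by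
    have := (tendsto_const_nhds (x := ∫ t in Iic x, h t)).sub h1
    simpa using this
  refine h2.congr' ((eventually_le_atBot x).mono fun z hz => ?_)
  rw [← intervalIntegral.integral_Iic_sub_Iic (hi.mono_set (Iic_subset_Iic.2 hz)) hi]
  ring

/-- The solution of `ε Q' = G - Q` that comes from `-∞`. -/
def waveInf (G : ℝ → ℝ) (ε z : ℝ) : ℝ :=
  ε⁻¹ * Real.exp (-z / ε) * ∫ t in Iic z, Real.exp (t / ε) * G t

lemma waveInf_eq_wave {G : ℝ → ℝ} {ε : ℝ}
    (hi : ∀ z, IntegrableOn (fun t => Real.exp (t / ε) * G t) (Iic z)) (b z : ℝ) :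
    waveInf G ε z = wave G ε b (waveInf G ε b) z := by
  rw [wave, waveInf, waveInf, ← intervalIntegral.integral_Iic_sub_Iic (hi _) (hi _)]
  have h3 : Real.exp (b / ε) * Real.exp (-b / ε) = 1 := by
    rw [← Real.exp_add]; simp [neg_div]
  linear_combination (-Real.exp (-z / ε) * ε⁻¹ * ∫ t in Iic b, Real.exp (t / ε) * G t) * h3

lemma waveInf_solves {G : ℝ → ℝ} (hG : Continuous G) {ε : ℝ}
    (hi : ∀ z, IntegrableOn (fun t => Real.exp (t / ε) * G t) (Iic z)) :
    Solves G ε (waveInf G ε) := by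
  rw [show waveInf G ε = wave G ε 0 (waveInf G ε 0) from funext fun z => waveInf_eq_wave hi 0 z]
  exact wave_solves hG _ _

/-- Dominated convergence: for t ≤ z the kernel e^{(t-z)/ε} increases with ε, so the integrand for
the largest parameter η dominates. -/
lemma continuousOn_waveInf {G : ℝ → ℝ} (hG : Continuous G) {η₁ η : ℝ} (hη₁ : 0 < η₁)
    (hi : ∀ z, IntegrableOn (fun t => Real.exp (t / η) * G t) (Iic z)) (z : ℝ) :
    ContinuousOn (fun ε => waveInf G ε z) (Icc η₁ η) := by
  have heq : ∀ ε, waveInf G ε z = ε⁻¹ * ∫ t in Iic z, Real.exp ((t - z) / ε) * G t := fun ε => by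
    rw [waveInf, mul_assoc, ← integral_const_mul]
    congr 2
    funext t
    rw [← mul_assoc, ← Real.exp_add]
    congr 2
    ring
  simp only [heq]
  have hinv : ContinuousOn (fun ε : ℝ => ε⁻¹) (Icc η₁ η) :=
    continuousOn_id.inv₀ fun ε hε => (hη₁.trans_le hε.1).ne'
  refine hinv.mul ?_
  have hbi : Integrable (fun t => Real.exp (-z / η) * |Real.exp (t / η) * G t|)
      (volume.restrict (Iic z)) := (hi z).abs.const_mul _
  refine continuousOn_of_dominated (bound := fun t => Real.exp (-z / η) * |Real.exp (t / η) * G t|)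
    (fun ε _ => (by fun_prop : Continuous fun t =>
      Real.exp ((t - z) / ε) * G t).aestronglyMeasurable) (fun ε hε => ?_) hbi ?_
  · refine (ae_restrict_iff' measurableSet_Iic).2 (Eventually.of_forall fun t ht => ?_)
    have ht' : t ≤ z := ht
    rw [Real.norm_eq_abs, abs_mul, abs_mul, abs_of_pos (Real.exp_pos _), abs_of_pos (Real.exp_pos _),
      ← mul_assoc, ← Real.exp_add]
    refine mul_le_mul_of_nonneg_right (Real.exp_le_exp.2 ?_) (abs_nonneg _)
    have h1 : (z - t) / η ≤ (z - t) / ε :=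
      div_le_div_of_nonneg_left (sub_nonneg.2 ht') (hη₁.trans_le hε.1) hε.2
    have h2 : (t - z) / ε = -((z - t) / ε) := by ring
    have h3 : -z / η + t / η = -((z - t) / η) := by ring
    linarith
  · refine Eventually.of_forall fun t => ?_
    have : ContinuousOn (fun ε : ℝ => (t - z) / ε) (Icc η₁ η) :=
      continuousOn_const.div continuousOn_id fun ε hε => (hη₁.trans_le hε.1).ne'
    exact this.rexp.mul continuousOn_const

/-- The bound is a tail of a convergent integral and vanishes as z → -∞; it provides the missing
initial condition for comparing waves that come from -∞. -/
lemma abs_exp_mul_waveInf_le {G : ℝ → ℝ} {ε ε' : ℝ} (hε : 0 < ε) (hle : ε ≤ ε')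
    (hi : ∀ z, IntegrableOn (fun t => Real.exp (t / ε) * G t) (Iic z))
    (hi' : ∀ z, IntegrableOn (fun t => Real.exp (t / ε') * G t) (Iic z)) (z : ℝ) :
    |Real.exp (z / ε') * waveInf G ε z| ≤ ε⁻¹ * ∫ t in Iic z, |Real.exp (t / ε') * G t| := by
  rw [waveInf, mul_assoc, mul_left_comm, abs_mul, abs_of_pos (inv_pos.2 hε), ← mul_assoc,
    ← Real.exp_add]
  refine mul_le_mul_of_nonneg_left ?_ (inv_pos.2 hε).le
  rw [← integral_const_mul]
  refine (abs_integral_le_integral_abs).trans ?_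
  refine setIntegral_mono_on ((hi z).const_mul _).abs (hi' z).abs measurableSet_Iic fun t ht => ?_
  have ht' : t ≤ z := ht
  rw [abs_mul, abs_mul, abs_mul, abs_of_pos (Real.exp_pos _), abs_of_pos (Real.exp_pos _),
    abs_of_pos (Real.exp_pos _), ← mul_assoc, ← Real.exp_add]
  refine mul_le_mul_of_nonneg_right (Real.exp_le_exp.2 ?_) (abs_nonneg _)
  have h1 : (z - t) / ε' ≤ (z - t) / ε := div_le_div_of_nonneg_left (sub_nonneg.2 ht') hε hle
  have h2 : z / ε' + -z / ε + t / ε = (z - t) / ε' - (z - t) / ε + t / ε' := by ring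
  linarith

/-- The weighted difference of the waves tends to 0 at -∞ and does not decrease, so it is
non-negative at x - 1; the last unit of length makes the inequality strict. -/
lemma waveInf_lt_waveInf {G : ℝ → ℝ} (hG : Continuous G) {ε ε' x : ℝ} (hε : 0 < ε) (hlt : ε < ε')
    (hi : ∀ z, IntegrableOn (fun t => Real.exp (t / ε) * G t) (Iic z))
    (hi' : ∀ z, IntegrableOn (fun t => Real.exp (t / ε') * G t) (Iic z))
    (hpos : ∀ z < x, G z < waveInf G ε z) : waveInf G ε x < waveInf G ε' x := by
  have hs := waveInf_solves hG hi
  have hs' := waveInf_solves hG hi'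
  set φ : ℝ → ℝ := fun z => Real.exp (z / ε') * (waveInf G ε' z - waveInf G ε z) with hφ
  have hlim0 : Tendsto (fun z => ∫ t in Iic z, |Real.exp (t / ε') * G t|) atBot (𝓝 0) :=
    tendsto_integral_Iic_atBot (hi' 0).abs
  have hlim : Tendsto φ atBot (𝓝 0) := by
    have h1 : Tendsto (fun z => Real.exp (z / ε') * waveInf G ε z) atBot (𝓝 0) :=
      squeeze_zero_norm (fun z => abs_exp_mul_waveInf_le hε hlt.le hi hi' z)
      (by have := hlim0.const_mul ε⁻¹; rwa [mul_zero] at this)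
    have h2 : Tendsto (fun z => Real.exp (z / ε') * waveInf G ε' z) atBot (𝓝 0) :=
      squeeze_zero_norm (fun z => abs_exp_mul_waveInf_le (hε.trans hlt) le_rfl hi' hi' z)
      (by have := hlim0.const_mul ε'⁻¹; rwa [mul_zero] at this)
    have h3 := h2.sub h1
    rw [sub_zero] at h3
    exact h3.congr fun z => by simp only [hφ]; ring
  have hge : 0 ≤ φ (x - 1) := by
    refine le_of_tendsto hlim ((eventually_le_atBot (x - 1)).mono fun z hz => ?_)
    exact hs.monotoneOn_cmp hs' hε hlt.le
      (fun w hw => (hpos w (by linarith [hw.2])).le) (left_mem_Icc.2 hz) (right_mem_Icc.2 hz) hz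
  refine hs.lt_of_le hs' hε hlt (by linarith : x - 1 < x) (fun z hz => hpos z hz.2) ?_
  exact sub_nonneg.1 (nonneg_of_mul_nonneg_right hge (Real.exp_pos _))

lemma family_waveInf {G : ℝ → ℝ} (hG : Continuous G) {η₁ η x : ℝ} (hη₁ : 0 < η₁)
    (hi : ∀ ε ∈ Icc η₁ η, ∀ z, IntegrableOn (fun t => Real.exp (t / ε) * G t) (Iic z))
    (hη : η₁ < η) (hpos : ∀ z ≤ x, G z < waveInf G η₁ z) :
    Family G η₁ η x (waveInf G) ∧ ∀ ε ∈ Icc η₁ η, ∀ z ≤ x, G z < waveInf G ε z := by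
  have m1 : η₁ ∈ Icc η₁ η := left_mem_Icc.2 hη.le
  have hpos' : ∀ ε ∈ Icc η₁ η, ∀ z ≤ x, G z < waveInf G ε z := fun ε hε z hz => by
    rcases hε.1.eq_or_lt with rfl | hlt
    · exact hpos z hz
    · exact (hpos z hz).trans (waveInf_lt_waveInf hG hη₁ hlt (hi _ m1) (hi _ hε)
        fun w hw => hpos w (hw.le.trans hz))
  exact ⟨⟨fun ε hε => waveInf_solves hG (hi ε hε), fun z => continuousOn_waveInf hG hη₁
    (hi η (right_mem_Icc.2 hη.le)) z, fun ε hε ε' hε' hlt => waveInf_lt_waveInf hG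
      (hη₁.trans_le hε.1) hlt (hi _ hε) (hi _ hε') fun z hz => hpos' ε hε z hz.le⟩, hpos'⟩

/-- Integration by parts on the half-line; the exponential bound kills the term at -∞. It identifies
the explicit m of a domain from infinity with the slope of `waveInf`. -/
lemma exp_integral_eq_sub_waveInf {h G : ℝ → ℝ} (hG : Continuous G) {κ ε : ℝ} (hε : 0 < ε)
    (hκ : 0 ≤ κ) (hκε : κ < 1 / ε) (hd : ∀ z, HasDerivAt h (G z) z) (hbh : ExpBound κ h)
    (hbG : ExpBound κ G) (u : ℝ) :
    ε⁻¹ * Real.exp (-u / ε) * ∫ t in Iic u, h t * Real.exp (t / ε) = h u - ε * waveInf G ε u := by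
  have hc : Continuous h := continuous_iff_continuousAt.2 fun z => (hd z).continuousAt
  have hi1 := hbh.integrableOn hκ hκε hc u
  have hi2 := hbG.integrableOn hκ hκε hG u
  have h1 : ∫ t in Iic u, ((1 / ε) * (Real.exp (t / ε) * h t) + Real.exp (t / ε) * G t) =
      Real.exp (u / ε) * h u - 0 := by
    refine integral_Iic_of_hasDerivAt_of_tendsto' (f := fun t => Real.exp (t / ε) * h t)
      (fun t _ => ?_) ((hi1.const_mul _).add hi2) (hbh.tendsto_atBot hκ hκε)
    refine ((hasDerivAt_exp_div ε t).mul (hd t)).congr_deriv ?_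
    ring
  rw [integral_add (hi1.const_mul _) hi2, integral_const_mul, sub_zero] at h1
  have h2 : ∫ t in Iic u, h t * Real.exp (t / ε) = ∫ t in Iic u, Real.exp (t / ε) * h t := by
    simp only [mul_comm]
  have h3 : Real.exp (-u / ε) * Real.exp (u / ε) = 1 := by
    rw [← Real.exp_add]; simp [neg_div]
  have h4 : ε * ε⁻¹ = 1 := mul_inv_cancel₀ hε.ne'
  rw [h2, waveInf]
  rw [one_div] at h1
  linear_combination Real.exp (-u / ε) * h1 + h u * h3 +
    (Real.exp (-u / ε) * ∫ t in Iic u, Real.exp (t / ε) * G t) * h4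

/-! ### The datum at infinity -/

lemma intd_one_Ioc {g : ℝ → ℝ} (hg : Continuous g) (h : LocallyBoundedVariationOn g univ) {b u : ℝ}
    (hbu : b ≤ u) : intd g (fun _ => 1) (Ioc b u) = g u - g b := by
  rw [intd_by_parts hg h (φ' := fun _ => 0) (fun x => hasDerivAt_const x 1) continuous_const hbu]
  simp

/-- For |s| ≤ |t| the weight e^{-|s|/ε∞} is at least e^{-|t|/ε∞}, so the variation of f'' between 0
and t is at most K e^{|t|/ε∞}. The factor 3 = 1 + 2 collects the two parts of dg. -/
lemma SummableDatum.expBound {f : ℝ → ℝ} {εinf : ℝ} (hε : 0 < εinf) (hreg : RegularDatum f)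
    (hsum : SummableDatum f εinf) : ExpBound (1 / εinf) (deriv (deriv f)) := by
  set g := deriv (deriv f) with hgdef
  have hg : Continuous g := continuous_deriv2_datum hreg.1
  have hbv : LocallyBoundedVariationOn g univ := hreg.locallyBoundedVariationOn
  set K := ∫ t, Real.exp (-|t| / εinf) ∂(totalVar g) with hK
  have hK0 : 0 ≤ K := integral_nonneg fun t => (Real.exp_pos _).le
  have hfin : ∀ b u, totalVar g (Ioc b u) < ⊤ := fun b u => by
    rw [totalVar, dif_pos hbv, StieltjesFunction.measure_Ioc]
    exact ENNReal.ofReal_lt_top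
  have hdle := defectVar_le hg
  have hfin' : ∀ b u, defectVar g (Ioc b u) < ⊤ := fun b u =>
    (hdle _).trans_lt (by
      rw [Measure.smul_apply]
      exact ENNReal.mul_lt_top (by simp) (hfin b u))
  have hmeas : ∀ b u M, (∀ t ∈ Ioc b u, |t| ≤ M) →
      (totalVar g).real (Ioc b u) ≤ K * Real.exp (M / εinf) := fun b u M hM => by
    have h1 : ∫ _ in Ioc b u, Real.exp (-M / εinf) ∂(totalVar g) ≤ K := by
      refine (setIntegral_mono_on (integrableOn_const (hfin b u).ne) hsum.integrableOn
        measurableSet_Ioc fun t ht => ?_).trans (setIntegral_le_integral hsum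
          (Eventually.of_forall fun t => (Real.exp_pos _).le))
      exact Real.exp_le_exp.2 (div_le_div_of_nonneg_right (neg_le_neg (hM t ht)) hε.le)
    rw [setIntegral_const, smul_eq_mul] at h1
    have h3 : Real.exp (-M / εinf) * Real.exp (M / εinf) = 1 := by
      rw [← Real.exp_add]; simp [neg_div]
    calc (totalVar g).real (Ioc b u)
        = (totalVar g).real (Ioc b u) * Real.exp (-M / εinf) * Real.exp (M / εinf) := by
          rw [mul_assoc, h3, mul_one]
      _ ≤ _ := mul_le_mul_of_nonneg_right h1 (Real.exp_pos _).le
  have hdiff : ∀ b u M, b ≤ u → (∀ t ∈ Ioc b u, |t| ≤ M) →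
      |g u - g b| ≤ 3 * K * Real.exp (M / εinf) := fun b u M hbu hM => by
    rw [← intd_one_Ioc hg hbv hbu, intd, setIntegral_const, setIntegral_const, smul_eq_mul,
      smul_eq_mul, mul_one, mul_one]
    have h1 := hmeas b u M hM
    have h2 : (defectVar g).real (Ioc b u) ≤ 2 * (totalVar g).real (Ioc b u) := by
      have := ENNReal.toReal_mono (by
        rw [Measure.smul_apply]
        exact (ENNReal.mul_lt_top (by simp) (hfin b u)).ne) (hdle (Ioc b u))
      simpa [Measure.real, Measure.smul_apply, NNReal.smul_def, ENNReal.smul_def] using this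
    have h3 : 0 ≤ (defectVar g).real (Ioc b u) := measureReal_nonneg
    have h4 : 0 ≤ (totalVar g).real (Ioc b u) := measureReal_nonneg
    rw [abs_le]
    constructor <;> linarith
  refine ⟨|g 0| + 3 * K, fun t => ?_⟩
  have h1 : |g t - g 0| ≤ 3 * K * Real.exp (|t| / εinf) := by
    rcases le_total 0 t with ht | ht
    · exact hdiff 0 t |t| ht fun s hs => by
        rw [abs_of_pos hs.1, abs_of_nonneg ht]; exact hs.2
    · rw [abs_sub_comm]
      exact hdiff t 0 |t| ht fun s hs => by
        rw [abs_of_nonpos hs.2, abs_of_nonpos ht]; linarith [hs.1]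
  have h2 : (1 : ℝ) ≤ Real.exp (|t| / εinf) := Real.one_le_exp (by positivity)
  have h3 : |g t| ≤ |g t - g 0| + |g 0| := by
    simpa using abs_add_le (g t - g 0) (g 0)
  rw [show 1 / εinf * |t| = |t| / εinf by ring, add_mul]
  nlinarith [mul_le_mul_of_nonneg_left h2 (abs_nonneg (g 0))]

/-- Integration costs a factor |t|, which any slightly larger exponent absorbs. -/
lemma ExpBound.primitive {κ κ' : ℝ} {h G : ℝ → ℝ} (hκ : 0 ≤ κ) (hκ' : κ < κ')
    (hd : ∀ z, HasDerivAt h (G z) z) (hb : ExpBound κ G) : ExpBound κ' h := by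
  obtain ⟨C, hC⟩ := hb
  have hC0 : 0 ≤ C := by simpa using (abs_nonneg _).trans (hC 0)
  refine ⟨|h 0| + C / (κ' - κ), fun t => ?_⟩
  have hsub : 0 < κ' - κ := sub_pos.2 hκ'
  have h1 : |h t - h 0| ≤ C * Real.exp (κ * |t|) * |t - 0| := by
    have := (convex_uIcc 0 t).norm_image_sub_le_of_norm_hasDerivWithin_le
      (f := h) (f' := G) (C := C * Real.exp (κ * |t|)) (x := 0) (y := t)
      (fun x _ => (hd x).hasDerivWithinAt) (fun x hx => ?_) left_mem_uIcc right_mem_uIcc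
    · simpa [Real.norm_eq_abs] using this
    · refine (hC x).trans ?_
      have : |x| ≤ |t| := by
        simpa using abs_sub_left_of_mem_uIcc hx
      gcongr
  have h2 : (κ' - κ) * |t| ≤ Real.exp ((κ' - κ) * |t|) := by
    linarith [Real.add_one_le_exp ((κ' - κ) * |t|)]
  have h2' : |t| ≤ Real.exp ((κ' - κ) * |t|) / (κ' - κ) := by
    rw [le_div_iff₀ hsub]; linarith
  have h3 : Real.exp (κ' * |t|) = Real.exp (κ * |t|) * Real.exp ((κ' - κ) * |t|) := by
    rw [← Real.exp_add]; congr 1; ring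
  have h4 : (1 : ℝ) ≤ Real.exp (κ' * |t|) :=
    Real.one_le_exp (mul_nonneg (hκ.trans hκ'.le) (abs_nonneg _))
  have h5 : |h t| ≤ |h t - h 0| + |h 0| := by simpa using abs_add_le (h t - h 0) (h 0)
  have h6 : C * Real.exp (κ * |t|) * |t - 0| ≤ C / (κ' - κ) * Real.exp (κ' * |t|) := by
    rw [sub_zero, h3]
    calc C * Real.exp (κ * |t|) * |t|
        ≤ C * Real.exp (κ * |t|) * (Real.exp ((κ' - κ) * |t|) / (κ' - κ)) := by gcongr
      _ = _ := by ring
  rw [add_mul]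
  nlinarith [mul_le_mul_of_nonneg_left h4 (abs_nonneg (h 0))]

/-- A datum satisfying the standing assumptions. -/
structure TameDatum (f : ℝ → ℝ) (εinf : ℝ) : Prop where
  reg : RegularDatum f
  pos : 0 < εinf
  sum : SummableDatum f εinf

namespace TameDatum

variable {f : ℝ → ℝ} {εinf ε : ℝ}

lemma cont (h : TameDatum f εinf) : Continuous (deriv (deriv f)) := continuous_deriv2_datum h.reg.1

lemma expBound (h : TameDatum f εinf) : ExpBound (1 / εinf) (deriv (deriv f)) :=
  h.sum.expBound h.pos h.reg

lemma one_div_lt (_h : TameDatum f εinf) (hε : ε ∈ Ioo 0 εinf) : 1 / εinf < 1 / ε :=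
  one_div_lt_one_div_of_lt hε.1 hε.2

lemma one_div_nonneg (h : TameDatum f εinf) : 0 ≤ 1 / εinf := (one_div_pos.2 h.pos).le

end TameDatum

/-! ### Forces -/

lemma exp_neg_mul_exp_div (x ε : ℝ) : Real.exp (-x / ε) * Real.exp (x / ε) = 1 := by
  rw [← Real.exp_add]; simp [neg_div]

lemma hasDerivAt_exp_div' (ε z : ℝ) :
    HasDerivAt (fun z => Real.exp (z / ε)) (ε⁻¹ * Real.exp (z / ε)) z :=
  (hasDerivAt_exp_div ε z).congr_deriv (by ring)

lemma hasDerivAt_exp_neg_div' (ε z : ℝ) :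
    HasDerivAt (fun z => Real.exp (-z / ε)) (-ε⁻¹ * Real.exp (-z / ε)) z :=
  (hasDerivAt_exp_neg_div ε z).congr_deriv (by ring)

/-- After integration by parts the force is f'' minus the wave that starts at b from the average
over the base, so its sign tells on which side of f'' the wave lies. -/
lemma forceR_eq {f : ℝ → ℝ} (hreg : RegularDatum f) {ε a b u : ℝ} (hu : b ≤ u) :
    forceR f ε a b u = deriv (deriv f) u -
      wave (deriv (deriv f)) ε b (av (deriv (deriv f)) a b) u := by
  have hg := continuous_deriv2_datum hreg.1
  rw [forceR, intd_by_parts hg hreg.locallyBoundedVariationOn (hasDerivAt_exp_div' ε)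
    (by fun_prop) hu, wave, DR]
  simp only [mul_assoc]
  rw [intervalIntegral.integral_const_mul, show (b - u) / ε = -u / ε + b / ε by ring, Real.exp_add]
  linear_combination deriv (deriv f) u * exp_neg_mul_exp_div u ε

lemma forceL_eq {f : ℝ → ℝ} (hreg : RegularDatum f) {ε a b u : ℝ} (hu : u ≤ a) :
    forceL f ε a b u =
      wave (fun z => deriv (deriv f) (-z)) ε (-a) (av (deriv (deriv f)) a b) (-u) -
        deriv (deriv f) u := by
  have hg := continuous_deriv2_datum hreg.1
  rw [forceL, intd_by_parts hg hreg.locallyBoundedVariationOn (hasDerivAt_exp_neg_div' ε)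
    (by fun_prop) hu, wave, DL]
  have h1 : ∫ t in -a..-u, Real.exp (t / ε) * deriv (deriv f) (-t) =
      ∫ t in u..a, Real.exp (-t / ε) * deriv (deriv f) t := by
    have := intervalIntegral.integral_comp_neg (a := -a) (b := -u)
      (fun t => Real.exp (-t / ε) * deriv (deriv f) t)
    simpa using this
  simp only [mul_assoc]
  rw [intervalIntegral.integral_const_mul, h1, show (u - a) / ε = u / ε + -a / ε by ring,
    Real.exp_add, neg_neg]
  linear_combination -deriv (deriv f) u * exp_neg_mul_exp_div u ε

lemma integrableOn_totalVar_Iic {f : ℝ → ℝ} {εinf ε : ℝ} (h : TameDatum f εinf)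
    (hε : ε ∈ Ioo 0 εinf) (u : ℝ) :
    IntegrableOn (fun t => Real.exp (t / ε)) (Iic u) (totalVar (deriv (deriv f))) := by
  -- For t ≤ u one has t ≤ 2|u| - |t|, and |t|/ε ≥ |t|/ε∞; so a constant multiple of the given
  -- weight dominates.
  have h1 : Integrable (fun t => Real.exp (2 * |u| / ε) * Real.exp (-|t| / εinf))
      ((totalVar (deriv (deriv f))).restrict (Iic u)) :=
    (h.sum.integrableOn (s := Iic u)).const_mul _
  refine h1.mono' (by fun_prop : Continuous fun t => Real.exp (t / ε)).aestronglyMeasurable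
    ((ae_restrict_iff' measurableSet_Iic).2 (Eventually.of_forall fun t ht => ?_))
  have ht' : t ≤ u := ht
  rw [Real.norm_eq_abs, abs_of_pos (Real.exp_pos _), ← Real.exp_add]
  refine Real.exp_le_exp.2 ?_
  have h2 : |t| / εinf ≤ |t| / ε := div_le_div_of_nonneg_left (abs_nonneg t) hε.1 hε.2.le
  have h3 : t / ε ≤ (2 * |u| - |t|) / ε := by
    refine div_le_div_of_nonneg_right ?_ hε.1.le
    rcases abs_cases t with h | h <;> rcases abs_cases u with h' | h' <;> linarith
  have h4 : (2 * |u| - |t|) / ε = 2 * |u| / ε - |t| / ε := by ring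
  have h5 : -|t| / εinf = -(|t| / εinf) := by ring
  linarith

lemma integrableOn_totalVar_Ioi {f : ℝ → ℝ} {εinf ε : ℝ} (h : TameDatum f εinf)
    (hε : ε ∈ Ioo 0 εinf) (u : ℝ) :
    IntegrableOn (fun t => Real.exp (-t / ε)) (Ioi u) (totalVar (deriv (deriv f))) := by
  have h1 : Integrable (fun t => Real.exp (2 * |u| / ε) * Real.exp (-|t| / εinf))
      ((totalVar (deriv (deriv f))).restrict (Ioi u)) :=
    (h.sum.integrableOn (s := Ioi u)).const_mul _
  refine h1.mono' (by fun_prop : Continuous fun t => Real.exp (-t / ε)).aestronglyMeasurable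
    ((ae_restrict_iff' measurableSet_Ioi).2 (Eventually.of_forall fun t ht => ?_))
  have ht' : u < t := ht
  rw [Real.norm_eq_abs, abs_of_pos (Real.exp_pos _), ← Real.exp_add]
  refine Real.exp_le_exp.2 ?_
  have h2 : |t| / εinf ≤ |t| / ε := div_le_div_of_nonneg_left (abs_nonneg t) hε.1 hε.2.le
  have h3 : -t / ε ≤ (2 * |u| - |t|) / ε := by
    refine div_le_div_of_nonneg_right ?_ hε.1.le
    rcases abs_cases t with h | h <;> rcases abs_cases u with h' | h' <;> linarith
  have h4 : (2 * |u| - |t|) / ε = 2 * |u| / ε - |t| / ε := by ring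
  have h5 : -|t| / εinf = -(|t| / εinf) := by ring
  linarith

lemma integrableOn_defectVar {g φ : ℝ → ℝ} (hg : Continuous g) {s : Set ℝ}
    (h : IntegrableOn φ s (totalVar g)) : IntegrableOn φ s (defectVar g) := by
  have h1 : IntegrableOn φ s ((2 : NNReal) • totalVar g) := by
    rw [IntegrableOn, Measure.restrict_smul]
    exact Integrable.smul_measure_nnreal h
  exact h1.mono_measure (defectVar_le hg)

lemma tendsto_intd_Iic {g φ : ℝ → ℝ} (hg : Continuous g) {u : ℝ}
    (h : IntegrableOn φ (Iic u) (totalVar g)) :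
    Tendsto (fun b => intd g φ (Ioc b u)) atBot (𝓝 (intd g φ (Iic u))) := by
  have h1 := (intervalIntegral_tendsto_integral_Iic u h tendsto_id).sub
    (intervalIntegral_tendsto_integral_Iic u (integrableOn_defectVar hg h) tendsto_id)
  refine h1.congr' ((eventually_le_atBot u).mono fun b hb => ?_)
  simp only [id_eq]
  rw [intervalIntegral.integral_of_le hb, intervalIntegral.integral_of_le hb]
  rfl

lemma tendsto_intd_Ioi {g φ : ℝ → ℝ} (hg : Continuous g) {u : ℝ}
    (h : IntegrableOn φ (Ioi u) (totalVar g)) :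
    Tendsto (fun b => intd g φ (Ioc u b)) atTop (𝓝 (intd g φ (Ioi u))) := by
  have h1 := (intervalIntegral_tendsto_integral_Ioi u h tendsto_id).sub
    (intervalIntegral_tendsto_integral_Ioi u (integrableOn_defectVar hg h) tendsto_id)
  refine h1.congr' ((eventually_ge_atTop u).mono fun b hb => ?_)
  simp only [id_eq]
  rw [intervalIntegral.integral_of_le hb, intervalIntegral.integral_of_le hb]
  rfl

/-- The integration by parts on (b, u] is passed to the limit b → -∞; the boundary term disappears
because f'' grows more slowly than e^{|t|/ε}. -/
lemma forceRInf_eq {f : ℝ → ℝ} {εinf ε : ℝ} (h : TameDatum f εinf) (hε : ε ∈ Ioo 0 εinf) (u : ℝ) :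
    forceRInf f ε u = deriv (deriv f) u - waveInf (deriv (deriv f)) ε u := by
  set g := deriv (deriv f) with hgdef
  have hg : Continuous g := h.cont
  have hi := h.expBound.integrableOn h.one_div_nonneg (h.one_div_lt hε) hg u
  have h1 := tendsto_intd_Iic hg (integrableOn_totalVar_Iic h hε u)
  have h2 : Tendsto (fun b => Real.exp (u / ε) * g u - Real.exp (b / ε) * g b -
      ε⁻¹ * ∫ t in b..u, Real.exp (t / ε) * g t) atBot
      (𝓝 (Real.exp (u / ε) * g u - 0 - ε⁻¹ * ∫ t in Iic u, Real.exp (t / ε) * g t)) :=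
    (tendsto_const_nhds.sub (h.expBound.tendsto_atBot h.one_div_nonneg (h.one_div_lt hε))).sub
      ((intervalIntegral_tendsto_integral_Iic u hi tendsto_id).const_mul _)
  have h3 := tendsto_nhds_unique (h1.congr' ((eventually_le_atBot u).mono fun b hb => by
    rw [intd_by_parts hg h.reg.locallyBoundedVariationOn (hasDerivAt_exp_div' ε) (by fun_prop) hb]
    simp only [mul_assoc]
    rw [intervalIntegral.integral_const_mul])) h2
  rw [forceRInf, h3, waveInf]
  linear_combination g u * exp_neg_mul_exp_div u ε

lemma forceLInf_eq {f : ℝ → ℝ} {εinf ε : ℝ} (h : TameDatum f εinf) (hε : ε ∈ Ioo 0 εinf) (u : ℝ) :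
    forceLInf f ε u = waveInf (fun z => deriv (deriv f) (-z)) ε (-u) - deriv (deriv f) u := by
  set g := deriv (deriv f) with hgdef
  have hg : Continuous g := h.cont
  have hbn : ExpBound (1 / εinf) fun z => g (-z) := h.expBound.comp_neg
  have hi := hbn.integrableOn h.one_div_nonneg (h.one_div_lt hε) (by fun_prop) (-u)
  have h1 := (tendsto_intd_Ioi hg (integrableOn_totalVar_Ioi h hε u)).comp tendsto_neg_atBot_atTop
  have h2 : Tendsto (fun b => Real.exp (b / ε) * g (-b) - Real.exp (-u / ε) * g u +
      ε⁻¹ * ∫ t in b..-u, Real.exp (t / ε) * g (-t)) atBot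
      (𝓝 (0 - Real.exp (-u / ε) * g u + ε⁻¹ * ∫ t in Iic (-u), Real.exp (t / ε) * g (-t))) :=
    ((hbn.tendsto_atBot h.one_div_nonneg (h.one_div_lt hε)).sub tendsto_const_nhds).add
      ((intervalIntegral_tendsto_integral_Iic (-u) hi tendsto_id).const_mul _)
  have h3 := tendsto_nhds_unique (h1.congr' ((eventually_le_atBot (-u)).mono fun b hb => by
    rw [Function.comp_apply, intd_by_parts hg h.reg.locallyBoundedVariationOn
      (hasDerivAt_exp_neg_div' ε) (by fun_prop) (by linarith), neg_neg]
    simp only [mul_assoc]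
    have h4 : ∫ t in b..-u, Real.exp (t / ε) * g (-t) =
        ∫ t in u..-b, Real.exp (-t / ε) * g t := by
      have := intervalIntegral.integral_comp_neg (a := b) (b := -u)
        (fun t => Real.exp (-t / ε) * g t)
      simpa using this
    rw [intervalIntegral.integral_const_mul, h4]
    ring)) h2
  rw [forceLInf, h3, waveInf, neg_neg]
  linear_combination -g u * exp_neg_mul_exp_div u ε

/-! ### Tails -/

lemma mem_rightTail {F : ℝ → ℝ} {x y : EReal} {u : ℝ} (hx : x < u) (hu : (u : EReal) < y)
    (h : ∀ s : ℝ, x < s → (s : EReal) < y → F s < 0) : u ∈ rightTail F x :=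
  ⟨hx, hu.trans_le (le_sSup ⟨hx.trans hu, h⟩)⟩

lemma mem_leftTail {F : ℝ → ℝ} {x y : EReal} {u : ℝ} (hx : (u : EReal) < x) (hu : y < u)
    (h : ∀ s : ℝ, y < s → (s : EReal) < x → 0 < F s) : u ∈ leftTail F x :=
  ⟨hx, (sInf_le (show y ∈ {t : EReal | t < x ∧ ∀ s : ℝ, t < (s : EReal) → (s : EReal) < x → 0 < F s}
    from ⟨hu.trans hx, h⟩)).trans_lt hu⟩

/-! ### Orientation -/

/-- The coordinate that increases in the direction of the orientation. -/
def Side.coord : Side → ℝ → ℝ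
  | .R, u => u
  | .L, u => -u

/-- `f''` in the coordinate of the orientation `s`. -/
def curv (f : ℝ → ℝ) (s : Side) (z : ℝ) : ℝ := deriv (deriv f) (s.coord z)

namespace FreeVertex

/-- The coordinate of the end of the figure from which tangents of orientation `s` go out. -/
def outEnd (s : Side) (v : FreeVertex) : EReal :=
  match s with
  | .R => v.rightEnd
  | .L => -v.leftEnd

/-- The coordinate of the end of the figure at which tangents of orientation `s` come in. -/
def inEnd (s : Side) (v : FreeVertex) : EReal :=
  match s with
  | .R => v.leftEnd
  | .L => -v.rightEnd

/-- The orientation of the tangent domain from which tangents of orientation `s` would go out. -/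
def outDir (s : Side) (v : FreeVertex) : Side :=
  match s with
  | .R => v.rightDir
  | .L => v.leftDir

/-- The orientation of the tangent domain in which tangents of orientation `s` would come in. -/
def inDir (s : Side) (v : FreeVertex) : Side :=
  match s with
  | .R => v.leftDir
  | .L => v.rightDir

end FreeVertex

lemma continuous_curv {f : ℝ → ℝ} (hg : Continuous (deriv (deriv f))) (s : Side) :
    Continuous (curv f s) := by
  cases s
  · exact hg
  · exact hg.comp continuous_neg

lemma TameDatum.integrableOn {f : ℝ → ℝ} {εinf ε : ℝ} (h : TameDatum f εinf)
    (hε : ε ∈ Ioo 0 εinf) (s : Side) (z : ℝ) :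
    IntegrableOn (fun t => Real.exp (t / ε) * curv f s t) (Iic z) := by
  cases s
  · exact h.expBound.integrableOn h.one_div_nonneg (h.one_div_lt hε) h.cont z
  · exact h.expBound.comp_neg.integrableOn h.one_div_nonneg (h.one_div_lt hε)
      (h.cont.comp continuous_neg) z

/-- A free vertex with the value that the second derivative of the candidate has on it. -/
abbrev LabelledVertex := FreeVertex × ℝ

/-- `Q` describes the tangents of orientation `s` that go out of the vertex. -/
def IsWave (f : ℝ → ℝ) (s : Side) (ε : ℝ) (V : LabelledVertex) (Q : ℝ → ℝ) : Prop :=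
  (∀ p, V.1.base = some p → Solves (curv f s) ε Q ∧ ∀ x : ℝ, V.1.outEnd s = x → Q x = V.2) ∧
  (V.1.base = none → Q = waveInf (curv f s) ε)

/-- The tangents of orientation `s` described by `Q` go from `V` to `V'`. -/
structure FlowsVia (f : ℝ → ℝ) (s : Side) (ε : ℝ) (V V' : LabelledVertex) (Q : ℝ → ℝ) : Prop where
  out_dir : V.1.outDir s = s
  in_dir : V'.1.inDir s = s
  lt : V.1.outEnd s < V'.1.inEnd s
  wave : IsWave f s ε V Q
  pos : ∀ z : ℝ, V.1.outEnd s < z → (z : EReal) < V'.1.inEnd s → curv f s z < Q z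
  val : ∀ x : ℝ, V'.1.inEnd s = x → Q x = V'.2

/-- A tangent domain of orientation `s` goes from `V` to `V'` and its force does not vanish at `V'`
if this is an angle. -/
def Flows (f : ℝ → ℝ) (s : Side) (ε : ℝ) (V V' : LabelledVertex) : Prop :=
  ∃ Q, FlowsVia f s ε V V' Q ∧ ∀ w, V'.1 = .angle w → curv f s (s.coord w) < Q (s.coord w)

/-- The vertices `V` and `V'` may follow each other in a graph. -/
def Link (f : ℝ → ℝ) (ε : ℝ) (V V' : LabelledVertex) : Prop :=
  Flows f .R ε V V' ∨ Flows f .L ε V' V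

/-- The label of the vertex is the average of `f''` over its base. -/
def LabelOK (f : ℝ → ℝ) (V : LabelledVertex) : Prop :=
  ∀ p, V.1.base = some p → V.2 = av (deriv (deriv f)) p.1 p.2

/-- The local requirements on the vertex of a smooth graph. -/
structure VertexOK (f : ℝ → ℝ) (ε : ℝ) (V : LabelledVertex) : Prop where
  admissible : V.1.Admissible f ε
  smooth : V.1.Smooth ε
  leafRoot : V.1.LeafRoot f
  label : LabelOK f V

lemma FreeVertex.Admissible.rightEnd_ne_bot {f : ℝ → ℝ} {ε : ℝ} {v : FreeVertex}
    (h : v.Admissible f ε) {p : ℝ × ℝ} (hp : v.base = some p) : v.rightEnd ≠ ⊥ := by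
  cases v with
  | multi kind k arcs t => exact (h.1.1 (Fin.last k)).2.2.ne'
  | _ => first | exact EReal.coe_ne_bot _ | simp [base] at hp

lemma FreeVertex.Admissible.leftEnd_ne_top {f : ℝ → ℝ} {ε : ℝ} {v : FreeVertex}
    (h : v.Admissible f ε) {p : ℝ × ℝ} (hp : v.base = some p) : v.leftEnd ≠ ⊤ := by
  cases v with
  | multi kind k arcs t => exact (h.1.1 0).2.1.ne
  | _ => first | exact EReal.coe_ne_top _ | simp [base] at hp

lemma FreeVertex.base_snd {v : FreeVertex} {p : ℝ × ℝ} (hp : v.base = some p) {x : ℝ}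
    (hx : v.rightEnd = x) : p.2 = x := by
  cases v with
  | multi kind k arcs t =>
    simp only [base, Option.some.injEq] at hp
    simp only [rightEnd] at hx
    rw [← hp]
    simp [Arc.rightPt, hx]
  | _ => simp_all [base, rightEnd]; try (rw [← hp]; try exact hx)

lemma FreeVertex.base_fst {v : FreeVertex} {p : ℝ × ℝ} (hp : v.base = some p) {x : ℝ}
    (hx : v.leftEnd = x) : p.1 = x := by
  cases v with
  | multi kind k arcs t =>
    simp only [base, Option.some.injEq] at hp
    simp only [leftEnd] at hx
    rw [← hp]
    simp [Arc.leftPt, hx]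
  | _ => simp_all [base, leftEnd]; try (rw [← hp]; try exact hx)

lemma FreeVertex.ends_of_base_none {v : FreeVertex} (hp : v.base = none) :
    (∃ w, v = .angle w) ∨ ((v.leftEnd = ⊥ ∨ v.leftEnd = ⊤) ∧ (v.rightEnd = ⊥ ∨ v.rightEnd = ⊤)) := by
  cases v <;> simp_all [base, leftEnd, rightEnd]

lemma IsWave.solves {f : ℝ → ℝ} {εinf ε : ℝ} (h : TameDatum f εinf) (hε : ε ∈ Ioo 0 εinf)
    {s : Side} {V : LabelledVertex} {Q : ℝ → ℝ} (hQ : IsWave f s ε V Q) :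
    Solves (curv f s) ε Q := by
  rcases hb : V.1.base with _ | p
  · rw [hQ.2 hb]
    exact waveInf_solves (continuous_curv h.cont s) (h.integrableOn hε s)
  · exact (hQ.1 p hb).1

/-! ### From flows to slopes and forces -/

/-- The slope coefficient of the tangents described by `Q`. -/
def slopeOf (f : ℝ → ℝ) (s : Side) (ε : ℝ) (Q : ℝ → ℝ) (u : ℝ) : ℝ :=
  match s with
  | .R => deriv f u - ε * Q u
  | .L => deriv f u + ε * Q (-u)

lemma hasDerivAt_slopeOf_R {f : ℝ → ℝ} (hf : ContDiff ℝ 2 f) {ε : ℝ} (hε : 0 < ε) {Q : ℝ → ℝ}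
    (hQ : Solves (curv f .R) ε Q) (u : ℝ) : HasDerivAt (slopeOf f .R ε Q) (Q u) u := by
  refine ((hasDerivAt_deriv_datum hf u).sub ((hQ u).const_mul ε)).congr_deriv ?_
  rw [mul_div_cancel₀ _ hε.ne']
  simp [curv, Side.coord]

lemma hasDerivAt_slopeOf_L {f : ℝ → ℝ} (hf : ContDiff ℝ 2 f) {ε : ℝ} (hε : 0 < ε) {Q : ℝ → ℝ}
    (hQ : Solves (curv f .L) ε Q) (u : ℝ) : HasDerivAt (slopeOf f .L ε Q) (Q (-u)) u := by
  refine ((hasDerivAt_deriv_datum hf u).add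
    (((hQ (-u)).comp u (hasDerivAt_neg u)).const_mul ε)).congr_deriv ?_
  rw [mul_neg_one, mul_neg, mul_div_cancel₀ _ hε.ne']
  simp [curv, Side.coord]

lemma TameDatum.integral_R {f : ℝ → ℝ} {εinf ε : ℝ} (h : TameDatum f εinf) (hε : ε ∈ Ioo 0 εinf)
    (u : ℝ) : ε⁻¹ * Real.exp (-u / ε) * ∫ t in Iic u, deriv f t * Real.exp (t / ε) =
      deriv f u - ε * waveInf (curv f .R) ε u := by
  change _ = deriv f u - ε * waveInf (deriv (deriv f)) ε u
  -- f' is controlled only with an exponent larger than 1/ε∞, and convergence needs one smaller than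
  -- 1/ε; κ lies between them.
  obtain ⟨κ, hκ, hκ'⟩ := exists_between (h.one_div_lt hε)
  exact exp_integral_eq_sub_waveInf h.cont hε.1 (h.one_div_nonneg.trans hκ.le) hκ'
    (hasDerivAt_deriv_datum h.reg.1) (h.expBound.primitive h.one_div_nonneg hκ
      (hasDerivAt_deriv_datum h.reg.1)) (h.expBound.mono hκ.le) u

lemma waveInf_neg (G : ℝ → ℝ) (ε z : ℝ) : waveInf (fun z => -G z) ε z = -waveInf G ε z := by
  simp only [waveInf, mul_neg, integral_neg]

/-- The formula on the right is applied to t ↦ f'(-t). Its derivative is minus the reflected f'',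
which turns the sign in front of ε. -/
lemma TameDatum.integral_L {f : ℝ → ℝ} {εinf ε : ℝ} (h : TameDatum f εinf) (hε : ε ∈ Ioo 0 εinf)
    (u : ℝ) : ε⁻¹ * Real.exp (u / ε) * ∫ t in Ioi u, deriv f t * Real.exp (-t / ε) =
      deriv f u + ε * waveInf (curv f .L) ε (-u) := by
  obtain ⟨κ, hκ, hκ'⟩ := exists_between (h.one_div_lt hε)
  have hd : ∀ z, HasDerivAt (fun t => deriv f (-t)) (-curv f .L z) z := fun z => by
    refine ((hasDerivAt_deriv_datum h.reg.1 (-z)).comp z (hasDerivAt_neg z)).congr_deriv ?_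
    simp [curv, Side.coord]
  have hb := h.expBound.mono hκ.le
  have hbn : ExpBound κ fun z => -curv f .L z := by
    obtain ⟨C, hC⟩ := hb.comp_neg
    exact ⟨C, fun t => by rw [abs_neg]; exact hC t⟩
  have := exp_integral_eq_sub_waveInf (continuous_curv h.cont .L).neg hε.1
    (h.one_div_nonneg.trans hκ.le) hκ' hd ((h.expBound.primitive h.one_div_nonneg hκ
      (hasDerivAt_deriv_datum h.reg.1)).comp_neg) hbn (-u)
  rw [show (-curv f .L) = fun z => -curv f .L z from rfl, waveInf_neg, neg_neg] at this
  have h2 := integral_comp_neg_Iic (-u) (fun t => deriv f t * Real.exp (-t / ε))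
  simp only [neg_neg] at h2
  rw [← h2, this]
  ring

/-- The wave is m' near u, so m'' is Q' = (G - Q)/ε. Agreement near u is enough, as the m of an
admissible graph is known on its domain only. -/
lemma deriv_deriv_neg_of_eventuallyEq_R {f : ℝ → ℝ} (hf : ContDiff ℝ 2 f) {ε : ℝ} (hε : 0 < ε)
    {Q m : ℝ → ℝ} (hQ : Solves (curv f .R) ε Q) {u : ℝ} (hm : m =ᶠ[𝓝 u] slopeOf f .R ε Q) :
    deriv (deriv m) u = (deriv (deriv f) u - Q u) / ε := by
  rw [hm.deriv.deriv_eq, show deriv (slopeOf f .R ε Q) = Q from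
    funext fun u => (hasDerivAt_slopeOf_R hf hε hQ u).deriv, (hQ u).deriv]
  rfl

lemma deriv_deriv_neg_of_eventuallyEq_L {f : ℝ → ℝ} (hf : ContDiff ℝ 2 f) {ε : ℝ} (hε : 0 < ε)
    {Q m : ℝ → ℝ} (hQ : Solves (curv f .L) ε Q) {u : ℝ} (hm : m =ᶠ[𝓝 u] slopeOf f .L ε Q) :
    deriv (deriv m) u = (Q (-u) - deriv (deriv f) u) / ε := by
  rw [hm.deriv.deriv_eq, show deriv (slopeOf f .L ε Q) = fun u => Q (-u) from
    funext fun u => (hasDerivAt_slopeOf_L hf hε hQ u).deriv]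
  have := ((hQ (-u)).comp u (hasDerivAt_neg u)).deriv
  rw [Function.comp_def] at this
  rw [this]
  simp only [curv, Side.coord, neg_neg]
  ring

lemma FlowsVia.isSlope_R {f : ℝ → ℝ} {εinf ε : ℝ} (h : TameDatum f εinf) (hε : ε ∈ Ioo 0 εinf)
    {V V' : LabelledVertex} {Q : ℝ → ℝ} (hQ : FlowsVia f .R ε V V' Q) (hV : V.1.Admissible f ε) :
    FoliationGraph.IsSlope f ε ⟨.R, V.1.rightEnd, V'.1.leftEnd⟩ (slopeOf f .R ε Q) := by
  have hs := hQ.wave.solves h hε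
  have hd := hasDerivAt_slopeOf_R h.reg.1 hε.1 hs
  refine ⟨fun u _ => (hd u).continuousAt.continuousWithinAt, fun u h1 h2 => ⟨?_, ?_⟩, fun hb u _ => ?_⟩
  · refine (hd u).congr_deriv ?_
    simp [slopeOf, hε.1.ne']
  · rw [deriv_deriv_neg_of_eventuallyEq_R h.reg.1 hε.1 hs (EventuallyEq.refl _ _)]
    exact div_neg_of_neg_of_pos (sub_neg.2 (hQ.pos u h1 h2)) hε.1
  · rcases hbase : V.1.base with _ | p
    · rw [h.integral_R hε, slopeOf, hQ.wave.2 hbase]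
    · exact absurd hb (hV.rightEnd_ne_bot hbase)

lemma FlowsVia.isSlope_L {f : ℝ → ℝ} {εinf ε : ℝ} (h : TameDatum f εinf) (hε : ε ∈ Ioo 0 εinf)
    {V V' : LabelledVertex} {Q : ℝ → ℝ} (hQ : FlowsVia f .L ε V' V Q) (hV : V'.1.Admissible f ε) :
    FoliationGraph.IsSlope f ε ⟨.L, V.1.rightEnd, V'.1.leftEnd⟩ (slopeOf f .L ε Q) := by
  have hs := hQ.wave.solves h hε
  have hd := hasDerivAt_slopeOf_L h.reg.1 hε.1 hs
  refine ⟨fun u _ => (hd u).continuousAt.continuousWithinAt, fun u h1 h2 => ⟨?_, ?_⟩, fun hb u _ => ?_⟩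
  · refine (hd u).congr_deriv ?_
    simp [slopeOf, hε.1.ne']
  · rw [deriv_deriv_neg_of_eventuallyEq_L h.reg.1 hε.1 hs (EventuallyEq.refl _ _)]
    refine div_pos (sub_pos.2 ?_) hε.1
    have := hQ.pos (-u) (by simpa [FreeVertex.outEnd] using h2) (by simpa [FreeVertex.inEnd] using h1)
    simpa [curv, Side.coord] using this
  · rcases hbase : V'.1.base with _ | p
    · rw [h.integral_L hε, slopeOf, hQ.wave.2 hbase]
    · exact absurd hb (hV.leftEnd_ne_top hbase)

lemma FlowsVia.glues_R {f : ℝ → ℝ} {ε : ℝ} {V V' : LabelledVertex} {Q : ℝ → ℝ}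
    (hQ : FlowsVia f .R ε V V' Q) (hV : V.1.Admissible f ε) (hV' : V'.1.Admissible f ε)
    (hl : LabelOK f V) (hl' : LabelOK f V') :
    V.1.Glues f ε .R (slopeOf f .R ε Q) V.1.rightEnd ∧
      V'.1.Glues f ε .R (slopeOf f .R ε Q) V'.1.leftEnd := by
  have hlt : V.1.rightEnd < V'.1.leftEnd := hQ.lt
  constructor
  · rcases hb : V.1.base with _ | p
    · simp [FreeVertex.Glues, hb]
    · simp only [FreeVertex.Glues, hb, slopeOf]
      rw [(hQ.wave.1 p hb).2 _ (EReal.coe_toReal (ne_top_of_lt hlt) (hV.rightEnd_ne_bot hb)).symm,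
        hl p hb]
  · rcases hb : V'.1.base with _ | p
    · simp [FreeVertex.Glues, hb]
    · simp only [FreeVertex.Glues, hb, slopeOf]
      rw [hQ.val _ (EReal.coe_toReal (hV'.leftEnd_ne_top hb) (ne_bot_of_gt hlt)).symm, hl' p hb]

lemma FlowsVia.glues_L {f : ℝ → ℝ} {ε : ℝ} {V V' : LabelledVertex} {Q : ℝ → ℝ}
    (hQ : FlowsVia f .L ε V' V Q) (hV : V.1.Admissible f ε) (hV' : V'.1.Admissible f ε)
    (hl : LabelOK f V) (hl' : LabelOK f V') :
    V.1.Glues f ε .L (slopeOf f .L ε Q) V.1.rightEnd ∧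
      V'.1.Glues f ε .L (slopeOf f .L ε Q) V'.1.leftEnd := by
  have hlt : V.1.rightEnd < V'.1.leftEnd := EReal.neg_lt_neg_iff.1 hQ.lt
  constructor
  · rcases hb : V.1.base with _ | p
    · simp [FreeVertex.Glues, hb]
    · simp only [FreeVertex.Glues, hb, slopeOf]
      have hr := EReal.coe_toReal (ne_top_of_lt hlt) (hV.rightEnd_ne_bot hb)
      rw [hQ.val (-V.1.rightEnd.toReal) (by rw [EReal.coe_neg, hr]; rfl), hl p hb]
  · rcases hb : V'.1.base with _ | p
    · simp [FreeVertex.Glues, hb]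
    · simp only [FreeVertex.Glues, hb, slopeOf]
      have hr := EReal.coe_toReal (hV'.leftEnd_ne_top hb) (ne_bot_of_gt hlt)
      rw [(hQ.wave.1 p hb).2 (-V'.1.leftEnd.toReal) (by rw [EReal.coe_neg, hr]; rfl), hl' p hb]

lemma IsWave.rightForce {f : ℝ → ℝ} {εinf ε : ℝ} (h : TameDatum f εinf) (hε : ε ∈ Ioo 0 εinf)
    {V : LabelledVertex} {Q : ℝ → ℝ} (hQ : IsWave f .R ε V Q) (hV : V.1.Admissible f ε)
    (hl : LabelOK f V) {u : ℝ} (hu : V.1.rightEnd < u) :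
    V.1.rightForce f ε u = deriv (deriv f) u - Q u := by
  rcases hb : V.1.base with _ | p
  · rw [FreeVertex.rightForce, hb, hQ.2 hb]
    exact forceRInf_eq h hε u
  · have hr := EReal.coe_toReal (ne_top_of_lt hu) (hV.rightEnd_ne_bot hb)
    have hp := FreeVertex.base_snd hb hr.symm
    have hu' : p.2 ≤ u := by
      rw [hp]
      rw [← hr] at hu
      exact (EReal.coe_lt_coe_iff.1 hu).le
    simp only [FreeVertex.rightForce, hb]
    rw [forceR_eq h.reg hu', (wave_solves h.cont _ _).eq_of_eq (hQ.1 p hb).1 (x := p.2)]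
    rw [wave_self, ← hl p hb, hp]
    exact ((hQ.1 p hb).2 _ hr.symm).symm

lemma IsWave.leftForce {f : ℝ → ℝ} {εinf ε : ℝ} (h : TameDatum f εinf) (hε : ε ∈ Ioo 0 εinf)
    {V : LabelledVertex} {Q : ℝ → ℝ} (hQ : IsWave f .L ε V Q) (hV : V.1.Admissible f ε)
    (hl : LabelOK f V) {u : ℝ} (hu : u < V.1.leftEnd) :
    V.1.leftForce f ε u = Q (-u) - deriv (deriv f) u := by
  rcases hb : V.1.base with _ | p
  · rw [FreeVertex.leftForce, hb, hQ.2 hb]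
    exact forceLInf_eq h hε u
  · have hr := EReal.coe_toReal (hV.leftEnd_ne_top hb) (ne_bot_of_gt hu)
    have hp := FreeVertex.base_fst hb hr.symm
    have hu' : u ≤ p.1 := by
      rw [hp]
      rw [← hr] at hu
      exact (EReal.coe_lt_coe_iff.1 hu).le
    simp only [FreeVertex.leftForce, hb]
    rw [forceL_eq h.reg hu', show (fun z => deriv (deriv f) (-z)) = curv f .L from rfl,
      (wave_solves (continuous_curv h.cont .L) _ _).eq_of_eq (hQ.1 p hb).1
      (x := -p.1)]
    rw [wave_self, ← hl p hb, hp]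
    refine ((hQ.1 p hb).2 _ ?_).symm
    rw [EReal.coe_neg, hr]
    rfl

/-- `E` carries the flow described by `Q` between its neighbours `V` on the left and `V'` on the
right. -/
structure EdgeFlow (f : ℝ → ℝ) (ε : ℝ) (s : Side) (V V' : LabelledVertex) (Q : ℝ → ℝ) : Prop where
  right : s = .R → FlowsVia f .R ε V V' Q ∧ ∀ w, V'.1 = .angle w → curv f .R w < Q w
  left : s = .L → FlowsVia f .L ε V' V Q ∧ ∀ w, V.1 = .angle w → curv f .L (-w) < Q (-w)

lemma Link.exists_edgeFlow {f : ℝ → ℝ} {ε : ℝ} {V V' : LabelledVertex} (h : Link f ε V V') :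
    ∃ s Q, EdgeFlow f ε s V V' Q := by
  rcases h with ⟨Q, h1, h2⟩ | ⟨Q, h1, h2⟩
  · exact ⟨.R, Q, fun _ => ⟨h1, h2⟩, fun h => by simp at h⟩
  · exact ⟨.L, Q, fun h => by simp at h, fun _ => ⟨h1, h2⟩⟩

lemma exists_gt_of_lt_at {G Q : ℝ → ℝ} (hG : Continuous G) (hQ : Continuous Q) {w : ℝ}
    (h : G w < Q w) : ∃ δ > 0, ∀ z ∈ Icc (w - δ) (w + δ), G z < Q z := by
  have h1 : ∀ᶠ z in 𝓝 w, G z < Q z := hG.continuousAt.eventually_lt hQ.continuousAt h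
  obtain ⟨δ, hδ, hb⟩ := Metric.eventually_nhds_iff.1 h1
  refine ⟨δ / 2, half_pos hδ, fun z hz => hb ?_⟩
  rw [Real.dist_eq, abs_lt]
  constructor <;> linarith [hz.1, hz.2]

/-- If the inequality between f'' and the wave is strict at the end u itself, it persists a little
beyond; hence u belongs to the open tail, as required of angles. -/
lemma FlowsVia.mem_rightTail {f : ℝ → ℝ} {εinf ε : ℝ} (h : TameDatum f εinf) (hε : ε ∈ Ioo 0 εinf)
    {V V' : LabelledVertex} {Q : ℝ → ℝ} (hQ : FlowsVia f .R ε V V' Q) (hV : V.1.Admissible f ε)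
    (hl : LabelOK f V) {u : ℝ} (hu : V.1.rightEnd < u)
    (hu' : u < V'.1.leftEnd ∨ V'.1.leftEnd = u ∧ curv f .R u < Q u) :
    u ∈ rightTail (V.1.rightForce f ε) V.1.rightEnd := by
  have hF : ∀ s : ℝ, V.1.rightEnd < s → curv f .R s < Q s → V.1.rightForce f ε s < 0 :=
    fun s h1 h2 => by
      rw [hQ.wave.rightForce h hε hV hl h1]
      exact sub_neg.2 h2
  rcases hu' with hu' | ⟨heq, hlt⟩
  · exact BellmanFoliation.mem_rightTail hu hu' fun s h1 h2 => hF s h1 (hQ.pos s h1 h2)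
  · obtain ⟨δ, hδ, hb⟩ := exists_gt_of_lt_at (continuous_curv h.cont .R)
      (hQ.wave.solves h hε).continuous hlt
    refine BellmanFoliation.mem_rightTail hu
      (EReal.coe_lt_coe_iff.2 (by linarith : u < u + δ)) fun s h1 h2 => hF s h1 ?_
    rcases lt_or_ge s u with h3 | h3
    · refine hQ.pos s h1 ?_
      rw [FreeVertex.inEnd, heq]
      exact EReal.coe_lt_coe_iff.2 h3
    · exact hb s ⟨by linarith, (EReal.coe_lt_coe_iff.1 h2).le⟩

lemma FlowsVia.mem_leftTail {f : ℝ → ℝ} {εinf ε : ℝ} (h : TameDatum f εinf) (hε : ε ∈ Ioo 0 εinf)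
    {V V' : LabelledVertex} {Q : ℝ → ℝ} (hQ : FlowsVia f .L ε V' V Q) (hV : V'.1.Admissible f ε)
    (hl : LabelOK f V') {u : ℝ} (hu : u < V'.1.leftEnd)
    (hu' : V.1.rightEnd < u ∨ V.1.rightEnd = u ∧ curv f .L (-u) < Q (-u)) :
    u ∈ leftTail (V'.1.leftForce f ε) V'.1.leftEnd := by
  have hF : ∀ s : ℝ, s < V'.1.leftEnd → curv f .L (-s) < Q (-s) → 0 < V'.1.leftForce f ε s :=
    fun s h1 h2 => by
      rw [hQ.wave.leftForce h hε hV hl h1]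
      refine sub_pos.2 ?_
      simpa [curv, Side.coord] using h2
  have hpos : ∀ s : ℝ, V.1.rightEnd < s → s < V'.1.leftEnd → curv f .L (-s) < Q (-s) :=
    fun s h1 h2 => hQ.pos (-s) (by simpa [FreeVertex.outEnd] using h2)
      (by simpa [FreeVertex.inEnd] using h1)
  rcases hu' with hu' | ⟨heq, hlt⟩
  · exact BellmanFoliation.mem_leftTail hu hu' fun s h1 h2 => hF s h2 (hpos s h1 h2)
  · obtain ⟨δ, hδ, hb⟩ := exists_gt_of_lt_at (continuous_curv h.cont .L)
      (hQ.wave.solves h hε).continuous hlt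
    refine BellmanFoliation.mem_leftTail hu
      (EReal.coe_lt_coe_iff.2 (by linarith : u - δ < u)) fun s h1 h2 => hF s h2 ?_
    rcases lt_or_ge u s with h3 | h3
    · refine hpos s ?_ h2
      rw [heq]
      exact EReal.coe_lt_coe_iff.2 h3
    · exact hb (-s) ⟨by linarith, by linarith [EReal.coe_lt_coe_iff.1 h1]⟩

/-- A row of linked vertices is the row of free vertices of a smooth graph. -/
lemma exists_graph_of_links {f : ℝ → ℝ} {εinf ε : ℝ} (h : TameDatum f εinf) (hε : ε ∈ Ioo 0 εinf)
    {n : ℕ} (W : Fin (n + 1) → LabelledVertex) (hW : ∀ i, VertexOK f ε (W i))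
    (hlink : ∀ i : Fin n, Link f ε (W i.castSucc) (W i.succ)) (h0 : (W 0).1.leftEnd = ⊥)
    (hn : (W (Fin.last n)).1.rightEnd = ⊤) :
    ∃ Γ : FoliationGraph, List.ofFn Γ.vertex = List.ofFn (fun i => (W i).1) ∧
      Γ.Admissible f ε ∧ Γ.Smooth ε ∧ Γ.NonDegenerateForces f ε ∧ Γ.LeafRoot f ∧
      Γ.AnglesInTails f ε := by
  choose s Q hE using fun i => (hlink i).exists_edgeFlow
  refine ⟨⟨n, fun i => (W i).1, fun i => ⟨s i, (W i.castSucc).1.rightEnd, (W i.succ).1.leftEnd⟩⟩,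
    rfl, ⟨⟨h0, hn, fun i => ⟨rfl, rfl, ?_, ?_, ?_⟩⟩, fun i => (hW i).admissible,
      fun i => slopeOf f (s i) ε (Q i), fun i => ⟨?_, ?_, ?_, fun j hj w hw => ?_⟩⟩,
    fun i => (hW i).smooth, fun i u h1 h2 => ?_, fun i => (hW i).leafRoot, fun i w hw => ?_⟩
  · rcases hs : s i with _ | _
    · exact ((hE i).right hs).1.lt
    · exact EReal.neg_lt_neg_iff.1 ((hE i).left hs).1.lt
  · show (s i) = (W i.castSucc).1.rightDir
    rcases hs : s i with _ | _
    · exact ((hE i).right hs).1.out_dir.symm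
    · exact ((hE i).left hs).1.in_dir.symm
  · show (s i) = (W i.succ).1.leftDir
    rcases hs : s i with _ | _
    · exact ((hE i).right hs).1.in_dir.symm
    · exact ((hE i).left hs).1.out_dir.symm
  · show FoliationGraph.IsSlope f ε ⟨s i, (W i.castSucc).1.rightEnd, (W i.succ).1.leftEnd⟩
      (slopeOf f (s i) ε (Q i))
    rcases hs : s i with _ | _
    · exact ((hE i).right hs).1.isSlope_R h hε (hW _).admissible
    · exact ((hE i).left hs).1.isSlope_L h hε (hW _).admissible
  · show (W i.castSucc).1.Glues f ε (s i) (slopeOf f (s i) ε (Q i)) (W i.castSucc).1.rightEnd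
    rcases hs : s i with _ | _
    · exact (((hE i).right hs).1.glues_R (hW _).admissible (hW _).admissible (hW _).label
        (hW _).label).1
    · exact (((hE i).left hs).1.glues_L (hW _).admissible (hW _).admissible (hW _).label
        (hW _).label).1
  · show (W i.succ).1.Glues f ε (s i) (slopeOf f (s i) ε (Q i)) (W i.succ).1.leftEnd
    rcases hs : s i with _ | _
    · exact (((hE i).right hs).1.glues_R (hW _).admissible (hW _).admissible (hW _).label
        (hW _).label).2
    · exact (((hE i).left hs).1.glues_L (hW _).admissible (hW _).admissible (hW _).label
        (hW _).label).2
  -- An angle forces a right domain before it and a left domain after it. Both waves take the label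
  -- of the angle as value there, so the terms with ε cancel in the sum of the slopes.
  · have hij : i.succ = j.castSucc := Fin.ext (by simp [hj])
    have hi : s i = .R := by
      rcases hs : s i with _ | _
      · rfl
      · have h1 : (W i.succ).1.leftDir = .L := ((hE i).left hs).1.out_dir
        have h2 : (W i.succ).1 = .angle w := hw
        rw [h2] at h1
        simp [FreeVertex.leftDir] at h1
    have hj' : s j = .L := by
      rcases hs : s j with _ | _
      · have h1 : (W j.castSucc).1.rightDir = .R := ((hE j).right hs).1.out_dir
        have h2 : (W i.succ).1 = .angle w := hw
        rw [← hij, h2] at h1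
        simp [FreeVertex.rightDir] at h1
      · rfl
    have h1 := ((hE i).right hi).1.val w (by
      have h2 : (W i.succ).1 = .angle w := hw
      rw [h2]; rfl)
    have h2 := ((hE j).left hj').1.val (-w) (by
      have h2 : (W i.succ).1 = .angle w := hw
      rw [← hij, h2]; rfl)
    rw [← hij] at h2
    show slopeOf f (s i) ε (Q i) w + slopeOf f (s j) ε (Q j) w = _
    rw [hi, hj']
    simp only [slopeOf]
    rw [h1, h2]
    ring
  · show u ∈ (match s i with
      | .R => rightTail ((W i.castSucc).1.rightForce f ε) (W i.castSucc).1.rightEnd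
      | .L => leftTail ((W i.succ).1.leftForce f ε) (W i.succ).1.leftEnd)
    rcases hs : s i with _ | _
    · exact ((hE i).right hs).1.mem_rightTail h hε (hW _).admissible (hW _).label h1 (Or.inl h2)
    · exact ((hE i).left hs).1.mem_leftTail h hε (hW _).admissible (hW _).label h2 (Or.inl h1)
  · show w ∈ (match s i with
      | .R => rightTail ((W i.castSucc).1.rightForce f ε) (W i.castSucc).1.rightEnd
      | .L => leftTail ((W i.succ).1.leftForce f ε) (W i.succ).1.leftEnd)
    have hw' : (W i.castSucc).1 = .angle w ∨ (W i.succ).1 = .angle w := hw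
    rcases hs : s i with _ | _
    · obtain ⟨h1, h2⟩ := (hE i).right hs
      have hw1 : (W i.succ).1 = .angle w := hw'.resolve_left fun h3 => by
        have h4 : (W i.castSucc).1.rightDir = .R := h1.out_dir
        rw [h3] at h4
        simp [FreeVertex.rightDir] at h4
      have h5 : (W i.succ).1.leftEnd = w := by rw [hw1]; rfl
      exact h1.mem_rightTail h hε (hW _).admissible (hW _).label
        (h5 ▸ (h1.lt : (W i.castSucc).1.rightEnd < (W i.succ).1.leftEnd)) (Or.inr ⟨h5, h2 w hw1⟩)
    · obtain ⟨h1, h2⟩ := (hE i).left hs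
      have hw1 : (W i.castSucc).1 = .angle w := hw'.resolve_right fun h3 => by
        have h4 : (W i.succ).1.leftDir = .L := h1.out_dir
        rw [h3] at h4
        simp [FreeVertex.leftDir] at h4
      have h5 : (W i.castSucc).1.rightEnd = w := by rw [hw1]; rfl
      exact h1.mem_leftTail h hε (hW _).admissible (hW _).label
        (h5 ▸ EReal.neg_lt_neg_iff.1 h1.lt) (Or.inr ⟨h5, h2 w hw1⟩)

lemma exists_graph_of_chain {f : ℝ → ℝ} {εinf ε : ℝ} (h : TameDatum f εinf) (hε : ε ∈ Ioo 0 εinf)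
    {l : List LabelledVertex} (hW : ∀ V ∈ l, VertexOK f ε V) (hlink : l.IsChain (Link f ε))
    (h0 : ∃ V, l.head? = some V ∧ V.1.leftEnd = ⊥)
    (hn : ∃ V, l.getLast? = some V ∧ V.1.rightEnd = ⊤) :
    ∃ Γ : FoliationGraph, List.ofFn Γ.vertex = l.map Prod.fst ∧
      Γ.Admissible f ε ∧ Γ.Smooth ε ∧ Γ.NonDegenerateForces f ε ∧ Γ.LeafRoot f ∧
      Γ.AnglesInTails f ε := by
  obtain ⟨n, hlen⟩ : ∃ n, l.length = n + 1 := by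
    refine ⟨l.length - 1, ?_⟩
    obtain ⟨V, hV, -⟩ := h0
    have : l ≠ [] := by rintro rfl; simp at hV
    have := List.length_pos_iff.2 this
    omega
  obtain ⟨W, rfl⟩ : ∃ W : Fin (n + 1) → LabelledVertex, l = List.ofFn W :=
    ⟨fun i => l.get (i.cast hlen.symm), by
      refine List.ext_get (by simp [hlen]) fun i h1 h2 => by simp [-List.ofFn_succ]⟩
  obtain ⟨V, hV, hV'⟩ := h0
  obtain ⟨U, hU, hU'⟩ := hn
  have h1 : W 0 = V := by simpa [List.head?_eq_getElem?] using hV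
  have h2 : W (Fin.last n) = U := by
    have : (List.ofFn W).getLast? = some (W (Fin.last n)) := by
      simp [List.getLast?_eq_getElem?, Fin.last, -List.ofFn_succ]
    rw [this] at hU
    exact Option.some.inj hU
  have h3 := List.isChain_ofFn.1 hlink
  obtain ⟨Γ, hΓ, h4⟩ := exists_graph_of_links h hε W (fun i => hW _ (List.mem_ofFn.2 ⟨i, rfl⟩))
    (fun i => h3 i (by omega)) (h1 ▸ hV') (h2 ▸ hU')
  exact ⟨Γ, by rw [hΓ, List.map_ofFn]; rfl, h4⟩

/-! ### From slopes to flows -/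

lemma eq_of_hasDerivAt_zero {D : ℝ → ℝ} {x y : ℝ} (hxy : x ≤ y) (hc : ContinuousOn D (Icc x y))
    (hd : ∀ t ∈ Ioo x y, HasDerivAt D 0 t) : D x = D y := by
  have h1 : MonotoneOn D (Icc x y) := monotoneOn_of_hasDerivWithinAt_nonneg (f' := fun _ => 0)
    (convex_Icc x y) hc
    (fun t ht => (hd t (by rwa [interior_Icc] at ht)).hasDerivWithinAt) fun _ _ => le_rfl
  have h2 : AntitoneOn D (Icc x y) := antitoneOn_of_hasDerivWithinAt_nonpos (f' := fun _ => 0)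
    (convex_Icc x y) hc
    (fun t ht => (hd t (by rwa [interior_Icc] at ht)).hasDerivWithinAt) fun _ _ => le_rfl
  exact le_antisymm (h1 (left_mem_Icc.2 hxy) (right_mem_Icc.2 hxy) hxy)
    (h2 (left_mem_Icc.2 hxy) (right_mem_Icc.2 hxy) hxy)

/-- The given m and the slope of the wave starting at V solve the same linear equation and agree at
V by gluing; if the tangents come from -∞, both are given by the explicit integral. Uniqueness is
proved on the interval itself, since nothing is known about m outside. -/
lemma isSlope_R_eq {f : ℝ → ℝ} {εinf ε : ℝ} (h : TameDatum f εinf) (hε : ε ∈ Ioo 0 εinf)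
    {V : LabelledVertex} (hV : V.1.Admissible f ε) (hl : LabelOK f V) {ur : EReal} {m : ℝ → ℝ}
    (hang : ∀ w, V.1 ≠ .angle w) (hlt : V.1.rightEnd < ur)
    (hm : FoliationGraph.IsSlope f ε ⟨.R, V.1.rightEnd, ur⟩ m)
    (hglue : V.1.Glues f ε .R m V.1.rightEnd) :
    ∃ Q, IsWave f .R ε V Q ∧ ∀ u : ℝ, V.1.rightEnd ≤ u → u ≤ ur → m u = slopeOf f .R ε Q u := by
  obtain ⟨hc, hode, hinf⟩ := hm
  rcases hb : V.1.base with _ | p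
  · refine ⟨waveInf (curv f .R) ε, ⟨fun p hp => by simp [hb] at hp, fun _ => rfl⟩, fun u h1 h2 => ?_⟩
    rcases FreeVertex.ends_of_base_none hb with ⟨w, hw⟩ | ⟨-, hbot | htop⟩
    · exact absurd hw (hang w)
    · rw [hinf hbot u h2, h.integral_R hε, slopeOf]
    · exact absurd hlt (htop ▸ not_top_lt)
  · have hr := EReal.coe_toReal (ne_top_of_lt hlt) (hV.rightEnd_ne_bot hb)
    set x := V.1.rightEnd.toReal with hx
    set Q := wave (curv f .R) ε x V.2 with hQ
    have hs : Solves (curv f .R) ε Q := wave_solves (continuous_curv h.cont .R) _ _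
    refine ⟨Q, ⟨fun p' hp' => ⟨hs, fun y hy => ?_⟩, fun hn => by simp [hb] at hn⟩, fun u h1 h2 => ?_⟩
    · have : y = x := EReal.coe_eq_coe_iff.1 (hr.trans hy).symm
      rw [this, hQ, wave_self]
    · have hxu : x ≤ u := by rw [← hr] at h1; exact EReal.coe_le_coe_iff.1 h1
      have hd := hasDerivAt_slopeOf_R h.reg.1 hε.1 hs
      have h3 := eq_of_hasDerivAt_zero (D := fun t => Real.exp (t / ε) *
        (m t - slopeOf f .R ε Q t)) hxu ?_ fun t ht => ?_
      · have h4 : m x = slopeOf f .R ε Q x := by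
          simp only [FreeVertex.Glues, hb] at hglue
          rw [hglue, slopeOf, hQ, wave_self, ← hl p hb]
        simp only [h4, sub_self, mul_zero] at h3
        exact sub_eq_zero.1 ((mul_eq_zero.1 h3.symm).resolve_left (Real.exp_pos _).ne')
      · refine (by fun_prop : Continuous fun t : ℝ => Real.exp (t / ε)).continuousOn.mul
          (ContinuousOn.sub (hc.mono fun t ht => ⟨?_, ?_⟩)
            fun t _ => (hd t).continuousAt.continuousWithinAt)
        · exact hr.symm.le.trans (EReal.coe_le_coe_iff.2 ht.1)
        · exact (EReal.coe_le_coe_iff.2 ht.2).trans h2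
      · have h5 := (hode t (hr.symm.trans_lt (EReal.coe_lt_coe_iff.2 ht.1))
          ((EReal.coe_lt_coe_iff.2 ht.2).trans_le h2)).1
        refine ((hasDerivAt_exp_div ε t).mul (h5.sub (hd t))).congr_deriv ?_
        simp only [slopeOf, Pi.sub_apply]
        have := hε.1.ne'
        field_simp
        ring

lemma isSlope_L_eq {f : ℝ → ℝ} {εinf ε : ℝ} (h : TameDatum f εinf) (hε : ε ∈ Ioo 0 εinf)
    {V : LabelledVertex} (hV : V.1.Admissible f ε) (hl : LabelOK f V) {ul : EReal} {m : ℝ → ℝ}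
    (hang : ∀ w, V.1 ≠ .angle w) (hlt : ul < V.1.leftEnd)
    (hm : FoliationGraph.IsSlope f ε ⟨.L, ul, V.1.leftEnd⟩ m)
    (hglue : V.1.Glues f ε .L m V.1.leftEnd) :
    ∃ Q, IsWave f .L ε V Q ∧ ∀ u : ℝ, ul ≤ u → u ≤ V.1.leftEnd → m u = slopeOf f .L ε Q u := by
  obtain ⟨hc, hode, hinf⟩ := hm
  rcases hb : V.1.base with _ | p
  · refine ⟨waveInf (curv f .L) ε, ⟨fun p hp => by simp [hb] at hp, fun _ => rfl⟩, fun u h1 h2 => ?_⟩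
    rcases FreeVertex.ends_of_base_none hb with ⟨w, hw⟩ | ⟨hbot | htop, -⟩
    · exact absurd hw (hang w)
    · exact absurd hlt (hbot ▸ not_lt_bot)
    · rw [hinf htop u h1, h.integral_L hε, slopeOf]
  · have hr := EReal.coe_toReal (hV.leftEnd_ne_top hb) (ne_bot_of_gt hlt)
    set x := V.1.leftEnd.toReal with hx
    set Q := wave (curv f .L) ε (-x) V.2 with hQ
    have hs : Solves (curv f .L) ε Q := wave_solves (continuous_curv h.cont .L) _ _
    refine ⟨Q, ⟨fun p' hp' => ⟨hs, fun y hy => ?_⟩, fun hn => by simp [hb] at hn⟩, fun u h1 h2 => ?_⟩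
    · have : y = -x := by
        have h3 : ((-x : ℝ) : EReal) = y := by rw [EReal.coe_neg, hr]; exact hy
        exact (EReal.coe_eq_coe_iff.1 h3).symm
      rw [this, hQ, wave_self]
    · have hxu : u ≤ x := by rw [← hr] at h2; exact EReal.coe_le_coe_iff.1 h2
      have hd := hasDerivAt_slopeOf_L h.reg.1 hε.1 hs
      have h3 := eq_of_hasDerivAt_zero (D := fun t => Real.exp (-t / ε) *
        (m t - slopeOf f .L ε Q t)) hxu ?_ fun t ht => ?_
      · have h4 : m x = slopeOf f .L ε Q x := by
          simp only [FreeVertex.Glues, hb] at hglue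
          rw [hglue, slopeOf, hQ, wave_self, ← hl p hb]
        simp only [h4, sub_self, mul_zero] at h3
        exact sub_eq_zero.1 ((mul_eq_zero.1 h3).resolve_left (Real.exp_pos _).ne')
      · refine (by fun_prop : Continuous fun t : ℝ => Real.exp (-t / ε)).continuousOn.mul
          (ContinuousOn.sub (hc.mono fun t ht => ⟨?_, ?_⟩)
            fun t _ => (hd t).continuousAt.continuousWithinAt)
        · exact h1.trans (EReal.coe_le_coe_iff.2 ht.1)
        · exact (EReal.coe_le_coe_iff.2 ht.2).trans hr.le
      · have h5 := (hode t (h1.trans_lt (EReal.coe_lt_coe_iff.2 ht.1))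
          ((EReal.coe_lt_coe_iff.2 ht.2).trans_le hr.le)).1
        refine ((hasDerivAt_exp_neg_div ε t).mul (h5.sub (hd t))).congr_deriv ?_
        simp only [slopeOf, Pi.sub_apply]
        have := hε.1.ne'
        field_simp
        ring

lemma eventually_between {x y : EReal} {u : ℝ} (h1 : x < u) (h2 : (u : EReal) < y) :
    ∀ᶠ t : ℝ in 𝓝 u, x < t ∧ (t : EReal) < y :=
  (continuous_coe_real_ereal.continuousAt.eventually_const_lt h1).and
    (continuous_coe_real_ereal.continuousAt.eventually_lt_const h2)

/-- The flows of an admissible graph, with labels on its vertices. -/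
lemma FoliationGraph.Admissible.exists_flows {f : ℝ → ℝ} {εinf ε : ℝ} (h : TameDatum f εinf)
    (hε : ε ∈ Ioo 0 εinf) {Γ : FoliationGraph} (hΓ : Γ.Admissible f ε) :
    ∃ (lab : Fin (Γ.n + 1) → ℝ) (Q : Fin Γ.n → ℝ → ℝ), (∀ i, LabelOK f (Γ.vertex i, lab i)) ∧
      ∀ i : Fin Γ.n,
        ((Γ.edge i).dir = .R → FlowsVia f .R ε (Γ.vertex i.castSucc, lab i.castSucc)
          (Γ.vertex i.succ, lab i.succ) (Q i)) ∧
        ((Γ.edge i).dir = .L → FlowsVia f .L ε (Γ.vertex i.succ, lab i.succ)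
          (Γ.vertex i.castSucc, lab i.castSucc) (Q i)) := by
  classical
  obtain ⟨⟨hw0, hwn, hwf⟩, hadm, m, hm⟩ := hΓ
  -- the label at an angle is read off from the tangents on its left
  set lab : Fin (Γ.n + 1) → ℝ := fun i =>
    match (Γ.vertex i).base with
    | some p => av (deriv (deriv f)) p.1 p.2
    | none => if hi : i ≠ 0 then
        (deriv f (Γ.vertex i).leftEnd.toReal - m (i.pred hi) (Γ.vertex i).leftEnd.toReal) / ε
      else 0 with hlab
  have hlok : ∀ i, LabelOK f (Γ.vertex i, lab i) := fun i p hp => by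
    have hp' : (Γ.vertex i).base = some p := hp
    simp only [hlab, hp']
  have key : ∀ i : Fin Γ.n, ∃ Q : ℝ → ℝ,
      ((Γ.edge i).dir = .R → FlowsVia f .R ε (Γ.vertex i.castSucc, lab i.castSucc)
          (Γ.vertex i.succ, lab i.succ) Q) ∧
        ((Γ.edge i).dir = .L → FlowsVia f .L ε (Γ.vertex i.succ, lab i.succ)
          (Γ.vertex i.castSucc, lab i.castSucc) Q) := fun i => by
    obtain ⟨hul, hur, hlt, hdr, hdl⟩ := hwf i
    obtain ⟨hslope, hg1, hg2, hang⟩ := hm i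
    rw [hul, hur] at hlt
    rcases hdir : (Γ.edge i).dir with _ | _
    · rw [hdir] at hg1 hg2 hdr hdl
      have hslope' : IsSlope f ε ⟨.R, (Γ.vertex i.castSucc).rightEnd, (Γ.vertex i.succ).leftEnd⟩
          (m i) := by
        rw [← hul, ← hur, ← hdir]; exact hslope
      rw [hul] at hg1
      rw [hur] at hg2
      obtain ⟨Q, hQ, heq⟩ := isSlope_R_eq h hε (V := (Γ.vertex i.castSucc, lab i.castSucc))
        (hadm _) (hlok _) (fun w hw => by
          have hw' : Γ.vertex i.castSucc = .angle w := hw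
          rw [hw'] at hdr
          simp [FreeVertex.rightDir] at hdr) hlt hslope' hg1
      refine ⟨Q, fun _ => ⟨hdr.symm, hdl.symm, hlt, hQ, fun u h1 h2 => ?_, fun x hx => ?_⟩,
        fun hc => by simp at hc⟩
      · have h3 := (hslope'.2.1 u h1 h2).2
        rw [deriv_deriv_neg_of_eventuallyEq_R h.reg.1 hε.1 (hQ.solves h hε)
          ((eventually_between h1 h2).mono fun t ht => heq t ht.1.le ht.2.le)] at h3
        exact sub_neg.1 ((div_neg_iff.1 h3).resolve_left fun h4 => h4.2.not_gt hε.1).1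
      · have hx' : (Γ.vertex i.succ).leftEnd = x := hx
        have h3 := heq x (hx' ▸ hlt.le) hx'.ge
        rw [slopeOf] at h3
        rcases hb : (Γ.vertex i.succ).base with _ | p
        · simp only [hlab, hb]
          rw [dif_pos (Fin.succ_ne_zero i), Fin.pred_succ, hx', EReal.toReal_coe, h3]
          have := hε.1.ne'
          field_simp
          ring
        · simp only [FreeVertex.Glues, hb] at hg2
          rw [hx', EReal.toReal_coe, h3] at hg2
          have h4 := hlok i.succ p hb
          rw [h4]
          have := hε.1.ne'
          exact mul_left_cancel₀ this (by linarith)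
    · rw [hdir] at hg1 hg2 hdr hdl
      have hslope' : IsSlope f ε ⟨.L, (Γ.vertex i.castSucc).rightEnd, (Γ.vertex i.succ).leftEnd⟩
          (m i) := by
        rw [← hul, ← hur, ← hdir]; exact hslope
      rw [hul] at hg1
      rw [hur] at hg2
      obtain ⟨Q, hQ, heq⟩ := isSlope_L_eq h hε (V := (Γ.vertex i.succ, lab i.succ))
        (hadm _) (hlok _) (fun w hw => by
          have hw' : Γ.vertex i.succ = .angle w := hw
          rw [hw'] at hdl
          simp [FreeVertex.leftDir] at hdl) hlt hslope' hg2
      refine ⟨Q, fun hc => by simp at hc, fun _ => ⟨hdl.symm, hdr.symm,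
        EReal.neg_lt_neg_iff.2 hlt, hQ, fun z h1 h2 => ?_, fun x hx => ?_⟩⟩
      · have h1' : ((-z : ℝ) : EReal) < (Γ.vertex i.succ).leftEnd := by
          rw [EReal.coe_neg]
          exact EReal.neg_lt_comm.1 h1
        have h2' : (Γ.vertex i.castSucc).rightEnd < ((-z : ℝ) : EReal) := by
          rw [EReal.coe_neg]
          exact EReal.lt_neg_comm.1 h2
        have h3 := (hslope'.2.1 (-z) h2' h1').2
        rw [deriv_deriv_neg_of_eventuallyEq_L h.reg.1 hε.1 (hQ.solves h hε)
          ((eventually_between h2' h1').mono fun t ht => heq t ht.1.le ht.2.le), neg_neg] at h3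
        exact sub_pos.1 ((div_pos_iff.1 h3).resolve_right fun h4 => h4.2.not_gt hε.1).1
      · have hx' : (Γ.vertex i.castSucc).rightEnd = ((-x : ℝ) : EReal) := by
          have h4 : -(Γ.vertex i.castSucc).rightEnd = x := hx
          rw [EReal.coe_neg, ← h4, neg_neg]
        have h3 := heq (-x) hx'.le (hx' ▸ hlt.le)
        rw [slopeOf, neg_neg] at h3
        rcases hb : (Γ.vertex i.castSucc).base with _ | p
        · rcases FreeVertex.ends_of_base_none hb with ⟨w, hw⟩ | ⟨-, hbot | htop⟩
          · have hwx : w = -x := by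
              rw [hw] at hx'
              exact EReal.coe_eq_coe_iff.1 hx'
            have hi0 : i.castSucc ≠ 0 := fun h0 => by
              rw [h0] at hw
              rw [hw] at hw0
              exact EReal.coe_ne_bot _ hw0
            -- The label of the angle was defined through the edge i - 1 on its left; the angle
            -- condition transfers this value to the wave on its right.
            obtain ⟨-, -, -, hang'⟩ := hm ⟨i - 1, by omega⟩
            have hi1 : 1 ≤ (i : ℕ) := by
              rcases Nat.eq_zero_or_pos (i : ℕ) with h5 | h5
              · exact absurd (Fin.ext (by simpa using h5)) hi0
              · exact h5
            have hsucc : (⟨i - 1, by omega⟩ : Fin Γ.n).succ = i.castSucc := Fin.ext (by simp; omega)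
            have h6 := hang' i (by simp; omega) w (by rw [hsucc]; exact hw)
            have hpred : i.castSucc.pred hi0 = ⟨i - 1, by omega⟩ := Fin.ext (by simp)
            simp only [hlab, hb]
            rw [dif_pos hi0, hpred, hw]
            simp only [FreeVertex.leftEnd, EReal.toReal_coe]
            rw [hwx] at h6 ⊢
            rw [h3] at h6
            have := hε.1.ne'
            rw [eq_div_iff this]
            linarith
          · rw [hbot] at hx'; exact absurd hx'.symm (EReal.coe_ne_bot _)
          · rw [htop] at hx'; exact absurd hx'.symm (EReal.coe_ne_top _)
        · simp only [FreeVertex.Glues, hb] at hg1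
          rw [hx', EReal.toReal_coe, h3] at hg1
          have h4 := hlok i.castSucc p hb
          rw [h4]
          have := hε.1.ne'
          exact mul_left_cancel₀ this (by linarith)
  choose Q hQ using key
  exact ⟨lab, Q, hlok, hQ⟩

/-! ### Trees below shrunk chords -/

lemma MultiBase.mono {f : ℝ → ℝ} {ε ε' : ℝ} (hle : ε ≤ ε') {k : ℕ} {arcs : Fin (k + 1) → Arc}
    (h : MultiBase f ε arcs) : MultiBase f ε' arcs := by
  obtain ⟨h1, h2, h3⟩ := h
  refine ⟨h1, fun i => ⟨(h2 i).1, (h2 i).2.trans ?_⟩, h3⟩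
  gcongr

lemma FixedTree.Admissible.mono {f : ℝ → ℝ} {ε ε' : ℝ} (hle : ε ≤ ε') {t : FixedTree}
    (h : t.Admissible f ε) : t.Admissible f ε' := by
  induction t with
  | cup d c => exact h
  | chord d a b t ih =>
    obtain ⟨h1, h2, h3, h4, h5, h6⟩ := h
    exact ⟨h1, h2, h3, h4, h5, ih h6⟩
  | closed d k arcs t ih =>
    obtain ⟨h1, h2, h3, h4, h5, h6, h7⟩ := h
    exact ⟨h1, h2.mono hle, h3, h4, by linarith, h6, fun i => ih i (h7 i)⟩

lemma FixedTree.Admissible.dom {f : ℝ → ℝ} {ε : ℝ} {t : FixedTree} (h : t.Admissible f ε) :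
    t.dom.Admissible f := by
  cases t <;> exact h.1

lemma FixedTree.dom_withDom (t : FixedTree) (d : ChordalDomain) : (t.withDom d).dom = d := by
  cases t <;> rfl

/-- What lies below sees its uppermost domain only through the lower chord of that domain. -/
lemma FixedTree.Admissible.withDom {f : ℝ → ℝ} {ε : ℝ} {t : FixedTree} (h : t.Admissible f ε)
    {d : ChordalDomain} (hd : d.Admissible f) (hbot : d.bot = t.dom.bot)
    (ha : d.a d.bot = t.dom.a t.dom.bot) (hb : d.b d.bot = t.dom.b t.dom.bot) :
    (t.withDom d).Admissible f ε := by
  have key : ∀ x y, t.dom.LowerChord x y → d.LowerChord x y := fun x y hxy =>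
    ⟨hbot.trans hxy.1, ha.trans hxy.2.1, hb.trans hxy.2.2⟩
  cases t with
  | cup d₀ c => exact ⟨hd, key _ _ h.2⟩
  | chord d₀ a b t =>
    obtain ⟨h1, h2, h3, h4⟩ := h
    exact ⟨hd, h2, key _ _ h3, h4⟩
  | closed d₀ k arcs t =>
    obtain ⟨h1, h2, h3, h4, h5⟩ := h
    exact ⟨hd, h2, h3, key _ _ h4, h5⟩

lemma FixedTree.leafRoot_withDom {f : ℝ → ℝ} (t : FixedTree) (d : ChordalDomain) :
    (t.withDom d).LeafRoot f ↔ t.LeafRoot f := by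
  cases t <;> rfl

lemma ChordalDomain.Admissible.withTop {f : ℝ → ℝ} {d : ChordalDomain} (h : d.Admissible f) {l : ℝ}
    (h1 : d.bot < l) (h2 : l ≤ d.top) : (d.withTop l).Admissible f := by
  obtain ⟨h0, hlt, hca, hcb, hlen, hdiff, hcup, hneg⟩ := h
  exact ⟨h0, h1, hca.mono (Icc_subset_Icc_right h2), hcb.mono (Icc_subset_Icc_right h2),
    fun x hx => hlen x ⟨hx.1, hx.2.trans h2⟩, fun x hx => hdiff x ⟨hx.1, hx.2.trans_le h2⟩,
    fun x hx => hcup x ⟨hx.1, hx.2.trans h2⟩, fun x hx => hneg x ⟨hx.1, hx.2.trans_le h2⟩⟩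

lemma FixedTree.Admissible.withTop {f : ℝ → ℝ} {ε : ℝ} {t : FixedTree} (h : t.Admissible f ε) {l : ℝ}
    (h1 : t.dom.bot < l) (h2 : l ≤ t.dom.top) : (t.withTop l).Admissible f ε :=
  h.withDom (h.dom.withTop h1 h2) rfl rfl rfl

lemma FixedTree.hangsAt_withTop {f : ℝ → ℝ} {ε : ℝ} {t : FixedTree} (h : t.Admissible f ε) {l : ℝ}
    (h1 : t.dom.bot < l) (h2 : l ≤ t.dom.top) : (t.withTop l).HangsAt (t.dom.a l) (t.dom.b l) := by
  rw [FixedTree.HangsAt, FixedTree.withTop, FixedTree.dom_withDom]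
  exact ⟨(h.dom.2.2.2.2.1 l ⟨h1.le, h2⟩).symm, rfl, rfl⟩

/-- The average of `f''` over the chord of length `l` of a chordal domain. -/
def ChordalDomain.lam (f : ℝ → ℝ) (d : ChordalDomain) (l : ℝ) : ℝ :=
  av (deriv (deriv f)) (d.a l) (d.b l)

/-- The coordinate at which tangents of orientation `s` come to the chord of length `l`. -/
def ChordalDomain.enter (s : Side) (d : ChordalDomain) (l : ℝ) : ℝ :=
  match s with
  | .R => d.a l
  | .L => -d.b l

/-- The coordinate from which tangents of orientation `s` leave the chord of length `l`. -/
def ChordalDomain.leave (s : Side) (d : ChordalDomain) (l : ℝ) : ℝ :=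
  match s with
  | .R => d.b l
  | .L => -d.a l

lemma ChordalDomain.Admissible.sideFlow {f : ℝ → ℝ} (hf : ContDiff ℝ 2 f) {d : ChordalDomain}
    (hd : d.Admissible f) (s : Side) {bot : ℝ} (h0 : 0 < bot) (h1 : d.bot ≤ bot) (h2 : bot < d.top) :
    Flow (curv f s) (d.enter s) (d.leave s) (d.lam f) bot d.top := by
  cases s
  · exact hd.flow hf h0 h1 h2
  · exact (hd.flow hf h0 h1 h2).reflect

/-- A length between those of the lower and of the upper chord. -/
def ChordalDomain.mid (d : ChordalDomain) : ℝ := (d.bot + d.top) / 2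

/-- For a short time the lengths stay near the upper chord; using only the upper half of the domain
keeps them positive, also in a cup. -/
lemma ChordalDomain.Admissible.midFlow {f : ℝ → ℝ} (hf : ContDiff ℝ 2 f) {d : ChordalDomain}
    (hd : d.Admissible f) (s : Side) :
    Flow (curv f s) (d.enter s) (d.leave s) (d.lam f) d.mid d.top := by
  have h0 := hd.1
  have h1 := hd.2.1
  exact hd.sideFlow hf s (by rw [ChordalDomain.mid]; linarith) (by rw [ChordalDomain.mid]; linarith)
    (by rw [ChordalDomain.mid]; linarith)

/-- The trolleybus over the chord of length `l`, with its label. -/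
def labelledTrolleybus (f : ℝ → ℝ) (s : Side) (t : FixedTree) (l : ℝ) : LabelledVertex :=
  (shrunkTrolleybus s t l, t.dom.lam f l)

/-- The birdie over the chord of length `l`, with its label. -/
def labelledBirdie (f : ℝ → ℝ) (t : FixedTree) (l : ℝ) : LabelledVertex :=
  (shrunkBirdie t l, t.dom.lam f l)

lemma outEnd_shrunkTrolleybus (s s' : Side) (t : FixedTree) (l : ℝ) :
    (shrunkTrolleybus s' t l).outEnd s = t.dom.leave s l := by
  cases s <;> simp [shrunkTrolleybus, FreeVertex.outEnd, FreeVertex.rightEnd, FreeVertex.leftEnd,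
    ChordalDomain.leave]

lemma inEnd_shrunkTrolleybus (s s' : Side) (t : FixedTree) (l : ℝ) :
    (shrunkTrolleybus s' t l).inEnd s = t.dom.enter s l := by
  cases s <;> simp [shrunkTrolleybus, FreeVertex.inEnd, FreeVertex.rightEnd, FreeVertex.leftEnd,
    ChordalDomain.enter]

lemma inEnd_shrunkBirdie (s : Side) (t : FixedTree) (l : ℝ) :
    (shrunkBirdie t l).inEnd s = t.dom.enter s l := by
  cases s <;> simp [shrunkBirdie, FreeVertex.inEnd, FreeVertex.rightEnd, FreeVertex.leftEnd,
    ChordalDomain.enter]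

lemma vertexOK_labelledTrolleybus {f : ℝ → ℝ} {ε η₁ : ℝ} (hε : η₁ < ε) {t : FixedTree}
    (h : t.Admissible f η₁) (hl : t.LeafRoot f) (s : Side) {l : ℝ} (h1 : t.dom.bot < l)
    (h2 : l ≤ t.dom.top) (h3 : t.dom.top ≤ 2 * η₁) : VertexOK f ε (labelledTrolleybus f s t l) := by
  have hlen := h.dom.2.2.2.2.1 l ⟨h1.le, h2⟩
  have h0 := h.dom.1
  refine ⟨⟨by linarith, by linarith, FixedTree.hangsAt_withTop h h1 h2, (h.withTop h1 h2).mono hε.le⟩,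
    trivial, (t.leafRoot_withDom _).2 hl, fun p hp => ?_⟩
  simp only [labelledTrolleybus, shrunkTrolleybus, FreeVertex.base, Option.some.injEq] at hp
  rw [← hp]
  rfl

lemma vertexOK_labelledBirdie {f : ℝ → ℝ} {ε η₁ : ℝ} (hε : η₁ < ε) {t : FixedTree}
    (h : t.Admissible f η₁) (hl : t.LeafRoot f) {l : ℝ} (h1 : t.dom.bot < l)
    (h2 : l ≤ t.dom.top) (h3 : t.dom.top ≤ 2 * η₁) : VertexOK f ε (labelledBirdie f t l) := by
  have hlen := h.dom.2.2.2.2.1 l ⟨h1.le, h2⟩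
  have h0 := h.dom.1
  refine ⟨⟨by linarith, by linarith, FixedTree.hangsAt_withTop h h1 h2, (h.withTop h1 h2).mono hε.le⟩,
    trivial, (t.leafRoot_withDom _).2 hl, fun p hp => ?_⟩
  simp only [labelledBirdie, shrunkBirdie, FreeVertex.base, Option.some.injEq] at hp
  rw [← hp]
  rfl

/-! ### Emitted tangents -/

/-- The tangents of orientation `s` described by `Q` that go out of `V` may be continued up to and
including the point `y`. -/
structure Reach (f : ℝ → ℝ) (s : Side) (ε : ℝ) (V : LabelledVertex) (Q : ℝ → ℝ) (y : ℝ) : Prop where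
  dir : V.1.outDir s = s
  wave : IsWave f s ε V Q
  lt : V.1.outEnd s < y
  pos : ∀ z : ℝ, V.1.outEnd s < z → z ≤ y → curv f s z < Q z

lemma Reach.extend {f : ℝ → ℝ} {s : Side} {ε : ℝ} {V : LabelledVertex} {Q : ℝ → ℝ} {y y' : ℝ}
    (h : Reach f s ε V Q y) (hy : y ≤ y') (hpos : ∀ z ∈ Icc y y', curv f s z < Q z) :
    Reach f s ε V Q y' :=
  ⟨h.dir, h.wave, h.lt.trans_le (EReal.coe_le_coe_iff.2 hy), fun z h1 h2 =>
    (le_total z y).elim (fun h3 => h.pos z h1 h3) fun h3 => hpos z ⟨h3, h2⟩⟩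

lemma Reach.restrict {f : ℝ → ℝ} {s : Side} {ε : ℝ} {V : LabelledVertex} {Q : ℝ → ℝ} {y y' : ℝ}
    (h : Reach f s ε V Q y) (hy : y' ≤ y) (hlt : V.1.outEnd s < y') : Reach f s ε V Q y' :=
  ⟨h.dir, h.wave, hlt, fun z h1 h2 => h.pos z h1 (h2.trans hy)⟩

lemma Reach.flows {f : ℝ → ℝ} {s : Side} {ε : ℝ} {V V' : LabelledVertex} {Q : ℝ → ℝ} {y : ℝ}
    (h : Reach f s ε V Q y) (hdir : V'.1.inDir s = s) (hin : V'.1.inEnd s = y) (hval : Q y = V'.2) :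
    Flows f s ε V V' := by
  refine ⟨Q, ⟨h.dir, hdir, hin ▸ h.lt, h.wave, fun z h1 h2 => ?_, fun x hx => ?_⟩, fun w hw => ?_⟩
  · rw [hin] at h2
    exact h.pos z h1 (EReal.coe_lt_coe_iff.1 h2).le
  · rw [hin] at hx
    rw [← EReal.coe_eq_coe_iff.1 hx, hval]
  · have : s.coord w = y := by
      rw [hw] at hin
      cases s
      · exact EReal.coe_eq_coe_iff.1 hin
      · refine EReal.coe_eq_coe_iff.1 ?_
        rw [← hin]
        simp [Side.coord, FreeVertex.inEnd, FreeVertex.rightEnd]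
    rw [this]
    exact h.pos y h.lt le_rfl

lemma reach_labelledTrolleybus {f : ℝ → ℝ} {s : Side} {ε : ℝ} {t : FixedTree} {l y : ℝ} {Q : ℝ → ℝ}
    (hQ : Solves (curv f s) ε Q) (hval : Q (t.dom.leave s l) = t.dom.lam f l)
    (hlt : t.dom.leave s l < y) (hpos : ∀ z ∈ Icc (t.dom.leave s l) y, curv f s z < Q z) :
    Reach f s ε (labelledTrolleybus f s t l) Q y := by
  have hend : (labelledTrolleybus f s t l).1.outEnd s = t.dom.leave s l :=
    outEnd_shrunkTrolleybus s s t l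
  refine ⟨by cases s <;> rfl, ⟨fun p _ => ⟨hQ, fun x hx => ?_⟩, fun hn => ?_⟩, ?_, fun z h1 h2 => ?_⟩
  · rw [hend] at hx
    rw [← EReal.coe_eq_coe_iff.1 hx, hval]
    rfl
  · simp [labelledTrolleybus, shrunkTrolleybus, FreeVertex.base] at hn
  · rw [hend]
    exact EReal.coe_lt_coe_iff.2 hlt
  · rw [hend] at h1
    exact hpos z ⟨(EReal.coe_lt_coe_iff.1 h1).le, h2⟩

/-- For each `ε ∈ (η₁, η]` the vertex `S ε` emits the tangents of orientation `s` described by `Q ε`,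
which reach the point `x` of the tangent domain that is described by `Q₀` at the time `η₁` and ends
at `e`. -/
structure Emission (f : ℝ → ℝ) (s : Side) (η₁ η : ℝ) (S : ℝ → LabelledVertex) (Q : ℝ → ℝ → ℝ) (x : ℝ)
    (e : EReal) (Q₀ : ℝ → ℝ) : Prop where
  init : Q η₁ = Q₀
  lt_end : x < e
  fam : Family (curv f s) η₁ η x Q
  pos_init : ∀ z : ℝ, x ≤ z → z < e → curv f s z < Q₀ z
  reach : ∀ ε ∈ Ioc η₁ η, Reach f s ε (S ε) (Q ε) x

namespace Emission

variable {f : ℝ → ℝ} {s : Side} {η₁ η η' x y : ℝ} {S : ℝ → LabelledVertex} {Q : ℝ → ℝ → ℝ} {e : EReal}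
  {Q₀ : ℝ → ℝ}

lemma mono (h : Emission f s η₁ η S Q x e Q₀) (hη : η' ≤ η) : Emission f s η₁ η' S Q x e Q₀ :=
  ⟨h.init, h.lt_end, h.fam.restrict hη, h.pos_init, fun ε hε => h.reach ε ⟨hε.1, hε.2.trans hη⟩⟩

lemma family_at (h : Emission f s η₁ η S Q x e Q₀) (hη₁ : 0 < η₁) (hxy : x ≤ y) (hy : y ≤ e) :
    Family (curv f s) η₁ η y Q :=
  h.fam.advance hη₁ hxy fun z hz => by
    rw [h.init]
    exact (h.pos_init z hz.1.le ((EReal.coe_lt_coe_iff.2 hz.2).trans_le hy)).le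

lemma le_at (h : Emission f s η₁ η S Q x e Q₀) (hG : Continuous (curv f s)) (hη : η₁ < η)
    (hxy : x < y) (hy : y ≤ e) : curv f s y ≤ Q₀ y := by
  have hQ : Continuous Q₀ := h.init ▸ (h.fam.solves η₁ (left_mem_Icc.2 hη.le)).continuous
  refine le_of_tendsto_of_tendsto (hG.continuousAt.mono_left nhdsWithin_le_nhds)
    (hQ.continuousAt.mono_left nhdsWithin_le_nhds) (b := 𝓝[<] y) ?_
  filter_upwards [Ioo_mem_nhdsLT hxy] with z hz
  exact (h.pos_init z hz.1.le ((EReal.coe_lt_coe_iff.2 hz.2).trans_le hy)).le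

/-- At the end of the old domain the old wave may touch f'', since m'' < 0 is assumed in the
interior only. The limit gives ≤ for the old wave, and the new wave is strictly larger, hence
strictly above f'' up to the end and at the end. -/
lemma reach_at (h : Emission f s η₁ η S Q x e Q₀) (hG : Continuous (curv f s)) (hη₁ : 0 < η₁)
    (hxy : x < y) (hy : y ≤ e) {ε : ℝ} (hε : ε ∈ Ioc η₁ η) : Reach f s ε (S ε) (Q ε) y := by
  refine (h.reach ε hε).extend hxy.le fun z hz => ?_
  have h1 : (z : EReal) ≤ e := (EReal.coe_le_coe_iff.2 hz.2).trans hy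
  have h2 : Q η₁ z < Q ε z := h.fam.gt hη₁ (y := y) (fun w hw => by
    rw [h.init]
    exact (h.pos_init w hw.1.le ((EReal.coe_lt_coe_iff.2 hw.2).trans_le hy)).le) hε hz
  refine lt_of_le_of_lt ?_ h2
  rw [h.init]
  rcases hz.1.eq_or_lt with rfl | hlt
  · exact (h.pos_init _ le_rfl h.lt_end).le
  · exact h.le_at hG (hε.1.trans_le hε.2) hlt h1

end Emission

/-! ### Rows of trees -/

/-- The gaps between the arcs `[lo j, hi j]`, in the coordinate of the orientation `s`, carry the
trees `t i`. -/
structure TreeRow (f : ℝ → ℝ) (s : Side) (η₁ Lam : ℝ) {k : ℕ} (t : Fin k → FixedTree)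
    (lo hi : Fin (k + 1) → ℝ) : Prop where
  le : ∀ j, lo j ≤ hi j
  arc_le : ∀ j, ∀ z ∈ Icc (lo j) (hi j), curv f s z ≤ Lam
  arc_eq : ∀ j, lo j < hi j → ∀ z ∈ Icc (lo j) (hi j), curv f s z = Lam
  adm : ∀ i, (t i).Admissible f η₁
  leaf : ∀ i, (t i).LeafRoot f
  enter_top : ∀ i, (t i).dom.enter s (t i).dom.top = hi i.castSucc
  leave_top : ∀ i, (t i).dom.leave s (t i).dom.top = lo i.succ
  lam_top : ∀ i, (t i).dom.lam f (t i).dom.top = Lam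
  top_le : ∀ i, (t i).dom.top ≤ 2 * η₁

lemma TreeRow.isRow {f : ℝ → ℝ} (hf : ContDiff ℝ 2 f) {s : Side} {η₁ Lam : ℝ} {k : ℕ}
    {t : Fin k → FixedTree} {lo hi : Fin (k + 1) → ℝ} (h : TreeRow f s η₁ Lam t lo hi) :
    IsRow (curv f s) η₁ Lam lo hi (fun i => (t i).dom.enter s) (fun i => (t i).dom.leave s)
      (fun i => (t i).dom.lam f) (fun i => (t i).dom.mid) (fun i => (t i).dom.top) :=
  ⟨h.le, h.arc_le, h.arc_eq, fun i => (h.adm i).dom.midFlow hf s, h.enter_top, h.leave_top, h.lam_top,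
    h.top_le⟩

/-- Families of waves on the arcs of a row of trees. -/
abbrev TreeWaves (f : ℝ → ℝ) (s : Side) (η₁ η Lam : ℝ) {k : ℕ} (t : Fin k → FixedTree)
    (lo : Fin (k + 1) → ℝ) (ℓ : Fin k → ℝ → ℝ) (Q : Fin (k + 1) → ℝ → ℝ → ℝ) : Prop :=
  RowWaves (curv f s) η₁ η Lam lo (fun i => (t i).dom.enter s) (fun i => (t i).dom.leave s)
      (fun i => (t i).dom.lam f) (fun i => (t i).dom.mid) (fun i => (t i).dom.top) ℓ Q

/-- The source of the tangents that come to the arc `j` of a row of trees. -/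
def rowSource (f : ℝ → ℝ) (s : Side) {k : ℕ} (t : Fin k → FixedTree) (ℓ : Fin k → ℝ → ℝ)
    (S : ℝ → LabelledVertex) (ε : ℝ) : Fin (k + 1) → LabelledVertex :=
  Fin.cons (S ε) fun i => labelledTrolleybus f s (t i) (ℓ i ε)

section Row

variable {f : ℝ → ℝ} {s : Side} {η₁ η Lam x : ℝ} {k : ℕ} {t : Fin k → FixedTree}
  {lo hi : Fin (k + 1) → ℝ} {ℓ : Fin k → ℝ → ℝ} {Q : Fin (k + 1) → ℝ → ℝ → ℝ} {S : ℝ → LabelledVertex}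
  {Q₀ : ℝ → ℝ}

lemma TreeWaves.length_mem (h : TreeRow f s η₁ Lam t lo hi)
    (hw : TreeWaves f s η₁ η Lam t lo ℓ Q) {ε : ℝ} (hε : ε ∈ Ioc η₁ η) (i : Fin k) :
    (t i).dom.bot < ℓ i ε ∧ ℓ i ε < (t i).dom.top := by
  have h1 := (hw.gap i).mem ε ⟨hε.1.le, hε.2⟩
  have h2 := (h.adm i).dom.2.1
  refine ⟨lt_trans (by rw [ChordalDomain.mid]; linarith) h1.1, ?_⟩
  have h3 := (hw.gap i).shrink
  rw [← h3.2.2]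
  exact h3.2.1 (left_mem_Icc.2 (hε.1.le.trans hε.2)) ⟨hε.1.le, hε.2⟩ hε.1

lemma TreeWaves.vertexOK (h : TreeRow f s η₁ Lam t lo hi)
    (hw : TreeWaves f s η₁ η Lam t lo ℓ Q) {ε : ℝ} (hε : ε ∈ Ioc η₁ η) (i : Fin k) (s' : Side) :
    VertexOK f ε (labelledTrolleybus f s' (t i) (ℓ i ε)) :=
  vertexOK_labelledTrolleybus hε.1 (h.adm i) (h.leaf i) s' (hw.length_mem h hε i).1
    (hw.length_mem h hε i).2.le (h.top_le i)

lemma TreeWaves.reach_lo (hf : ContDiff ℝ 2 f) (hη₁ : 0 < η₁) (h : TreeRow f s η₁ Lam t lo hi)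
    (hw : TreeWaves f s η₁ η Lam t lo ℓ Q) (he : Emission f s η₁ η S (Q 0) x (lo 0) Q₀)
    {ε : ℝ} (hε : ε ∈ Ioc η₁ η) (j : Fin (k + 1)) :
    Reach f s ε (rowSource f s t ℓ S ε j) (Q j ε) (lo j) := by
  have hε' : ε ∈ Icc η₁ η := ⟨hε.1.le, hε.2⟩
  refine Fin.cases ?_ (fun i => ?_) j
  · exact he.reach_at (continuous_curv (continuous_deriv2_datum hf) s) hη₁
      (EReal.coe_lt_coe_iff.1 he.lt_end) le_rfl hε
  · have h1 := hw.length_mem h hε i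
    have h2 := (h.isRow hf).flow i
    have h3 := (hw.gap i).mem ε hε'
    refine reach_labelledTrolleybus ((hw.fam i.succ).solves ε hε') ((hw.gap i).exit ε hε') ?_ ?_
    · rw [← h.leave_top i]
      exact h2.strictMonoOn_B ⟨h3.1.le, h3.2⟩ (right_mem_Icc.2 h2.lt.le) h1.2
    · rw [← h.leave_top i]
      exact (hw.gap i).pos_exit ε hε

lemma TreeWaves.reach_hi (hf : ContDiff ℝ 2 f) (hη₁ : 0 < η₁) (h : TreeRow f s η₁ Lam t lo hi)
    (hw : TreeWaves f s η₁ η Lam t lo ℓ Q) (he : Emission f s η₁ η S (Q 0) x (lo 0) Q₀)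
    {ε : ℝ} (hε : ε ∈ Ioc η₁ η) (j : Fin (k + 1)) :
    Reach f s ε (rowSource f s t ℓ S ε j) (Q j ε) (hi j) :=
  (hw.reach_lo hf hη₁ h he hε j).extend (h.le j)
    ((h.isRow hf).pos_on_arc hη₁ (hw.fam j) (hw.start j) hε)

lemma TreeWaves.reach_enter (hf : ContDiff ℝ 2 f) (hη₁ : 0 < η₁) (h : TreeRow f s η₁ Lam t lo hi)
    (hw : TreeWaves f s η₁ η Lam t lo ℓ Q) (he : Emission f s η₁ η S (Q 0) x (lo 0) Q₀)
    {ε : ℝ} (hε : ε ∈ Ioc η₁ η) (i : Fin k) :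
    Reach f s ε (rowSource f s t ℓ S ε i.castSucc) (Q i.castSucc ε) ((t i).dom.enter s (ℓ i ε)) := by
  have h1 := hw.length_mem h hε i
  have h2 := (h.isRow hf).flow i
  have h3 := (hw.gap i).mem ε ⟨hε.1.le, hε.2⟩
  refine (hw.reach_hi hf hη₁ h he hε i.castSucc).extend ?_ ?_
  · rw [← h.enter_top i]
    exact h2.strictAntiOn_A.antitoneOn ⟨h3.1.le, h3.2⟩ (right_mem_Icc.2 h2.lt.le) h3.2
  · rw [← h.enter_top i]
    exact (hw.gap i).pos_enter ε hε

lemma TreeWaves.flows (hf : ContDiff ℝ 2 f) (hη₁ : 0 < η₁) (h : TreeRow f s η₁ Lam t lo hi)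
    (hw : TreeWaves f s η₁ η Lam t lo ℓ Q) (he : Emission f s η₁ η S (Q 0) x (lo 0) Q₀)
    {ε : ℝ} (hε : ε ∈ Ioc η₁ η) (i : Fin k) :
    Flows f s ε (rowSource f s t ℓ S ε i.castSucc) (rowSource f s t ℓ S ε i.succ) :=
  (hw.reach_enter hf hη₁ h he hε i).flows (by cases s <;> rfl) (inEnd_shrunkTrolleybus s s _ _)
    ((hw.gap i).enter ε ⟨hε.1.le, hε.2⟩)

/-- The tangents emitted after a row continue those of the next tangent domain. -/
lemma TreeWaves.emission (hf : ContDiff ℝ 2 f) (hη₁ : 0 < η₁) (hη : η₁ < η)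
    (h : TreeRow f s η₁ Lam t lo hi) (hw : TreeWaves f s η₁ η Lam t lo ℓ Q)
    (he : Emission f s η₁ η S (Q 0) x (lo 0) Q₀) {e : EReal} {Q₁ : ℝ → ℝ}
    (hQ₁ : Solves (curv f s) η₁ Q₁) (h1 : Q₁ (hi (Fin.last k)) = Lam) (hlt : hi (Fin.last k) < e)
    (hpos : ∀ z : ℝ, hi (Fin.last k) < z → z < e → curv f s z < Q₁ z) :
    ∃ x', Emission f s η₁ η (fun ε => rowSource f s t ℓ S ε (Fin.last k)) (Q (Fin.last k)) x' e
      Q₁ := by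
  obtain ⟨x', hx1, hx2⟩ := EReal.exists_between_coe_real hlt
  have hx1' : hi (Fin.last k) < x' := EReal.coe_lt_coe_iff.1 hx1
  have m1 : η₁ ∈ Icc η₁ η := left_mem_Icc.2 hη.le
  -- At η₁ the wave on the last arc and the old outgoing wave have the same value Lam at the end of
  -- the row, so they are one solution.
  have hinit : Q (Fin.last k) η₁ = Q₁ := ((hw.fam _).solves η₁ m1).eq_of_eq hQ₁
    (((h.isRow hf).eq_at_hi ((hw.fam _).solves η₁ m1) (hw.start _) _
      (right_mem_Icc.2 (h.le _))).trans h1.symm)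
  have hfam := (h.isRow hf).family_at_hi hη₁ hη (hw.fam (Fin.last k)) (hw.start _)
  have hpos' : ∀ z ∈ Ioo (hi (Fin.last k)) x', curv f s z ≤ Q (Fin.last k) η₁ z := fun z hz => by
    rw [hinit]
    exact (hpos z hz.1 ((EReal.coe_lt_coe_iff.2 hz.2).trans hx2)).le
  refine ⟨x', hinit, hx2, hfam.advance hη₁ hx1'.le hpos',
    fun z h3 h4 => hpos z (hx1'.trans_le h3) h4, fun ε hε => ?_⟩
  have hr := hw.reach_hi hf hη₁ h he hε (Fin.last k)
  refine hr.extend hx1'.le fun z hz => ?_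
  rcases hz.1.eq_or_lt with rfl | hlt'
  · exact hr.pos _ hr.lt le_rfl
  · refine lt_of_lt_of_le ?_ (hfam.gt hη₁ hpos' hε hz).le
    rw [hinit]
    exact hpos z hlt' ((EReal.coe_le_coe_iff.2 hz.2).trans_lt hx2)

end Row

/-! ### Blocks of a row of vertices -/

/-- The source of the right tangents that come to a block, if the tangents on its left are right. -/
def sourceBefore : Option (Side × LabelledVertex) → List LabelledVertex
  | some (.R, V) => [V]
  | _ => []

/-- The source of the left tangents that come to a block, if the tangents on its right are left. -/
def sourceAfter : Option (Side × LabelledVertex) → List LabelledVertex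
  | some (.L, V) => [V]
  | _ => []

/-- The row may begin at a place with the tangents `a` on the left. -/
def HeadOK (a : Option (Side × LabelledVertex)) (l : List LabelledVertex) : Prop :=
  match a with
  | none => ∃ V, l.head? = some V ∧ V.1.leftEnd = ⊥
  | some (.L, V) => l.head? = some V
  | some (.R, _) => True

/-- The row may end at a place with the tangents `b` on the right. -/
def LastOK (b : Option (Side × LabelledVertex)) (l : List LabelledVertex) : Prop :=
  match b with
  | none => ∃ V, l.getLast? = some V ∧ V.1.rightEnd = ⊤
  | some (.R, V) => l.getLast? = some V
  | some (.L, _) => True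

/-- The block `B` fits between tangents that come from the sources in `a` and in `b`, or from the
vertices of the block. -/
structure Fits (f : ℝ → ℝ) (ε : ℝ) (a : Option (Side × LabelledVertex)) (B : List LabelledVertex)
    (b : Option (Side × LabelledVertex)) : Prop where
  chain : (sourceBefore a ++ B ++ sourceAfter b).IsChain (Link f ε)
  head : HeadOK a (B ++ sourceAfter b)
  last : LastOK b (sourceBefore a ++ B)

lemma HeadOK.append {a : Option (Side × LabelledVertex)} {l l' : List LabelledVertex}
    (h : HeadOK a l) : HeadOK a (l ++ l') := by
  rcases a with _ | ⟨_ | _, V⟩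
  · obtain ⟨V, h1, h2⟩ := h
    exact ⟨V, by rw [List.head?_append, h1]; rfl, h2⟩
  · trivial
  · show (l ++ l').head? = some V
    rw [List.head?_append, show l.head? = some V from h]
    rfl

lemma LastOK.append {b : Option (Side × LabelledVertex)} {l l' : List LabelledVertex}
    (h : LastOK b l') : LastOK b (l ++ l') := by
  rcases b with _ | ⟨_ | _, V⟩
  · obtain ⟨V, h1, h2⟩ := h
    exact ⟨V, by rw [List.getLast?_append, h1]; rfl, h2⟩
  · show (l ++ l').getLast? = some V
    rw [List.getLast?_append, show l'.getLast? = some V from h]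
    rfl
  · trivial

lemma isChain_glue {α : Type*} {R : α → α → Prop} {x y : List α} {V : α}
    (h1 : (x ++ [V]).IsChain R) (h2 : (V :: y).IsChain R) : (x ++ V :: y).IsChain R := by
  rw [List.isChain_append] at h1 ⊢
  exact ⟨h1.1, h2, fun a ha b hb => h1.2.2 a ha b (by simpa using hb)⟩

/-- The tangents between two blocks have one source. It is the last vertex so far for right tangents
and the first vertex to come for left ones, and both chains contain it, so they can be joined at it.
The block between may be empty, and then the source is simply handed on. -/
lemma Fits.comp {f : ℝ → ℝ} {ε : ℝ} {a c : Option (Side × LabelledVertex)} {s : Side}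
    {V : LabelledVertex} {B C : List LabelledVertex} (h1 : Fits f ε a B (some (s, V)))
    (h2 : Fits f ε (some (s, V)) C c) : Fits f ε a (B ++ C) c := by
  cases s with
  | R =>
    have hl : (sourceBefore a ++ B).getLast? = some V := h1.last
    obtain ⟨x, hx⟩ := List.getLast?_eq_some_iff.1 hl
    have c1 : (sourceBefore a ++ B).IsChain (Link f ε) := by simpa [sourceAfter] using h1.chain
    have c2 : (V :: (C ++ sourceAfter c)).IsChain (Link f ε) := by
      simpa [sourceBefore] using h2.chain
    refine ⟨?_, ?_, ?_⟩
    · rw [← List.append_assoc, hx, List.append_assoc, List.append_assoc]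
      exact isChain_glue (hx ▸ c1) c2
    · rw [List.append_assoc]
      exact HeadOK.append (by simpa [sourceAfter] using h1.head)
    · rw [← List.append_assoc, hx, List.append_assoc]
      exact LastOK.append h2.last
  | L =>
    have hl : (C ++ sourceAfter c).head? = some V := h2.head
    obtain ⟨y, hy⟩ := List.head?_eq_some_iff.1 hl
    have c1 : (sourceBefore a ++ B ++ [V]).IsChain (Link f ε) := h1.chain
    have c2 : (C ++ sourceAfter c).IsChain (Link f ε) := by simpa [sourceBefore] using h2.chain
    refine ⟨?_, ?_, ?_⟩
    · rw [← List.append_assoc, List.append_assoc _ C, hy]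
      exact isChain_glue c1 (hy ▸ c2)
    · rw [List.append_assoc, hy, show B ++ V :: y = (B ++ [V]) ++ y by simp]
      exact HeadOK.append h1.head
    · rw [← List.append_assoc]
      exact LastOK.append (by simpa [sourceBefore] using h2.last)

/-! ### Tangent domains during the evolution -/

/-- A tangent domain at the time `η₁`: its orientation, the tangents, and its end. -/
structure OldEdge where
  dir : Side
  wave : ℝ → ℝ
  terminus : EReal

/-- A tangent domain after the time `η₁`, up to the time `time`: the vertex from which it starts, the
tangents, and a point over which they stay. -/
structure NewEdge where
  time : ℝ
  source : ℝ → LabelledVertex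
  wave : ℝ → ℝ → ℝ
  point : ℝ

/-- The tangent domain `E` comes to the vertex `V`. -/
structure Incoming (V : LabelledVertex) (s : Side) (E : OldEdge) : Prop where
  dir : E.dir = s
  in_dir : V.1.inDir s = s
  terminus : E.terminus = V.1.inEnd s
  ne_bot : E.terminus ≠ ⊥
  val : ∀ x : ℝ, V.1.inEnd s = x → E.wave x = V.2

/-- The tangent domain `E` goes out of the vertex `V`. -/
structure Outgoing (f : ℝ → ℝ) (η₁ : ℝ) (V : LabelledVertex) (s : Side) (E : OldEdge) : Prop where
  dir : E.dir = s
  out_dir : V.1.outDir s = s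
  lt : V.1.outEnd s < E.terminus
  wave : IsWave f s η₁ V E.wave
  pos : ∀ z : ℝ, V.1.outEnd s < z → z < E.terminus → curv f s z < E.wave z

/-- The side of `V` on which tangents of orientation `s` come in: there is a tangent domain, or
nothing if the figure is unbounded. -/
def InSide (V : LabelledVertex) (s : Side) : Option OldEdge → Prop
  | none => V.1.inEnd s = ⊥
  | some E => Incoming V s E

/-- The side of `V` from which tangents of orientation `s` go out. -/
def OutSide (f : ℝ → ℝ) (η₁ : ℝ) (V : LabelledVertex) (s : Side) : Option OldEdge → Prop
  | none => V.1.outEnd s = ⊤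
  | some E => Outgoing f η₁ V s E

/-- `D` describes how the tangent domain `E` changes. -/
def Continues (f : ℝ → ℝ) (η₁ εinf : ℝ) (D : NewEdge) : Option OldEdge → Prop
  | none => True
  | some E => D.time ∈ Ioo η₁ εinf ∧
      Emission f E.dir η₁ D.time D.source D.wave D.point E.terminus E.wave

/-- The orientation and the source of a new tangent domain. -/
def edgeState (E : Option OldEdge) (D : NewEdge) (ε : ℝ) : Option (Side × LabelledVertex) :=
  E.map fun E => (E.dir, D.source ε)

/-- Between the new tangent domains `D` on the left and `D'` on the right, the vertex `V` may be
replaced according to its local rule. -/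
def Evolution (f : ℝ → ℝ) (η₁ εinf : ℝ) (V : LabelledVertex) (l r : Option OldEdge)
    (D D' : NewEdge) : Prop :=
  ∃ η ∈ Ioo η₁ εinf, ∃ B : ℝ → List LabelledVertex,
    LocalRule f η₁ η (fun ε => (B ε).map Prod.fst) V.1 ∧
    ∀ ε ∈ Ioc η₁ η, (∀ U ∈ B ε, VertexOK f ε U) ∧
      Fits f ε (edgeState l D ε) (B ε) (edgeState r D' ε)

/-- The same with the tangent domains named from the orientation `s`. -/
def Evolution' (s : Side) (f : ℝ → ℝ) (η₁ εinf : ℝ) (V : LabelledVertex) (inn out : Option OldEdge)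
    (D D' : NewEdge) : Prop :=
  match s with
  | .R => Evolution f η₁ εinf V inn out D D'
  | .L => Evolution f η₁ εinf V out inn D' D

/-- List the vertices, given in the order of the orientation `s`, from left to right. -/
def orient {α : Type*} (s : Side) (l : List α) : List α :=
  match s with
  | .R => l
  | .L => l.reverse

lemma mem_orient {α : Type*} {s : Side} {l : List α} {x : α} : x ∈ orient s l ↔ x ∈ l := by
  cases s <;> simp [orient]

/-- The vertices `C`, given in the order of the orientation `s`, fit between the source `V` of the
tangents that come in and the source of those that go out. -/
def FitsAlong (f : ℝ → ℝ) (ε : ℝ) (s : Side) (V : LabelledVertex) (C : List LabelledVertex)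
    (o : Option LabelledVertex) : Prop :=
  match s with
  | .R => Fits f ε (some (.R, V)) (orient .R C) (o.map fun U => (.R, U))
  | .L => Fits f ε (o.map fun U => (.L, U)) (orient .L C) (some (.L, V))

lemma fits_of_flows {f : ℝ → ℝ} {ε : ℝ} {s : Side} {V : LabelledVertex} {C : List LabelledVertex}
    {o : Option LabelledVertex} (hc : (V :: C).IsChain (Flows f s ε))
    (ho : ∀ U, o = some U → (V :: C).getLast? = some U)
    (hn : o = none → ∃ U, C.getLast? = some U ∧ U.1.outEnd s = ⊤) :
    FitsAlong f ε s V C o := by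
  cases s with
  | R =>
    have hc' : (V :: C).IsChain (Link f ε) := hc.imp fun _ _ => Or.inl
    rcases o with _ | U
    · refine ⟨by simpa [sourceBefore, sourceAfter, orient] using hc', trivial, ?_⟩
      obtain ⟨U, h1, h2⟩ := hn rfl
      refine ⟨U, ?_, h2⟩
      show ([V] ++ C).getLast? = some U
      rw [List.getLast?_append, h1]
      rfl
    · exact ⟨by simpa [sourceBefore, sourceAfter, orient] using hc', trivial, ho U rfl⟩
  | L =>
    have hc' : (V :: C).reverse.IsChain (Link f ε) := by
      rw [List.isChain_reverse]
      exact hc.imp fun _ _ => Or.inr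
    rw [List.reverse_cons] at hc'
    rcases o with _ | U
    · refine ⟨by simpa [sourceBefore, sourceAfter, orient] using hc', ?_, trivial⟩
      obtain ⟨U, h1, h2⟩ := hn rfl
      refine ⟨U, ?_, ?_⟩
      · show (C.reverse ++ [V]).head? = some U
        rw [List.head?_append, List.head?_reverse, h1]
        rfl
      · rw [← neg_neg U.1.leftEnd, show -U.1.leftEnd = ⊤ from h2]
        rfl
    · refine ⟨by simpa [sourceBefore, sourceAfter, orient] using hc', ?_, trivial⟩
      show (C.reverse ++ [V]).head? = some U
      rw [← List.reverse_cons, List.head?_reverse]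
      exact ho U rfl

/-- Evolution of a vertex through which tangents of one orientation pass. -/
lemma evolution'_of_flows {f : ℝ → ℝ} {η₁ εinf η : ℝ} {s : Side} {V : LabelledVertex} {E : OldEdge}
    {out : Option OldEdge} {D D' : NewEdge} (hE : Incoming V s E)
    (hout : ∀ E', out = some E' → E'.dir = s) (hη : η ∈ Ioo η₁ εinf) {C : ℝ → List LabelledVertex}
    (hrule : LocalRule f η₁ η (fun ε => (orient s (C ε)).map Prod.fst) V.1)
    (hok : ∀ ε ∈ Ioc η₁ η, ∀ U ∈ C ε, VertexOK f ε U)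
    (hc : ∀ ε ∈ Ioc η₁ η, (D.source ε :: C ε).IsChain (Flows f s ε))
    (ho : ∀ ε ∈ Ioc η₁ η, out ≠ none → (D.source ε :: C ε).getLast? = some (D'.source ε))
    (hn : ∀ ε ∈ Ioc η₁ η, out = none → ∃ U, (C ε).getLast? = some U ∧ U.1.outEnd s = ⊤) :
    Evolution' s f η₁ εinf V (some E) out D D' := by
  have key : ∀ ε ∈ Ioc η₁ η, FitsAlong f ε s (D.source ε) (C ε) (out.map fun _ => D'.source ε) := 
    fun ε hε => fits_of_flows (hc ε hε) (fun U hU => by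
      rcases out with _ | E'
      · simp at hU
      · rw [ho ε hε (by simp)]
        simpa using hU) (fun h => hn ε hε (by simpa using h))
  have hE' := hE.dir
  cases s with
  | R =>
    refine ⟨η, hη, fun ε => orient .R (C ε), hrule, fun ε hε =>
      ⟨fun U hU => hok ε hε U (mem_orient.1 hU), ?_⟩⟩
    have := key ε hε
    rw [FitsAlong] at this
    rcases out with _ | E''
    · simpa [edgeState, hE'] using this
    · simpa [edgeState, hE', hout E'' rfl] using this
  | L =>
    refine ⟨η, hη, fun ε => orient .L (C ε), hrule, fun ε hε =>
      ⟨fun U hU => hok ε hε U (mem_orient.1 hU), ?_⟩⟩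
    have := key ε hε
    rw [FitsAlong] at this
    rcases out with _ | E''
    · simpa [edgeState, hE'] using this
    · simpa [edgeState, hE', hout E'' rfl] using this

/-- Tangents of orientation `s` may be continued through the vertex `V`. -/
def Passes (f : ℝ → ℝ) (η₁ εinf : ℝ) (s : Side) (V : LabelledVertex) (inn out : Option OldEdge) :
    Prop :=
  ∀ D, Continues f η₁ εinf D inn → ∃ D', Continues f η₁ εinf D' out ∧
    Evolution' s f η₁ εinf V inn out D D'

lemma getLast?_cons_ofFn {α : Type*} {k : ℕ} (V : α) (T : Fin k → α) :
    (V :: List.ofFn T).getLast? = some ((Fin.cons V T : Fin (k + 1) → α) (Fin.last k)) := by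
  have : V :: List.ofFn T = List.ofFn (Fin.cons V T : Fin (k + 1) → α) := by
    rw [List.ofFn_succ]; simp
  rw [this, List.getLast?_eq_getElem?]
  simp [Fin.last, -List.ofFn_succ]

lemma isChain_cons_ofFn {α : Type*} {R : α → α → Prop} {k : ℕ} {V : α} {T : Fin k → α}
    (h : ∀ i : Fin k, R ((Fin.cons V T : Fin (k + 1) → α) i.castSucc) (T i)) :
    (V :: List.ofFn T).IsChain R := by
  have : V :: List.ofFn T = List.ofFn (Fin.cons V T : Fin (k + 1) → α) := by
    rw [List.ofFn_succ]; simp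
  rw [this, List.isChain_ofFn]
  intro i hi
  exact h ⟨i, by omega⟩

/-- A row of trees through which tangents pass to a further tangent domain. -/
lemma TreeRow.passes {f : ℝ → ℝ} {εinf η₁ : ℝ} (h : TameDatum f εinf) (hη₁ : 0 < η₁) {s : Side}
    {V : LabelledVertex} {E E' : OldEdge} (hE : Incoming V s E) (hE' : Outgoing f η₁ V s E') {k : ℕ}
    {t : Fin k → FixedTree} {lo hi : Fin (k + 1) → ℝ} (hrow : TreeRow f s η₁ V.2 t lo hi)
    (hlo : V.1.inEnd s = lo 0) (hhi : V.1.outEnd s = hi (Fin.last k)) (hb : V.1.base ≠ none)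
    (hrule : ∀ (η : ℝ) (ℓ : Fin k → ℝ → ℝ), (∀ i, ShrinkingLength η₁ η (t i).dom.top (ℓ i)) →
      LocalRule f η₁ η (fun ε => orient s (List.ofFn fun i => shrunkTrolleybus s (t i) (ℓ i ε)))
        V.1) :
    Passes f η₁ εinf s V (some E) (some E') := by
  intro D ⟨hD1, hD2⟩
  have hf := h.reg.1
  have hG := continuous_curv h.cont s
  rw [hE.dir, hE.terminus, hlo] at hD2
  obtain ⟨η, hη, ℓ, Q, hw, hQ0⟩ := exists_rowWaves hG hη₁ (hrow.isRow hf) hD1.1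
    (hD2.family_at hη₁ (EReal.coe_lt_coe_iff.1 hD2.lt_end).le le_rfl)
    (by rw [hD2.init]; exact hE.val _ hlo)
  have hem : Emission f s η₁ η D.source (Q 0) D.point (lo 0) E.wave := hQ0 ▸ hD2.mono hη.2
  obtain ⟨p, hp⟩ := Option.ne_none_iff_exists'.1 hb
  have hlt := hE'.lt
  have hpos := hE'.pos
  rw [hhi] at hlt hpos
  obtain ⟨x', hx'⟩ := TreeWaves.emission hf hη₁ hη.1 hrow hw hem (hE'.wave.1 p hp).1
    ((hE'.wave.1 p hp).2 _ hhi) hlt fun z hz => hpos z (EReal.coe_lt_coe_iff.2 hz)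
  have hηI : η ∈ Ioo η₁ εinf := ⟨hη.1, hη.2.trans_lt hD1.2⟩
  -- The new tangents start at the trolleybus over the last gap, or, if there are no gaps, still at
  -- the source of the incoming ones.
  refine ⟨⟨η, fun ε => rowSource f s t ℓ D.source ε (Fin.last k), Q (Fin.last k), x'⟩, ⟨hηI, hE'.dir.symm ▸ hx'⟩, evolution'_of_flows hE
    (fun E'' h'' => by rw [← Option.some.inj h'']; exact hE'.dir) hηI
    (C := fun ε => List.ofFn fun i => labelledTrolleybus f s (t i) (ℓ i ε)) ?_ ?_ ?_ ?_ ?_⟩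
  · have := hrule η ℓ fun i => (hw.gap i).shrink
    convert this using 2 with ε
    cases s <;> simp [orient, List.map_ofFn, Function.comp_def, labelledTrolleybus]
  · intro ε hε U hU
    obtain ⟨i, rfl⟩ := List.mem_ofFn.1 hU
    exact TreeWaves.vertexOK hrow hw hε i s
  · exact fun ε hε => isChain_cons_ofFn fun i => TreeWaves.flows hf hη₁ hrow hw hem hε i
  · exact fun ε hε _ => getLast?_cons_ofFn _ _
  · intro ε hε hn
    simp at hn

/-- The infinity to which tangents of orientation `s` go. -/
def endInfinity : Side → FreeVertex
  | .R => .plusInfinity .R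
  | .L => .minusInfinity .L

lemma outEnd_endInfinity (s : Side) : (endInfinity s).outEnd s = ⊤ := by
  cases s <;> simp [endInfinity, FreeVertex.outEnd, FreeVertex.rightEnd, FreeVertex.leftEnd]

lemma inEnd_endInfinity (s : Side) : (endInfinity s).inEnd s = ⊤ := by
  cases s <;> simp [endInfinity, FreeVertex.inEnd, FreeVertex.rightEnd, FreeVertex.leftEnd]

lemma vertexOK_endInfinity (f : ℝ → ℝ) (ε : ℝ) (s : Side) : VertexOK f ε (endInfinity s, 0) := by
  cases s <;> exact ⟨trivial, trivial, trivial, fun p hp => by simp [endInfinity, FreeVertex.base] at hp⟩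

lemma flows_endInfinity {f : ℝ → ℝ} {s : Side} {ε x : ℝ} {V : LabelledVertex} {Q : ℝ → ℝ}
    (h : ∀ y, x ≤ y → Reach f s ε V Q y) : Flows f s ε V (endInfinity s, 0) := by
  have hx := h x le_rfl
  refine ⟨Q, ⟨hx.dir, by cases s <;> rfl, ?_, hx.wave, fun z h1 _ => ?_, fun y hy => ?_⟩, fun w hw => ?_⟩
  · rw [inEnd_endInfinity]
    exact hx.lt.trans (EReal.coe_lt_top x)
  · exact (h (max x z) (le_max_left _ _)).pos z h1 (le_max_right _ _)
  · rw [inEnd_endInfinity] at hy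
    exact absurd hy (EReal.coe_ne_top y).symm
  · cases s <;> simp [endInfinity] at hw

/-- A row of trees followed by a ray. -/
lemma TreeRow.passes_ray {f : ℝ → ℝ} {εinf η₁ : ℝ} (h : TameDatum f εinf) (hη₁ : 0 < η₁) {s : Side}
    {V : LabelledVertex} {E : OldEdge} (hE : Incoming V s E) {k : ℕ}
    {t : Fin k → FixedTree} {lo hi : Fin (k + 1) → ℝ} (hrow : TreeRow f s η₁ V.2 t lo hi)
    (hlo : V.1.inEnd s = lo 0) (hray : ∀ z, lo (Fin.last k) ≤ z → curv f s z = V.2)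
    (hrule : ∀ (η : ℝ) (ℓ : Fin k → ℝ → ℝ), (∀ i, ShrinkingLength η₁ η (t i).dom.top (ℓ i)) →
      LocalRule f η₁ η (fun ε => orient s ((List.ofFn fun i => shrunkTrolleybus s (t i) (ℓ i ε)) ++
        [endInfinity s])) V.1) :
    Passes f η₁ εinf s V (some E) none := by
  intro D ⟨hD1, hD2⟩
  have hf := h.reg.1
  have hG := continuous_curv h.cont s
  rw [hE.dir, hE.terminus, hlo] at hD2
  obtain ⟨η, hη, ℓ, Q, hw, hQ0⟩ := exists_rowWaves hG hη₁ (hrow.isRow hf) hD1.1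
    (hD2.family_at hη₁ (EReal.coe_lt_coe_iff.1 hD2.lt_end).le le_rfl)
    (by rw [hD2.init]; exact hE.val _ hlo)
  have hem : Emission f s η₁ η D.source (Q 0) D.point (lo 0) E.wave := hQ0 ▸ hD2.mono hη.2
  have hηI : η ∈ Ioo η₁ εinf := ⟨hη.1, hη.2.trans_lt hD1.2⟩
  -- There is no tangent domain on the other side; D only fills the empty place.
  refine ⟨D, trivial, evolution'_of_flows hE (fun E'' h'' => by simp at h'') hηI
    (C := fun ε => (List.ofFn fun i => labelledTrolleybus f s (t i) (ℓ i ε)) ++ [(endInfinity s, 0)])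
    ?_ ?_ ?_ ?_ ?_⟩
  · have := hrule η ℓ fun i => (hw.gap i).shrink
    convert this using 2 with ε
    cases s <;> simp [orient, List.map_ofFn, Function.comp_def, labelledTrolleybus]
  · intro ε hε U hU
    rcases List.mem_append.1 hU with hU | hU
    · obtain ⟨i, rfl⟩ := List.mem_ofFn.1 hU
      exact TreeWaves.vertexOK hrow hw hε i s
    · rw [List.mem_singleton.1 hU]
      exact vertexOK_endInfinity f ε s
  · intro ε hε
    rw [← List.cons_append, List.isChain_append]
    refine ⟨isChain_cons_ofFn fun i => TreeWaves.flows hf hη₁ hrow hw hem hε i,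
      List.isChain_singleton _, fun a ha b hb => ?_⟩
    rw [getLast?_cons_ofFn] at ha
    have ha' := Option.some.inj ha
    have hb' : (endInfinity s, (0 : ℝ)) = b := by simpa using hb
    rw [← ha', ← hb']
    have hr := TreeWaves.reach_lo hf hη₁ hrow hw hem hε (Fin.last k)
    have hsol := (hw.fam (Fin.last k)).solves η₁ (left_mem_Icc.2 hη.1.le)
    -- At η₁ the wave runs along the constant value of f'' on the ray; later waves lie strictly
    -- above it, so the ray becomes a tangent domain going to infinity.
    have heq : ∀ z, lo (Fin.last k) ≤ z → Q (Fin.last k) η₁ z = V.2 := fun z hz =>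
      hsol.eq_const hz (fun w hw => hray w hw.1) (hw.start _)
    refine flows_endInfinity (x := lo (Fin.last k)) fun y hy => hr.extend hy fun z hz => ?_
    rw [hray z hz.1, ← heq z hz.1]
    exact (hw.fam (Fin.last k)).gt hη₁ (y := y)
      (fun w hw => by rw [hray w hw.1.le, heq w hw.1.le]) hε hz
  · intro ε hε hn
    simp at hn
  · intro ε hε _
    exact ⟨(endInfinity s, 0), by simp, outEnd_endInfinity s⟩

/-- Tangents that go to infinity. -/
lemma passes_endInfinity {f : ℝ → ℝ} {εinf η₁ : ℝ} (h : TameDatum f εinf) (hη₁ : 0 < η₁) {s : Side}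
    {V : LabelledVertex} (hV : V.1 = endInfinity s) {E : OldEdge} (hE : Incoming V s E) :
    Passes f η₁ εinf s V (some E) none := by
  intro D ⟨hD1, hD2⟩
  have hG := continuous_curv h.cont s
  rw [hE.dir, hE.terminus, hV, inEnd_endInfinity] at hD2
  refine ⟨D, trivial, evolution'_of_flows hE (fun E'' h'' => by simp at h'') hD1
    (C := fun ε => [(endInfinity s, 0)]) ?_ ?_ ?_ ?_ ?_⟩
  · rw [hV]
    cases s <;> exact fun _ _ => rfl
  · intro ε hε U hU
    rw [List.mem_singleton.1 hU]
    exact vertexOK_endInfinity f ε s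
  · intro ε hε
    refine List.isChain_pair.2 (flows_endInfinity (x := D.point) (Q := D.wave ε) fun y hy => ?_)
    rcases hy.eq_or_lt with rfl | hlt
    · exact hD2.reach ε hε
    · exact hD2.reach_at hG hη₁ hlt le_top hε
  · intro ε hε hn
    simp at hn
  · intro ε hε _
    exact ⟨(endInfinity s, 0), rfl, outEnd_endInfinity s⟩

/-- The infinity from which tangents of orientation `s` come. -/
def startInfinity : Side → FreeVertex
  | .R => .minusInfinity .R
  | .L => .plusInfinity .L

/-- Tangents that come from infinity. -/
lemma passes_startInfinity {f : ℝ → ℝ} {εinf η₁ : ℝ} (h : TameDatum f εinf) (hη₁ : 0 < η₁)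
    (hη₁inf : η₁ < εinf) {s : Side} {V : LabelledVertex} (hV : V.1 = startInfinity s) {E : OldEdge}
    (hE : Outgoing f η₁ V s E) : Passes f η₁ εinf s V none (some E) := by
  intro D _
  have hG := continuous_curv h.cont s
  have hout : V.1.outEnd s = ⊥ := by
    rw [hV]
    cases s <;> simp [startInfinity, FreeVertex.outEnd, FreeVertex.rightEnd, FreeVertex.leftEnd]
  have hbase : V.1.base = none := by
    rw [hV]
    cases s <;> rfl
  have hwave := hE.wave.2 hbase
  have hlt := hE.lt
  have hpos := hE.pos
  rw [hout] at hlt hpos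
  obtain ⟨x, -, hx⟩ := EReal.exists_between_coe_real hlt
  obtain ⟨η, hη⟩ := exists_between hη₁inf
  have hi : ∀ ε ∈ Icc η₁ η, ∀ z, IntegrableOn (fun t => Real.exp (t / ε) * curv f s t) (Iic z) :=
    fun ε hε => h.integrableOn ⟨hη₁.trans_le hε.1, hε.2.trans_lt hη.2⟩ s
  have hpos' : ∀ z ≤ x, curv f s z < waveInf (curv f s) η₁ z := fun z hz => by
    rw [← hwave]
    exact hpos z (EReal.bot_lt_coe z) ((EReal.coe_le_coe_iff.2 hz).trans_lt hx)
  obtain ⟨hfam, hp⟩ := family_waveInf hG hη₁ hi hη.1 hpos'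
  refine ⟨⟨η, fun _ => (startInfinity s, 0), waveInf (curv f s), x⟩, ⟨hη, hE.dir.symm ▸
    ⟨hwave.symm, hx, hfam, fun z _ hz => hpos z (EReal.bot_lt_coe z) hz, fun ε hε =>
      ⟨by cases s <;> rfl, ⟨fun p hp => ?_, fun _ => rfl⟩, ?_, fun z _ hz =>
        hp ε ⟨hε.1.le, hε.2⟩ z hz⟩⟩⟩, ?_⟩
  · cases s <;> simp [startInfinity, FreeVertex.base] at hp
  · show (startInfinity s).outEnd s < x
    rw [← hV, hout]
    exact EReal.bot_lt_coe x
  · have hd := hE.dir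
    cases s with
    | R =>
      refine ⟨η, hη, fun _ => [(startInfinity .R, 0)], by rw [hV]; exact fun _ _ => rfl, fun ε hε =>
        ⟨fun U hU => ?_, ?_⟩⟩
      · rw [List.mem_singleton.1 hU]
        exact ⟨trivial, trivial, trivial, fun p hp => by simp [startInfinity, FreeVertex.base] at hp⟩
      · simp only [edgeState, Option.map_some, Option.map_none, hd]
        exact ⟨by simp [sourceBefore, sourceAfter], ⟨_, rfl, rfl⟩, rfl⟩
    | L =>
      refine ⟨η, hη, fun _ => [(startInfinity .L, 0)], by rw [hV]; exact fun _ _ => rfl, fun ε hε =>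
        ⟨fun U hU => ?_, ?_⟩⟩
      · rw [List.mem_singleton.1 hU]
        exact ⟨trivial, trivial, trivial, fun p hp => by simp [startInfinity, FreeVertex.base] at hp⟩
      · simp only [edgeState, Option.map_some, Option.map_none, hd]
        exact ⟨by simp [sourceBefore, sourceAfter], rfl, ⟨_, rfl, rfl⟩⟩

/-! ### Arcs -/

/-- The left end of an arc or, on a ray going to `-∞`, its right end. -/
def Arc.finLo (A : Arc) : ℝ := open Classical in if A.lo = ⊥ then A.hi.toReal else A.lo.toReal

/-- The right end of an arc or, on a ray going to `+∞`, its left end. -/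
def Arc.finHi (A : Arc) : ℝ := open Classical in if A.hi = ⊤ then A.lo.toReal else A.hi.toReal

lemma Arc.Valid.coe_finLo {A : Arc} (h : A.Valid) (hlo : A.lo ≠ ⊥) : (A.finLo : EReal) = A.lo := by
  rw [Arc.finLo, if_neg hlo, EReal.coe_toReal h.2.1.ne hlo]

lemma Arc.Valid.coe_finHi {A : Arc} (h : A.Valid) (hhi : A.hi ≠ ⊤) : (A.finHi : EReal) = A.hi := by
  rw [Arc.finHi, if_neg hhi, EReal.coe_toReal hhi h.2.2.ne']

lemma Arc.Valid.finLo_mem {A : Arc} (h : A.Valid) (hA : A.lo ≠ ⊥ ∨ A.hi ≠ ⊤) : A.finLo ∈ A.toSet := by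
  by_cases hlo : A.lo = ⊥
  · have hhi := hA.resolve_left (not_not.2 hlo)
    rw [Arc.finLo, if_pos hlo]
    rw [Arc.toSet, mem_ofPred_eq, EReal.coe_toReal hhi h.2.2.ne']
    exact ⟨h.1, le_rfl⟩
  · rw [Arc.toSet, mem_ofPred_eq, h.coe_finLo hlo]
    exact ⟨le_rfl, h.1⟩

lemma Arc.Valid.finHi_mem {A : Arc} (h : A.Valid) (hA : A.lo ≠ ⊥ ∨ A.hi ≠ ⊤) : A.finHi ∈ A.toSet := by
  by_cases hhi : A.hi = ⊤
  · have hlo := hA.resolve_right (not_not.2 hhi)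
    rw [Arc.finHi, if_pos hhi]
    rw [Arc.toSet, mem_ofPred_eq, EReal.coe_toReal h.2.1.ne hlo]
    exact ⟨le_rfl, h.1⟩
  · rw [Arc.toSet, mem_ofPred_eq, h.coe_finHi hhi]
    exact ⟨h.1, le_rfl⟩

lemma Arc.Valid.finLo_le_finHi {A : Arc} (h : A.Valid) (hA : A.lo ≠ ⊥ ∨ A.hi ≠ ⊤) :
    A.finLo ≤ A.finHi := by
  by_cases hhi : A.hi = ⊤
  · have hlo := hA.resolve_right (not_not.2 hhi)
    rw [Arc.finHi, if_pos hhi, Arc.finLo, if_neg hlo]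
  · rw [← EReal.coe_le_coe_iff, h.coe_finHi hhi]
    exact (h.finLo_mem hA).2

lemma Arc.ordConnected_toSet (A : Arc) : A.toSet.OrdConnected :=
  ⟨fun _ hx _ hy _ hz => ⟨hx.1.trans (EReal.coe_le_coe_iff.2 hz.1),
    (EReal.coe_le_coe_iff.2 hz.2).trans hy.2⟩⟩

lemma deriv2_eq_of_affine {f : ℝ → ℝ} (hf : ContDiff ℝ 2 f) {A : Arc} (hA : A.lo < A.hi) {α β : ℝ}
    (h : ∀ x ∈ A.toSet, deriv f x = α + β * x) {x : ℝ} (hx : x ∈ A.toSet) :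
    deriv (deriv f) x = β := by
  obtain ⟨p, hp1, hp2⟩ := EReal.exists_between_coe_real hA
  obtain ⟨q, hq1, hq2⟩ := EReal.exists_between_coe_real hp2
  have hpq : p < q := EReal.coe_lt_coe_iff.1 hq1
  have hint : (interior A.toSet).Nonempty := by
    obtain ⟨r, hr⟩ := exists_between hpq
    refine ⟨r, mem_interior.2 ⟨Ioo p q, fun z hz => ⟨?_, ?_⟩, isOpen_Ioo, hr⟩⟩
    · exact (hp1.trans (EReal.coe_lt_coe_iff.2 hz.1)).le
    · exact ((EReal.coe_lt_coe_iff.2 hz.2).trans hq2).le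
  have h1 : HasDerivWithinAt (deriv f) (deriv (deriv f) x) A.toSet x :=
    (hasDerivAt_deriv_datum hf x).hasDerivWithinAt
  have h2 : HasDerivWithinAt (deriv f) β A.toSet x :=
    HasDerivWithinAt.congr (f := fun x => α + β * x)
      (by simpa using (((hasDerivAt_id x).const_mul β).const_add α).hasDerivWithinAt) h (h x hx)
  exact (uniqueDiffOn_convex A.ordConnected_toSet.convex hint x hx).eq_deriv _ h1 h2

lemma av_deriv2_of_affine {f : ℝ → ℝ} (hf : ContDiff ℝ 2 f) {α β a b : ℝ} (hab : a < b)
    (ha : deriv f a = α + β * a) (hb : deriv f b = α + β * b) : av (deriv (deriv f)) a b = β := by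
  rw [av_deriv (contDiff_deriv_datum hf) hab, ha, hb]
  field_simp [(sub_pos.2 hab).ne']
  ring

namespace MultiBase

variable {f : ℝ → ℝ} {ε : ℝ} {k : ℕ} {arcs : Fin (k + 1) → Arc}

lemma hi_ne_top (h : MultiBase f ε arcs) (i : Fin k) : (arcs i.castSucc).hi ≠ ⊤ :=
  ((h.2.1 i).1.trans_le le_top).ne

lemma lo_ne_bot (h : MultiBase f ε arcs) (i : Fin k) : (arcs i.succ).lo ≠ ⊥ :=
  (bot_le.trans_lt (h.2.1 i).1).ne'

lemma not_line (h : MultiBase f ε arcs) (hend : (arcs 0).lo ≠ ⊥ ∨ (arcs (Fin.last k)).hi ≠ ⊤)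
    (j : Fin (k + 1)) : (arcs j).lo ≠ ⊥ ∨ (arcs j).hi ≠ ⊤ := by
  rcases Fin.eq_zero_or_eq_succ j with rfl | ⟨i, rfl⟩
  · rcases hend with hend | hend
    · exact Or.inl hend
    · rcases Fin.eq_castSucc_or_eq_last (0 : Fin (k + 1)) with ⟨i, hi⟩ | hi
      · rw [hi]
        exact Or.inr (h.hi_ne_top i)
      · rw [hi]
        exact Or.inr hend
  · exact Or.inl (h.lo_ne_bot i)

lemma strictMono_lo (h : MultiBase f ε arcs) : StrictMono fun j => (arcs j).lo :=
  Fin.strictMono_iff_lt_succ.2 fun i => (h.1 i.castSucc).1.trans_lt (h.2.1 i).1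

lemma hi_lt_lo (h : MultiBase f ε arcs) {i j : Fin (k + 1)} (hij : i < j) :
    (arcs i).hi < (arcs j).lo := by
  obtain ⟨i', rfl⟩ := Fin.exists_castSucc_eq.2 (hij.trans_le (Fin.le_last j)).ne
  exact (h.2.1 i').1.trans_le (h.strictMono_lo.monotone (Fin.castSucc_lt_iff_succ_le.1 hij))

end MultiBase

/-- Seen from the other orientation the order of arcs and gaps is reversed, which accounts for
`Fin.rev` and for the exchange of left and right ends. -/
lemma TreeRow.reflect {f : ℝ → ℝ} {η₁ Lam : ℝ} {k : ℕ} {t : Fin k → FixedTree}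
    {lo hi : Fin (k + 1) → ℝ} (h : TreeRow f .R η₁ Lam t lo hi) :
    TreeRow f .L η₁ Lam (fun i => t i.rev) (fun j => -hi j.rev) (fun j => -lo j.rev) where
  le j := neg_le_neg (h.le _)
  arc_le j z hz := h.arc_le j.rev (-z) ⟨by linarith [hz.2], by linarith [hz.1]⟩
  arc_eq j hj z hz := h.arc_eq j.rev (neg_lt_neg_iff.1 hj) (-z) ⟨by linarith [hz.2], by linarith [hz.1]⟩
  adm i := h.adm _
  leaf i := h.leaf _
  enter_top i := by
    rw [Fin.rev_castSucc, ← h.leave_top i.rev]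
    rfl
  leave_top i := by
    rw [Fin.rev_succ, ← h.enter_top i.rev]
    rfl
  lam_top i := h.lam_top _
  top_le i := h.top_le _

/-- The row of trees below a multifigure. -/
lemma treeRow_multi {f : ℝ → ℝ} (hf : ContDiff ℝ 2 f) {η₁ Lam : ℝ} {kind : MultiKind} {k : ℕ}
    {arcs : Fin (k + 1) → Arc} {t : Fin k → FixedTree}
    (h : (FreeVertex.multi kind k arcs t).Admissible f η₁)
    (hl : (FreeVertex.multi kind k arcs t).LeafRoot f)
    (hlab : LabelOK f (FreeVertex.multi kind k arcs t, Lam))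
    (hend : (arcs 0).lo ≠ ⊥ ∨ (arcs (Fin.last k)).hi ≠ ⊤) :
    TreeRow f .R η₁ Lam t (fun j => (arcs j).finLo) (fun j => (arcs j).finHi) ∧
      ∀ j, (arcs j).lo < (arcs j).hi → ∀ x ∈ (arcs j).toSet, deriv (deriv f) x = Lam := by
  obtain ⟨hB, hhang, hadm, -⟩ := h
  have hline := hB.not_line hend
  have hval := hB.1
  obtain ⟨α, β, haff⟩ := hB.2.2.1
  have hhi : ∀ i : Fin k, (arcs i.castSucc).finHi = (arcs i.castSucc).hi.toReal := fun i => by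
    rw [Arc.finHi, if_neg (hB.hi_ne_top i)]
  have hlo : ∀ i : Fin k, (arcs i.succ).finLo = (arcs i.succ).lo.toReal := fun i => by
    rw [Arc.finLo, if_neg (hB.lo_ne_bot i)]
  have hgap : ∀ i : Fin k, (arcs i.castSucc).finHi < (arcs i.succ).finLo := fun i => by
    rw [← EReal.coe_lt_coe_iff, (hval _).coe_finHi (hB.hi_ne_top i),
      (hval _).coe_finLo (hB.lo_ne_bot i)]
    exact (hB.2.1 i).1
  have heq : ∀ j, (arcs j).lo < (arcs j).hi → ∀ x ∈ (arcs j).toSet, deriv (deriv f) x = β :=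
    fun j hj x hx => deriv2_eq_of_affine hf hj (haff j) hx
  -- The two base points lie in the extreme arcs, also when these are rays, and are distinct; hence
  -- the average of f'' over the base is the slope β of the line carrying the points (x, f'(x)).
  have hLam : Lam = β := by
    have h1 : Lam = _ := hlab _ rfl
    have hl0 : (arcs 0).leftPt ∈ (arcs 0).toSet := by
      by_cases h0 : (arcs 0).lo = ⊥
      · have h00 := (hline 0).resolve_left (not_not.2 h0)
        rw [Arc.leftPt, if_pos h0, if_neg h00]
        refine ⟨h0 ▸ bot_le, ?_⟩
        rw [← EReal.coe_toReal h00 (hval 0).2.2.ne', EReal.toReal_coe]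
        exact EReal.coe_le_coe_iff.2 (by linarith)
      · rw [Arc.leftPt, if_neg h0]
        have := (hval 0).finLo_mem (hline 0)
        rwa [Arc.finLo, if_neg h0] at this
    have hr0 : (arcs (Fin.last k)).rightPt ∈ (arcs (Fin.last k)).toSet := by
      by_cases h0 : (arcs (Fin.last k)).hi = ⊤
      · have h00 := (hline (Fin.last k)).resolve_right (not_not.2 h0)
        rw [Arc.rightPt, if_pos h0, if_neg h00]
        refine ⟨?_, h0 ▸ le_top⟩
        rw [← EReal.coe_toReal (hval _).2.1.ne h00, EReal.toReal_coe]
        exact EReal.coe_le_coe_iff.2 (by linarith)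
      · rw [Arc.rightPt, if_neg h0]
        have := (hval (Fin.last k)).finHi_mem (hline (Fin.last k))
        rwa [Arc.finHi, if_neg h0] at this
    have hlt : (arcs 0).leftPt < (arcs (Fin.last k)).rightPt := by
      rcases Nat.eq_zero_or_pos k with rfl | hk
      · have hnt : (arcs 0).lo < (arcs 0).hi := by
          rcases hB.2.2.2.2 with h2 | ⟨i, hi⟩
          · omega
          · rwa [Subsingleton.elim (α := Fin 1) i 0] at hi
        show (arcs 0).leftPt < (arcs 0).rightPt
        by_cases h0 : (arcs 0).lo = ⊥
        · have h00 := (hline 0).resolve_left (not_not.2 h0)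
          rw [Arc.leftPt, if_pos h0, if_neg h00, Arc.rightPt, if_neg h00]
          linarith
        · by_cases h00 : (arcs 0).hi = ⊤
          · rw [Arc.leftPt, if_neg h0, Arc.rightPt, if_pos h00, if_neg h0]
            linarith
          · rw [Arc.leftPt, if_neg h0, Arc.rightPt, if_neg h00]
            rwa [← EReal.coe_lt_coe_iff, EReal.coe_toReal (hval 0).2.1.ne h0,
              EReal.coe_toReal h00 (hval 0).2.2.ne']
      · rw [← EReal.coe_lt_coe_iff]
        exact hl0.2.trans_lt ((hB.hi_lt_lo (i := 0) (j := Fin.last k)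
          (by rw [Fin.lt_def]; simpa using hk)).trans_le hr0.1)
    rw [h1]
    exact av_deriv2_of_affine hf hlt (haff _ _ hl0) (haff _ _ hr0)
  have hent : ∀ i, (t i).dom.enter .R (t i).dom.top = (arcs i.castSucc).finHi := fun i => by
    rw [hhi]
    exact (hhang i).2.1
  have hlea : ∀ i, (t i).dom.leave .R (t i).dom.top = (arcs i.succ).finLo := fun i => by
    rw [hlo]
    exact (hhang i).2.2
  have hlam : ∀ i, (t i).dom.lam f (t i).dom.top = Lam := fun i => by
    have e1 : (t i).dom.a (t i).dom.top = _ := hent i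
    have e2 : (t i).dom.b (t i).dom.top = _ := hlea i
    rw [ChordalDomain.lam, e1, e2, hLam]
    exact av_deriv2_of_affine hf (hgap i) (haff _ _ ((hval _).finHi_mem (hline _)))
      (haff _ _ ((hval _).finLo_mem (hline _)))
  refine ⟨⟨fun j => (hval j).finLo_le_finHi (hline j), fun j z hz => ?_, fun j hj z hz => ?_, hadm,
    hl.2, hent, hlea, hlam, fun i => ?_⟩, fun j hj x hx => (heq j hj x hx).trans hLam.symm⟩
  · have hmem : z ∈ (arcs j).toSet := (arcs j).ordConnected_toSet.out
      ((hval j).finLo_mem (hline j)) ((hval j).finHi_mem (hline j)) hz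
    by_cases hj : (arcs j).lo < (arcs j).hi
    · exact ((heq j hj z hmem).trans hLam.symm).le
    · have hpt : (arcs j).lo = (arcs j).hi := (hval j).1.eq_of_not_lt hj
      have hz' : ∀ y ∈ (arcs j).toSet, z = y := fun y hy => EReal.coe_eq_coe_iff.1
        ((le_antisymm (hpt ▸ hmem.2) hmem.1).trans (le_antisymm hy.1 (hpt ▸ hy.2)))
      -- At a one-point arc f'' ≤ Lam comes from the sign of a differential of the upper chord over
      -- an adjacent gap. Such a gap exists, since a multifigure has more than one point.
      rcases Fin.eq_castSucc_or_eq_last j with ⟨i, rfl⟩ | rfl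
      · have hF := (hadm i).dom.midFlow hf .R
        have := hF.leA _ (right_mem_Icc.2 hF.lt.le)
        rwa [hent, hlam, ← hz' _ ((hval _).finHi_mem (hline _))] at this
      · rcases Fin.eq_zero_or_eq_succ (Fin.last k) with h0 | ⟨i, h0⟩
        · exfalso
          rcases hB.2.2.2.2 with h2 | ⟨i, hi⟩
          · have := congrArg Fin.val h0
            simp at this
            omega
          · have hk : k = 0 := by simpa using congrArg Fin.val h0
            subst hk
            rw [Subsingleton.elim (α := Fin 1) i (Fin.last 0)] at hi
            exact hj hi
        · rw [h0] at hz' hmem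
          have hF := (hadm i).dom.midFlow hf .R
          have := hF.leB _ (right_mem_Icc.2 hF.lt.le)
          rwa [hlea, hlam, ← hz' _ ((hval _).finLo_mem (hline _))] at this
  · have hmem : z ∈ (arcs j).toSet := (arcs j).ordConnected_toSet.out
      ((hval j).finLo_mem (hline j)) ((hval j).finHi_mem (hline j)) hz
    refine (heq j ?_ z hmem).trans hLam.symm
    have h1 := ((hval j).finLo_mem (hline j)).1
    have h2 := ((hval j).finHi_mem (hline j)).2
    exact h1.trans_lt ((EReal.coe_lt_coe_iff.2 hj).trans_le h2)
  · rw [(hhang i).1, ← hlo, ← hhi]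
    have := (hB.2.1 i).2
    rw [← (hval _).coe_finHi (hB.hi_ne_top i), ← (hval _).coe_finLo (hB.lo_ne_bot i),
      ← EReal.coe_add, EReal.coe_le_coe_iff] at this
    linarith

lemma reverse_ofFn_rev {α : Type*} {k : ℕ} (T : Fin k → α) :
    (List.ofFn fun i => T i.rev).reverse = List.ofFn T := by
  refine List.ext_getElem (by simp) fun i h1 h2 => ?_
  simp only [List.length_ofFn] at h2
  simp only [List.getElem_reverse, List.getElem_ofFn, List.length_ofFn]
  congr 1
  ext
  simp only [Fin.val_rev]
  omega

lemma reverse_ofFn {α : Type*} {k : ℕ} (T : Fin k → α) :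
    (List.ofFn T).reverse = List.ofFn fun i => T i.rev := by
  rw [← reverse_ofFn_rev fun i => T i.rev]
  simp only [Fin.rev_rev]

/-- A trolleybus or a birdie is a row with one gap between two one-point arcs, so it needs no
argument of its own. -/
lemma treeRow_trolleybus {f : ℝ → ℝ} (hf : ContDiff ℝ 2 f) {η₁ Lam a b : ℝ} {t : FixedTree}
    (hlen : b - a ≤ 2 * η₁) (hhang : t.HangsAt a b) (hadm : t.Admissible f η₁) (hl : t.LeafRoot f)
    (hlab : Lam = av (deriv (deriv f)) a b) :
    TreeRow f .R η₁ Lam (fun _ : Fin 1 => t) ![a, b] ![a, b] := by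
  have hF := hadm.dom.midFlow hf .R
  have e1 : t.dom.enter .R t.dom.top = a := hhang.2.1
  have e2 : t.dom.leave .R t.dom.top = b := hhang.2.2
  have e3 : t.dom.lam f t.dom.top = Lam := by
    rw [hlab, ChordalDomain.lam, hhang.2.1, hhang.2.2]
  have h1 := hF.leA _ (right_mem_Icc.2 hF.lt.le)
  have h2 := hF.leB _ (right_mem_Icc.2 hF.lt.le)
  rw [e1, e3] at h1
  rw [e2, e3] at h2
  refine ⟨fun _ => le_rfl, fun j z hz => ?_, fun j hj => absurd hj (lt_irrefl _), fun _ => hadm,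
    fun _ => hl, fun i => ?_, fun i => ?_, fun _ => e3, fun _ => hhang.1.trans_le hlen⟩
  · rw [Icc_self, mem_singleton_iff] at hz
    rw [hz]
    fin_cases j
    · exact h1
    · exact h2
  · rw [Subsingleton.elim i 0]
    exact e1
  · rw [Subsingleton.elim i 0]
    exact e2

/-! ### Vertices at which the orientation is kept -/

/-- Tangents of one orientation may be continued through any vertex at which the orientation does not
change. -/
lemma passes_vertex {f : ℝ → ℝ} {εinf η₁ : ℝ} (h : TameDatum f εinf) (hη₁ : η₁ ∈ Ioo 0 εinf)
    {s : Side} {V : LabelledVertex} {inn out : Option OldEdge} (hadm : V.1.Admissible f η₁)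
    (hleaf : V.1.LeafRoot f) (hlab : LabelOK f V) (hin : InSide V s inn)
    (hout : OutSide f η₁ V s out) (hid : V.1.inDir s = s) (hod : V.1.outDir s = s) :
    Passes f η₁ εinf s V inn out := by
  have hf := h.reg.1
  obtain ⟨v, lam⟩ := V
  have hin' : ∀ x : ℝ, v.inEnd s = x → ∃ E, inn = some E ∧ Incoming (v, lam) s E := fun x hx => by
    rcases inn with _ | E
    · exact absurd (hx.symm.trans hin) (EReal.coe_ne_bot x)
    · exact ⟨E, rfl, hin⟩
  have hout' : ∀ x : ℝ, v.outEnd s = x → ∃ E, out = some E ∧ Outgoing f η₁ (v, lam) s E :=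
    fun x hx => by
      rcases out with _ | E
      · exact absurd (hx.symm.trans hout) (EReal.coe_ne_top x)
      · exact ⟨E, rfl, hout⟩
  cases v with
  | angle w => cases s <;> simp [FreeVertex.inDir, FreeVertex.outDir, FreeVertex.leftDir,
      FreeVertex.rightDir] at hid hod
  | birdie a b t => cases s <;> simp [FreeVertex.inDir, FreeVertex.outDir, FreeVertex.leftDir,
      FreeVertex.rightDir] at hid hod
  | fict1 a b t => cases s <;> simp [FreeVertex.inDir, FreeVertex.leftDir,
      FreeVertex.rightDir] at hid hod
  | fict3 a b t => cases s <;> simp [FreeVertex.inDir, FreeVertex.leftDir,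
      FreeVertex.rightDir] at hid hod
  | minusInfinity s' =>
    have hs : s' = s := by cases s <;> exact hid
    subst hs
    cases s' with
    | R =>
      rcases inn with _ | E
      · rcases out with _ | E'
        · exact absurd (show (⊥ : EReal) = ⊤ from hout) bot_ne_top
        · exact passes_startInfinity h hη₁.1 hη₁.2 rfl hout
      · exact absurd hin.terminus hin.ne_bot
    | L =>
      rcases inn with _ | E
      · exact absurd (show -(⊥ : EReal) = ⊥ from hin) (by simp)
      · rcases out with _ | E'
        · exact passes_endInfinity h hη₁.1 rfl hin
        · have := hout.lt
          simp [FreeVertex.outEnd, FreeVertex.leftEnd] at this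
  | plusInfinity s' =>
    have hs : s' = s := by cases s <;> exact hid
    subst hs
    cases s' with
    | R =>
      rcases inn with _ | E
      · exact absurd (show (⊤ : EReal) = ⊥ from hin) top_ne_bot
      · rcases out with _ | E'
        · exact passes_endInfinity h hη₁.1 rfl hin
        · have := hout.lt
          simp [FreeVertex.outEnd, FreeVertex.rightEnd] at this
    | L =>
      rcases inn with _ | E
      · rcases out with _ | E'
        · exact absurd (show -(⊤ : EReal) = ⊤ from hout) (by simp)
        · exact passes_startInfinity h hη₁.1 hη₁.2 rfl hout
      · exact absurd (hin.terminus.trans (by simp [FreeVertex.inEnd, FreeVertex.rightEnd])) hin.ne_bot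
  | fict5 s' c =>
    have hs : s' = s := by cases s <;> exact hid
    subst hs
    have hl : lam = deriv (deriv f) c := (hlab (c, c) rfl).trans (by simp [av])
    obtain ⟨E, rfl, hE⟩ := hin' (s'.coord c) (by cases s' <;> rfl)
    obtain ⟨E', rfl, hE'⟩ := hout' (s'.coord c) (by cases s' <;> rfl)
    -- A vertex of the fifth type is a row without gaps on the one-point arc c: the waves pass over
    -- it and nothing is left in its place.
    refine TreeRow.passes (k := 0) (t := Fin.elim0) (lo := fun _ => s'.coord c)
      (hi := fun _ => s'.coord c) h hη₁.1 hE hE' ⟨fun _ => le_rfl, fun j z hz => ?_,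
        fun j hj => absurd hj (lt_irrefl _), fun i => i.elim0, fun i => i.elim0, fun i => i.elim0,
        fun i => i.elim0, fun i => i.elim0, fun i => i.elim0⟩ (by cases s' <;> rfl)
        (by cases s' <;> rfl) (by simp [FreeVertex.base]) fun η ℓ hℓ ε hε => ?_
    · rw [Icc_self, mem_singleton_iff] at hz
      rw [hz, hl]
      cases s' <;> simp [curv, Side.coord]
    · cases s' <;> simp [orient]
  | trolleybus s' a b t =>
    have hs : s' = s := by cases s <;> exact hid
    subst hs
    obtain ⟨hab, hlen, hhang, hta⟩ := hadm
    have hrow := treeRow_trolleybus hf hlen hhang hta hleaf (hlab (a, b) rfl)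
    cases s' with
    | R =>
      obtain ⟨E, rfl, hE⟩ := hin' a rfl
      obtain ⟨E', rfl, hE'⟩ := hout' b rfl
      exact hrow.passes h hη₁.1 hE hE' rfl rfl (by simp [FreeVertex.base]) fun η ℓ hℓ =>
        ⟨ℓ 0, hhang.1 ▸ hℓ 0, fun ε _ => by simp [orient]⟩
    | L =>
      obtain ⟨E, rfl, hE⟩ := hin' (-b) rfl
      obtain ⟨E', rfl, hE'⟩ := hout' (-a) rfl
      exact hrow.reflect.passes h hη₁.1 hE hE' rfl rfl (by simp [FreeVertex.base]) fun η ℓ hℓ =>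
        ⟨ℓ 0, hhang.1 ▸ hℓ 0, fun ε _ => by simp [orient]⟩
  | multi kind k arcs t =>
    cases kind with
    | multicup => cases s <;> simp [FreeVertex.inDir, FreeVertex.leftDir,
        FreeVertex.rightDir] at hid hod
    | multibirdie => cases s <;> simp [FreeVertex.inDir, FreeVertex.outDir, FreeVertex.leftDir,
        FreeVertex.rightDir] at hid hod
    | multitrolleybus s' =>
      have hs : s' = s := by cases s <;> exact hid
      subst hs
      have hhang := hadm.2.1
      have hval := hadm.1.1
      cases s' with
      | R =>
        have hlo : (arcs 0).lo ≠ ⊥ := (show ⊥ < (arcs 0).lo from hadm.2.2.2).ne'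
        obtain ⟨hrow, hflat⟩ := treeRow_multi hf hadm hleaf hlab (Or.inl hlo)
        have h0 := (hval 0).coe_finLo hlo
        obtain ⟨E, rfl, hE⟩ := hin' _ h0.symm
        rcases out with _ | E'
        · have hhi : (arcs (Fin.last k)).hi = ⊤ := hout
          have hlk := hadm.1.not_line (Or.inl hlo) (Fin.last k)
          have hlk' := hlk.resolve_right (not_not.2 hhi)
          refine hrow.passes_ray h hη₁.1 hE h0.symm (fun z hz => ?_) fun η ℓ hℓ =>
            ⟨ℓ, fun i => (hhang i).1 ▸ hℓ i, fun ε _ => ?_⟩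
          · refine hflat (Fin.last k) (hhi ▸ lt_top_iff_ne_top.2 (hval _).2.1.ne) z ⟨?_, hhi ▸ le_top⟩
            rw [← (hval _).coe_finLo hlk']
            exact EReal.coe_le_coe_iff.2 hz
          · simp only [orient, parade, if_pos hhi]
            rfl
        · have hhi : (arcs (Fin.last k)).hi ≠ ⊤ := (hout.lt.trans_le le_top).ne
          refine hrow.passes h hη₁.1 hE hout h0.symm ((hval _).coe_finHi hhi).symm
            (by simp [FreeVertex.base]) fun η ℓ hℓ => ⟨ℓ, fun i => (hhang i).1 ▸ hℓ i, fun ε _ => ?_⟩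
          simp only [orient, parade, if_neg hhi, List.append_nil]
      | L =>
        have hhi : (arcs (Fin.last k)).hi ≠ ⊤ := (show (arcs (Fin.last k)).hi < ⊤ from hadm.2.2.2).ne
        obtain ⟨hrow, hflat⟩ := treeRow_multi hf hadm hleaf hlab (Or.inr hhi)
        have h0 := (hval (Fin.last k)).coe_finHi hhi
        have h0' : (FreeVertex.multi (.multitrolleybus .L) k arcs t).inEnd .L =
            ((-(arcs (0 : Fin (k + 1)).rev).finHi : ℝ) : EReal) := by
          rw [Fin.rev_zero, EReal.coe_neg, h0]
          rfl
        obtain ⟨E, rfl, hE⟩ := hin' _ h0'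
        rcases out with _ | E'
        · have hlo : (arcs 0).lo = ⊥ := by
            have : -(arcs 0).lo = ⊤ := hout
            simpa using this
          have hlk := hadm.1.not_line (Or.inr hhi) 0
          have hlk' := hlk.resolve_left (not_not.2 hlo)
          refine hrow.reflect.passes_ray h hη₁.1 hE h0' (fun z hz => ?_) fun η ℓ hℓ =>
            ⟨fun i => ℓ i.rev, fun i => ?_, fun ε _ => ?_⟩
          · refine hflat 0 (hlo ▸ bot_lt_iff_ne_bot.2 (hval _).2.2.ne') (-z) ⟨hlo ▸ bot_le, ?_⟩
            rw [← (hval _).coe_finHi hlk']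
            rw [Fin.rev_last] at hz
            exact EReal.coe_le_coe_iff.2 (by linarith)
          · have := hℓ i.rev
            rw [Fin.rev_rev, (hhang i).1] at this
            exact this
          · simp only [orient, parade, if_pos hlo, List.reverse_append, reverse_ofFn, Fin.rev_rev]
            rfl
        · have hlo : (arcs 0).lo ≠ ⊥ := fun hcon => by
            have := hout.lt
            simp [FreeVertex.outEnd, FreeVertex.leftEnd, hcon] at this
          have h1 : (FreeVertex.multi (.multitrolleybus .L) k arcs t).outEnd .L =
              ((-(arcs (Fin.last k).rev).finLo : ℝ) : EReal) := by
            rw [Fin.rev_last, EReal.coe_neg, (hval 0).coe_finLo hlo]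
            rfl
          refine hrow.reflect.passes h hη₁.1 hE hout h0' h1
            (by simp [FreeVertex.base]) fun η ℓ hℓ =>
            ⟨fun i => ℓ i.rev, fun i => ?_, fun ε _ => ?_⟩
          · have := hℓ i.rev
            rw [Fin.rev_rev, (hhang i).1] at this
            exact this
          · simp only [orient, parade, if_neg hlo, List.nil_append, reverse_ofFn, Fin.rev_rev]

/-! ### Tangents of both orientations that meet over a row of trees -/

lemma curv_L_neg (f : ℝ → ℝ) : (fun z => curv f .L (-z)) = curv f .R := by
  funext z
  simp [curv, Side.coord]

lemma RegularDatum.locallyMonotone_curv {f : ℝ → ℝ} (h : RegularDatum f) (s : Side) :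
    LocallyMonotone (curv f s) := by
  cases s
  · exact h.locallyMonotone
  · exact h.locallyMonotone.reflect

/-- Right tangents from `S` and left tangents from `S'` on both sides of a row of trees, and points
`p` and `q` outside of the row that separate them. -/
structure Encounter (f : ℝ → ℝ) (η₁ η Lam : ℝ) {k : ℕ} (t : Fin k → FixedTree)
    (lo hi : Fin (k + 1) → ℝ) (S S' : ℝ → LabelledVertex) (Q₀ Q₀' : ℝ → ℝ) (x x' : ℝ)
    (ℓR ℓL : Fin k → ℝ → ℝ) (QR QL : Fin (k + 1) → ℝ → ℝ → ℝ) (p q : ℝ) : Prop where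
  lt : η₁ < η
  wavesR : TreeWaves f .R η₁ η Lam t lo ℓR QR
  wavesL : TreeWaves f .L η₁ η Lam (fun i => t i.rev) (fun j => -hi j.rev) ℓL QL
  emR : Emission f .R η₁ η S (QR 0) x (lo 0) Q₀
  emL : Emission f .L η₁ η S' (QL 0) x' ((-hi (Fin.rev 0) : ℝ)) Q₀'
  hp : p ∈ Ioo x (lo 0)
  hq : q ∈ Ioo (hi (Fin.last k)) (-x')
  gtp : ∀ ε ∈ Icc η₁ η, QL (Fin.last k) ε (-p) < QR 0 ε p
  ltq : ∀ ε ∈ Icc η₁ η, QR (Fin.last k) ε q < QL 0 ε (-q)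
  initR : ∀ z ∈ Ioc (hi (Fin.last k)) q, curv f .R z < QR (Fin.last k) η₁ z
  initL : ∀ z ∈ Ico p (lo 0), curv f .R z < QL (Fin.last k) η₁ (-z)
  posR : ∀ ε ∈ Ioc η₁ η, ∀ z ∈ Icc (hi (Fin.last k)) q, curv f .R z < QR (Fin.last k) ε z
  posL : ∀ ε ∈ Ioc η₁ η, ∀ z ∈ Icc p (lo 0), curv f .R z < QL (Fin.last k) ε (-z)

section Encounter

variable {f : ℝ → ℝ} {εinf η₁ η Lam : ℝ} {k : ℕ} {t : Fin k → FixedTree}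
    {lo hi : Fin (k + 1) → ℝ} {S S' : ℝ → LabelledVertex} {Q₀ Q₀' : ℝ → ℝ} {x x' : ℝ}
    {ℓR ℓL : Fin k → ℝ → ℝ} {QR QL : Fin (k + 1) → ℝ → ℝ → ℝ} {p q : ℝ}

/-- Both families are carried through the entire row. Just after the row the right wave is below the
left one, and just before it above; these strict inequalities at q and p survive for a short time
and enclose every possible place of meeting. -/
lemma exists_encounter (hreg : RegularDatum f) (hη₁ : 0 < η₁) (hη : η₁ < η)
    (hrow : TreeRow f .R η₁ Lam t lo hi) {Q Q' : ℝ → ℝ → ℝ}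
    (hR : Emission f .R η₁ η S Q x (lo 0) Q₀)
    (hL : Emission f .L η₁ η S' Q' x' ((-hi (Fin.last k) : ℝ)) Q₀')
    (h0 : Q₀ (lo 0) = Lam) (h0' : Q₀' (-hi (Fin.last k)) = Lam) :
    ∃ η' ∈ Ioc η₁ η, ∃ ℓR ℓL QR QL p q,
      Encounter f η₁ η' Lam t lo hi S S' Q₀ Q₀' x x' ℓR ℓL QR QL p q := by
  have hf := hreg.1
  have hg := continuous_curv (continuous_deriv2_datum hf)
  have hxR : x < lo 0 := EReal.coe_lt_coe_iff.1 hR.lt_end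
  have hxL : x' < -hi (Fin.last k) := EReal.coe_lt_coe_iff.1 hL.lt_end
  have hrev : Fin.rev (0 : Fin (k + 1)) = Fin.last k := Fin.rev_zero k
  obtain ⟨ηa, hηa, ℓR, QR, hwR, rfl⟩ := exists_rowWaves (hg .R) hη₁ (hrow.isRow hf) hη
    (hR.family_at hη₁ hxR.le le_rfl) (by rw [hR.init, h0])
  obtain ⟨ηb, hηb, ℓL, QL, hwL, rfl⟩ := exists_rowWaves (hg .L) hη₁ (hrow.reflect.isRow hf) hηa.1
    (Q₀ := Q') (by
      have := (hL.mono hηa.2).family_at hη₁ hxL.le le_rfl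
      rwa [← hrev] at this) (by rw [hL.init, ← h0', hrev])
  have hwR' := hwR.restrict hηb.2
  have m1 : η₁ ∈ Icc η₁ ηb := left_mem_Icc.2 hηb.1.le
  have hfR := (hrow.isRow hf).family_at_hi hη₁ hηb.1 (hwR'.fam (Fin.last k)) (hwR'.start _)
  have eqR : QR (Fin.last k) η₁ (hi (Fin.last k)) = Lam :=
    (hrow.isRow hf).eq_at_hi (hfR.solves η₁ m1) (hwR'.start _) _ (right_mem_Icc.2 (hrow.le _))
  have hfL := (hrow.reflect.isRow hf).family_at_hi hη₁ hηb.1 (hwL.fam (Fin.last k)) (hwL.start _)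
  have eqL := (hrow.reflect.isRow hf).eq_at_hi (hfL.solves η₁ m1) (hwL.start _) _
    (right_mem_Icc.2 (hrow.reflect.le _))
  rw [Fin.rev_last] at hfL eqL
  obtain ⟨q, hq, ηc, hηc, hq1, hq2, hq3⟩ := exists_crossing_end (hg .R)
    (hreg.locallyMonotone_curv .R) hη₁ hηb.1 (by linarith : hi (Fin.last k) < -x') hfR
    (QL := QL 0) (fun ε hε => (hwL.fam 0).solves ε hε) (hwL.fam 0).cont
    (by rw [eqR, hL.init, h0']) (by
      rw [eqR]
      exact hrow.arc_le _ _ (right_mem_Icc.2 (hrow.le _))) (fun z hz => by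
      rw [hL.init]
      have := hL.pos_init (-z) (by linarith [hz.2]) (EReal.coe_lt_coe_iff.2 (by linarith [hz.1]))
      rwa [← congrFun (curv_L_neg f) z])
  obtain ⟨p, hp, ηd, hηd, hp1, hp2, hp3⟩ := exists_crossing_end (hg .L)
    (hreg.locallyMonotone_curv .L) hη₁ hηc.1 (by linarith : -lo 0 < -x) (hfL.restrict hηc.2)
    (QL := QR 0) (fun ε hε => by
      rw [curv_L_neg]
      exact (hwR'.fam 0).solves ε ⟨hε.1, hε.2.trans hηc.2⟩) ((hwR'.restrict hηc.2).fam 0).cont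
    (by rw [eqL, hR.init, neg_neg, h0]) (by
      rw [eqL]
      have := hrow.arc_le 0 (lo 0) (left_mem_Icc.2 (hrow.le _))
      rwa [← congrFun (curv_L_neg f) (lo 0)] at this) (fun z hz => by
      rw [hR.init]
      exact hR.pos_init (-z) (by linarith [hz.2]) (EReal.coe_lt_coe_iff.2 (by linarith [hz.1])))
  have hle : ηd ≤ ηb := hηd.2.trans hηc.2
  refine ⟨ηd, ⟨hηd.1, hle.trans (hηb.2.trans hηa.2)⟩, ℓR, ℓL, QR, QL, -p, q,
    ⟨hηd.1, hwR'.restrict hle, hwL.restrict hle, hR.mono (hle.trans (hηb.2.trans hηa.2)), ?_,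
      ⟨by linarith [hp.2], by linarith [hp.1]⟩, hq, fun ε hε => ?_, fun ε hε =>
        hq1 ε ⟨hε.1, hε.2.trans hηd.2⟩, hq2, fun z hz => ?_,
      fun ε hε => hq3 ε ⟨hε.1, hε.2.trans hηd.2⟩, fun ε hε z hz => ?_⟩⟩
  · rw [hrev]
    exact hL.mono (hle.trans (hηb.2.trans hηa.2))
  · rw [neg_neg]
    exact hp1 ε hε
  · have := hp2 (-z) ⟨by linarith [hz.2], by linarith [hz.1]⟩
    rwa [← congrFun (curv_L_neg f) z]
  · have := hp3 ε hε (-z) ⟨by linarith [hz.2], by linarith [hz.1]⟩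
    rwa [← congrFun (curv_L_neg f) z]

namespace Encounter

/-- The left waves are indexed along the reflected row; the indices are turned back to the common
order from left to right. -/
lemma gapL (h : Encounter f η₁ η Lam t lo hi S S' Q₀ Q₀' x x' ℓR ℓL QR QL p q) (i : Fin k) :
    GapCrossing (curv f .L) ((t i).dom.enter .L) ((t i).dom.leave .L) ((t i).dom.lam f)
      (t i).dom.mid (t i).dom.top η₁ η (ℓL i.rev) (QL i.succ.rev) (QL i.castSucc.rev) := by
  have := h.wavesL.gap i.rev
  beta_reduce at this
  rwa [Fin.rev_rev, ← Fin.rev_succ, ← Fin.rev_castSucc] at this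

lemma posR_before (h : Encounter f η₁ η Lam t lo hi S S' Q₀ Q₀' x x' ℓR ℓL QR QL p q)
    (hf : ContDiff ℝ 2 f) (hη₁ : 0 < η₁) {ε : ℝ} (hε : ε ∈ Ioc η₁ η) :
    Reach f .R ε (S ε) (QR 0 ε) (lo 0) :=
  h.emR.reach_at (continuous_curv (continuous_deriv2_datum hf) .R) hη₁
    (EReal.coe_lt_coe_iff.1 h.emR.lt_end) le_rfl hε

lemma posL_before (h : Encounter f η₁ η Lam t lo hi S S' Q₀ Q₀' x x' ℓR ℓL QR QL p q)
    (hf : ContDiff ℝ 2 f) (hη₁ : 0 < η₁) {ε : ℝ} (hε : ε ∈ Ioc η₁ η) :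
    Reach f .L ε (S' ε) (QL 0 ε) (-hi (Fin.last k)) := by
  have := h.emL.reach_at (continuous_curv (continuous_deriv2_datum hf) .L) hη₁
    (EReal.coe_lt_coe_iff.1 h.emL.lt_end) le_rfl hε
  rwa [Fin.rev_zero] at this

lemma reachR_p (h : Encounter f η₁ η Lam t lo hi S S' Q₀ Q₀' x x' ℓR ℓL QR QL p q)
    (hf : ContDiff ℝ 2 f) (hη₁ : 0 < η₁) {ε : ℝ} (hε : ε ∈ Ioc η₁ η) :
    Reach f .R ε (S ε) (QR 0 ε) p :=
  (h.posR_before hf hη₁ hε).restrict h.hp.2.le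
    ((h.emR.reach ε hε).lt.trans (EReal.coe_lt_coe_iff.2 h.hp.1))

lemma reachL_q (h : Encounter f η₁ η Lam t lo hi S S' Q₀ Q₀' x x' ℓR ℓL QR QL p q)
    (hf : ContDiff ℝ 2 f) (hη₁ : 0 < η₁) {ε : ℝ} (hε : ε ∈ Ioc η₁ η) :
    Reach f .L ε (S' ε) (QL 0 ε) (-q) :=
  (h.posL_before hf hη₁ hε).restrict (by linarith [h.hq.1])
    ((h.emL.reach ε hε).lt.trans (EReal.coe_lt_coe_iff.2 (by linarith [h.hq.2])))

lemma posp_R (h : Encounter f η₁ η Lam t lo hi S S' Q₀ Q₀' x x' ℓR ℓL QR QL p q)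
    (hf : ContDiff ℝ 2 f) (hη₁ : 0 < η₁) {ε : ℝ} (hε : ε ∈ Ioc η₁ η) :
    ∀ z ∈ Icc p (lo 0), curv f .R z < QR 0 ε z := fun z hz =>
  (h.posR_before hf hη₁ hε).pos z
    ((h.reachR_p hf hη₁ hε).lt.trans_le (EReal.coe_le_coe_iff.2 hz.1)) hz.2

lemma posq_L (h : Encounter f η₁ η Lam t lo hi S S' Q₀ Q₀' x x' ℓR ℓL QR QL p q)
    (hf : ContDiff ℝ 2 f) (hη₁ : 0 < η₁) {ε : ℝ} (hε : ε ∈ Ioc η₁ η) :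
    ∀ z ∈ Icc (hi (Fin.last k)) q, curv f .R z < QL 0 ε (-z) := fun z hz => by
  rw [← congrFun (curv_L_neg f) z]
  exact (h.posL_before hf hη₁ hε).pos (-z)
    ((h.reachL_q hf hη₁ hε).lt.trans_le (EReal.coe_le_coe_iff.2 (neg_le_neg hz.2)))
    (by linarith [hz.1])

lemma meeting (h : Encounter f η₁ η Lam t lo hi S S' Q₀ Q₀' x x' ℓR ℓL QR QL p q)
    (hf : ContDiff ℝ 2 f) (hη₁ : 0 < η₁) (hrow : TreeRow f .R η₁ Lam t lo hi) {ε : ℝ}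
    (hε : ε ∈ Ioc η₁ η) :
    Meeting (curv f .R) ε lo hi (fun i => (t i).dom.enter .R) (fun i => (t i).dom.leave .R)
      (fun i => (t i).dom.lam f) (fun i => (t i).dom.mid) (fun i => (t i).dom.top)
      (fun i => ℓR i ε) (fun i => ℓL i.rev ε) (fun j => QR j ε) (fun j => QL j.rev ε) p q := by
  have hε' : ε ∈ Icc η₁ η := ⟨hε.1.le, hε.2⟩
  have hmem : ∀ {A B lam : ℝ → ℝ} {bot top : ℝ} {G : ℝ → ℝ} {ℓ : ℝ → ℝ} {Q Q' : ℝ → ℝ → ℝ},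
      GapCrossing G A B lam bot top η₁ η ℓ Q Q' → ℓ ε ∈ Ioo bot top := fun hg =>
    ⟨(hg.mem ε hε').1, by
      rw [← hg.shrink.2.2]
      exact hg.shrink.2.1 (left_mem_Icc.2 h.lt.le) hε' hε.1⟩
  have hneg : ∀ z, curv f .R z = curv f .L (-z) := fun z => (congrFun (curv_L_neg f) z).symm
  have hrR := hrow.isRow hf
  have hrL := hrow.reflect.isRow hf
  exact {
    pos := hη₁.trans hε.1
    le := hrow.le
    flow := hrR.flow
    A_top := hrow.enter_top
    B_top := hrow.leave_top
    hr := fun i => hmem (h.wavesR.gap i)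
    hs := fun i => hmem (h.gapL i)
    solR := fun j => (h.wavesR.fam j).solves ε hε'
    solL := fun j => (h.wavesL.fam j.rev).solves ε hε'
    arcR := fun j => hrR.pos_on_arc hη₁ (h.wavesR.fam j) (h.wavesR.start j) hε
    arcL := fun j z hz => by
      rw [hneg]
      refine hrL.pos_on_arc hη₁ (h.wavesL.fam j.rev) (h.wavesL.start j.rev) hε (-z) ?_
      rw [Fin.rev_rev]
      exact ⟨neg_le_neg hz.2, neg_le_neg hz.1⟩
    enterR := fun i => (h.wavesR.gap i).enter ε hε'
    exitR := fun i => (h.wavesR.gap i).exit ε hε'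
    enterR_gt := fun i => (h.wavesR.gap i).enter_gt ε hε'
    exitR_gt := fun i => (h.wavesR.gap i).exit_gt ε hε'
    pos_enterR := fun i => (h.wavesR.gap i).pos_enter ε hε
    pos_exitR := fun i => (h.wavesR.gap i).pos_exit ε hε
    enterL := fun i => (h.gapL i).enter ε hε'
    exitL := fun i => (h.gapL i).exit ε hε'
    enterL_gt := fun i => (h.gapL i).enter_gt ε hε'
    exitL_gt := fun i => (h.gapL i).exit_gt ε hε'
    pos_enterL := fun i z hz => by
      rw [hneg]
      exact (h.gapL i).pos_enter ε hε (-z) ⟨neg_le_neg hz.2, neg_le_neg hz.1⟩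
    pos_exitL := fun i z hz => by
      rw [hneg]
      exact (h.gapL i).pos_exit ε hε (-z) ⟨neg_le_neg hz.2, neg_le_neg hz.1⟩
    hp := h.hp.2
    hq := h.hq.1
    posp_R := h.posp_R hf hη₁ hε
    posp_L := fun z hz => by
      rw [Fin.rev_zero]
      exact h.posL ε hε z hz
    posq_R := h.posR ε hε
    posq_L := fun z hz => by
      rw [Fin.rev_last]
      exact h.posq_L hf hη₁ hε z hz
    gtp := by
      rw [Fin.rev_zero]
      exact h.gtp ε hε'
    ltq := by
      rw [Fin.rev_last]
      exact h.ltq ε hε' }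

end Encounter

end Encounter

/-- Vertices `X 0, …, X j, M, Y j', …, Y k` with the ends considered separately. -/
lemma isChain_meeting {α : Type*} {R : α → α → Prop} {k : ℕ} {X Y : Fin (k + 1) → α} {M : α}
    (hX : ∀ i : Fin k, R (X i.castSucc) (X i.succ)) (hY : ∀ i : Fin k, R (Y i.castSucc) (Y i.succ))
    (j j' : Fin (k + 1)) (h1 : R (X j) M) (h2 : R M (Y j')) :
    ([X 0] ++ ((List.ofFn fun i : Fin k => X i.succ).take j ++ [M] ++
      (List.ofFn fun i : Fin k => Y i.castSucc).drop j') ++ [Y (Fin.last k)]).IsChain R := by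
  have e1 : [X 0] ++ (List.ofFn fun i : Fin k => X i.succ).take j = (List.ofFn X).take (j + 1) := by
    rw [List.ofFn_succ]
    rfl
  have e2 : (List.ofFn fun i : Fin k => Y i.castSucc).drop j' ++ [Y (Fin.last k)] =
      (List.ofFn Y).drop j' := by
    rw [List.ofFn_succ_last, List.drop_append_of_le_length (by simp; omega)]
  have e3 : [X 0] ++ ((List.ofFn fun i : Fin k => X i.succ).take j ++ [M] ++
      (List.ofFn fun i : Fin k => Y i.castSucc).drop j') ++ [Y (Fin.last k)] =
      (List.ofFn X).take (j + 1) ++ M :: (List.ofFn Y).drop j' := by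
    rw [← e1, ← e2]
    simp
  have cX : (List.ofFn X).IsChain R := List.isChain_ofFn.2 fun i hi => hX ⟨i, by omega⟩
  have cY : (List.ofFn Y).IsChain R := List.isChain_ofFn.2 fun i hi => hY ⟨i, by omega⟩
  rw [e3, List.isChain_append]
  refine ⟨cX.take _, ?_, fun a ha b hb => ?_⟩
  · rw [List.isChain_cons]
    refine ⟨fun b hb => ?_, cY.drop _⟩
    rw [List.head?_drop, List.getElem?_ofFn] at hb
    simp only [Fin.is_lt, dite_true, Fin.eta, Option.mem_def, Option.some.injEq] at hb
    rwa [← hb]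
  · rw [List.getLast?_take] at ha
    simp only [List.head?_cons, Option.mem_def, Option.some.injEq] at hb
    rw [← hb]
    simp [-List.ofFn_succ] at ha
    rcases ha with ⟨-, rfl⟩ | ⟨hlt, -⟩
    · exact h1
    · omega

/-- Before the meeting place the chord of the right waves is used, after it that of the left ones,
and in each case it is the shorter of the two. The minimum is one length function for a gap,
whichever waves arrive there. -/
lemma shrinkingLength_min {η₁ η l₀ : ℝ} {r s : ℝ → ℝ} (hr : ShrinkingLength η₁ η l₀ r)
    (hs : ShrinkingLength η₁ η l₀ s) : ShrinkingLength η₁ η l₀ fun ε => min (r ε) (s ε) := by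
  obtain ⟨h1, h2, h3⟩ := hr
  obtain ⟨h1', h2', h3'⟩ := hs
  exact ⟨ContinuousOn.inf h1 h1', fun u hu v hv huv => min_lt_min (h2 hu hv huv) (h2' hu hv huv), by simp [h3, h3']⟩

lemma vertexOK_angle (f : ℝ → ℝ) (ε w c : ℝ) : VertexOK f ε (.angle w, c) :=
  ⟨trivial, trivial, trivial, fun p hp => by simp [FreeVertex.base] at hp⟩

lemma fits_meeting {f : ℝ → ℝ} {ε : ℝ} {V V' : LabelledVertex} {B : List LabelledVertex}
    (h : ([V] ++ B ++ [V']).IsChain (Link f ε)) :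
    Fits f ε (some (.R, V)) B (some (.L, V')) := ⟨h, trivial, trivial⟩

section Encounter

variable {f : ℝ → ℝ} {εinf η₁ η Lam : ℝ} {k : ℕ} {t : Fin k → FixedTree}
    {lo hi : Fin (k + 1) → ℝ} {S S' : ℝ → LabelledVertex} {Q₀ Q₀' : ℝ → ℝ} {x x' : ℝ}
    {ℓR ℓL : Fin k → ℝ → ℝ} {QR QL : Fin (k + 1) → ℝ → ℝ → ℝ} {p q : ℝ}

/-- Where the tangents meet, there are right trolleybuses on the left, left trolleybuses on the
right, and an angle or a birdie between them. -/
lemma Encounter.exists_block (h : Encounter f η₁ η Lam t lo hi S S' Q₀ Q₀' x x' ℓR ℓL QR QL p q)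
    (hf : ContDiff ℝ 2 f) (hη₁ : 0 < η₁) (hrow : TreeRow f .R η₁ Lam t lo hi) {ε : ℝ}
    (hε : ε ∈ Ioc η₁ η) :
    ∃ B : List LabelledVertex, (∀ U ∈ B, VertexOK f ε U) ∧
      Fits f ε (some (.R, S ε)) B (some (.L, S' ε)) ∧
      ((∃ (j : Fin (k + 1)) (w : ℝ), B.map Prod.fst =
        (parade .R t fun i => min (ℓR i ε) (ℓL i.rev ε)).take j ++ [.angle w] ++
          (parade .L t fun i => min (ℓR i ε) (ℓL i.rev ε)).drop j) ∨
      ∃ j : Fin k, B.map Prod.fst =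
        (parade .R t fun i => min (ℓR i ε) (ℓL i.rev ε)).take j ++
          [shrunkBirdie (t j) (min (ℓR j ε) (ℓL j.rev ε))] ++
          (parade .L t fun i => min (ℓR i ε) (ℓL i.rev ε)).drop (j + 1)) := by
  have hε' : ε ∈ Icc η₁ η := ⟨hε.1.le, hε.2⟩
  set X : Fin (k + 1) → LabelledVertex := rowSource f .R t ℓR S ε with hXdef
  set Y : Fin (k + 1) → LabelledVertex := fun j => rowSource f .L (fun i => t i.rev) ℓL S' ε j.rev
    with hYdef
  have hX0 : X 0 = S ε := rfl
  have hXs : ∀ i : Fin k, X i.succ = labelledTrolleybus f .R (t i) (ℓR i ε) := fun i => rfl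
  have hYl : Y (Fin.last k) = S' ε := by
    simp only [hYdef, Fin.rev_last]
    rfl
  have hYc : ∀ i : Fin k, Y i.castSucc = labelledTrolleybus f .L (t i) (ℓL i.rev ε) := fun i => by
    simp only [hYdef, Fin.rev_castSucc, rowSource, Fin.cons_succ, Fin.rev_rev]
  have hX : ∀ i : Fin k, Link f ε (X i.castSucc) (X i.succ) := fun i =>
    Or.inl (h.wavesR.flows hf hη₁ hrow h.emR hε i)
  have hY : ∀ i : Fin k, Link f ε (Y i.castSucc) (Y i.succ) := fun i => by
    have := h.wavesL.flows hf hη₁ hrow.reflect h.emL hε i.rev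
    rw [← Fin.rev_succ, ← Fin.rev_castSucc] at this
    exact Or.inr this
  have hokR : ∀ i, VertexOK f ε (labelledTrolleybus f .R (t i) (ℓR i ε)) := fun i =>
    h.wavesR.vertexOK hrow hε i .R
  have hokL : ∀ i : Fin k, VertexOK f ε (labelledTrolleybus f .L (t i) (ℓL i.rev ε)) := fun i => by
    have := h.wavesL.vertexOK hrow.reflect hε i.rev .L
    rwa [Fin.rev_rev] at this
  have hM := h.meeting hf hη₁ hrow hε
  -- Both outcomes have the same shape: right trolleybuses over the gaps before j, the middle vertex
  -- M, left trolleybuses over the gaps from j' on.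
  have build : ∀ (j j' : Fin (k + 1)) (M : LabelledVertex), VertexOK f ε M → Link f ε (X j) M →
      Link f ε M (Y j') → (∀ i : Fin k, i.castSucc < j → ℓR i ε ≤ ℓL i.rev ε) →
      (∀ i : Fin k, j' ≤ i.castSucc → ℓL i.rev ε ≤ ℓR i ε) →
      ∃ B : List LabelledVertex, (∀ U ∈ B, VertexOK f ε U) ∧
        Fits f ε (some (.R, S ε)) B (some (.L, S' ε)) ∧ B.map Prod.fst =
          (parade .R t fun i => min (ℓR i ε) (ℓL i.rev ε)).take j ++ [M.1] ++
          (parade .L t fun i => min (ℓR i ε) (ℓL i.rev ε)).drop j' := by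
    intro j j' M hMok h1 h2 h3 h4
    have hc := isChain_meeting hX hY j j' h1 h2
    rw [hX0, hYl] at hc
    refine ⟨_, fun U hU => ?_, fits_meeting hc, ?_⟩
    · rcases List.mem_append.1 hU with hU | hU
      · rcases List.mem_append.1 hU with hU | hU
        · obtain ⟨i, rfl⟩ := List.mem_ofFn.1 (List.mem_of_mem_take hU)
          exact hokR i
        · rwa [List.mem_singleton.1 hU]
      · obtain ⟨i, rfl⟩ := List.mem_ofFn.1 (List.mem_of_mem_drop hU)
        rw [hYc]
        exact hokL i
    · rw [List.map_append, List.map_append, List.map_take, List.map_drop, List.map_ofFn, List.map_ofFn]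
      congr 1
      · congr 1
        refine List.ext_getElem (by simp [parade]) fun n hn1 hn2 => ?_
        simp only [List.length_take, List.length_ofFn, lt_min_iff] at hn1
        simp only [parade, List.getElem_take, List.getElem_ofFn, Function.comp_apply, hXs]
        rw [min_eq_left (h3 _ (by rw [Fin.lt_def]; exact hn1.1))]
        rfl
      · refine List.ext_getElem (by simp [parade]) fun n hn1 hn2 => ?_
        simp only [parade, List.getElem_drop, List.getElem_ofFn, Function.comp_apply, hYc]
        rw [min_eq_right (h4 _ (by rw [Fin.le_def]; simp))]
        rfl
  rcases hM.resolve with ⟨j, hj, hlt, hgt⟩ | ⟨j, w, hlt, hgt, hval, hj0, hjs, hjl, hjc⟩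
  -- A birdie takes up the gap j, which is therefore left out on both sides; an angle takes up no
  -- gap and uses j' = j.
  · obtain ⟨B, hB1, hB2, hB3⟩ := build j.castSucc j.succ (labelledBirdie f (t j) (ℓR j ε))
      (vertexOK_labelledBirdie hε.1 (hrow.adm j) (hrow.leaf j) (h.wavesR.length_mem hrow hε j).1
        (h.wavesR.length_mem hrow hε j).2.le (hrow.top_le j))
      (Or.inl ((h.wavesR.reach_enter hf hη₁ hrow h.emR hε j).flows rfl
        (inEnd_shrunkBirdie .R _ _) ((h.wavesR.gap j).enter ε hε')))
      (Or.inr ((by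
        have := h.wavesL.reach_enter hf hη₁ hrow.reflect h.emL hε j.rev
        rw [← Fin.rev_succ, Fin.rev_rev, ← show ℓR j ε = ℓL j.rev ε from hj] at this
        refine this.flows rfl (inEnd_shrunkBirdie .L _ _) ?_
        have h2 := (h.gapL j).enter ε hε'
        rwa [← show ℓR j ε = ℓL j.rev ε from hj] at h2)))
      (fun i hi => (hlt i (Fin.castSucc_lt_castSucc_iff.1 hi)).le)
      (fun i hi => (hgt i (Fin.succ_le_castSucc_iff.1 hi)).le)
    refine ⟨B, hB1, hB2, Or.inr ⟨j, ?_⟩⟩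
    rw [hB3, ← show ℓR j ε = ℓL j.rev ε from hj, min_self]
    rfl
  · obtain ⟨B, hB1, hB2, hB3⟩ := build j j (.angle w, QR j ε w) (vertexOK_angle f ε w _)
      (Or.inl ((show Reach f .R ε (X j) (QR j ε) w from by
        rcases Fin.eq_zero_or_eq_succ j with rfl | ⟨i, rfl⟩
        · exact (h.reachR_p hf hη₁ hε).extend (hj0 rfl).1.le (hj0 rfl).2
        · exact reach_labelledTrolleybus ((h.wavesR.fam _).solves ε hε')
            ((h.wavesR.gap i).exit ε hε') (hjs i rfl).1 (hjs i rfl).2).flows rfl rfl rfl))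
      (Or.inr ((show Reach f .L ε (Y j) (QL j.rev ε) (-w) from by
        have hneg : ∀ z, curv f .L z = curv f .R (-z) := fun z => rfl
        rcases Fin.eq_castSucc_or_eq_last j with ⟨i, rfl⟩ | rfl
        · rw [hYc]
          refine reach_labelledTrolleybus ((h.wavesL.fam _).solves ε hε')
            ((h.gapL i).exit ε hε') (neg_lt_neg (hjc i rfl).1) fun z hz => ?_
          have := (hjc i rfl).2 (-z) ⟨by linarith [hz.2], by
            have h7 : -(t i).dom.a (ℓL i.rev ε) ≤ z := hz.1
            show -z ≤ (t i).dom.a (ℓL i.rev ε)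
            linarith⟩
          rwa [neg_neg] at this
        · rw [hYl, Fin.rev_last]
          refine (h.reachL_q hf hη₁ hε).extend (neg_le_neg (hjl rfl).1.le) fun z hz => ?_
          have := (hjl rfl).2 (-z) ⟨by linarith [hz.2], by linarith [hz.1]⟩
          rwa [neg_neg, Fin.rev_last] at this).flows rfl rfl hval.symm))
      (fun i hi => (hlt i hi).le) (fun i hi => (hgt i hi).le)
    exact ⟨B, hB1, hB2, Or.inl ⟨j, w, hB3⟩⟩

end Encounter

/-! ### Vertices at which tangents meet -/

/-- Tangents that come to the vertex `V` from both sides may be continued. -/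
def Meets (f : ℝ → ℝ) (η₁ εinf : ℝ) (V : LabelledVertex) (l r : Option OldEdge) : Prop :=
  ∀ D D', Continues f η₁ εinf D l → Continues f η₁ εinf D' r → Evolution f η₁ εinf V l r D D'

/-- The row is demanded only under f'' ≤ V.2 at its left end. For an angle this inequality has no
other source than the incoming wave, which gives it by passing to the limit. -/
lemma exists_encounter_of_continues {f : ℝ → ℝ} {εinf η₁ : ℝ} (h : TameDatum f εinf) (hη₁ : 0 < η₁)
    {V : LabelledVertex} {E E' : OldEdge} (hE : Incoming V .R E) (hE' : Incoming V .L E') {k : ℕ}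
    {t : Fin k → FixedTree} {lo hi : Fin (k + 1) → ℝ}
    (h0 : V.1.inEnd .R = lo 0) (h1 : V.1.inEnd .L = ((-hi (Fin.last k) : ℝ) : EReal)) {D D' : NewEdge}
    (hD : Continues f η₁ εinf D (some E)) (hD' : Continues f η₁ εinf D' (some E'))
    (hrow : curv f .R (lo 0) ≤ V.2 → TreeRow f .R η₁ V.2 t lo hi) :
    TreeRow f .R η₁ V.2 t lo hi ∧ ∃ η ∈ Ioo η₁ εinf, ∃ ℓR ℓL QR QL p q,
      Encounter f η₁ η V.2 t lo hi D.source D'.source E.wave E'.wave D.point D'.point ℓR ℓL QR QL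
        p q := by
  obtain ⟨hD1, hD2⟩ := hD
  obtain ⟨hD1', hD2'⟩ := hD'
  rw [hE.dir, hE.terminus, h0] at hD2
  rw [hE'.dir, hE'.terminus, h1] at hD2'
  have hη : η₁ < min D.time D'.time := lt_min hD1.1 hD1'.1
  have hrow' := hrow (by
    have := hD2.le_at (continuous_curv h.cont .R) hD1.1 (EReal.coe_lt_coe_iff.1 hD2.lt_end) le_rfl
    rwa [hE.val _ h0] at this)
  obtain ⟨η, hη', hex⟩ := exists_encounter h.reg hη₁ hη hrow' (hD2.mono (min_le_left _ _))
    (hD2'.mono (min_le_right _ _)) (hE.val _ h0) (hE'.val _ h1)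
  exact ⟨hrow', η, ⟨hη'.1, (hη'.2.trans (min_le_left _ _)).trans_lt hD1.2⟩, hex⟩

/-- For every ε, the initial one included, the difference of the waves decreases strictly on one
fixed interval [p, q] and changes sign on it. So its zero is unique, depends continuously on ε, and
equals w at η₁. -/
lemma meets_angle {f : ℝ → ℝ} {εinf η₁ : ℝ} (h : TameDatum f εinf) (hη₁ : 0 < η₁) {w lam : ℝ}
    {E E' : OldEdge} (hE : Incoming (.angle w, lam) .R E) (hE' : Incoming (.angle w, lam) .L E') :
    Meets f η₁ εinf (.angle w, lam) (some E) (some E') := by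
  intro D D' hD hD'
  have hf := h.reg.1
  obtain ⟨hrow, η, hη, ℓR, ℓL, QR, QL, p, q, henc⟩ := exists_encounter_of_continues h hη₁ hE hE' (k := 0)
    (t := Fin.elim0) (lo := fun _ => w) (hi := fun _ => w) rfl rfl hD hD' fun hle =>
      ⟨fun _ => le_rfl, fun j z hz => by
        rw [Icc_self, mem_singleton_iff] at hz
        rwa [hz], fun j hj => absurd hj (lt_irrefl _), fun i => i.elim0, fun i => i.elim0,
        fun i => i.elim0, fun i => i.elim0, fun i => i.elim0, fun i => i.elim0⟩
  have hpw : p < w := henc.hp.2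
  have hwq : w < q := henc.hq.1
  have m1 : η₁ ∈ Icc η₁ η := left_mem_Icc.2 henc.lt.le
  have hp0 : ∀ ε ∈ Icc η₁ η, QL 0 ε (-p) < QR 0 ε p := henc.gtp
  have hq0 : ∀ ε ∈ Icc η₁ η, QR 0 ε q < QL 0 ε (-q) := henc.ltq
  have iR : ∀ z ∈ Ioc w q, curv f .R z < QR 0 η₁ z := henc.initR
  have iL : ∀ z ∈ Ico p w, curv f .R z < QL 0 η₁ (-z) := henc.initL
  have pR : ∀ ε ∈ Ioc η₁ η, ∀ z ∈ Icc w q, curv f .R z < QR 0 ε z := henc.posR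
  have pL : ∀ ε ∈ Ioc η₁ η, ∀ z ∈ Icc p w, curv f .R z < QL 0 ε (-z) := henc.posL
  have sR : ∀ ε ∈ Icc η₁ η, Solves (curv f .R) ε (QR 0 ε) := (henc.wavesR.fam 0).solves
  have sL : ∀ ε ∈ Icc η₁ η, Solves (fun z => curv f .R (-z)) ε (QL 0 ε) :=
    (henc.wavesL.fam 0).solves
  have hanti : ∀ ε ∈ Icc η₁ η, StrictAntiOn (fun z => QR 0 ε z - QL 0 ε (-z)) (Icc p q) := by
    intro ε hε
    rcases hε.1.eq_or_lt with rfl | hlt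
    -- At η₁ both waves may touch f'' at w, so monotonicity is proved separately on the two sides of
    -- w and joined.
    · rw [← Icc_union_Icc_eq_Icc hpw.le hwq.le]
      refine StrictAntiOn.union (strictAntiOn_sub_reflect hη₁ (sR _ m1) (sL _ m1) (fun z hz => ?_)
        fun z hz => iL z ⟨hz.1.le, hz.2⟩) (strictAntiOn_sub_reflect hη₁ (sR _ m1) (sL _ m1)
        (fun z hz => iR z ⟨hz.1, hz.2.le⟩) fun z hz => ?_) (isGreatest_Icc hpw.le)
        (isLeast_Icc hwq.le)
      · rw [henc.emR.init]
        exact henc.emR.pos_init z (henc.hp.1.trans hz.1).le (EReal.coe_lt_coe_iff.2 hz.2)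
      · rw [henc.emL.init, ← congrFun (curv_L_neg f) z]
        exact henc.emL.pos_init (-z) (by linarith [hz.2, henc.hq.2])
          (EReal.coe_lt_coe_iff.2 (neg_lt_neg hz.1))
    · have hε' : ε ∈ Ioc η₁ η := ⟨hlt, hε.2⟩
      refine strictAntiOn_sub_reflect (hη₁.trans hlt) (sR _ hε) (sL _ hε) (fun z hz => ?_)
        fun z hz => ?_
      · rcases le_total z w with hz' | hz'
        · exact henc.posp_R hf hη₁ hε' z ⟨hz.1.le, hz'⟩
        · exact pR ε hε' z ⟨hz', hz.2.le⟩
      · rcases le_total z w with hz' | hz'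
        · exact pL ε hε' z ⟨hz.1.le, hz'⟩
        · exact henc.posq_L hf hη₁ hε' z ⟨hz', hz.2.le⟩
  -- The sign is changed because the lemma on roots asks for increasing functions.
  obtain ⟨W, hWc, hW⟩ := exists_continuous_root (y := fun ε z => -(QR 0 ε z - QL 0 ε (-z)))
    (hpw.trans hwq).le
    (fun z _ => (((henc.wavesR.fam 0).cont z).sub ((henc.wavesL.fam 0).cont (-z))).neg)
    (fun ε hε => (((sR ε hε).continuous.sub
      ((sL ε hε).continuous.comp continuous_neg)).neg).continuousOn)
    (fun ε hε => fun u hu v hv huv => neg_lt_neg (hanti ε hε hu hv huv))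
    (fun ε hε => by linarith [hp0 ε hε]) (fun ε hε => by linarith [hq0 ε hε])
  have hWeq : ∀ ε ∈ Icc η₁ η, QR 0 ε (W ε) = QL 0 ε (-W ε) := fun ε hε => by linarith [(hW ε hε).2]
  have hW1 : W η₁ = w := by
    refine (hanti η₁ m1).injOn (Ioc_subset_Icc_self (hW η₁ m1).1) ⟨hpw.le, hwq.le⟩ ?_
    have e1 : QR 0 η₁ w = lam := by
      rw [henc.emR.init]
      exact hE.val w rfl
    have e2 : QL 0 η₁ (-w) = lam := by
      rw [henc.emL.init]
      exact hE'.val (-w) rfl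
    simp only [hWeq η₁ m1, sub_self, e1, e2]
  refine ⟨η, hη, fun ε => [(.angle (W ε), QR 0 ε (W ε))], ⟨W, hWc, hW1, fun ε _ => rfl⟩,
    fun ε hε => ⟨fun U hU => ?_, ?_⟩⟩
  · rw [List.mem_singleton.1 hU]
    exact vertexOK_angle f ε _ _
  · have hε' : ε ∈ Icc η₁ η := ⟨hε.1.le, hε.2⟩
    obtain ⟨hWm, -⟩ := hW ε hε'
    simp only [edgeState, Option.map_some, hE.dir, hE'.dir]
    refine fits_meeting (List.isChain_cons_cons.2 ⟨Or.inl ?_, List.isChain_pair.2 (Or.inr ?_)⟩)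
    · exact (((henc.posR_before hf hη₁ hε).extend hwq.le (pR ε hε)).restrict hWm.2
        ((henc.reachR_p hf hη₁ hε).lt.trans (EReal.coe_lt_coe_iff.2 hWm.1))).flows rfl rfl rfl
    · refine (((henc.posL_before hf hη₁ hε).extend (neg_le_neg hpw.le) fun z hz => ?_).restrict
        (neg_le_neg hWm.1.le) ((henc.reachL_q hf hη₁ hε).lt.trans_le
          (EReal.coe_le_coe_iff.2 (neg_le_neg hWm.2)))).flows rfl rfl (hWeq ε hε').symm
      have := pL ε hε (-z) ⟨by linarith [hz.2], by linarith [hz.1]⟩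
      rwa [neg_neg] at this

/-- Tangents that meet at a row of trees may be continued. -/
lemma TreeRow.meets {f : ℝ → ℝ} {εinf η₁ : ℝ} (h : TameDatum f εinf) (hη₁ : 0 < η₁)
    {V : LabelledVertex} {E E' : OldEdge} (hE : Incoming V .R E) (hE' : Incoming V .L E') {k : ℕ}
    {t : Fin k → FixedTree} {lo hi : Fin (k + 1) → ℝ} (hrow : TreeRow f .R η₁ V.2 t lo hi)
    (h0 : V.1.inEnd .R = lo 0) (h1 : V.1.inEnd .L = ((-hi (Fin.last k) : ℝ) : EReal))
    (hrule : ∀ (η : ℝ) (ℓ : Fin k → ℝ → ℝ) (L : ℝ → List FreeVertex),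
      (∀ i, ShrinkingLength η₁ η (t i).dom.top (ℓ i)) → (∀ ε ∈ Ioc η₁ η,
        (∃ (j : Fin (k + 1)) (w : ℝ), L ε = (parade .R t fun i => ℓ i ε).take j ++ [.angle w] ++
          (parade .L t fun i => ℓ i ε).drop j) ∨
        ∃ j : Fin k, L ε = (parade .R t fun i => ℓ i ε).take j ++ [shrunkBirdie (t j) (ℓ j ε)] ++
          (parade .L t fun i => ℓ i ε).drop (j + 1)) → LocalRule f η₁ η L V.1) :
    Meets f η₁ εinf V (some E) (some E') := by
  intro D D' hD hD'
  have hf := h.reg.1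
  obtain ⟨-, η, hη, ℓR, ℓL, QR, QL, p, q, henc⟩ :=
    exists_encounter_of_continues h hη₁ hE hE' h0 h1 hD hD' fun _ => hrow
  have hex := fun ε (hε : ε ∈ Ioc η₁ η) => henc.exists_block hf hη₁ hrow hε
  choose! B hB1 hB2 hB3 using hex
  refine ⟨η, hη, B, hrule η (fun i ε => min (ℓR i ε) (ℓL i.rev ε)) _ (fun i =>
    shrinkingLength_min (henc.wavesR.gap i).shrink (henc.gapL i).shrink) hB3, fun ε hε =>
    ⟨hB1 ε hε, ?_⟩⟩
  simp only [edgeState, Option.map_some, hE.dir, hE'.dir]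
  exact hB2 ε hε

/-- Tangents that meet at a vertex may be continued. -/
lemma meets_vertex {f : ℝ → ℝ} {εinf η₁ : ℝ} (h : TameDatum f εinf) (hη₁ : 0 < η₁)
    {V : LabelledVertex} {l r : Option OldEdge} (hadm : V.1.Admissible f η₁)
    (hleaf : V.1.LeafRoot f) (hlab : LabelOK f V) (hl : InSide V .R l) (hr : InSide V .L r)
    (hld : V.1.leftDir = .R) (hrd : V.1.rightDir = .L) : Meets f η₁ εinf V l r := by
  have hf := h.reg.1
  obtain ⟨v, lam⟩ := V
  have hl' : ∀ x : ℝ, v.inEnd .R = x → ∃ E, l = some E ∧ Incoming (v, lam) .R E := fun x hx => by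
    rcases l with _ | E
    · exact absurd (hx.symm.trans hl) (EReal.coe_ne_bot x)
    · exact ⟨E, rfl, hl⟩
  have hr' : ∀ x : ℝ, v.inEnd .L = x → ∃ E, r = some E ∧ Incoming (v, lam) .L E := fun x hx => by
    rcases r with _ | E
    · exact absurd (hx.symm.trans hr) (EReal.coe_ne_bot x)
    · exact ⟨E, rfl, hr⟩
  cases v with
  | fict1 a b t => simp [FreeVertex.leftDir] at hld
  | fict3 a b t => simp [FreeVertex.leftDir] at hld
  | trolleybus s a b t => simp_all [FreeVertex.leftDir, FreeVertex.rightDir]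
  | minusInfinity s => simp_all [FreeVertex.leftDir, FreeVertex.rightDir]
  | plusInfinity s => simp_all [FreeVertex.leftDir, FreeVertex.rightDir]
  | fict5 s c => simp_all [FreeVertex.leftDir, FreeVertex.rightDir]
  | angle w =>
    obtain ⟨E, rfl, hE⟩ := hl' w rfl
    obtain ⟨E', rfl, hE'⟩ := hr' (-w) rfl
    exact meets_angle h hη₁ hE hE'
  | birdie a b t =>
    obtain ⟨hab, hlen, hhang, hta⟩ := hadm
    have hrow := treeRow_trolleybus hf hlen hhang hta hleaf (hlab (a, b) rfl)
    obtain ⟨E, rfl, hE⟩ := hl' a rfl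
    obtain ⟨E', rfl, hE'⟩ := hr' (-b) rfl
    refine hrow.meets h hη₁ hE hE' rfl rfl fun η ℓ L hℓ hL => ⟨ℓ 0, hhang.1 ▸ hℓ 0, fun ε hε => ?_⟩
    rcases hL ε hε with ⟨j, w, hj⟩ | ⟨j, hj⟩
    · refine Or.inr ⟨w, ?_⟩
      -- j = 0: the angle precedes a left trolleybus; j = 1: it follows a right one.
      fin_cases j
      · exact Or.inr (by simpa [parade] using hj)
      · exact Or.inl (by simpa [parade] using hj)
    · rw [Subsingleton.elim j 0] at hj
      exact Or.inl (by simpa [parade] using hj)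
  | multi kind k arcs t =>
    cases kind with
    | multicup => simp [FreeVertex.leftDir] at hld
    | multitrolleybus s => simp_all [FreeVertex.leftDir, FreeVertex.rightDir]
    | multibirdie =>
      have hb : BoundedArcs arcs := hadm.2.2.2
      have hhang := hadm.2.1
      have hval := hadm.1.1
      obtain ⟨hrow, -⟩ := treeRow_multi hf hadm hleaf hlab (Or.inl (hb 0).1.ne')
      have h0 := (hval 0).coe_finLo (hb 0).1.ne'
      have h1 : (FreeVertex.multi .multibirdie k arcs t).inEnd .L =
          ((-(arcs (Fin.last k)).finHi : ℝ) : EReal) := by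
        rw [EReal.coe_neg, (hval _).coe_finHi (hb _).2.ne]
        rfl
      obtain ⟨E, rfl, hE⟩ := hl' _ h0.symm
      obtain ⟨E', rfl, hE'⟩ := hr' _ h1
      refine hrow.meets h hη₁ hE hE' h0.symm h1 fun η ℓ L hℓ hL =>
        ⟨ℓ, fun i => (hhang i).1 ▸ hℓ i, fun ε hε => ?_⟩
      rcases hL ε hε with ⟨j, w, hj⟩ | hj
      · exact Or.inl ⟨j, by omega, w, hj⟩
      · exact Or.inr hj

/-! ### Vertices from which tangents of both orientations start -/

lemma FallsAfter.reflect {G : ℝ → ℝ} {x : ℝ} (h : FallsAfter (fun z => G (-z)) (-x)) :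
    RisesBefore G x := by
  obtain ⟨δ, hδ, hm, hlt⟩ := h
  refine ⟨δ, hδ, fun u hu v hv huv => ?_, fun z hz => ?_⟩
  · have := hm (a := -v) (b := -u) ⟨by linarith [hv.2], by linarith [hv.1]⟩
      ⟨by linarith [hu.2], by linarith [hu.1]⟩ (by linarith)
    simpa using this
  · have := hlt (-z) ⟨by linarith [hz.2], by linarith [hz.1]⟩
    simpa using this

/-- The tangents that start from the vertex `V` may be continued. -/
def Springs (f : ℝ → ℝ) (η₁ εinf : ℝ) (V : LabelledVertex) (l r : Option OldEdge) : Prop :=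
  ∃ D D', Continues f η₁ εinf D l ∧ Continues f η₁ εinf D' r ∧ Evolution f η₁ εinf V l r D D'

section Outgoing

variable {f : ℝ → ℝ} {η₁ εinf : ℝ} {V : LabelledVertex} {s : Side} {E : OldEdge} {p : ℝ × ℝ} {β : ℝ}

lemma Outgoing.solves (h : Outgoing f η₁ V s E) (hp : V.1.base = some p) :
    Solves (curv f s) η₁ E.wave := (h.wave.1 p hp).1

lemma Outgoing.val (h : Outgoing f η₁ V s E) (hp : V.1.base = some p) (hβ : V.1.outEnd s = β) :
    E.wave β = V.2 := (h.wave.1 p hp).2 β hβ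

lemma Outgoing.exists_pos (h : Outgoing f η₁ V s E) (hβ : V.1.outEnd s = β) :
    ∃ e : ℝ, β < e ∧ (e : EReal) < E.terminus ∧ ∀ z ∈ Ioc β e, curv f s z < E.wave z := by
  have hlt := h.lt
  rw [hβ] at hlt
  obtain ⟨e, he1, he2⟩ := EReal.exists_between_coe_real hlt
  exact ⟨e, EReal.coe_lt_coe_iff.1 he1, he2, fun z hz => h.pos z
    (hβ ▸ EReal.coe_lt_coe_iff.2 hz.1) ((EReal.coe_le_coe_iff.2 hz.2).trans_lt he2)⟩

/-- The inequality on the tangent domain is passed to its starting point. In this way the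
differentials of a long chord from which tangents start are seen to be non-positive. -/
lemma Outgoing.le_out (h : Outgoing f η₁ V s E) (hf : ContDiff ℝ 2 f) (hp : V.1.base = some p)
    (hβ : V.1.outEnd s = β) : curv f s β ≤ V.2 := by
  obtain ⟨e, he, -, hpos⟩ := h.exists_pos hβ
  rw [← h.val hp hβ]
  refine le_of_tendsto_of_tendsto
    ((continuous_curv (continuous_deriv2_datum hf) s).continuousAt.mono_left nhdsWithin_le_nhds)
    ((h.solves hp).continuous.continuousAt.mono_left nhdsWithin_le_nhds) (b := 𝓝[>] β) ?_
  filter_upwards [Ioo_mem_nhdsGT he] with z hz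
  exact (hpos z ⟨hz.1, hz.2.le⟩).le

lemma Outgoing.fallsAfter (h : Outgoing f η₁ V s E) (hreg : RegularDatum f) (hη₁ : 0 < η₁)
    (hp : V.1.base = some p) (hβ : V.1.outEnd s = β) (heq : curv f s β = V.2) :
    FallsAfter (curv f s) β := by
  obtain ⟨e, he, -, hpos⟩ := h.exists_pos hβ
  exact (h.solves hp).fallsAfter hη₁ (hreg.locallyMonotone_curv s) he
    ((h.val hp hβ).trans heq.symm) fun z hz => hpos z ⟨hz.1, hz.2.le⟩

/-- Tangents that start from an unchanged figure. -/
lemma Outgoing.emission_const (h : Outgoing f η₁ V s E) (hf : ContDiff ℝ 2 f) (hη₁ : 0 < η₁)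
    (hp : V.1.base = some p) (hβ : V.1.outEnd s = β) (η : ℝ) :
    ∃ x, Emission f s η₁ η (fun _ => V) (fun ε => BellmanFoliation.wave (curv f s) ε β V.2) x E.terminus E.wave := by
  have hG := continuous_curv (continuous_deriv2_datum hf) s
  obtain ⟨x, hx1, hx2, hpos⟩ := h.exists_pos hβ
  set Q : ℝ → ℝ → ℝ := fun ε => BellmanFoliation.wave (curv f s) ε β V.2 with hQ
  have hsol : ∀ ε, Solves (curv f s) ε (Q ε) := fun ε => wave_solves hG _ _
  have hst : ∀ ε, Q ε β = V.2 := fun ε => wave_self _ _ _ _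
  have hinit : Q η₁ = E.wave := (hsol η₁).eq_of_eq (h.solves hp) ((hst η₁).trans (h.val hp hβ).symm)
  have hgt : ∀ ε, η₁ ≤ ε → ∀ z ∈ Ioc β x, curv f s z < Q ε z := fun ε hε z hz => by
    have h1 : curv f s z < Q η₁ z := by
      rw [hinit]
      exact hpos z hz
    rcases hε.eq_or_lt with rfl | hlt
    · exact h1
    · refine h1.trans ((hsol η₁).lt_of_le (hsol ε) hη₁ hlt hz.1 (fun w hw => ?_)
        ((hst η₁).trans (hst ε).symm).le)
      rw [hinit]
      exact hpos w ⟨hw.1, hw.2.le.trans hz.2⟩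
  refine ⟨x, hinit, hx2, ⟨fun ε _ => hsol ε, fun z => ?_, fun ε hε ε' hε' hlt => ?_⟩,
    fun z h1 h2 => h.pos z (hβ ▸ EReal.coe_lt_coe_iff.2 (hx1.trans_le h1)) h2, fun ε hε =>
    ⟨h.out_dir, ⟨fun p' _ => ⟨hsol ε, fun y hy => ?_⟩, fun hn => by simp [hn] at hp⟩,
      hβ ▸ EReal.coe_lt_coe_iff.2 hx1, fun z h1 h2 => hgt ε hε.1.le z ⟨?_, h2⟩⟩⟩
  · exact continuousOn_wave hG (fun ε hε => hη₁.trans_le hε.1) continuousOn_const continuousOn_const z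
  · exact (hsol ε).lt_of_le (hsol ε') (hη₁.trans_le hε.1) hlt hx1
      (fun z hz => hgt ε hε.1 z ⟨hz.1, hz.2.le⟩) ((hst ε).trans (hst ε').symm).le
  · rw [hβ] at hy
    rw [← EReal.coe_eq_coe_iff.1 hy]
    exact hst ε
  · rw [hβ] at h1
    exact EReal.coe_lt_coe_iff.1 h1

/-- The vertex of a full chordal domain cut at the chord of length `2ε`, with its label. -/
def labelledFull (f : ℝ → ℝ) (d : ChordalDomain) (t : FixedTree) (ε : ℝ) : LabelledVertex :=
  (fullChordal d t ε, d.lam f (2 * ε))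

lemma outEnd_fullChordal (s : Side) (d : ChordalDomain) (t : FixedTree) (ε : ℝ) :
    (fullChordal d t ε).outEnd s = d.leave s (2 * ε) := by
  cases s <;> simp [fullChordal, FreeVertex.outEnd, FreeVertex.rightEnd, FreeVertex.leftEnd,
    ChordalDomain.leave]

/-- Tangents that start from a growing full chord. -/
lemma Outgoing.emission_full (h : Outgoing f η₁ V s E) (hf : ContDiff ℝ 2 f) (hη₁ : 0 < η₁)
    (hp : V.1.base = some p) {d : ChordalDomain} (hd : d.Admissible f) (h0 : d.bot ≤ 2 * η₁)
    (h1 : 2 * η₁ < d.top) (hβ : V.1.outEnd s = d.leave s (2 * η₁)) (hlam : V.2 = d.lam f (2 * η₁))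
    (t : FixedTree) :
    ∃ η, η₁ < η ∧ 2 * η ≤ d.top ∧ ∃ x,
      Emission f s η₁ η (labelledFull f d t)
        (fun ε => BellmanFoliation.wave (curv f s) ε (d.leave s (2 * ε)) (d.lam f (2 * ε))) x E.terminus E.wave := by
  have hG := continuous_curv (continuous_deriv2_datum hf) s
  have hF : Flow (curv f s) (d.enter s) (d.leave s) (d.lam f) (2 * η₁) (2 * (d.top / 2)) := by
    rw [mul_div_cancel₀ _ two_ne_zero]
    exact hd.sideFlow hf s (by linarith) h0 h1
  obtain ⟨e, he1, he2, hpos⟩ := h.exists_pos hβ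
  obtain ⟨η, hη, x, hx, hfam, hinit, hreach⟩ := hF.exists_source hG hη₁ (h.solves hp)
    ((h.val hp hβ).trans hlam) he1 fun z hz => hpos z ⟨hz.1, hz.2.le⟩
  refine ⟨η, hη.1, by linarith [hη.2], x, hinit, (EReal.coe_lt_coe_iff.2 hx.2).trans he2, hfam,
    fun z h1 h2 => h.pos z (hβ ▸ EReal.coe_lt_coe_iff.2 (hx.1.trans_le h1)) h2, fun ε hε =>
    ⟨by cases s <;> rfl, ⟨fun p' _ => ⟨wave_solves hG _ _, fun y hy => ?_⟩, fun hn => by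
      simp [labelledFull, fullChordal, FreeVertex.base] at hn⟩, ?_, fun z h1 h2 => ?_⟩⟩
  · rw [labelledFull, outEnd_fullChordal] at hy
    rw [← EReal.coe_eq_coe_iff.1 hy]
    exact wave_self _ _ _ _
  · rw [labelledFull, outEnd_fullChordal]
    exact EReal.coe_lt_coe_iff.2 (hreach ε hε).1
  · rw [labelledFull, outEnd_fullChordal] at h1
    exact (hreach ε hε).2 z ⟨(EReal.coe_lt_coe_iff.1 h1).le, h2⟩

end Outgoing

lemma fits_spring {f : ℝ → ℝ} {ε : ℝ} {V : LabelledVertex} {l r : Option (Side × LabelledVertex)}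
    (hl : l = some (.L, V) ∨ l = none ∧ V.1.leftEnd = ⊥)
    (hr : r = some (.R, V) ∨ r = none ∧ V.1.rightEnd = ⊤) : Fits f ε l [V] r := by
  rcases hl with rfl | ⟨rfl, hl⟩ <;> rcases hr with rfl | ⟨rfl, hr⟩
  · exact ⟨List.isChain_singleton _, rfl, rfl⟩
  · exact ⟨List.isChain_singleton _, rfl, V, rfl, hr⟩
  · exact ⟨List.isChain_singleton _, ⟨V, rfl, hl⟩, rfl⟩
  · exact ⟨List.isChain_singleton _, ⟨V, rfl, hl⟩, V, rfl, hr⟩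

/-- One family of chords feeds both tangent domains. Full multicups and long chords of both types
differ only in the domain d and in the tree t it stands on. -/
lemma springs_full {f : ℝ → ℝ} {η₁ εinf : ℝ} (hf : ContDiff ℝ 2 f) (hη₁ : η₁ ∈ Ioo 0 εinf)
    {V : LabelledVertex} {E E' : OldEdge} (hE : Outgoing f η₁ V .L E) (hE' : Outgoing f η₁ V .R E')
    {a b : ℝ} (hbase : V.1.base = some (a, b)) (ha : V.1.leftEnd = a) (hb : V.1.rightEnd = b)
    (hlab : V.2 = av (deriv (deriv f)) a b) {d : ChordalDomain} (hd : d.Admissible f)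
    (h0 : d.bot ≤ 2 * η₁) (h1 : 2 * η₁ < d.top) (hda : d.a (2 * η₁) = a) (hdb : d.b (2 * η₁) = b)
    {t : FixedTree} (ht : ∀ ε, η₁ < ε → 2 * ε < d.top →
      (t.withDom (d.withTop (2 * ε))).Admissible f ε) (hleaf : t.LeafRoot f)
    (hrule : ∀ η, η₁ < η → 2 * η < d.top → LocalRule f η₁ η (fun ε => [fullChordal d t ε]) V.1) :
    Springs f η₁ εinf V (some E) (some E') := by
  have hlam : V.2 = d.lam f (2 * η₁) := by rw [hlab, ChordalDomain.lam, hda, hdb]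
  have hL : V.1.outEnd .L = d.leave .L (2 * η₁) := by
    show -V.1.leftEnd = ((-d.a (2 * η₁) : ℝ) : EReal)
    rw [ha, hda]
    rfl
  have hR : V.1.outEnd .R = d.leave .R (2 * η₁) := by
    show V.1.rightEnd = ((d.b (2 * η₁) : ℝ) : EReal)
    rw [hb, hdb]
  obtain ⟨η, hη, hηt, x, hx⟩ := hE.emission_full hf hη₁.1 hbase hd h0 h1 hL hlam t
  obtain ⟨η', hη', hηt', x', hx'⟩ := hE'.emission_full hf hη₁.1 hbase hd h0 h1 hR hlam t
  -- ζ is strictly smaller than both times, so the chords of length 2ε are inner chords of d; their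
  -- differentials are strictly negative and the vertices are of the first type.
  obtain ⟨ζ, hζ1, hζ2⟩ := exists_between (lt_min (lt_min hη hη') hη₁.2)
  have hζη : ζ < η := hζ2.trans_le ((min_le_left _ _).trans (min_le_left _ _))
  have hζη' : ζ < η' := hζ2.trans_le ((min_le_left _ _).trans (min_le_right _ _))
  have hζ : ζ ∈ Ioo η₁ εinf := ⟨hζ1, hζ2.trans_le (min_le_right _ _)⟩
  obtain ⟨D, hD, hDs⟩ : ∃ D : NewEdge, Continues f η₁ εinf D (some E) ∧ D.source = labelledFull f d t :=
    ⟨⟨ζ, _, _, x⟩, ⟨hζ, hE.dir.symm ▸ hx.mono hζη.le⟩, rfl⟩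
  obtain ⟨D', hD', hDs'⟩ : ∃ D : NewEdge, Continues f η₁ εinf D (some E') ∧
      D.source = labelledFull f d t :=
    ⟨⟨ζ, _, _, x'⟩, ⟨hζ, hE'.dir.symm ▸ hx'.mono hζη'.le⟩, rfl⟩
  refine ⟨D, D', hD, hD', ζ, hζ, fun ε => [labelledFull f d t ε],
    hrule ζ hζ1 (by linarith), fun ε hε => ⟨fun U hU => ?_, fits_spring (Or.inl ?_) (Or.inl ?_)⟩⟩
  · rw [List.mem_singleton.1 hU]
    have hin : 2 * ε ∈ Ioo d.bot d.top := ⟨by linarith [hε.1], by linarith [hε.2]⟩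
    have hneg := hd.2.2.2.2.2.2.2 _ hin
    have hlen := hd.2.2.2.2.1 _ (Ioo_subset_Icc_self hin)
    refine ⟨⟨hlen, hneg.1.ne, hneg.2.ne, ?_, ht ε hε.1 hin.2⟩, trivial,
      (t.leafRoot_withDom _).2 hleaf, fun p hp => ?_⟩
    · rw [FixedTree.HangsAt, FixedTree.dom_withDom]
      exact ⟨hlen.symm, rfl, rfl⟩
    · simp only [labelledFull, fullChordal, FreeVertex.base, Option.some.injEq] at hp
      rw [← hp]
      rfl
  · simp only [edgeState, Option.map_some, hE.dir, hDs]
  · simp only [edgeState, Option.map_some, hE'.dir, hDs']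

/-- A full chordal domain above a long chord from which tangents start. -/
lemma exists_fullDomain {f : ℝ → ℝ} {η₁ : ℝ} (hreg : RegularDatum f) (hη₁ : 0 < η₁)
    {V : LabelledVertex} {E E' : OldEdge} (hE : Outgoing f η₁ V .L E) (hE' : Outgoing f η₁ V .R E')
    {a b : ℝ} (hbase : V.1.base = some (a, b)) (ha : V.1.leftEnd = a) (hb : V.1.rightEnd = b)
    (hlab : V.2 = av (deriv (deriv f)) a b) (hlen : b - a = 2 * η₁) (hcup : CupEq f a b) :
    ∃ d : ChordalDomain, d.Admissible f ∧ d.LowerChord a b ∧ 2 * η₁ < d.top := by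
  have hf := hreg.1
  have hL : V.1.outEnd .L = ((-a : ℝ) : EReal) := by
    show -V.1.leftEnd = _
    rw [ha]
    rfl
  have hneg : ∀ z, curv f .L (-z) = deriv (deriv f) z := fun z => congrFun (curv_L_neg f) z
  have h1 := hE.le_out hf hbase hL
  have h2 : deriv (deriv f) b ≤ V.2 := hE'.le_out hf hbase hb
  rw [hneg] at h1
  -- The signs of the differentials are read off from the two outgoing waves. If one vanishes, the
  -- same wave yields the rise or fall of f'' needed to build longer chords.
  have hDL : DL f a b ≤ 0 := by rw [DL, ← hlab]; linarith
  have hDR : DR f a b ≤ 0 := by rw [DR, ← hlab]; linarith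
  obtain ⟨δ, hδ, A, B, hA, hB, hcA, hcB, hAB, hin⟩ := exists_chords_above hf
    (by linarith : a < b) hcup hDL hDR (fun h0 => by
      refine FallsAfter.reflect (hE.fallsAfter hreg hη₁ hbase hL ?_)
      rw [hneg, hlab]
      exact sub_eq_zero.1 h0) (fun h0 => hE'.fallsAfter hreg hη₁ hbase hb (by
      rw [hlab]
      exact sub_eq_zero.1 h0))
  refine ⟨⟨A, B, b - a, b - a + δ⟩, admissible_of_innerChord (by show 0 ≤ b - a; linarith)
    (by show b - a < b - a + δ; linarith) hcA hcB (fun l _ => hAB l) ?_ hin, ⟨rfl, hA, hB⟩, ?_⟩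
  · show CupEq f (A (b - a)) (B (b - a)) ∧ DL f (A (b - a)) (B (b - a)) ≤ 0 ∧
      DR f (A (b - a)) (B (b - a)) ≤ 0
    rw [hA, hB]
    exact ⟨hcup, hDL, hDR⟩
  · show 2 * η₁ < b - a + δ
    linarith

lemma ChordalDomain.LowerChord.withTop {d : ChordalDomain} {a b : ℝ} (h : d.LowerChord a b) (l : ℝ) :
    (d.withTop l).LowerChord a b := h

/-- Tangents that start from a vertex in both directions may be continued. -/
lemma springs_vertex {f : ℝ → ℝ} {εinf η₁ : ℝ} (h : TameDatum f εinf) (hη₁ : η₁ ∈ Ioo 0 εinf)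
    {V : LabelledVertex} {l r : Option OldEdge} (hadm : V.1.Admissible f η₁)
    (hleaf : V.1.LeafRoot f) (hlab : LabelOK f V) (hl : OutSide f η₁ V .L l)
    (hr : OutSide f η₁ V .R r) (hld : V.1.leftDir = .L) (hrd : V.1.rightDir = .R) :
    Springs f η₁ εinf V l r := by
  have hf := h.reg.1
  obtain ⟨v, lam⟩ := V
  have hl' : ∀ x : ℝ, v.outEnd .L = x → ∃ E, l = some E ∧ Outgoing f η₁ (v, lam) .L E :=
    fun x hx => by
      rcases l with _ | E
      · exact absurd (hx.symm.trans hl) (EReal.coe_ne_top x)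
      · exact ⟨E, rfl, hl⟩
  have hr' : ∀ x : ℝ, v.outEnd .R = x → ∃ E, r = some E ∧ Outgoing f η₁ (v, lam) .R E :=
    fun x hx => by
      rcases r with _ | E
      · exact absurd (hx.symm.trans hr) (EReal.coe_ne_top x)
      · exact ⟨E, rfl, hr⟩
  cases v with
  | angle w => simp [FreeVertex.leftDir] at hld
  | birdie a b t => simp [FreeVertex.leftDir] at hld
  | trolleybus s a b t => simp_all [FreeVertex.leftDir, FreeVertex.rightDir]
  | minusInfinity s => simp_all [FreeVertex.leftDir, FreeVertex.rightDir]
  | plusInfinity s => simp_all [FreeVertex.leftDir, FreeVertex.rightDir]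
  | fict5 s c => simp_all [FreeVertex.leftDir, FreeVertex.rightDir]
  | fict1 a b t =>
    obtain ⟨hlen, hDL, hDR, ⟨htop, hta, htb⟩, hadm⟩ := hadm
    obtain ⟨E, rfl, hE⟩ := hl' (-a) rfl
    obtain ⟨E', rfl, hE'⟩ := hr' b rfl
    have hd₀ := hadm.dom
    have htop' : t.dom.top = 2 * η₁ := htop.trans hlen
    have hm := hd₀.2.2.2.2.2.2.1 _ (right_mem_Icc.2 hd₀.2.1.le)
    have hbm := hd₀.2.2.2.2.2.2.1 _ (left_mem_Icc.2 hd₀.2.1.le)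
    rw [hta, htb] at hm
    obtain ⟨δ, hδ, A, B, hA, hB, hcA, hcB, hAB, hin⟩ := exists_chordal_extension hf hd₀
      (by rw [hta, htb]; exact lt_of_le_of_ne hm.2.1 hDL)
      (by rw [hta, htb]; exact lt_of_le_of_ne hm.2.2 hDR)
    have e1 := hA (mem_Iic.2 hd₀.2.1.le)
    have e2 := hB (mem_Iic.2 hd₀.2.1.le)
    have e3 := hA (mem_Iic.2 le_rfl)
    have e4 := hB (mem_Iic.2 le_rfl)
    set d : ChordalDomain := ⟨A, B, t.dom.bot, t.dom.top + δ⟩ with hd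
    have hda : d.Admissible f := admissible_of_innerChord hd₀.1
      (by show t.dom.bot < t.dom.top + δ; linarith [hd₀.2.1]) hcA hcB hAB (by
        show CupEq f (A t.dom.bot) (B t.dom.bot) ∧ DL f (A t.dom.bot) (B t.dom.bot) ≤ 0 ∧
          DR f (A t.dom.bot) (B t.dom.bot) ≤ 0
        rw [e1, e2]
        exact hbm) hin
    have hbot : t.dom.bot < 2 * η₁ := htop' ▸ hd₀.2.1
    have hdt : d.top = 2 * η₁ + δ := by rw [← htop']
    refine springs_full hf hη₁ hE hE' (a := a) (b := b) rfl rfl rfl (hlab _ rfl) hda hbot.le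
      (by linarith) (by rw [← htop', ← hta]; exact e3) (by rw [← htop', ← htb]; exact e4)
      (t := t) (fun ε hε hε' => ?_) hleaf fun η hη hη' => ?_
    · exact (hadm.mono hε.le).withDom (hda.withTop (by show t.dom.bot < 2 * ε; linarith) hε'.le) rfl
        e1 e2
    · refine ⟨d.withTop (2 * η), ⟨hda.withTop (by show t.dom.bot < 2 * η; linarith) hη'.le, rfl, rfl,
        fun l hl => hA (mem_Iic.2 (hl.2.trans htop'.ge)),
        fun l hl => hB (mem_Iic.2 (hl.2.trans htop'.ge))⟩, fun ε _ => rfl⟩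
  | fict3 a b t =>
    obtain ⟨hlen, hD, hhang, hadm⟩ := hadm
    obtain ⟨E, rfl, hE⟩ := hl' (-a) rfl
    obtain ⟨E', rfl, hE'⟩ := hr' b rfl
    have hd₀ := hadm.dom
    have hm := hd₀.2.2.2.2.2.2.1 _ (right_mem_Icc.2 hd₀.2.1.le)
    rw [hhang.2.1, hhang.2.2] at hm
    have hη₁0 := hη₁.1
    obtain ⟨d, hda, hlow, hdt⟩ := exists_fullDomain h.reg hη₁.1 hE hE' (a := a) (b := b) rfl rfl rfl
      (hlab _ rfl) hlen hm.1
    have hbot : d.bot = 2 * η₁ := hlow.1.trans hlen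
    refine springs_full hf hη₁ hE hE' (a := a) (b := b) rfl rfl rfl (hlab _ rfl) hda hbot.le
      hdt (by rw [← hbot]; exact hlow.2.1) (by rw [← hbot]; exact hlow.2.2)
      (t := .chord d a b t) (fun ε hε hε' => ?_) hleaf fun η hη hη' => ?_
    · exact ⟨hda.withTop (by linarith) hε'.le, by linarith, hlow.withTop _, hD, hhang,
        hadm.mono hε.le⟩
    · exact ⟨d.withTop (2 * η), ⟨hda.withTop (by linarith) hη'.le, hlow.withTop _, hbot, rfl⟩,
        fun ε _ => rfl⟩
  | multi kind k arcs t =>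
    cases kind with
    | multibirdie => simp [FreeVertex.leftDir] at hld
    | multitrolleybus s => simp_all [FreeVertex.leftDir, FreeVertex.rightDir]
    | multicup =>
      obtain ⟨hB, hhang, hta, hwidth⟩ := hadm
      have hval := hB.1
      change (arcs 0).lo + ((2 * η₁ : ℝ) : EReal) ≤ (arcs (Fin.last k)).hi at hwidth
      -- A multicup of width exactly 2η₁ becomes the base of a growing chordal domain; a wider one
      -- survives unchanged for a short time.
      rcases hwidth.eq_or_lt with hfull | hwide
      · have hlo : (arcs 0).lo ≠ ⊥ := fun hcon => by
          rw [hcon, EReal.bot_add] at hfull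
          exact (hval (Fin.last k)).2.2.ne hfull
        have hlo' := EReal.coe_toReal (hval 0).2.1.ne hlo
        have hhi : (arcs (Fin.last k)).hi = (((arcs 0).lo.toReal + 2 * η₁ : ℝ) : EReal) := by
          rw [← hfull, EReal.coe_add, hlo']
        have hhi' : (arcs (Fin.last k)).hi.toReal = (arcs 0).lo.toReal + 2 * η₁ := by
          rw [hhi, EReal.toReal_coe]
        have hhit : (arcs (Fin.last k)).hi ≠ ⊤ := hhi ▸ EReal.coe_ne_top _
        set a := (arcs 0).lo.toReal with ha
        set b := (arcs (Fin.last k)).hi.toReal with hb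
        have hb' : (arcs (Fin.last k)).hi = b := by rw [hhi, hhi']
        have hbase : (FreeVertex.multi .multicup k arcs t).base = some (a, b) := by
          simp [FreeVertex.base, Arc.leftPt, Arc.rightPt, hlo, hhit, ha, hb]
        have hlen : b - a = 2 * η₁ := by linarith
        obtain ⟨E, rfl, hE⟩ := hl' (-a) (by
          show -(arcs 0).lo = _
          rw [← hlo']
          rfl)
        obtain ⟨E', rfl, hE'⟩ := hr' b hb'
        have hcup : CupEq f a b := hB.2.2.2.1 0 (Fin.last k) a ⟨hlo'.ge, hlo' ▸ (hval 0).1⟩ b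
          ⟨hb' ▸ (hval (Fin.last k)).1, hb'.ge⟩
        obtain ⟨d, hda, hlow, hdt⟩ := exists_fullDomain h.reg hη₁.1 hE hE' hbase hlo'.symm hb'
          (hlab _ hbase) hlen hcup
        have hbot : d.bot = 2 * η₁ := hlow.1.trans hlen
        have hbdd : BoundedArcs arcs := fun i => by
          constructor
          · rcases Fin.eq_zero_or_eq_succ i with rfl | ⟨i, rfl⟩
            · exact bot_lt_iff_ne_bot.2 hlo
            · exact bot_lt_iff_ne_bot.2 (hB.lo_ne_bot i)
          · rcases Fin.eq_castSucc_or_eq_last i with ⟨i, rfl⟩ | rfl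
            · exact lt_top_iff_ne_top.2 (hB.hi_ne_top i)
            · exact lt_top_iff_ne_top.2 hhit
        refine springs_full hf hη₁ hE hE' hbase hlo'.symm hb' (hlab _ hbase) hda hbot.le
          hdt (by rw [← hbot]; exact hlow.2.1) (by rw [← hbot]; exact hlow.2.2)
          (t := .closed d k arcs t) (fun ε hε hε' => ?_) hleaf fun η hη hη' => ?_
        · exact ⟨hda.withTop (by linarith) hε'.le, hB.mono hε.le, hbdd, hlow.withTop _, by linarith,
            hhang, fun i => (hta i).mono hε.le⟩
        · show LocalRule f η₁ η _ (FreeVertex.multi .multicup k arcs t)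
          simp only [LocalRule]
          rw [if_pos (show FreeVertex.IsFullMulticup η₁ (.multi .multicup k arcs t) from hfull)]
          exact ⟨d.withTop (2 * η), ⟨hda.withTop (by linarith) hη'.le, hlow.withTop _, hbot, rfl⟩,
            fun ε _ => rfl⟩
      -- The time is limited so that 2η is still less than the width, which may be infinite.
      · obtain ⟨η, hη, hηw⟩ : ∃ η ∈ Ioo η₁ εinf,
            (arcs 0).lo + ((2 * η : ℝ) : EReal) < (arcs (Fin.last k)).hi := by
          obtain ⟨ζ, hζ⟩ := exists_between hη₁.2
          by_cases hlo : (arcs 0).lo = ⊥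
          · refine ⟨ζ, hζ, ?_⟩
            rw [hlo, EReal.bot_add]
            exact (hval (Fin.last k)).2.2
          · rw [← EReal.coe_toReal (hval 0).2.1.ne hlo] at hwide ⊢
            rw [← EReal.coe_add] at hwide
            obtain ⟨c, hc1, hc2⟩ := EReal.exists_between_coe_real hwide
            have hc1' := EReal.coe_lt_coe_iff.1 hc1
            obtain ⟨η, hη1, hη2⟩ := exists_between
              (lt_min hη₁.2 (by linarith : η₁ < (c - (arcs 0).lo.toReal) / 2))
            refine ⟨η, ⟨hη1, hη2.trans_le (min_le_left _ _)⟩, lt_of_le_of_lt ?_ hc2⟩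
            rw [← EReal.coe_add, EReal.coe_le_coe_iff]
            have := hη2.trans_le (min_le_right _ _)
            linarith
        set V : LabelledVertex := (.multi .multicup k arcs t, lam) with hV
        have hbase : V.1.base = some ((arcs 0).leftPt, (arcs (Fin.last k)).rightPt) := rfl
        have hD : ∀ (s : Side) (o : Option OldEdge), OutSide f η₁ V s o →
            V.1.outEnd s ≠ ⊥ → ∃ D : NewEdge, Continues f η₁ εinf D o ∧ D.source = fun _ => V := by
          intro s o ho hbot
          rcases o with _ | E
          -- On an unbounded side nothing is emitted; only the source is used, and the other entries
          -- are arbitrary.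
          · exact ⟨⟨η, fun _ => V, fun _ _ => 0, 0⟩, trivial, rfl⟩
          · have ho : Outgoing f η₁ V s E := ho
            obtain ⟨x, hx⟩ := ho.emission_const hf hη₁.1 hbase
              (EReal.coe_toReal (ho.lt.trans_le le_top).ne hbot).symm η
            exact ⟨⟨η, fun _ => V, _, x⟩, ⟨hη, ho.dir.symm ▸ hx⟩, rfl⟩
        obtain ⟨D, hD1, hD2⟩ := hD .L l hl (by
          show -(arcs 0).lo ≠ ⊥
          simpa using (hval 0).2.1.ne)
        obtain ⟨D', hD1', hD2'⟩ := hD .R r hr (hval (Fin.last k)).2.2.ne'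
        refine ⟨D, D', hD1, hD1', η, hη, fun _ => [V], ?_, fun ε hε => ⟨fun U hU => ?_, fits_spring ?_ ?_⟩⟩
        · show LocalRule f η₁ η _ (FreeVertex.multi .multicup k arcs t)
          simp only [LocalRule]
          rw [if_neg (show ¬ FreeVertex.IsFullMulticup η₁ (.multi .multicup k arcs t) from hwide.ne)]
          exact fun ε _ => rfl
        · rw [List.mem_singleton.1 hU]
          have hle : (arcs 0).lo + ((2 * ε : ℝ) : EReal) < (arcs (Fin.last k)).hi := by
            refine lt_of_le_of_lt ?_ hηw
            gcongr
            exact hε.2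
          exact ⟨⟨hB.mono hε.1.le, hhang, fun i => (hta i).mono hε.1.le, hle.le⟩, hle.ne, hleaf, hlab⟩
        · rcases l with _ | E
          · refine Or.inr ⟨rfl, ?_⟩
            have : -(arcs 0).lo = ⊤ := hl
            show (arcs 0).lo = ⊥
            simpa using this
          · refine Or.inl ?_
            simp only [edgeState, Option.map_some, hl.dir, hD2]
        · rcases r with _ | E
          · exact Or.inr ⟨rfl, hr⟩
          · refine Or.inl ?_
            simp only [edgeState, Option.map_some, hr.dir, hD2']

/-! ### From the local rules to the whole graph -/

lemma ShrinkingLength.mono {η₁ η η' l₀ : ℝ} {l : ℝ → ℝ} (h : ShrinkingLength η₁ η l₀ l)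
    (hη : η' ≤ η) : ShrinkingLength η₁ η' l₀ l :=
  ⟨h.1.mono (Icc_subset_Icc_right hη), h.2.1.mono (Icc_subset_Icc_right hη), h.2.2⟩

lemma FullFlowAbove.cut {f : ℝ → ℝ} {η₁ η η' a b : ℝ} {d : ChordalDomain}
    (h : FullFlowAbove f η₁ η a b d) (h1 : η₁ < η') (h2 : η' ≤ η) :
    FullFlowAbove f η₁ η' a b (d.withTop (2 * η')) := by
  obtain ⟨ha, hl, hb, ht⟩ := h
  exact ⟨ha.withTop (by linarith) (by linarith), hl, hb, rfl⟩

/-- Each vertex comes with its own time, and all are cut to a common one. Flows of full chords must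
reach exactly the length 2η', so their domains are cut at that chord. -/
lemma LocalRule.mono {f : ℝ → ℝ} {η₁ η η' : ℝ} {L : ℝ → List FreeVertex} {v : FreeVertex}
    (hv : v.Admissible f η₁) (h : LocalRule f η₁ η L v) (h1 : η₁ < η') (h2 : η' ≤ η) :
    LocalRule f η₁ η' L v := by
  have hsub : ∀ ε ∈ Ioc η₁ η', ε ∈ Ioc η₁ η := fun ε hε => ⟨hε.1, hε.2.trans h2⟩
  cases v with
  | angle w =>
    obtain ⟨W, hc, h0, hW⟩ := h
    exact ⟨W, hc.mono (Icc_subset_Icc_right h2), h0, fun ε hε => hW ε (hsub ε hε)⟩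
  | trolleybus s a b t =>
    obtain ⟨l, hl, hL⟩ := h
    exact ⟨l, hl.mono h2, fun ε hε => hL ε (hsub ε hε)⟩
  | birdie a b t =>
    obtain ⟨l, hl, hL⟩ := h
    exact ⟨l, hl.mono h2, fun ε hε => hL ε (hsub ε hε)⟩
  | multi kind k arcs t =>
    rcases kind with _ | ⟨_ | _⟩ | _
    · simp only [LocalRule] at h ⊢
      split_ifs at h ⊢
      · obtain ⟨d, hd, hL⟩ := h
        exact ⟨d.withTop (2 * η'), hd.cut h1 h2, fun ε hε => hL ε (hsub ε hε)⟩
      · exact fun ε hε => h ε (hsub ε hε)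
    all_goals
      obtain ⟨l, hl, hL⟩ := h
      exact ⟨l, fun i => (hl i).mono h2, fun ε hε => hL ε (hsub ε hε)⟩
  | fict1 a b t =>
    obtain ⟨d, ⟨ha, hb, ht, hea, heb⟩, hL⟩ := h
    obtain ⟨hab, -, -, hang, htree⟩ := hv
    -- The new upper length must exceed the lower one, which is below the length 2η₁ of the original
    -- long chord.
    have hbt : t.dom.bot < 2 * η₁ := by
      have h3 := htree.dom.2.1
      have h4 : t.dom.top = b - a := hang.1
      linarith
    exact ⟨d.withTop (2 * η'), ⟨ha.withTop (by linarith) (by linarith), hb, rfl, hea, heb⟩,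
      fun ε hε => hL ε (hsub ε hε)⟩
  | fict3 a b t =>
    obtain ⟨d, hd, hL⟩ := h
    exact ⟨d.withTop (2 * η'), hd.cut h1 h2, fun ε hε => hL ε (hsub ε hε)⟩
  | _ => exact fun ε hε => h ε (hsub ε hε)

/-- Blocks are joined across tangent domains, so every inner place must carry one; only the two ends
of the row carry none. -/
lemma fits_flatten {f : ℝ → ℝ} {ε : ℝ} {n : ℕ} (B : Fin (n + 1) → List LabelledVertex)
    (st : ℕ → Option (Side × LabelledVertex)) (hst : ∀ m < n, st (m + 1) ≠ none)
    (h : ∀ i : Fin (n + 1), Fits f ε (st i) (B i) (st (i + 1))) :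
    Fits f ε (st 0) (List.ofFn B).flatten (st (n + 1)) := by
  induction n generalizing st with
  | zero => simpa using h 0
  | succ n ih =>
    have h1 := ih (fun i => B i.succ) (fun m => st (m + 1)) (fun m hm => hst (m + 1) (by omega))
      fun i => by simpa using h i.succ
    have h2 := h 0
    obtain ⟨⟨s, V⟩, hV⟩ := Option.ne_none_iff_exists'.1 (hst 0 (by omega))
    rw [List.ofFn_succ, List.flatten_cons]
    simp only [Fin.val_zero, zero_add, hV] at h1 h2
    exact h2.comp h1

/-- Data on the edges of a path can be chosen one after another along the orientations of the
edges. -/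
lemma exists_path_data {α : Type*} (N : ℕ) (d : ℕ → Side) (C : ℕ → α → Prop) (R : ℕ → α → α → Prop)
    (h0 : ∃ D, C 0 D) (hN : ∃ D, C N D)
    (hRR : ∀ m < N, d m = .R → d (m + 1) = .R → ∀ D, C m D → ∃ D', C (m + 1) D' ∧ R m D D')
    (hLL : ∀ m < N, d m = .L → d (m + 1) = .L → ∀ D', C (m + 1) D' → ∃ D, C m D ∧ R m D D')
    (hRL : ∀ m < N, d m = .R → d (m + 1) = .L → ∀ D D', C m D → C (m + 1) D' → R m D D')
    (hLR : ∀ m < N, d m = .L → d (m + 1) = .R → ∃ D D', C m D ∧ C (m + 1) D' ∧ R m D D') :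
    ∃ D : ℕ → α, ∀ m < N, R m (D m) (D (m + 1)) := by
  -- The induction claim depends on the orientation of the edge m. If it points right, everything on
  -- its left can be settled with some admissible datum on it. If it points left, its datum comes
  -- from the right, so the left part must adapt to any prescribed admissible datum.
  have key : ∀ m ≤ N,
      (d m = .R → ∃ D : ℕ → α, C m (D m) ∧ ∀ j < m, R j (D j) (D (j + 1))) ∧
      (d m = .L → ∀ x, C m x → ∃ D : ℕ → α, D m = x ∧ ∀ j < m, R j (D j) (D (j + 1))) := by
    intro m
    induction m with
    | zero =>
      intro _
      obtain ⟨x, hx⟩ := h0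
      exact ⟨fun _ => ⟨fun _ => x, hx, by simp⟩, fun _ y _ => ⟨fun _ => y, rfl, by simp⟩⟩
    | succ m ih =>
      intro hm
      obtain ⟨i1, i2⟩ := ih (by omega)
      have ext : ∀ (D : ℕ → α) (y : α), (∀ j < m, R j (D j) (D (j + 1))) → R m (D m) y →
          ∃ D' : ℕ → α, D' (m + 1) = y ∧ ∀ j < m + 1, R j (D' j) (D' (j + 1)) := by
        intro D y hD hy
        refine ⟨Function.update D (m + 1) y, Function.update_self .., fun j hj => ?_⟩
        rw [Function.update_of_ne (by omega)]
        rcases Nat.lt_succ_iff_lt_or_eq.1 hj with h | rfl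
        · rw [Function.update_of_ne (by omega)]
          exact hD j h
        · rwa [Function.update_self]
      constructor
      · intro hd
        cases hdm : d m with
        | R =>
          obtain ⟨D, hC, hD⟩ := i1 hdm
          obtain ⟨y, hy, hR⟩ := hRR m hm hdm hd _ hC
          obtain ⟨D', rfl, h'⟩ := ext D y hD hR
          exact ⟨D', hy, h'⟩
        | L =>
          obtain ⟨x, y, hx, hy, hR⟩ := hLR m hm hdm hd
          obtain ⟨D, rfl, hD⟩ := i2 hdm x hx
          obtain ⟨D', rfl, h'⟩ := ext D y hD hR
          exact ⟨D', hy, h'⟩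
      · intro hd y hy
        cases hdm : d m with
        | R =>
          obtain ⟨D, hC, hD⟩ := i1 hdm
          exact ext D y hD (hRL m hm hdm hd _ _ hC hy)
        | L =>
          obtain ⟨x, hx, hR⟩ := hLL m hm hdm hd y hy
          obtain ⟨D, rfl, hD⟩ := i2 hdm x hx
          exact ext D y hD hR
  cases hdN : d N with
  | R =>
    obtain ⟨D, -, hD⟩ := (key N le_rfl).1 hdN
    exact ⟨D, hD⟩
  | L =>
    obtain ⟨x, hx⟩ := hN
    obtain ⟨D, -, hD⟩ := (key N le_rfl).2 hdN x hx
    exact ⟨D, hD⟩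

/-- The tangent domain of orientation `s` that comes to `V`, with the tangents `Q`. -/
def oldEdge (s : Side) (V : LabelledVertex) (Q : ℝ → ℝ) : OldEdge := ⟨s, Q, V.1.inEnd s⟩

lemma FlowsVia.incoming {f : ℝ → ℝ} {s : Side} {ε : ℝ} {V V' : LabelledVertex} {Q : ℝ → ℝ}
    (h : FlowsVia f s ε V V' Q) : Incoming V' s (oldEdge s V' Q) :=
  ⟨rfl, h.in_dir, rfl, (bot_le.trans_lt h.lt).ne', h.val⟩

lemma FlowsVia.outgoing {f : ℝ → ℝ} {s : Side} {ε : ℝ} {V V' : LabelledVertex} {Q : ℝ → ℝ}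
    (h : FlowsVia f s ε V V' Q) : Outgoing f ε V s (oldEdge s V' Q) :=
  ⟨rfl, h.out_dir, h.lt, h.wave, h.pos⟩

/-- The tangents on the left of the vertex `V`. -/
def LeftSide (f : ℝ → ℝ) (η₁ : ℝ) (V : LabelledVertex) (o : Option OldEdge) : Prop :=
  (V.1.leftDir = .R → InSide V .R o) ∧ (V.1.leftDir = .L → OutSide f η₁ V .L o)

/-- The tangents on the right of the vertex `V`. -/
def RightSide (f : ℝ → ℝ) (η₁ : ℝ) (V : LabelledVertex) (o : Option OldEdge) : Prop :=
  (V.1.rightDir = .R → OutSide f η₁ V .R o) ∧ (V.1.rightDir = .L → InSide V .L o)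

/-- Each vertex is made to see the waves on either side as incoming or outgoing according to the
orientation there, a missing wave meaning that the figure reaches infinity. -/
lemma FoliationGraph.Admissible.exists_oldEdges {f : ℝ → ℝ} {εinf ε : ℝ} (h : TameDatum f εinf)
    (hε : ε ∈ Ioo 0 εinf) {Γ : FoliationGraph} (hΓ : Γ.Admissible f ε) :
    ∃ (V : Fin (Γ.n + 1) → LabelledVertex) (old : ℕ → Option OldEdge) (d : ℕ → Side),
      (∀ i, (V i).1 = Γ.vertex i ∧ LabelOK f (V i)) ∧ old 0 = none ∧ old (Γ.n + 1) = none ∧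
      (∀ m < Γ.n, old (m + 1) ≠ none) ∧
      ∀ i : Fin (Γ.n + 1), d i = (V i).1.leftDir ∧ d (i + 1) = (V i).1.rightDir ∧
        LeftSide f ε (V i) (old i) ∧ RightSide f ε (V i) (old (i + 1)) := by
  obtain ⟨lab, Q, hlab, hflow⟩ := hΓ.exists_flows h hε
  obtain ⟨hbot, htop, hwf⟩ := hΓ.1
  let V : Fin (Γ.n + 1) → LabelledVertex := fun i => (Γ.vertex i, lab i)
  let E : Fin Γ.n → OldEdge := fun i => match (Γ.edge i).dir with
    | .R => oldEdge .R (V i.succ) (Q i)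
    | .L => oldEdge .L (V i.castSucc) (Q i)
  -- The vertex m lies between the places m and m + 1; the places 0 and n + 1 carry no tangent
  -- domain, so the indices of the edges are shifted by one.
  let old : ℕ → Option OldEdge := fun m => match m with
    | 0 => none
    | k + 1 => if hk : k < Γ.n then some (E ⟨k, hk⟩) else none
  let d : ℕ → Side := fun m => match m with
    | 0 => (V 0).1.leftDir
    | k + 1 => if hk : k < Γ.n + 1 then (V ⟨k, hk⟩).1.rightDir else .R
  have hold : ∀ k (hk : k < Γ.n), old (k + 1) = some (E ⟨k, hk⟩) := fun k hk => dif_pos hk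
  have hlast : old (Γ.n + 1) = none := dif_neg (lt_irrefl _)
  have hd : ∀ k (hk : k < Γ.n + 1), d (k + 1) = (V ⟨k, hk⟩).1.rightDir := fun k hk => dif_pos hk
  have hER : ∀ i, (Γ.edge i).dir = .R → E i = oldEdge .R (V i.succ) (Q i) := fun i hi => by
    simp only [E, hi]
  have hEL : ∀ i, (Γ.edge i).dir = .L → E i = oldEdge .L (V i.castSucc) (Q i) := fun i hi => by
    simp only [E, hi]
  refine ⟨V, old, d, fun i => ⟨rfl, hlab i⟩, rfl, hlast, fun m hm => ?_, fun ⟨m, hm⟩ => ⟨?_, hd m hm,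
    ?_, ?_⟩⟩
  · rw [hold m hm]
    exact Option.some_ne_none _
  · cases m with
    | zero => rfl
    | succ k =>
      have h1 := hwf ⟨k, by omega⟩
      exact (hd k (by omega)).trans (h1.2.2.2.1.symm.trans h1.2.2.2.2)
  · cases m with
    | zero =>
      refine ⟨fun _ => hbot, fun _ => ?_⟩
      show -(Γ.vertex 0).leftEnd = ⊤
      rw [hbot, EReal.neg_bot]
    | succ k =>
      have hk : k < Γ.n := by omega
      have h1 := (hwf ⟨k, hk⟩).2.2.2.2
      show LeftSide f ε (V (Fin.succ ⟨k, hk⟩)) (old (k + 1))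
      rw [hold k hk]
      refine ⟨fun hs => ?_, fun hs => ?_⟩
      · have h2 := h1.trans hs
        rw [hER _ h2]
        exact ((hflow _).1 h2).incoming
      · have h2 := h1.trans hs
        rw [hEL _ h2]
        exact ((hflow _).2 h2).outgoing
  · by_cases hk : m < Γ.n
    · have h1 := (hwf ⟨m, hk⟩).2.2.2.1
      show RightSide f ε (V (Fin.castSucc ⟨m, hk⟩)) (old (m + 1))
      rw [hold m hk]
      refine ⟨fun hs => ?_, fun hs => ?_⟩
      · have h2 := h1.trans hs
        rw [hER _ h2]
        exact ((hflow _).1 h2).outgoing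
      · have h2 := h1.trans hs
        rw [hEL _ h2]
        exact ((hflow _).2 h2).incoming
    · obtain rfl : m = Γ.n := by omega
      show RightSide f ε (V (Fin.last Γ.n)) (old (Γ.n + 1))
      rw [hlast]
      refine ⟨fun _ => htop, fun _ => ?_⟩
      show -(Γ.vertex (Fin.last Γ.n)).rightEnd = ⊥
      rw [htop, EReal.neg_top]

/-- The four pairs of orientations around a vertex correspond to passing right, passing left,
meeting and springing, which are the four hypotheses on a path. -/
lemma exists_evolution {f : ℝ → ℝ} {εinf η₁ : ℝ} (h : TameDatum f εinf) (hη₁ : η₁ ∈ Ioo 0 εinf)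
    {n : ℕ} {V : Fin (n + 1) → LabelledVertex} {old : ℕ → Option OldEdge} {d : ℕ → Side}
    (hadm : ∀ i, (V i).1.Admissible f η₁) (hleaf : ∀ i, (V i).1.LeafRoot f)
    (hlab : ∀ i, LabelOK f (V i)) (h0 : old 0 = none) (hn : old (n + 1) = none)
    (hV : ∀ i : Fin (n + 1), d i = (V i).1.leftDir ∧ d (i + 1) = (V i).1.rightDir ∧
      LeftSide f η₁ (V i) (old i) ∧ RightSide f η₁ (V i) (old (i + 1))) :
    ∃ D : ℕ → NewEdge, ∀ i : Fin (n + 1),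
      Evolution f η₁ εinf (V i) (old i) (old (i + 1)) (D i) (D (i + 1)) := by
  let D₀ : NewEdge := ⟨0, fun _ => V 0, fun _ _ => 0, 0⟩
  suffices H : ∃ D : ℕ → NewEdge, ∀ m < n + 1, ∀ hm : m < n + 1,
      Evolution f η₁ εinf (V ⟨m, hm⟩) (old m) (old (m + 1)) (D m) (D (m + 1)) by
    obtain ⟨D, hD⟩ := H
    exact ⟨D, fun i => hD i i.2 i.2⟩
  refine exists_path_data (n + 1) d (fun m D => Continues f η₁ εinf D (old m))
    (fun m D D' => ∀ hm : m < n + 1, Evolution f η₁ εinf (V ⟨m, hm⟩) (old m) (old (m + 1)) D D')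
    ⟨D₀, by rw [h0]; trivial⟩ ⟨D₀, by rw [hn]; trivial⟩ ?_ ?_ ?_ ?_
  all_goals
    intro m hm h1 h2
    obtain ⟨e1, e2, hl, hr⟩ := hV ⟨m, hm⟩
    have hld := e1.symm.trans h1
    have hrd := e2.symm.trans h2
  · intro D hC
    obtain ⟨D', hC', hE⟩ := passes_vertex (s := .R) h hη₁ (hadm _) (hleaf _) (hlab _) (hl.1 hld)
      (hr.1 hrd) hld hrd D hC
    exact ⟨D', hC', fun _ => hE⟩
  · intro D hC
    obtain ⟨D', hC', hE⟩ := passes_vertex (s := .L) h hη₁ (hadm _) (hleaf _) (hlab _) (hr.2 hrd)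
      (hl.2 hld) hrd hld D hC
    exact ⟨D', hC', fun _ => hE⟩
  · exact fun D D' hC hC' _ => meets_vertex h hη₁.1 (hadm _) (hleaf _) (hlab _) (hl.1 hld) (hr.2 hrd)
      hld hrd D D' hC hC'
  · obtain ⟨D, D', hC, hC', hE⟩ := springs_vertex h hη₁ (hadm _) (hleaf _) (hlab _) (hl.2 hld)
      (hr.1 hrd) hld hrd
    exact ⟨D, D', hC, hC', fun _ => hE⟩

lemma FoliationGraph.Admissible.exists_evolves {f : ℝ → ℝ} {εinf η₁ : ℝ} (h : TameDatum f εinf)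
    (hη₁ : η₁ ∈ Ioo 0 εinf) {Γ : FoliationGraph} (hadm : Γ.Admissible f η₁) (hleaf : Γ.LeafRoot f) :
    ∃ η₂ : ℝ, η₁ < η₂ ∧ η₂ < εinf ∧ ∃ G : ℝ → FoliationGraph,
      (∀ ε ∈ Ioc η₁ η₂,
        (G ε).Admissible f ε ∧ (G ε).Smooth ε ∧ (G ε).NonDegenerateForces f ε ∧
          (G ε).LeafRoot f ∧ (G ε).AnglesInTails f ε) ∧
      Evolves f η₁ η₂ Γ G := by
  obtain ⟨V, old, d, hV, h0, hn, hsome, hside⟩ := hadm.exists_oldEdges h hη₁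
  have hVadm : ∀ i, (V i).1.Admissible f η₁ := fun i => by
    rw [(hV i).1]
    exact hadm.2.1 i
  have hVleaf : ∀ i, (V i).1.LeafRoot f := fun i => by
    rw [(hV i).1]
    exact hleaf i
  obtain ⟨D, hD⟩ := exists_evolution h hη₁ hVadm hVleaf (fun i => (hV i).2) h0 hn hside
  choose η hη B hrule hfits using hD
  -- The common time is the smallest of the finitely many times found at the vertices.
  obtain ⟨i₀, -, hi₀⟩ := Finset.exists_min_image Finset.univ η Finset.univ_nonempty
  have hle : ∀ i, η i₀ ≤ η i := fun i => hi₀ i (Finset.mem_univ i)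
  have hgraph : ∀ ε, ε ∈ Ioc η₁ (η i₀) → ∃ Γ' : FoliationGraph,
      List.ofFn Γ'.vertex = (List.ofFn fun i => B i ε).flatten.map Prod.fst ∧
      Γ'.Admissible f ε ∧ Γ'.Smooth ε ∧ Γ'.NonDegenerateForces f ε ∧ Γ'.LeafRoot f ∧
      Γ'.AnglesInTails f ε := fun ε hε => by
    have hε' : ∀ i, ε ∈ Ioc η₁ (η i) := fun i => ⟨hε.1, hε.2.trans (hle i)⟩
    have hF := fits_flatten (fun i => B i ε) (fun m => edgeState (old m) (D m) ε)
      (fun m hm => by simpa [edgeState] using hsome m hm) fun i => (hfits i ε (hε' i)).2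
    simp only [h0, hn, edgeState, Option.map_none] at hF
    refine exists_graph_of_chain h ⟨hη₁.1.trans hε.1, hε.2.trans_lt (hη i₀).2⟩ (fun U hU => ?_)
      (by simpa [sourceBefore, sourceAfter, -List.ofFn_succ] using hF.chain)
      (by simpa [HeadOK, sourceAfter, -List.ofFn_succ] using hF.head)
      (by simpa [LastOK, sourceBefore, -List.ofFn_succ] using hF.last)
    obtain ⟨l, hl, hUl⟩ := List.mem_flatten.1 hU
    obtain ⟨i, rfl⟩ := (List.mem_ofFn' ..).1 hl
    exact (hfits i ε (hε' i)).1 U hUl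
  have : Nonempty FoliationGraph := ⟨Γ⟩
  choose! G hG using hgraph
  refine ⟨η i₀, (hη i₀).1, (hη i₀).2, G, fun ε hε => (hG ε hε).2, fun i ε => (B i ε).map Prod.fst,
    fun i => ?_, fun ε hε => ?_⟩
  · rw [← (hV i).1]
    exact (hrule i).mono (hVadm i) (hη i₀).1 (hle i)
  · rw [(hG ε hε).1, List.map_flatten, List.map_ofFn]
    rfl

end

end BellmanFoliation

/-! ### The theorem -/

open BellmanFoliation in
theorem mainTheorem6 (f : ℝ → ℝ) (εinf : ℝ) (hεinf : 0 < εinf)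
    (hreg : RegularDatum f) (hsum : SummableDatum f εinf)
    (η₁ : ℝ) (hη₁ : 0 < η₁) (hη₁inf : η₁ < εinf)
    (Γ : FoliationGraph) (hadm : Γ.Admissible f η₁)
    (hforce : Γ.NonDegenerateForces f η₁) (hleaf : Γ.LeafRoot f) :
    ∃ η₂ : ℝ, η₁ < η₂ ∧ η₂ < εinf ∧ ∃ G : ℝ → FoliationGraph,
      (∀ ε ∈ Set.Ioc η₁ η₂,
        (G ε).Admissible f ε ∧ (G ε).Smooth ε ∧ (G ε).NonDegenerateForces f ε ∧
          (G ε).LeafRoot f ∧ (G ε).AnglesInTails f ε) ∧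
      Evolves f η₁ η₂ Γ G :=
  hadm.exists_evolves ⟨hreg, hεinf, hsum⟩ ⟨hη₁, hη₁inf⟩ hleaf
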